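/- Let $(M,g)$ be a smooth four-dimensional spacetime of signature $(-,+,+,+)$ that is a vacuum solution, $\mathrm{Ric}=0$. All notions below are local. Let $W$ be the Weyl tensor, $*$ the Hodge dual, and $\mathcal W=\frac12(W-\mathrm i\,{*W})$. The spacetime is of type N if $W\neq0$ and $\mathcal W^2=0$ at every point, where $(\mathcal W^2)_{\alpha\beta\mu\nu}=\frac12\mathcal W_{\alpha\beta\lambda\rho}\mathcal W^{\lambda\rho}{}_{\mu\nu}$. Then locally $W=L\otimes L-{*L}\otimes{*L}$ with $L=\ell\wedge e_2$, $\ell$ null and future-pointing, and $e_2$ a unit space-like vector orthogonal to $\ell$. The fundamental vector $\ell$ is unique and $L$ is unique up to sign. Write $\mathcal L=\frac1{\sqrt2}(L-\mathrm i\,{*L})$, and let $x$ be an arbitrary time-like vector field. Here $(\cdot,\cdot)$ is the metric product, with $(F,H)=\frac12F_{\alpha\beta}H^{\alpha\beta}$ on 2-forms, and $(A\,\bar\wedge\,v)_{\alpha\beta\gamma}=A_{\alpha\beta}v_\gamma-A_{\alpha\gamma}v_\beta$, $(v\,\bar\wedge\,A)_{\alpha\beta\gamma}=v_\alpha A_{\beta\gamma}-v_\beta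 A_{\alpha\gamma}$, $(\nabla\ell)_{\alpha\beta}=\nabla_\alpha\ell_\beta$. Put $$a_\alpha=-\tfrac1{(\ell,x)}\nabla_\alpha L_{\beta\mu}\,\ell^\mu x^\beta,\qquad a^*_\alpha=\tfrac1{(\ell,x)}\nabla_\alpha{*L}_{\beta\mu}\,\ell^\mu x^\beta,\qquad \alpha=\tfrac{(a,x)}{(\ell,x)},\qquad \alpha^*=\tfrac{(a^*,x)}{(\ell,x)},$$ $$B_{\alpha\beta}=\nabla_\alpha\ell_\beta+\nabla_\beta\ell_\alpha,\qquad b=\tfrac1{(\ell,x)}\Big[B(x)-\tfrac{B(x,x)}{2(\ell,x)}\,\ell\Big],$$ $$C_{\alpha\beta\gamma}=\nabla_{(\alpha}{*L}_{\beta}{}^{\mu}L_{\gamma)\mu},\qquad c=\tfrac1{(\ell,x)^3}\big[3(\ell,x)\,C(x,x)-2\,C(x,x,x)\,\ell\big],$$ $$f=\mathrm d\alpha-\alpha^*c,\qquad f^*=\mathrm d\alpha^*+\alpha c,\qquad \mathcal F_1=\nabla_\ell\mathcal L,\quad \mathcal F_2=\nabla_a\mathcal L,\quad \mathcal F_2^*=\nabla_{a^*}\mathcal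 L,$$ $$\varphi_1=(\mathcal F_1,\mathcal F_1),\quad \varphi_2=|(\mathcal F_2,\mathcal F_2)|+|(\mathcal F^*_2,\mathcal F^*_2)|,\quad \varphi_3=(\mathrm d\ell,\mathrm d\ell),\quad \varphi_4=(\ell\wedge c,\ell\wedge c),\quad \varphi_5=(\mathrm db,\mathrm db),$$ $$\varphi_6=*(\ell\wedge f\wedge f^*),\qquad \varphi_7=*(\ell\wedge b\wedge c).$$ A type N spacetime belongs to the family $\widehat{\mathrm Cn}$ if $\varphi_i=0$ everywhere for all $i\le n$. It belongs to the class $\mathrm Cn$ if $\varphi_i=0$ everywhere for all $i<n$ and $\varphi_n\neq0$ at every point. A pp-wave is a spacetime that has, on a neighbourhood of each point, a covariantly constant, nowhere zero null vector field. A plane wave is a spacetime in which each point has a neighbourhood with coordinates $(u,v,x_1,x_2)$ such that $g=\mathrm dx_1^2+\mathrm dx_2^2-2\,\mathrm du\,\mathrm dv-2h\,\mathrm du^2$ and $h=P(u)x_1^2+2Q(u)x_1x_2+R(u)x_2^2$ with $P,Q,R$ smooth. The isotropy group at $p$ is the group generated by the Killing vector fields defined near $p$ that vanish at $p$; it is trivial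 if every such field vanishes near $p$. Proposition. 1. $(M,g)$ is a pp-wave with $W\neq0$ at every point if and only if it is of type N and belongs to $\widehat{\mathrm C5}$. This holds if and only if it is of type N and $\nabla\ell\,\bar\wedge\,\ell=0$. 2. Let $(M,g)$ be a (vacuum) pp-wave with $W\neq0$ at every point. - If $\varphi_7$ vanishes either nowhere or identically, then the isotropy group is trivial at every point if and only if $(M,g)$ belongs to class $\mathrm C7$. Class $\mathrm C7$ means here that $\ell\wedge b\wedge c\neq0$ at every point. - Without that proviso, the isotropy group is trivial at every point where $\ell\wedge b\wedge c\neq0$. At a point where it is trivial, $\ell\wedge b\wedge c$ does not vanish identically on any neighbourhood of the point. - The isotropy group is non-trivial at every point if and only if $(M,g)$ is a plane wave. - $(M,g)$ is a plane wave if and only if $\ell\,\bar\wedge\,\nabla\ell=0$ everywhere. At each point, $\ell\,\bar\wedge\,\nabla\ell=0$ holds if and only if $\ell\wedge b\wedge c=0$. -/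

import Mathlib

open scoped ContDiff Manifold Topology

noncomputable section

namespace TypeN

/-! ### Tensor calculus in a coordinate domain of a four-dimensional spacetime

A tensor field on a coordinate domain is given by its components. Indices are covariant (lower)
unless a comment says otherwise; `G y i j` are the components of the metric at the point `y`. -/

/-- The coordinate space. -/
abbrev E4 : Type := Fin 4 → ℝ

/-- The components of a metric in a coordinate domain. -/
abbrev CMetric : Type := E4 → Matrix (Fin 4) (Fin 4) ℝ

/-- The coordinate derivative `∂ᵢ f`. -/
def pd {F : Type*} [NormedAddCommGroup F] [NormedSpace ℝ F] (i : Fin 4) (f : E4 → F) (y : E4) : F :=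
  fderiv ℝ f y (Pi.single i 1)

/-- The contravariant components `gⁱʲ` of the metric. -/
def ginv (G : CMetric) (y : E4) (i j : Fin 4) : ℝ := (G y)⁻¹ i j

/-- The Christoffel symbols `Γᵏᵢⱼ` of the Levi-Civita connection. -/
def chr (G : CMetric) (y : E4) (k i j : Fin 4) : ℝ :=
  (1 / 2) * ∑ l, ginv G y k l *
    (pd i (fun z => G z j l) y + pd j (fun z => G z i l) y - pd l (fun z => G z i j) y)

/-- The covariant derivative `∇ᵢ ξⱼ` of a 1-form. -/
def cov1 (G : CMetric) (ξ : E4 → Fin 4 → ℝ) (y : E4) (i j : Fin 4) : ℝ :=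
  pd i (fun z => ξ z j) y - ∑ k, chr G y k i j * ξ y k

/-- The covariant derivative `∇ᵢ Tⱼₖ` of a (real or complex) 2-tensor. -/
def cov2 {F : Type*} [NormedAddCommGroup F] [NormedSpace ℝ F] (G : CMetric)
    (T : E4 → Fin 4 → Fin 4 → F) (y : E4) (i j k : Fin 4) : F :=
  pd i (fun z => T z j k) y
    - ∑ m, chr G y m i j • T y m k - ∑ m, chr G y m i k • T y j m

/-- The exterior derivative of a 1-form. -/
def extd (ξ : E4 → Fin 4 → ℝ) (y : E4) (i j : Fin 4) : ℝ :=
  pd i (fun z => ξ z j) y - pd j (fun z => ξ z i) y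

/-- The Riemann tensor `Rˡₖᵢⱼ = ∂ᵢ Γˡⱼₖ - ∂ⱼ Γˡᵢₖ + Γˡᵢₘ Γᵐⱼₖ - Γˡⱼₘ Γᵐᵢₖ`. -/
def riem (G : CMetric) (y : E4) (l k i j : Fin 4) : ℝ :=
  pd i (fun z => chr G z l j k) y - pd j (fun z => chr G z l i k) y
    + ∑ m, (chr G y l i m * chr G y m j k - chr G y l j m * chr G y m i k)

/-- The Riemann tensor with all indices lowered. -/
def riemLow (G : CMetric) (y : E4) (a b c d : Fin 4) : ℝ := ∑ l, G y a l * riem G y l b c d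

/-- The Ricci tensor `Rₖⱼ = Rⁱₖᵢⱼ`. -/
def ric (G : CMetric) (y : E4) (k j : Fin 4) : ℝ := ∑ i, riem G y i k i j

/-- The scalar curvature. -/
def scal (G : CMetric) (y : E4) : ℝ := ∑ i, ∑ j, ginv G y i j * ric G y i j

/-- The Weyl tensor in dimension four. -/
def weyl (G : CMetric) (y : E4) (a b c d : Fin 4) : ℝ :=
  riemLow G y a b c d
    - (1 / 2) * (G y a c * ric G y b d - G y a d * ric G y b c
        - G y b c * ric G y a d + G y b d * ric G y a c)
    + scal G y / 6 * (G y a c * G y b d - G y a d * G y b c)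

/-- The permutation symbol. -/
def eps (i j k l : Fin 4) : ℝ :=
  Matrix.det (Matrix.of fun a b : Fin 4 => if ![i, j, k, l] a = b then (1 : ℝ) else 0)

/-- The metric volume element `η` (for the orientation given by the coordinates). -/
def vol (G : CMetric) (y : E4) (i j k l : Fin 4) : ℝ := √|(G y).det| * eps i j k l

/-- The dual of a 2-form, `(*F)_{ab} = ½ η_{abcd} F^{cd}`. -/
def hodge (G : CMetric) (F : E4 → Fin 4 → Fin 4 → ℝ) (y : E4) (a b : Fin 4) : ℝ :=
  (1 / 2) * ∑ c, ∑ d, ∑ m, ∑ n, vol G y a b c d * ginv G y c m * ginv G y d n * F y m n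

/-- The dual of the product of three 1-forms, `*(u ∧ v ∧ w)_d = η_{abcd} uᵃ vᵇ wᶜ`. -/
def dual3 (G : CMetric) (u v w : E4 → Fin 4 → ℝ) (y : E4) (d : Fin 4) : ℝ :=
  ∑ a, ∑ b, ∑ c, vol G y a b c d * (∑ m, ginv G y a m * u y m) *
    (∑ m, ginv G y b m * v y m) * (∑ m, ginv G y c m * w y m)

/-- The product of 2-forms `(F, H) = ¼ (g_{am} g_{bn} - g_{an} g_{bm}) F^{ab} H^{mn}
= ½ F_{ab} H^{ab}`, for real 2-forms and for complex ones (bilinear). -/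
def ip2 {R : Type*} [CommRing R] [Algebra ℝ R] (G : CMetric) (y : E4)
    (F H : Fin 4 → Fin 4 → R) : R :=
  (1 / 2 : ℝ) • ∑ a, ∑ b, ∑ c, ∑ d, (ginv G y a c * ginv G y b d) • (F a b * H c d)

/-- The product `(ξ, v)` of a 1-form and a vector. -/
def pairing (ξ v : Fin 4 → ℝ) : ℝ := ∑ i, ξ i * v i

/-- The vector metrically equivalent to a 1-form. -/
def sharp (G : CMetric) (y : E4) (ξ : Fin 4 → ℝ) (i : Fin 4) : ℝ := ∑ j, ginv G y i j * ξ j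

/-- The product of two 1-forms. -/
def ip1 (G : CMetric) (y : E4) (ξ θ : Fin 4 → ℝ) : ℝ := pairing ξ (sharp G y θ)

/-- The exterior product of 1-forms, `(v ∧ w)_{ij} = vᵢ wⱼ - wᵢ vⱼ`. -/
def wedge (v w : Fin 4 → ℝ) (i j : Fin 4) : ℝ := v i * w j - w i * v j

/-- `(A ∧̄ v)_{ijk} = A_{ij} v_k - A_{ik} v_j` for a 2-tensor `A` and a 1-form `v`. -/
def wedgeBarRight (A : Fin 4 → Fin 4 → ℝ) (v : Fin 4 → ℝ) (i j k : Fin 4) : ℝ :=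
  A i j * v k - A i k * v j

/-- `(v ∧̄ A)_{ijk} = v_i A_{jk} - v_j A_{ik}` for a 2-tensor `A` and a 1-form `v`. -/
def wedgeBarLeft (v : Fin 4 → ℝ) (A : Fin 4 → Fin 4 → ℝ) (i j k : Fin 4) : ℝ :=
  v i * A j k - v j * A i k

/-! ### Type N Weyl tensors and their fundamental elements -/

/-- The self-dual Weyl tensor `𝒲 = ½ (W - i *W)`. -/
def sdWeyl (G : CMetric) (y : E4) (a b c d : Fin 4) : ℂ :=
  (1 / 2 : ℂ) * ((weyl G y a b c d : ℂ)
    - Complex.I * (hodge G (fun z m n => weyl G z m n c d) y a b : ℂ))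

/-- `(𝒲²)_{abmn} = ½ 𝒲_{abcd} 𝒲^{cd}_{mn}`. -/
def sdWeylSq (G : CMetric) (y : E4) (a b m n : Fin 4) : ℂ :=
  (1 / 2 : ℂ) * ∑ c, ∑ d, ∑ p, ∑ q, ((ginv G y c p * ginv G y d q : ℝ) : ℂ) *
    (sdWeyl G y a b c d * sdWeyl G y p q m n)

/-- The Weyl tensor is of type N at `y`: `𝒲 ≠ 0` and `𝒲² = 0`. -/
def TypeNAt (G : CMetric) (y : E4) : Prop := weyl G y ≠ 0 ∧ sdWeylSq G y = 0

/-- A smooth choice, on the set `V`, of the fundamental elements of a type N Weyl tensor: the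
fundamental 2-form `L` (`W = L ⊗ L - *L ⊗ *L`), the fundamental vector `ℓ` (null, with `L = ℓ ∧ e₂`
for some unit space-like `e₂` orthogonal to `ℓ`), and a time-like vector field `x`, which gives the
time orientation for which `ℓ` is future-pointing and which serves as the arbitrary time-like
vector of the formulas below. The components of `L` and `ℓ` are covariant, those of `x`
contravariant. -/
structure Fund (G : CMetric) (V : Set E4) where
  L : E4 → Fin 4 → Fin 4 → ℝ
  ell : E4 → Fin 4 → ℝ
  x : E4 → Fin 4 → ℝ
  smooth_L : ∀ i j, ContDiffOn ℝ ∞ (fun y => L y i j) V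
  smooth_ell : ∀ i, ContDiffOn ℝ ∞ (fun y => ell y i) V
  smooth_x : ∀ i, ContDiffOn ℝ ∞ (fun y => x y i) V
  weyl_eq : ∀ y ∈ V, ∀ a b c d,
    weyl G y a b c d = L y a b * L y c d - hodge G L y a b * hodge G L y c d
  ell_ne : ∀ y ∈ V, ell y ≠ 0
  ell_null : ∀ y ∈ V, ip1 G y (ell y) (ell y) = 0
  L_eq : ∀ y ∈ V, ∃ e2 : Fin 4 → ℝ, ip1 G y e2 e2 = 1 ∧ ip1 G y (ell y) e2 = 0 ∧
    L y = wedge (ell y) e2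
  x_timelike : ∀ y ∈ V, ∑ i, ∑ j, G y i j * x y i * x y j < 0
  future : ∀ y ∈ V, pairing (ell y) (x y) < 0

namespace Fund

variable {G : CMetric} {V : Set E4} (D : Fund G V)

/-- The dual `*L` of the fundamental 2-form. -/
def sL (y : E4) (i j : Fin 4) : ℝ := hodge G D.L y i j

/-- The fundamental bivector `ℒ = (L - i *L) / √2`. -/
def cL (y : E4) (i j : Fin 4) : ℂ :=
  ((1 / √2 : ℝ) : ℂ) * ((D.L y i j : ℂ) - Complex.I * (D.sL y i j : ℂ))

/-- The scalar `(ℓ, x)`. -/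
def lx (y : E4) : ℝ := pairing (D.ell y) (D.x y)

/-- `ℱ₁ = ∇_ℓ ℒ`. -/
def F1 (y : E4) (j k : Fin 4) : ℂ := ∑ i, sharp G y (D.ell y) i • cov2 G D.cL y i j k

/-- `a = -(1 / (ℓ, x)) (∇L · ℓ)(x)`. -/
def a (y : E4) (i : Fin 4) : ℝ :=
  -(1 / D.lx y) * ∑ j, (∑ m, cov2 G D.L y i j m * sharp G y (D.ell y) m) * D.x y j

/-- `a* = (1 / (ℓ, x)) (∇*L · ℓ)(x)`. -/
def aS (y : E4) (i : Fin 4) : ℝ :=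
  (1 / D.lx y) * ∑ j, (∑ m, cov2 G D.sL y i j m * sharp G y (D.ell y) m) * D.x y j

/-- `ℱ₂ = ∇_a ℒ`. -/
def F2 (y : E4) (j k : Fin 4) : ℂ := ∑ i, sharp G y (D.a y) i • cov2 G D.cL y i j k

/-- `ℱ₂* = ∇_{a*} ℒ`. -/
def F2S (y : E4) (j k : Fin 4) : ℂ := ∑ i, sharp G y (D.aS y) i • cov2 G D.cL y i j k

/-- `α = (a, x) / (ℓ, x)`. -/
def al (y : E4) : ℝ := pairing (D.a y) (D.x y) / D.lx y

/-- `α* = (a*, x) / (ℓ, x)`. -/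
def alS (y : E4) : ℝ := pairing (D.aS y) (D.x y) / D.lx y

/-- `B = ∇ℓ + ᵗ∇ℓ`. -/
def B (y : E4) (i j : Fin 4) : ℝ := cov1 G D.ell y i j + cov1 G D.ell y j i

/-- `b = (1 / (ℓ, x)) [B(x) - (B(x, x) / (2 (ℓ, x))) ℓ]`. -/
def b (y : E4) (i : Fin 4) : ℝ :=
  (1 / D.lx y) * ((∑ j, D.B y i j * D.x y j)
    - (∑ j, ∑ k, D.B y j k * D.x y j * D.x y k) / (2 * D.lx y) * D.ell y i)

/-- `F₃ = dℓ`. -/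
def F3 (y : E4) (i j : Fin 4) : ℝ := extd D.ell y i j

/-- The 3-tensor `∇_i *L_j^m L_{km}`, whose symmetric part is `C`. -/
def preC (y : E4) (i j k : Fin 4) : ℝ :=
  ∑ m, ∑ n, cov2 G D.sL y i j m * ginv G y m n * D.L y k n

/-- `C = ∇_{(i} *L_j^m L_{k)m}`. -/
def C (y : E4) (i j k : Fin 4) : ℝ :=
  (1 / 6) * (D.preC y i j k + D.preC y j k i + D.preC y k i j
    + D.preC y i k j + D.preC y k j i + D.preC y j i k)

/-- `c = (1 / (ℓ, x)³) [3 (ℓ, x) C(x, x) - 2 C(x, x, x) ℓ]`. -/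
def c (y : E4) (i : Fin 4) : ℝ :=
  (1 / D.lx y ^ 3) * (3 * D.lx y * (∑ j, ∑ k, D.C y i j k * D.x y j * D.x y k)
    - 2 * (∑ h, ∑ j, ∑ k, D.C y h j k * D.x y h * D.x y j * D.x y k) * D.ell y i)

/-- `F₄ = ℓ ∧ c`. -/
def F4 (y : E4) (i j : Fin 4) : ℝ := wedge (D.ell y) (D.c y) i j

/-- `F₅ = db`. -/
def F5 (y : E4) (i j : Fin 4) : ℝ := extd D.b y i j

/-- `f = dα - α* c`. -/
def f (y : E4) (i : Fin 4) : ℝ := pd i D.al y - D.alS y * D.c y i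

/-- `f* = dα* + α c`. -/
def fS (y : E4) (i : Fin 4) : ℝ := pd i D.alS y + D.al y * D.c y i

def phi1 (y : E4) : ℂ := ip2 G y (D.F1 y) (D.F1 y)

def phi2 (y : E4) : ℝ := ‖ip2 G y (D.F2 y) (D.F2 y)‖ + ‖ip2 G y (D.F2S y) (D.F2S y)‖

def phi3 (y : E4) : ℝ := ip2 G y (D.F3 y) (D.F3 y)

def phi4 (y : E4) : ℝ := ip2 G y (D.F4 y) (D.F4 y)

def phi5 (y : E4) : ℝ := ip2 G y (D.F5 y) (D.F5 y)

/-- `φ₆ = *(ℓ ∧ f ∧ f*)`. -/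
def phi6 (y : E4) : Fin 4 → ℝ := dual3 G D.ell D.f D.fS y

/-- `φ₇ = *(ℓ ∧ b ∧ c)`. -/
def phi7 (y : E4) : Fin 4 → ℝ := dual3 G D.ell D.b D.c y

/-- The condition `φₙ = 0` at the point `y`, for `n = 1, …, 7`. -/
def PhiZero (n : ℕ) (y : E4) : Prop :=
  match n with
  | 1 => D.phi1 y = 0
  | 2 => D.phi2 y = 0
  | 3 => D.phi3 y = 0
  | 4 => D.phi4 y = 0
  | 5 => D.phi5 y = 0
  | 6 => D.phi6 y = 0
  | 7 => D.phi7 y = 0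
  | _ => True

/-- `∇ℓ ∧̄ ℓ = 0` at the point `y`. -/
def PPCond (y : E4) : Prop := wedgeBarRight (cov1 G D.ell y) (D.ell y) = 0

/-- `ℓ ∧̄ ∇ℓ = 0` at the point `y`. -/
def PlaneCond (y : E4) : Prop := wedgeBarLeft (D.ell y) (cov1 G D.ell y) = 0

end Fund

/-! ### Waves and isotropy in a coordinate domain -/

/-- On a neighbourhood of `y` (inside `U`) there is a covariantly constant null vector field. -/
def PPWaveNear (G : CMetric) (U : Set E4) (y : E4) : Prop :=
  ∃ V : Set E4, IsOpen V ∧ y ∈ V ∧ V ⊆ U ∧ ∃ k : E4 → Fin 4 → ℝ,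
    (∀ i, ContDiffOn ℝ ∞ (fun z => k z i) V) ∧
    ∀ z ∈ V, k z ≠ 0 ∧ ip1 G z (k z) (k z) = 0 ∧ cov1 G k z = 0

/-- On a neighbourhood of `y` (inside `U`) the metric takes the plane wave form
`dx² + dy² - 2 du dv - 2 h du²` with `h = P(u) x² + 2 Q(u) x y + R(u) y²`. (As the metric is
non-degenerate, the four functions `u, v, x₁, x₂` are local coordinates.) -/
def PlaneWaveNear (G : CMetric) (U : Set E4) (y : E4) : Prop :=
  ∃ V : Set E4, IsOpen V ∧ y ∈ V ∧ V ⊆ U ∧ ∃ (u v x₁ x₂ : E4 → ℝ) (P Q R : ℝ → ℝ),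
    ContDiffOn ℝ ∞ u V ∧ ContDiffOn ℝ ∞ v V ∧ ContDiffOn ℝ ∞ x₁ V ∧ ContDiffOn ℝ ∞ x₂ V ∧
    ContDiffOn ℝ ∞ P (u '' V) ∧ ContDiffOn ℝ ∞ Q (u '' V) ∧ ContDiffOn ℝ ∞ R (u '' V) ∧
    ∀ z ∈ V, ∀ i j, G z i j =
      pd i x₁ z * pd j x₁ z + pd i x₂ z * pd j x₂ z
        - (pd i u z * pd j v z + pd i v z * pd j u z)
        - 2 * (P (u z) * x₁ z ^ 2 + 2 * Q (u z) * (x₁ z * x₂ z) + R (u z) * x₂ z ^ 2)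
          * (pd i u z * pd j u z)

/-- The Lie derivative of the metric along the vector field with contravariant components `X`. -/
def lieMetric (G : CMetric) (X : E4 → Fin 4 → ℝ) (y : E4) (i j : Fin 4) : ℝ :=
  ∑ k, (X y k * pd k (fun z => G z i j) y + G y k j * pd i (fun z => X z k) y
    + G y i k * pd j (fun z => X z k) y)

/-- The isotropy group at `y` is trivial: a Killing vector field defined on a neighbourhood of `y`
and vanishing at `y` vanishes near `y`. -/
def TrivialIsotropyNear (G : CMetric) (U : Set E4) (y : E4) : Prop :=
  ∀ V : Set E4, IsOpen V → y ∈ V → V ⊆ U → ∀ X : E4 → Fin 4 → ℝ,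
    (∀ i, ContDiffOn ℝ ∞ (fun z => X z i) V) → (∀ z ∈ V, lieMetric G X z = 0) → X y = 0 →
    ∀ᶠ z in 𝓝 y, X z = 0

/-! ### Spacetimes -/

/-- A smooth Lorentzian metric, of signature `(-,+,+,+)`, on a four-dimensional manifold. -/
structure LorentzianMetric (M : Type*) [TopologicalSpace M] [ChartedSpace E4 M] where
  val : ∀ p : M, TangentSpace 𝓘(ℝ, E4) p →ₗ[ℝ] TangentSpace 𝓘(ℝ, E4) p →ₗ[ℝ] ℝ
  symm : ∀ p v w, val p v w = val p w v
  signature : ∀ p, ∃ e : Module.Basis (Fin 4) ℝ (TangentSpace 𝓘(ℝ, E4) p),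
    ∀ i j, val p (e i) (e j) = if i = j then (if i = 0 then -1 else 1) else 0
  smooth : ∀ e ∈ IsManifold.maximalAtlas 𝓘(ℝ, E4) ∞ M, ∀ i j : Fin 4,
    ContDiffOn ℝ ∞ (fun y : E4 => val (e.symm y)
      (mfderiv 𝓘(ℝ, E4) 𝓘(ℝ, E4) e.symm y (Pi.single i 1 : E4))
      (mfderiv 𝓘(ℝ, E4) 𝓘(ℝ, E4) e.symm y (Pi.single j 1 : E4))) e.target

namespace LorentzianMetric

variable {M : Type*} [TopologicalSpace M] [ChartedSpace E4 M] (g : LorentzianMetric M)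

/-- The components of the metric in a chart. -/
def inChart (e : OpenPartialHomeomorph M E4) : CMetric := fun y => Matrix.of fun i j =>
  g.val (e.symm y) (mfderiv 𝓘(ℝ, E4) 𝓘(ℝ, E4) e.symm y (Pi.single i 1 : E4))
    (mfderiv 𝓘(ℝ, E4) 𝓘(ℝ, E4) e.symm y (Pi.single j 1 : E4))

/-- A statement about metrics on coordinate domains holds at every point, in every chart of the
smooth structure. -/
def InCharts (P : CMetric → Set E4 → E4 → Prop) : Prop :=
  ∀ e ∈ IsManifold.maximalAtlas 𝓘(ℝ, E4) ∞ M, ∀ y ∈ e.target, P (g.inChart e) e.target y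

/-- A statement about fundamental elements holds at every point for all local smooth choices of
them, in every chart of the smooth structure. -/
def ForFund (P : ∀ (G : CMetric) (V : Set E4), Fund G V → E4 → Prop) : Prop :=
  ∀ e ∈ IsManifold.maximalAtlas 𝓘(ℝ, E4) ∞ M, ∀ V : Set E4, IsOpen V → V ⊆ e.target →
    ∀ (D : Fund (g.inChart e) V), ∀ y ∈ V, P (g.inChart e) V D y

/-- Vacuum (`Λ = 0`): the Ricci tensor vanishes. -/
def IsVacuum : Prop := g.InCharts fun G _ y => ric G y = 0

/-- The Weyl tensor vanishes at no point. -/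
def WeylNonvanishing : Prop := g.InCharts fun G _ y => weyl G y ≠ 0

/-- The spacetime is of type N at every point. -/
def IsTypeN : Prop := g.InCharts fun G _ y => TypeNAt G y

/-- pp-waves: there is, locally, a covariantly constant null vector field. -/
def IsPPWave : Prop := g.InCharts PPWaveNear

/-- Plane waves. -/
def IsPlaneWave : Prop := g.InCharts PlaneWaveNear

/-- The family `Ĉn` of type N spacetimes: `φᵢ = 0` for all `i ≤ n`. -/
def InFamily (n : ℕ) : Prop :=
  g.IsTypeN ∧ g.ForFund fun _ _ D y => ∀ i, 1 ≤ i → i ≤ n → D.PhiZero i y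

/-- The class `Cn` of type N spacetimes: `φᵢ = 0` for all `i < n`, and `φₙ ≠ 0`. -/
def InClass (n : ℕ) : Prop :=
  g.IsTypeN ∧ g.ForFund fun _ _ D y => (∀ i, 1 ≤ i → i < n → D.PhiZero i y) ∧ ¬ D.PhiZero n y

/-- The isotropy group is trivial at every point. -/
def TrivialIsotropy : Prop := g.InCharts TrivialIsotropyNear

/-- The isotropy group is non-trivial at every point. -/
def NontrivialIsotropy : Prop := g.InCharts fun G U y => ¬ TrivialIsotropyNear G U y

end LorentzianMetric

end TypeN

end

/-!
The proof is a moving-frame computation in a null coframe adapted to the Weyl tensor, together with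
the integration of the resulting differential systems.

*The coframe.* A type N vacuum metric has, near each point, a smooth null coframe `ℓ, n, e, f` with
`L = ℓ ∧ e` and `*L = ℓ ∧ f`; for a given choice of `ℓ`, `L` and `x` it is normalised by
`e(x) = f(x) = 0` (`Fund.frame`). The Levi-Civita connection is given by six 1-forms
`θ, a, b, μ, ν, ψ`, for instance `∇ℓ = θ ⊗ ℓ + a ⊗ e + b ⊗ f`, and since the curvature is
`L ⊗ L - *L ⊗ *L`, the structure equations are short (`NullFrame.ricci_l`, `NullFrame.ricci_n`,
`NullFrame.ricci_e`). The form `a` of the statement is the connection form `a`, and `a*` is `-b`.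

*pp-waves.* `∇ℓ ∧̄ ℓ = 0` says that `a = b = 0`, so that `ℓ` is recurrent (`Fund.ppCond_iff`).
`φ₁` and `φ₂` are made of squares of components of the complex form `a - i b`, and they vanish only
if `a = α ℓ` and `a* = α* ℓ` (`Fund.kundt`); the structure equations then give
`φ₅ = -(α² + α*²)²` (`Fund.phi5_eq`), so `φ₁ = φ₂ = φ₅ = 0` forces `ℓ` to be recurrent. Conversely,
if `ℓ` is recurrent, then `dθ = dψ = 0`, the vectors `b` and `c` of the statement are `θ` and `-ψ`,
and the Bianchi identity, obtained as `d² = 0` on `μ` and `ν`, says that `θ` and `ψ` are orthogonal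
to `ℓ` and that `ψ` is `θ` rotated by a right angle, modulo `ℓ` (`NullFrame.Recurrent.components`).
Hence `φ₁, …, φ₆` vanish (`Fund.phiZero_of_recurrent`), and `φ₇ = ∓(θ(e)² + θ(f)²) ℓ`
(`Fund.phi7_eq`). In particular `φ₇ = 0` at a point exactly when `θ` is a multiple of `ℓ` there,
which is the condition `ℓ ∧̄ ∇ℓ = 0` (`Fund.planeCond_iff`). Primitives of `θ` and `ψ` serve to
rescale and rotate the coframe into one with `ℓ = dU` covariantly constant
(`NullFrame.Recurrent.exists_parallelFrame`). In the other direction a covariantly constant null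
vector is proportional to `ℓ`, because it annihilates the curvature
(`NullFrame.eq_of_parallel`), and a nonzero vacuum curvature tensor annihilated by a null vector is
of type N (`typeNAt_of_parallel`).

*Plane waves.* If `θ` is a multiple of `ℓ` on an open set, the curvature coefficients of the
parallel coframe are functions of `U` alone, and the coordinates of a plane wave are solutions of an
integrable affine differential system (`ParallelFrame.planeWaveNear`). A plane wave has a nonzero
Killing field vanishing at any given point, built from a solution of a linear ordinary differential
equation in `U` (`not_trivialIsotropyNear_of_planeWaveNear`).

*Trivial isotropy.* Write a Killing field and its covariant derivative in the coframe. The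
prolonged Killing equation is a linear first order system, so a Killing field that vanishes together
with its derivative at a point vanishes nearby (`NullFrame.killing_eventually_zero`). Its
integrability conditions (`NullFrame.killing_integrability`), differentiated once more, show that
where `θ` is not a multiple of `ℓ` the vanishing of the field already implies that of its derivative
(`NullFrame.kil_eq_zero`). Hence the isotropy is trivial wherever `φ₇ ≠ 0`.

*Existence of the coframe.* In an orthonormal basis a trace-free curvature tensor is a symmetric
trace-free complex `3 × 3` matrix, and `𝒲² = 0` says that this matrix has square zero. It is then
`q ⊗ q` with `q` isotropic, which yields `ℓ`, `e` and `f` at the point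
(`exists_nullProducts_of_typeN`). Smoothness is obtained by contracting the Weyl tensor with a
constant bivector and normalising (`exists_smooth_L`, `exists_fund`).
-/


noncomputable section

namespace TypeN

/-! ### Coordinate derivatives -/

section Calculus

variable {F : Type*} [NormedAddCommGroup F] [NormedSpace ℝ F]

theorem pd_contDiffOn {V : Set E4} (hV : IsOpen V) {f : E4 → F} (hf : ContDiffOn ℝ ∞ f V)
    (i : Fin 4) : ContDiffOn ℝ ∞ (pd i f) V := by
  have h := ((contDiffOn_infty_iff_fderiv_of_isOpen hV).1 hf).2
  exact h.clm_apply contDiffOn_const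

theorem differentiableAt_of_smooth {V : Set E4} (hV : IsOpen V) {f : E4 → F}
    (hf : ContDiffOn ℝ ∞ f V) {z : E4} (hz : z ∈ V) : DifferentiableAt ℝ f z :=
  (hf.contDiffAt (hV.mem_nhds hz)).differentiableAt (by simp)

theorem pd_congr {f g : E4 → F} {z : E4} (h : f =ᶠ[𝓝 z] g) (i : Fin 4) : pd i f z = pd i g z := by
  unfold pd; rw [h.fderiv_eq]

theorem pd_congr_on {V : Set E4} (hV : IsOpen V) {f g : E4 → F} (h : ∀ z ∈ V, f z = g z)
    {z : E4} (hz : z ∈ V) (i : Fin 4) : pd i f z = pd i g z :=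
  pd_congr (Filter.eventuallyEq_of_mem (hV.mem_nhds hz) h) i

theorem pd_comm {V : Set E4} (hV : IsOpen V) {f : E4 → F} (hf : ContDiffOn ℝ ∞ f V)
    {z : E4} (hz : z ∈ V) (i j : Fin 4) : pd i (pd j f) z = pd j (pd i f) z := by
  have hc : ContDiffAt ℝ ∞ f z := hf.contDiffAt (hV.mem_nhds hz)
  have h2 : minSmoothness ℝ 2 ≤ (∞ : WithTop ℕ∞) := by
    rw [minSmoothness_of_isRCLikeNormedField]; exact WithTop.coe_le_coe.2 (le_top : (2 : ℕ∞) ≤ ⊤)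
  have hs := (hc.isSymmSndFDerivAt h2).eq (Pi.single i 1 : E4) (Pi.single j 1 : E4)
  have hd : DifferentiableAt ℝ (fderiv ℝ f) z :=
    (hc.fderiv_right (m := 1) (by norm_cast)).differentiableAt (by simp)
  unfold pd
  rw [fderiv_clm_apply hd (differentiableAt_const _), fderiv_clm_apply hd (differentiableAt_const _)]
  simpa using hs

@[simp] theorem pd_const (i : Fin 4) (c : F) (z : E4) : pd i (fun _ => c) z = 0 := by
  simp [pd]

theorem pd_add {f g : E4 → F} {z : E4} (hf : DifferentiableAt ℝ f z) (hg : DifferentiableAt ℝ g z)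
    (i : Fin 4) : pd i (fun y => f y + g y) z = pd i f z + pd i g z := by
  unfold pd; rw [fderiv_fun_add hf hg]; rfl

theorem pd_sub {f g : E4 → F} {z : E4} (hf : DifferentiableAt ℝ f z) (hg : DifferentiableAt ℝ g z)
    (i : Fin 4) : pd i (fun y => f y - g y) z = pd i f z - pd i g z := by
  unfold pd; rw [fderiv_fun_sub hf hg]; rfl

theorem pd_neg {f : E4 → F} {z : E4} (i : Fin 4) : pd i (fun y => - f y) z = - pd i f z := by
  unfold pd; rw [fderiv_fun_neg]; rfl

theorem pd_sum {ι : Type*} (s : Finset ι) {f : ι → E4 → F} {z : E4}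
    (hf : ∀ a ∈ s, DifferentiableAt ℝ (f a) z) (i : Fin 4) :
    pd i (fun y => ∑ a ∈ s, f a y) z = ∑ a ∈ s, pd i (f a) z := by
  unfold pd; rw [fderiv_fun_sum hf]; simp

theorem pd_smul {s : E4 → ℝ} {f : E4 → F} {z : E4} (hs : DifferentiableAt ℝ s z)
    (hf : DifferentiableAt ℝ f z) (i : Fin 4) :
    pd i (fun y => s y • f y) z = s z • pd i f z + pd i s z • f z := by
  unfold pd; rw [fderiv_fun_smul hs hf]; simp

theorem pd_mul {f g : E4 → ℝ} {z : E4} (hf : DifferentiableAt ℝ f z) (hg : DifferentiableAt ℝ g z)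
    (i : Fin 4) : pd i (fun y => f y * g y) z = f z * pd i g z + pd i f z * g z := by
  simpa [smul_eq_mul] using pd_smul hf hg i

theorem pd_const_mul {f : E4 → ℝ} {z : E4} (c : ℝ) (hf : DifferentiableAt ℝ f z) (i : Fin 4) :
    pd i (fun y => c * f y) z = c * pd i f z := by
  rw [pd_mul (differentiableAt_const _) hf]; simp

/-- A function all of whose coordinate derivatives are known has the corresponding differential. -/
theorem fderiv_eq_sum_pd {f : E4 → F} {z : E4} (v : E4) :
    fderiv ℝ f z v = ∑ i, v i • pd i f z := by
  have : v = ∑ i, v i • (Pi.single i 1 : E4) := by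
    ext j; simp [Finset.sum_apply, Pi.single_apply]
  conv_lhs => rw [this]
  simp [pd]

/-! ### The exterior derivative -/

theorem extd_congr_on {V : Set E4} (hV : IsOpen V) {ξ θ : E4 → Fin 4 → ℝ}
    (h : ∀ z ∈ V, ∀ i, ξ z i = θ z i) {z : E4} (hz : z ∈ V) (i j : Fin 4) :
    extd ξ z i j = extd θ z i j := by
  unfold extd
  rw [pd_congr_on hV (fun y hy => h y hy j) hz, pd_congr_on hV (fun y hy => h y hy i) hz]

theorem extd_pd {V : Set E4} (hV : IsOpen V) {f : E4 → ℝ} (hf : ContDiffOn ℝ ∞ f V)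
    {z : E4} (hz : z ∈ V) (i j : Fin 4) : extd (fun y k => pd k f y) z i j = 0 := by
  unfold extd
  exact sub_eq_zero.2 (pd_comm hV hf hz i j)

theorem extd_add {ξ θ : E4 → Fin 4 → ℝ} {z : E4} (hξ : ∀ i, DifferentiableAt ℝ (fun y => ξ y i) z)
    (hθ : ∀ i, DifferentiableAt ℝ (fun y => θ y i) z) (i j : Fin 4) :
    extd (fun y k => ξ y k + θ y k) z i j = extd ξ z i j + extd θ z i j := by
  unfold extd; rw [pd_add (hξ j) (hθ j), pd_add (hξ i) (hθ i)]; ring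

theorem extd_sub {ξ θ : E4 → Fin 4 → ℝ} {z : E4} (hξ : ∀ i, DifferentiableAt ℝ (fun y => ξ y i) z)
    (hθ : ∀ i, DifferentiableAt ℝ (fun y => θ y i) z) (i j : Fin 4) :
    extd (fun y k => ξ y k - θ y k) z i j = extd ξ z i j - extd θ z i j := by
  unfold extd; rw [pd_sub (hξ j) (hθ j), pd_sub (hξ i) (hθ i)]; ring

theorem extd_neg {ξ : E4 → Fin 4 → ℝ} {z : E4} (i j : Fin 4) :
    extd (fun y k => - ξ y k) z i j = - extd ξ z i j := by
  unfold extd; rw [pd_neg, pd_neg]; ring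

theorem extd_mul {s : E4 → ℝ} {θ : E4 → Fin 4 → ℝ} {z : E4} (hs : DifferentiableAt ℝ s z)
    (hθ : ∀ i, DifferentiableAt ℝ (fun y => θ y i) z) (i j : Fin 4) :
    extd (fun y k => s y * θ y k) z i j = s z * extd θ z i j + wedge (fun k => pd k s z) (θ z) i j := by
  unfold extd wedge; rw [pd_mul hs (hθ j), pd_mul hs (hθ i)]; ring

/-- The exterior derivative of a 2-form, as a sum over cyclic permutations. -/
def extd2 (T : E4 → Fin 4 → Fin 4 → ℝ) (z : E4) (i j k : Fin 4) : ℝ :=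
  pd i (fun y => T y j k) z + pd j (fun y => T y k i) z + pd k (fun y => T y i j) z

theorem extd2_congr_on {V : Set E4} (hV : IsOpen V) {S T : E4 → Fin 4 → Fin 4 → ℝ}
    (h : ∀ z ∈ V, ∀ i j, S z i j = T z i j) {z : E4} (hz : z ∈ V) (i j k : Fin 4) :
    extd2 S z i j k = extd2 T z i j k := by
  unfold extd2
  rw [pd_congr_on hV (fun y hy => h y hy j k) hz, pd_congr_on hV (fun y hy => h y hy k i) hz,
    pd_congr_on hV (fun y hy => h y hy i j) hz]

theorem extd2_extd {V : Set E4} (hV : IsOpen V) {ξ : E4 → Fin 4 → ℝ}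
    (hξ : ∀ i, ContDiffOn ℝ ∞ (fun y => ξ y i) V) {z : E4} (hz : z ∈ V) (i j k : Fin 4) :
    extd2 (extd ξ) z i j k = 0 := by
  have hd : ∀ a b, DifferentiableAt ℝ (pd a (fun y => ξ y b)) z := fun a b =>
    differentiableAt_of_smooth hV (pd_contDiffOn hV (hξ b) a) hz
  have h : ∀ a b c, pd a (fun y => extd ξ y b c) z
      = pd a (pd b fun y => ξ y c) z - pd a (pd c fun y => ξ y b) z := fun a b c =>
    pd_sub (hd b c) (hd c b) a
  unfold extd2
  rw [h, h, h, pd_comm hV (hξ k) hz i j, pd_comm hV (hξ j) hz i k, pd_comm hV (hξ i) hz j k]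
  ring

theorem extd2_add {S T : E4 → Fin 4 → Fin 4 → ℝ} {z : E4}
    (hS : ∀ i j, DifferentiableAt ℝ (fun y => S y i j) z)
    (hT : ∀ i j, DifferentiableAt ℝ (fun y => T y i j) z) (i j k : Fin 4) :
    extd2 (fun y a b => S y a b + T y a b) z i j k = extd2 S z i j k + extd2 T z i j k := by
  unfold extd2
  rw [pd_add (hS _ _) (hT _ _), pd_add (hS _ _) (hT _ _), pd_add (hS _ _) (hT _ _)]; ring

theorem extd2_sub {S T : E4 → Fin 4 → Fin 4 → ℝ} {z : E4}
    (hS : ∀ i j, DifferentiableAt ℝ (fun y => S y i j) z)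
    (hT : ∀ i j, DifferentiableAt ℝ (fun y => T y i j) z) (i j k : Fin 4) :
    extd2 (fun y a b => S y a b - T y a b) z i j k = extd2 S z i j k - extd2 T z i j k := by
  unfold extd2
  rw [pd_sub (hS _ _) (hT _ _), pd_sub (hS _ _) (hT _ _), pd_sub (hS _ _) (hT _ _)]; ring

/-- The product of a 2-form and a 1-form. -/
def wedge3 (T : Fin 4 → Fin 4 → ℝ) (v : Fin 4 → ℝ) (i j k : Fin 4) : ℝ :=
  T i j * v k + T j k * v i + T k i * v j

theorem wedge_differentiableAt {ξ θ : E4 → Fin 4 → ℝ} {z : E4}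
    (hξ : ∀ i, DifferentiableAt ℝ (fun y => ξ y i) z)
    (hθ : ∀ i, DifferentiableAt ℝ (fun y => θ y i) z) (i j : Fin 4) :
    DifferentiableAt ℝ (fun y => wedge (ξ y) (θ y) i j) z :=
  ((hξ i).fun_mul (hθ j)).fun_sub ((hθ i).fun_mul (hξ j))

theorem extd2_wedge {ξ θ : E4 → Fin 4 → ℝ} {z : E4}
    (hξ : ∀ i, DifferentiableAt ℝ (fun y => ξ y i) z)
    (hθ : ∀ i, DifferentiableAt ℝ (fun y => θ y i) z) (i j k : Fin 4) :
    extd2 (fun y => wedge (ξ y) (θ y)) z i j k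
      = wedge3 (extd ξ z) (θ z) i j k - wedge3 (extd θ z) (ξ z) i j k := by
  have h : ∀ a b c, pd a (fun y => wedge (ξ y) (θ y) b c) z
      = ξ z b * pd a (fun y => θ y c) z + pd a (fun y => ξ y b) z * θ z c
        - (ξ z c * pd a (fun y => θ y b) z + pd a (fun y => ξ y c) z * θ z b) := by
    intro a b c
    rw [← pd_mul (hξ b) (hθ c), ← pd_mul (hξ c) (hθ b),
      ← pd_sub ((hξ b).fun_mul (hθ c)) ((hξ c).fun_mul (hθ b))]
    congr 1; funext y; unfold wedge; ring
  unfold extd2; rw [h, h, h]; unfold wedge3 extd; ring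

end Calculus

/-! ### Lorentzian metrics in a coordinate domain -/

/-- `G` is, on the open set `V`, a smooth symmetric metric of signature `(-,+,+,+)`; the rows of
the matrix `B` are the vectors of an orthonormal basis. -/
structure MetricOn (G : CMetric) (V : Set E4) : Prop where
  isOpen : IsOpen V
  smooth : ∀ i j, ContDiffOn ℝ ∞ (fun z => G z i j) V
  symm : ∀ z ∈ V, ∀ i j, G z i j = G z j i
  lor : ∀ z ∈ V, ∃ B : Matrix (Fin 4) (Fin 4) ℝ,
    B * G z * B.transpose = Matrix.diagonal ![-1, 1, 1, 1]

theorem ContDiffOn.finset_prod_real {ι : Type*} {s : Finset ι} {V : Set E4} {f : ι → E4 → ℝ}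
    (h : ∀ a ∈ s, ContDiffOn ℝ ∞ (f a) V) : ContDiffOn ℝ ∞ (fun z => ∏ a ∈ s, f a z) V := by
  classical
  induction s using Finset.induction_on with
  | empty => simpa using contDiffOn_const
  | insert a s ha ih =>
    simp only [Finset.prod_insert ha]
    exact (h a (Finset.mem_insert_self _ _)).mul (ih fun b hb => h b (Finset.mem_insert_of_mem hb))

theorem det_contDiffOn {V : Set E4} {A : E4 → Matrix (Fin 4) (Fin 4) ℝ}
    (h : ∀ i j, ContDiffOn ℝ ∞ (fun z => A z i j) V) : ContDiffOn ℝ ∞ (fun z => (A z).det) V := by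
  simp only [Matrix.det_apply, Units.smul_def, zsmul_eq_mul]
  exact ContDiffOn.sum fun σ _ => contDiffOn_const.mul
    (ContDiffOn.finset_prod_real fun a _ => h _ _)

theorem inv_contDiffOn {V : Set E4} {A : E4 → Matrix (Fin 4) (Fin 4) ℝ}
    (h : ∀ i j, ContDiffOn ℝ ∞ (fun z => A z i j) V) (hd : ∀ z ∈ V, (A z).det ≠ 0) (i j : Fin 4) :
    ContDiffOn ℝ ∞ (fun z => (A z)⁻¹ i j) V := by
  have : (fun z => (A z)⁻¹ i j) = fun z => (A z).det⁻¹ * ((A z).updateRow j (Pi.single i 1)).det := by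
    funext z
    rw [Matrix.inv_def, Ring.inverse_eq_inv', Matrix.smul_apply, Matrix.adjugate_apply, smul_eq_mul]
  rw [this]
  refine ((det_contDiffOn h).inv hd).mul (det_contDiffOn fun a b => ?_)
  by_cases hab : a = j
  · subst hab; simpa using contDiffOn_const
  · simpa [Matrix.updateRow_ne hab] using h a b

namespace MetricOn

variable {G : CMetric} {V : Set E4}

theorem mono (h : MetricOn G V) {W : Set E4} (hW : IsOpen W) (hWV : W ⊆ V) : MetricOn G W :=
  ⟨hW, fun i j => (h.smooth i j).mono hWV, fun z hz => h.symm z (hWV hz),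
    fun z hz => h.lor z (hWV hz)⟩

theorem det_neg (h : MetricOn G V) {z : E4} (hz : z ∈ V) : (G z).det < 0 := by
  obtain ⟨B, hB⟩ := h.lor z hz
  have := congrArg Matrix.det hB
  rw [Matrix.det_mul, Matrix.det_mul, Matrix.det_transpose, Matrix.det_diagonal,
    Fin.prod_univ_four] at this
  simp at this
  nlinarith [sq_nonneg B.det, sq_nonneg ((G z).det)]

theorem det_ne (h : MetricOn G V) {z : E4} (hz : z ∈ V) : (G z).det ≠ 0 := (h.det_neg hz).ne

theorem mul_inv (h : MetricOn G V) {z : E4} (hz : z ∈ V) : G z * (G z)⁻¹ = 1 :=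
  Matrix.mul_nonsing_inv _ (h.det_ne hz).isUnit

theorem inv_mul (h : MetricOn G V) {z : E4} (hz : z ∈ V) : (G z)⁻¹ * G z = 1 :=
  Matrix.nonsing_inv_mul _ (h.det_ne hz).isUnit

theorem sum_mul_ginv (h : MetricOn G V) {z : E4} (hz : z ∈ V) (i j : Fin 4) :
    ∑ k, G z i k * ginv G z k j = if i = j then 1 else 0 := by
  have := congrFun (congrFun (h.mul_inv hz) i) j
  rwa [Matrix.mul_apply, Matrix.one_apply] at this

theorem ginv_symm (h : MetricOn G V) {z : E4} (hz : z ∈ V) (i j : Fin 4) :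
    ginv G z i j = ginv G z j i := by
  have hs : (G z).transpose = G z := by ext a b; exact h.symm z hz b a
  have : (G z)⁻¹.transpose = (G z)⁻¹ := by rw [Matrix.transpose_nonsing_inv, hs]
  exact (congrFun (congrFun this i) j).symm

theorem ginv_smooth (h : MetricOn G V) (i j : Fin 4) : ContDiffOn ℝ ∞ (fun z => ginv G z i j) V :=
  inv_contDiffOn h.smooth (fun _ hz => h.det_ne hz) i j

theorem chr_smooth (h : MetricOn G V) (k i j : Fin 4) :
    ContDiffOn ℝ ∞ (fun z => chr G z k i j) V := by
  unfold chr
  refine contDiffOn_const.mul (ContDiffOn.sum fun l _ => (h.ginv_smooth k l).mul ?_)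
  exact ((pd_contDiffOn h.isOpen (h.smooth j l) i).add (pd_contDiffOn h.isOpen (h.smooth i l) j)).sub
    (pd_contDiffOn h.isOpen (h.smooth i j) l)

theorem pd_symm (h : MetricOn G V) {z : E4} (hz : z ∈ V) (k i j : Fin 4) :
    pd k (fun y => G y i j) z = pd k (fun y => G y j i) z :=
  pd_congr_on h.isOpen (fun y hy => h.symm y hy i j) hz k

theorem chr_symm (h : MetricOn G V) {z : E4} (hz : z ∈ V) (k i j : Fin 4) :
    chr G z k i j = chr G z k j i := by
  unfold chr
  congr 1
  refine Finset.sum_congr rfl fun l _ => ?_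
  rw [h.pd_symm hz l i j]; ring

theorem sum_mul_chr (h : MetricOn G V) {z : E4} (hz : z ∈ V) (m i j : Fin 4) :
    ∑ k, G z m k * chr G z k i j = (1 / 2) *
      (pd i (fun y => G y j m) z + pd j (fun y => G y i m) z - pd m (fun y => G y i j) z) := by
  unfold chr
  simp only [Finset.mul_sum]
  rw [Finset.sum_comm]
  have : ∀ l, ∑ k, G z m k * (1 / 2 * (ginv G z k l *
      (pd i (fun y => G y j l) z + pd j (fun y => G y i l) z - pd l (fun y => G y i j) z)))
      = (if m = l then 1 else 0) * (1 / 2 *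
      (pd i (fun y => G y j l) z + pd j (fun y => G y i l) z - pd l (fun y => G y i j) z)) := by
    intro l
    rw [← h.sum_mul_ginv hz m l, Finset.sum_mul]
    exact Finset.sum_congr rfl fun k _ => by ring
  simp only [this]
  simp

/-- The Levi-Civita connection is metric. -/
theorem pd_metric (h : MetricOn G V) {z : E4} (hz : z ∈ V) (k i j : Fin 4) :
    pd k (fun y => G y i j) z
      = ∑ m, chr G z m k i * G z m j + ∑ m, chr G z m k j * G z i m := by
  have h1 : ∑ m, chr G z m k i * G z m j = ∑ m, G z j m * chr G z m k i :=
    Finset.sum_congr rfl fun m _ => by rw [h.symm z hz m j, mul_comm]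
  have h2 : ∑ m, chr G z m k j * G z i m = ∑ m, G z i m * chr G z m k j :=
    Finset.sum_congr rfl fun m _ => by rw [mul_comm]
  rw [h1, h2, h.sum_mul_chr hz, h.sum_mul_chr hz, h.pd_symm hz k j i]; ring

theorem cov1_smooth (h : MetricOn G V) {ξ : E4 → Fin 4 → ℝ}
    (hξ : ∀ i, ContDiffOn ℝ ∞ (fun z => ξ z i) V) (i j : Fin 4) :
    ContDiffOn ℝ ∞ (fun z => cov1 G ξ z i j) V :=
  (pd_contDiffOn h.isOpen (hξ j) i).sub
    (ContDiffOn.sum fun k _ => (h.chr_smooth k i j).mul (hξ k))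

theorem sharp_smooth (h : MetricOn G V) {ξ : E4 → Fin 4 → ℝ}
    (hξ : ∀ i, ContDiffOn ℝ ∞ (fun z => ξ z i) V) (i : Fin 4) :
    ContDiffOn ℝ ∞ (fun z => sharp G z (ξ z) i) V :=
  ContDiffOn.sum fun j _ => (h.ginv_smooth i j).mul (hξ j)

theorem ip1_smooth (h : MetricOn G V) {ξ θ : E4 → Fin 4 → ℝ}
    (hξ : ∀ i, ContDiffOn ℝ ∞ (fun z => ξ z i) V) (hθ : ∀ i, ContDiffOn ℝ ∞ (fun z => θ z i) V) :
    ContDiffOn ℝ ∞ (fun z => ip1 G z (ξ z) (θ z)) V := by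
  unfold ip1 pairing
  exact ContDiffOn.sum fun i _ => (hξ i).mul (h.sharp_smooth hθ i)

theorem ip1_comm (h : MetricOn G V) {z : E4} (hz : z ∈ V) (v w : Fin 4 → ℝ) :
    ip1 G z v w = ip1 G z w v := by
  unfold ip1 pairing sharp
  simp only [Finset.mul_sum]
  rw [Finset.sum_comm]
  refine Finset.sum_congr rfl fun i _ => Finset.sum_congr rfl fun j _ => ?_
  rw [h.ginv_symm hz j i]; ring

/-- Lowering the index of `v♯` gives back `v`. -/
theorem sum_mul_sharp (h : MetricOn G V) {z : E4} (hz : z ∈ V) (v : Fin 4 → ℝ) (i : Fin 4) :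
    ∑ j, G z i j * sharp G z v j = v i := by
  unfold sharp
  simp only [Finset.mul_sum]
  rw [Finset.sum_comm]
  have : ∀ k, ∑ j, G z i j * (ginv G z j k * v k) = (if i = k then 1 else 0) * v k := by
    intro k
    rw [← h.sum_mul_ginv hz i k, Finset.sum_mul]
    exact Finset.sum_congr rfl fun j _ => by ring
  simp [this]

theorem sharp_lower (h : MetricOn G V) {z : E4} (hz : z ∈ V) (v : Fin 4 → ℝ) (i : Fin 4) :
    sharp G z (fun k => ∑ j, G z k j * v j) i = v i := by
  have := congrFun (congrArg (fun M : Matrix (Fin 4) (Fin 4) ℝ => M.mulVec v) (h.inv_mul hz)) i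
  simp only [← Matrix.mulVec_mulVec, Matrix.one_mulVec] at this
  exact this

/-- The Ricci identity for the covariant derivative of a 1-form. -/
theorem ricci_identity (h : MetricOn G V) {ξ : E4 → Fin 4 → ℝ}
    (hξ : ∀ i, ContDiffOn ℝ ∞ (fun z => ξ z i) V) {z : E4} (hz : z ∈ V) (i j k : Fin 4) :
    pd i (fun y => cov1 G ξ y j k) z - pd j (fun y => cov1 G ξ y i k) z
      - ∑ m, (chr G z m i k * cov1 G ξ z j m - chr G z m j k * cov1 G ξ z i m)
      = - ∑ m, riem G z m k i j * ξ z m := by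
  have hd : ∀ a b, DifferentiableAt ℝ (pd a (fun y => ξ y b)) z := fun a b =>
    differentiableAt_of_smooth h.isOpen (pd_contDiffOn h.isOpen (hξ b) a) hz
  have hc : ∀ a b c, DifferentiableAt ℝ (fun y => chr G y a b c) z := fun a b c =>
    differentiableAt_of_smooth h.isOpen (h.chr_smooth a b c) hz
  have hx : ∀ a, DifferentiableAt ℝ (fun y => ξ y a) z := fun a =>
    differentiableAt_of_smooth h.isOpen (hξ a) hz
  have e : ∀ a b, pd a (fun y => cov1 G ξ y b k) z = pd a (pd b fun y => ξ y k) z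
      - ∑ m, (chr G z m b k * pd a (fun y => ξ y m) z + pd a (fun y => chr G y m b k) z * ξ z m) := by
    intro a b
    unfold cov1
    rw [pd_sub (hd b k) (DifferentiableAt.fun_sum fun m _ => (hc m b k).fun_mul (hx m)),
      pd_sum _ (fun m _ => (hc m b k).fun_mul (hx m))]
    congr 1
    exact Finset.sum_congr rfl fun m _ => pd_mul (hc m b k) (hx m) a
  rw [e, e, pd_comm h.isOpen (hξ k) hz j i]
  unfold cov1 riem
  simp only [Fin.sum_univ_four]
  ring

/-- The Levi-Civita connection is metric, for the contravariant components. -/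
theorem pd_ginv (h : MetricOn G V) {z : E4} (hz : z ∈ V) (k i j : Fin 4) :
    pd k (fun y => ginv G y i j) z
      = - ∑ m, chr G z i k m * ginv G z m j - ∑ m, chr G z j k m * ginv G z i m := by
  have hg : ∀ a b, DifferentiableAt ℝ (fun y => ginv G y a b) z := fun a b =>
    differentiableAt_of_smooth h.isOpen (h.ginv_smooth a b) hz
  have hG : ∀ a b, DifferentiableAt ℝ (fun y => G y a b) z := fun a b =>
    differentiableAt_of_smooth h.isOpen (h.smooth a b) hz
  let dG : Matrix (Fin 4) (Fin 4) ℝ := fun a b => pd k (fun y => G y a b) z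
  let dg : Matrix (Fin 4) (Fin 4) ℝ := fun a b => pd k (fun y => ginv G y a b) z
  let Γ : Matrix (Fin 4) (Fin 4) ℝ := fun a b => chr G z a k b
  have h0 : dG * (G z)⁻¹ + G z * dg = 0 := by
    ext a b
    have h1 : pd k (fun y => ∑ m, G y a m * ginv G y m b) z = 0 := by
      rw [pd_congr_on h.isOpen (g := fun _ => if a = b then (1 : ℝ) else 0)
        (fun y hy => h.sum_mul_ginv hy a b) hz, pd_const]
    rw [pd_sum _ fun m _ => (hG a m).fun_mul (hg m b)] at h1
    refine Eq.trans ?_ h1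
    rw [Matrix.add_apply, Matrix.mul_apply, Matrix.mul_apply, ← Finset.sum_add_distrib]
    refine Finset.sum_congr rfl fun m _ => ?_
    rw [pd_mul (hG a m) (hg m b), add_comm]; rfl
  have h1 : dG = Γ.transpose * G z + G z * Γ := by
    ext a b
    rw [Matrix.add_apply, Matrix.mul_apply, Matrix.mul_apply]
    refine (h.pd_metric hz k a b).trans ?_
    congr 1
    exact Finset.sum_congr rfl fun m _ => mul_comm _ _
  have hs : (G z)⁻¹ * (dG * (G z)⁻¹ + G z * dg) = 0 := by rw [h0, mul_zero]
  have h2 : dg = - (Γ * (G z)⁻¹) - (G z)⁻¹ * Γ.transpose := by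
    rw [h1, mul_add, ← mul_assoc (G z)⁻¹ (G z), h.inv_mul hz, one_mul, add_mul, mul_assoc _ (G z),
      h.mul_inv hz, mul_one, mul_add, mul_assoc (G z), ← mul_assoc (G z)⁻¹ (G z), h.inv_mul hz,
      one_mul] at hs
    rw [← sub_eq_zero, ← hs]; abel
  have h3 := congrFun (congrFun h2 i) j
  refine h3.trans ?_
  rw [Matrix.sub_apply, Matrix.neg_apply, Matrix.mul_apply, Matrix.mul_apply]
  congr 1
  exact Finset.sum_congr rfl fun m _ => mul_comm _ _

theorem pd_ip1 (h : MetricOn G V) {ξ θ : E4 → Fin 4 → ℝ} {z : E4} (hz : z ∈ V)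
    (hξ : ∀ i, DifferentiableAt ℝ (fun y => ξ y i) z)
    (hθ : ∀ i, DifferentiableAt ℝ (fun y => θ y i) z) (k : Fin 4) :
    pd k (fun y => ip1 G y (ξ y) (θ y)) z
      = ip1 G z (cov1 G ξ z k) (θ z) + ip1 G z (ξ z) (cov1 G θ z k) := by
  have hg : ∀ a b, DifferentiableAt ℝ (fun y => ginv G y a b) z := fun a b =>
    differentiableAt_of_smooth h.isOpen (h.ginv_smooth a b) hz
  have e : ∀ i j, pd k (fun y => ξ y i * (ginv G y i j * θ y j)) z
      = ξ z i * (ginv G z i j * pd k (fun y => θ y j) z + pd k (fun y => ginv G y i j) z * θ z j)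
        + pd k (fun y => ξ y i) z * (ginv G z i j * θ z j) := fun i j => by
    rw [pd_mul (hξ i) ((hg i j).fun_mul (hθ j)), pd_mul (hg i j) (hθ j)]
  unfold ip1 pairing sharp
  simp only [Finset.mul_sum]
  rw [pd_sum _ fun i _ => DifferentiableAt.fun_sum fun j _ =>
    (hξ i).fun_mul ((hg i j).fun_mul (hθ j))]
  have e' : ∀ i, pd k (fun y => ∑ j, ξ y i * (ginv G y i j * θ y j)) z
      = ∑ j, (ξ z i * (ginv G z i j * pd k (fun y => θ y j) z
        + pd k (fun y => ginv G y i j) z * θ z j)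
        + pd k (fun y => ξ y i) z * (ginv G z i j * θ z j)) := fun i => by
    rw [pd_sum _ fun j _ => (hξ i).fun_mul ((hg i j).fun_mul (hθ j))]
    exact Finset.sum_congr rfl fun j _ => e i j
  rw [Finset.sum_congr rfl fun i _ => e' i]
  simp only [h.pd_ginv hz, cov1, Fin.sum_univ_four]
  ring

end MetricOn

/-! ### Algebra of the metric product of 1-forms -/

section Ip

variable {G : CMetric} {z : E4}

theorem ip1_comb (p q r s : ℝ) (t u v w x : Fin 4 → ℝ) :
    ip1 G z (fun k => p * t k + q * u k + r * v k + s * w k) x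
      = p * ip1 G z t x + q * ip1 G z u x + r * ip1 G z v x + s * ip1 G z w x := by
  unfold ip1 pairing
  simp only [Finset.mul_sum, ← Finset.sum_add_distrib]
  exact Finset.sum_congr rfl fun _ _ => by ring

theorem ip1_comb₂ (p q r s : ℝ) (t u v w x : Fin 4 → ℝ) :
    ip1 G z x (fun k => p * t k + q * u k + r * v k + s * w k)
      = p * ip1 G z x t + q * ip1 G z x u + r * ip1 G z x v + s * ip1 G z x w := by
  have : ∀ i, sharp G z (fun k => p * t k + q * u k + r * v k + s * w k) i
      = p * sharp G z t i + q * sharp G z u i + r * sharp G z v i + s * sharp G z w i := by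
    intro i
    unfold sharp
    simp only [Finset.mul_sum, ← Finset.sum_add_distrib]
    exact Finset.sum_congr rfl fun _ _ => by ring
  unfold ip1 pairing
  simp only [Finset.mul_sum, ← Finset.sum_add_distrib, this]
  exact Finset.sum_congr rfl fun _ _ => by ring

/-- The product of 2-forms is bilinear and given on decomposable forms by Gram determinants. -/
theorem ip2_wedge (a b c d : Fin 4 → ℝ) :
    ip2 G z (wedge a b) (wedge c d)
      = ip1 G z a c * ip1 G z b d - ip1 G z a d * ip1 G z b c := by
  have key : ∀ a b c d : Fin 4 → ℝ, ∑ i, ∑ j, ∑ k, ∑ m,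
      ginv G z i k * ginv G z j m * (a i * b j * (c k * d m)) = ip1 G z a c * ip1 G z b d := by
    intro a b c d
    unfold ip1 pairing sharp
    rw [Finset.sum_mul_sum]
    refine Finset.sum_congr rfl fun i _ => Finset.sum_congr rfl fun j _ => ?_
    rw [mul_mul_mul_comm, Finset.sum_mul_sum, Finset.mul_sum]
    refine Finset.sum_congr rfl fun k _ => ?_
    rw [Finset.mul_sum]
    exact Finset.sum_congr rfl fun m _ => by ring
  unfold ip2
  simp only [smul_eq_mul]
  have : ∀ i j k m, ginv G z i k * ginv G z j m * (wedge a b i j * wedge c d k m)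
      = ginv G z i k * ginv G z j m * (a i * b j * (c k * d m))
        - ginv G z i k * ginv G z j m * (a i * b j * (d k * c m))
        - ginv G z i k * ginv G z j m * (b i * a j * (c k * d m))
        + ginv G z i k * ginv G z j m * (b i * a j * (d k * c m)) := by
    intro i j k m; unfold wedge; ring
  simp only [this, Finset.sum_add_distrib, Finset.sum_sub_distrib, key]
  ring

end Ip

/-! ### Null frames -/

/-- The 1-forms `l, n, e, f` are a null coframe of the metric at the point `z`: the metric is
`- l n - n l + e e + f f`. -/
def IsNullFrame (G : CMetric) (z : E4) (l n e f : Fin 4 → ℝ) : Prop :=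
  ∀ i j, G z i j = -(l i * n j + n i * l j) + e i * e j + f i * f j

/-- The products of the 1-forms of a null coframe. -/
structure NullProducts (G : CMetric) (z : E4) (l n e f : Fin 4 → ℝ) : Prop where
  ll : ip1 G z l l = 0
  ln : ip1 G z l n = -1
  le : ip1 G z l e = 0
  lf : ip1 G z l f = 0
  nl : ip1 G z n l = -1
  nn : ip1 G z n n = 0
  ne : ip1 G z n e = 0
  nf : ip1 G z n f = 0
  el : ip1 G z e l = 0
  en : ip1 G z e n = 0
  ee : ip1 G z e e = 1
  ef : ip1 G z e f = 0
  fl : ip1 G z f l = 0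
  fn : ip1 G z f n = 0
  fe : ip1 G z f e = 0
  ff : ip1 G z f f = 1

/-- The matrix of the components of a null coframe. -/
def coframe (l n e f : Fin 4 → ℝ) : Matrix (Fin 4) (Fin 4) ℝ := Matrix.of ![l, n, e, f]

/-- The Gram matrix of a null coframe. -/
def nullGram : Matrix (Fin 4) (Fin 4) ℝ := !![0, -1, 0, 0; -1, 0, 0, 0; 0, 0, 1, 0; 0, 0, 0, 1]

theorem nullGram_mul_self : nullGram * nullGram = 1 := by
  unfold nullGram
  ext i j
  fin_cases i <;> fin_cases j <;> simp [Matrix.mul_apply, Fin.sum_univ_four]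

theorem IsNullFrame.eq_mul {G : CMetric} {z : E4} {l n e f : Fin 4 → ℝ}
    (h : IsNullFrame G z l n e f) :
    G z = (coframe l n e f).transpose * nullGram * coframe l n e f := by
  ext i j
  rw [h i j]
  simp [coframe, nullGram, Matrix.mul_apply, Fin.sum_univ_four]

theorem gram_apply {G : CMetric} {z : E4} {l n e f : Fin 4 → ℝ} (a b : Fin 4) :
    (coframe l n e f * (G z)⁻¹ * (coframe l n e f).transpose) a b
      = ip1 G z (coframe l n e f a) (coframe l n e f b) := by
  simp only [ip1, pairing, sharp, ginv, Matrix.mul_apply, Matrix.transpose_apply, Fin.sum_univ_four]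
  ring

theorem isUnit_det_of_gram {C K : Matrix (Fin 4) (Fin 4) ℝ}
    (h : C * K * C.transpose = nullGram) : IsUnit C.det := by
  have h1 : C * (K * C.transpose * nullGram) = 1 := by
    rw [← mul_assoc, ← mul_assoc, h, nullGram_mul_self]
  exact Matrix.isUnit_det_of_right_inverse h1

theorem IsNullFrame.products {G : CMetric} {V : Set E4} (hG : MetricOn G V) {z : E4} (hz : z ∈ V)
    {l n e f : Fin 4 → ℝ} (h : IsNullFrame G z l n e f) : NullProducts G z l n e f := by
  have hd := hG.det_ne hz
  have hE := h.eq_mul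
  have hC : IsUnit (coframe l n e f).det := by
    refine isUnit_iff_ne_zero.2 fun h0 => hd ?_
    rw [hE, Matrix.det_mul, h0, mul_zero]
  have hN : nullGram⁻¹ = nullGram := Matrix.inv_eq_right_inv nullGram_mul_self
  have key : coframe l n e f * (G z)⁻¹ * (coframe l n e f).transpose = nullGram := by
    have hCt : IsUnit (coframe l n e f).transpose.det := by rwa [Matrix.det_transpose]
    rw [hE, Matrix.mul_inv_rev, Matrix.mul_inv_rev, hN, ← mul_assoc, Matrix.mul_nonsing_inv _ hC,
      one_mul, mul_assoc, Matrix.nonsing_inv_mul _ hCt, mul_one]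
  have e' : ∀ a b, ip1 G z (coframe l n e f a) (coframe l n e f b) = nullGram a b := fun a b => by
    rw [← gram_apply, key]
  constructor
  exacts [e' 0 0, e' 0 1, e' 0 2, e' 0 3, e' 1 0, e' 1 1, e' 1 2, e' 1 3, e' 2 0, e' 2 1, e' 2 2,
    e' 2 3, e' 3 0, e' 3 1, e' 3 2, e' 3 3]

theorem NullProducts.isNullFrame {G : CMetric} {V : Set E4} (hG : MetricOn G V) {z : E4}
    (hz : z ∈ V) {l n e f : Fin 4 → ℝ} (h : NullProducts G z l n e f) :
    IsNullFrame G z l n e f := by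
  have key : coframe l n e f * (G z)⁻¹ * (coframe l n e f).transpose = nullGram := by
    ext a b
    rw [gram_apply]
    fin_cases a <;> fin_cases b
    exacts [h.ll, h.ln, h.le, h.lf, h.nl, h.nn, h.ne, h.nf, h.el, h.en, h.ee, h.ef, h.fl, h.fn,
      h.fe, h.ff]
  set C := coframe l n e f
  have hC := isUnit_det_of_gram key
  have hCt : IsUnit C.transpose.det := by rwa [Matrix.det_transpose]
  have hN : nullGram⁻¹ = nullGram := Matrix.inv_eq_right_inv nullGram_mul_self
  have hE : G z = C.transpose * nullGram * C := by
    have h1 := congrArg (fun M => C.transpose * M⁻¹ * C) key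
    simp only [hN] at h1
    rw [← h1, Matrix.mul_inv_rev, Matrix.mul_inv_rev, Matrix.nonsing_inv_nonsing_inv _
      (hG.det_ne hz).isUnit, ← mul_assoc, Matrix.mul_nonsing_inv _ hCt, one_mul, mul_assoc,
      Matrix.nonsing_inv_mul _ hC, mul_one]
  intro i j
  rw [hE]
  simp [C, coframe, nullGram, Matrix.mul_apply, Fin.sum_univ_four]

section Pointwise

variable {G : CMetric} {V : Set E4} {z : E4} {l n e f : Fin 4 → ℝ}

/-- The expansion of a 1-form in a null coframe. -/
theorem IsNullFrame.expand (h : IsNullFrame G z l n e f) (hG : MetricOn G V) (hz : z ∈ V)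
    (v : Fin 4 → ℝ) (k : Fin 4) : v k = (-ip1 G z v n) * l k + (-ip1 G z v l) * n k
      + ip1 G z v e * e k + ip1 G z v f * f k := by
  rw [hG.ip1_comm hz v n, hG.ip1_comm hz v l, hG.ip1_comm hz v e, hG.ip1_comm hz v f]
  conv_lhs => rw [← hG.sum_mul_sharp hz v k]
  simp only [h k, ip1, pairing, Fin.sum_univ_four]
  ring

/-- The forms of a null coframe are linearly independent. -/
theorem NullProducts.coeff_zero (h : NullProducts G z l n e f) {p q r s : ℝ}
    (h0 : ∀ k, p * l k + q * n k + r * e k + s * f k = 0) : p = 0 ∧ q = 0 ∧ r = 0 ∧ s = 0 := by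
  have e0 : (fun k => p * l k + q * n k + r * e k + s * f k) = fun _ => (0 : ℝ) := funext h0
  have hv : ∀ v, p * ip1 G z l v + q * ip1 G z n v + r * ip1 G z e v + s * ip1 G z f v = 0 := by
    intro v
    rw [← ip1_comb, e0]; simp [ip1, pairing]
  have a1 := hv l
  have a2 := hv n
  have a3 := hv e
  have a4 := hv f
  rw [h.ll, h.nl, h.el, h.fl] at a1
  rw [h.ln, h.nn, h.en, h.fn] at a2
  rw [h.le, h.ne, h.ee, h.fe] at a3
  rw [h.lf, h.nf, h.ef, h.ff] at a4
  exact ⟨by linarith, by linarith, by linarith, by linarith⟩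

end Pointwise

/-- A smooth null coframe on an open set. -/
structure NullFrame (G : CMetric) (V : Set E4) where
  l : E4 → Fin 4 → ℝ
  n : E4 → Fin 4 → ℝ
  e : E4 → Fin 4 → ℝ
  f : E4 → Fin 4 → ℝ
  sl : ∀ i, ContDiffOn ℝ ∞ (fun z => l z i) V
  sn : ∀ i, ContDiffOn ℝ ∞ (fun z => n z i) V
  se : ∀ i, ContDiffOn ℝ ∞ (fun z => e z i) V
  sf : ∀ i, ContDiffOn ℝ ∞ (fun z => f z i) V
  frame : ∀ z ∈ V, IsNullFrame G z (l z) (n z) (e z) (f z)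

namespace NullFrame

variable {G : CMetric} {V : Set E4} (F : NullFrame G V)

/-! The connection forms of a null coframe, with the index of differentiation as their only index:
`∇l = θ ⊗ l + a ⊗ e + b ⊗ f`, `∇n = -θ ⊗ n + μ ⊗ e + ν ⊗ f`, `∇e = a ⊗ n + μ ⊗ l + ψ ⊗ f` and
`∇f = b ⊗ n + ν ⊗ l - ψ ⊗ e`. -/

/-- The connection form `θ`, the `l`-part of `∇l`. -/
def th (z : E4) (i : Fin 4) : ℝ := - ip1 G z (cov1 G F.l z i) (F.n z)

/-- The connection form `a`, the `e`-part of `∇l`. -/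
def a (z : E4) (i : Fin 4) : ℝ := ip1 G z (cov1 G F.l z i) (F.e z)

/-- The connection form `b`, the `f`-part of `∇l`. -/
def b (z : E4) (i : Fin 4) : ℝ := ip1 G z (cov1 G F.l z i) (F.f z)

/-- The connection form `μ`, the `e`-part of `∇n`. -/
def mu (z : E4) (i : Fin 4) : ℝ := ip1 G z (cov1 G F.n z i) (F.e z)

/-- The connection form `ν`, the `f`-part of `∇n`. -/
def nu (z : E4) (i : Fin 4) : ℝ := ip1 G z (cov1 G F.n z i) (F.f z)

/-- The connection form `ψ`, the `f`-part of `∇e`. -/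
def ps (z : E4) (i : Fin 4) : ℝ := ip1 G z (cov1 G F.e z i) (F.f z)

/-- The null 2-form `l ∧ e`. -/
def L (z : E4) : Fin 4 → Fin 4 → ℝ := wedge (F.l z) (F.e z)

/-- The null 2-form `l ∧ f`. -/
def M (z : E4) : Fin 4 → Fin 4 → ℝ := wedge (F.l z) (F.f z)

/-- The curvature is that of a vacuum type N metric with fundamental forms `l ∧ e`, `l ∧ f`. -/
def TypeNCurvature : Prop := ∀ z ∈ V, ∀ a b c d,
  riemLow G z a b c d = F.L z a b * F.L z c d - F.M z a b * F.M z c d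

theorem prods (hG : MetricOn G V) {z : E4} (hz : z ∈ V) :
    NullProducts G z (F.l z) (F.n z) (F.e z) (F.f z) :=
  (F.frame z hz).products hG hz

theorem s_th (hG : MetricOn G V) (i : Fin 4) : ContDiffOn ℝ ∞ (fun z => F.th z i) V :=
  (hG.ip1_smooth (hG.cov1_smooth F.sl i) F.sn).neg

theorem s_a (hG : MetricOn G V) (i : Fin 4) : ContDiffOn ℝ ∞ (fun z => F.a z i) V :=
  hG.ip1_smooth (hG.cov1_smooth F.sl i) F.se

theorem s_b (hG : MetricOn G V) (i : Fin 4) : ContDiffOn ℝ ∞ (fun z => F.b z i) V :=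
  hG.ip1_smooth (hG.cov1_smooth F.sl i) F.sf

theorem s_mu (hG : MetricOn G V) (i : Fin 4) : ContDiffOn ℝ ∞ (fun z => F.mu z i) V :=
  hG.ip1_smooth (hG.cov1_smooth F.sn i) F.se

theorem s_nu (hG : MetricOn G V) (i : Fin 4) : ContDiffOn ℝ ∞ (fun z => F.nu z i) V :=
  hG.ip1_smooth (hG.cov1_smooth F.sn i) F.sf

theorem s_ps (hG : MetricOn G V) (i : Fin 4) : ContDiffOn ℝ ∞ (fun z => F.ps z i) V :=
  hG.ip1_smooth (hG.cov1_smooth F.se i) F.sf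

theorem cov_skew {ξ θ : E4 → Fin 4 → ℝ} (hG : MetricOn G V)
    (hξ : ∀ i, ContDiffOn ℝ ∞ (fun z => ξ z i) V) (hθ : ∀ i, ContDiffOn ℝ ∞ (fun z => θ z i) V)
    {c : ℝ} (hc : ∀ z ∈ V, ip1 G z (ξ z) (θ z) = c) {z : E4} (hz : z ∈ V) (i : Fin 4) :
    ip1 G z (cov1 G ξ z i) (θ z) = - ip1 G z (cov1 G θ z i) (ξ z) := by
  have h := hG.pd_ip1 hz (fun j => differentiableAt_of_smooth hG.isOpen (hξ j) hz)
    (fun j => differentiableAt_of_smooth hG.isOpen (hθ j) hz) i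
  rw [pd_congr_on hG.isOpen (g := fun _ => c) hc hz, pd_const, hG.ip1_comm hz (ξ z)] at h
  linarith

theorem cov_l (hG : MetricOn G V) {z : E4} (hz : z ∈ V) (i j : Fin 4) : cov1 G F.l z i j
    = F.th z i * F.l z j + F.a z i * F.e z j + F.b z i * F.f z j := by
  have h1 := cov_skew hG F.sl F.sl (fun z hz => (F.prods hG hz).ll) hz i
  rw [(F.frame z hz).expand hG hz (cov1 G F.l z i) j]
  have : ip1 G z (cov1 G F.l z i) (F.l z) = 0 := by linarith
  rw [this]; unfold th a b; ring

theorem cov_n (hG : MetricOn G V) {z : E4} (hz : z ∈ V) (i j : Fin 4) : cov1 G F.n z i j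
    = - F.th z i * F.n z j + F.mu z i * F.e z j + F.nu z i * F.f z j := by
  have h1 := cov_skew hG F.sn F.sn (fun z hz => (F.prods hG hz).nn) hz i
  have h2 := cov_skew hG F.sn F.sl (fun z hz => (F.prods hG hz).nl) hz i
  rw [(F.frame z hz).expand hG hz (cov1 G F.n z i) j]
  have : ip1 G z (cov1 G F.n z i) (F.n z) = 0 := by linarith
  rw [this, h2]; unfold th mu nu; ring

theorem cov_e (hG : MetricOn G V) {z : E4} (hz : z ∈ V) (i j : Fin 4) : cov1 G F.e z i j
    = F.a z i * F.n z j + F.mu z i * F.l z j + F.ps z i * F.f z j := by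
  have h1 := cov_skew hG F.se F.se (fun z hz => (F.prods hG hz).ee) hz i
  have h2 := cov_skew hG F.se F.sl (fun z hz => (F.prods hG hz).el) hz i
  have h3 := cov_skew hG F.se F.sn (fun z hz => (F.prods hG hz).en) hz i
  rw [(F.frame z hz).expand hG hz (cov1 G F.e z i) j]
  have : ip1 G z (cov1 G F.e z i) (F.e z) = 0 := by linarith
  rw [this, h2, h3]; unfold a mu ps; ring

theorem cov_f (hG : MetricOn G V) {z : E4} (hz : z ∈ V) (i j : Fin 4) : cov1 G F.f z i j
    = F.b z i * F.n z j + F.nu z i * F.l z j - F.ps z i * F.e z j := by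
  have h1 := cov_skew hG F.sf F.sf (fun z hz => (F.prods hG hz).ff) hz i
  have h2 := cov_skew hG F.sf F.sl (fun z hz => (F.prods hG hz).fl) hz i
  have h3 := cov_skew hG F.sf F.sn (fun z hz => (F.prods hG hz).fn) hz i
  have h4 := cov_skew hG F.sf F.se (fun z hz => (F.prods hG hz).fe) hz i
  rw [(F.frame z hz).expand hG hz (cov1 G F.f z i) j]
  have : ip1 G z (cov1 G F.f z i) (F.f z) = 0 := by linarith
  rw [this, h2, h3, h4]; unfold b nu ps; ring

end NullFrame

/-! ### Structure equations of a null coframe -/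

@[simp] theorem extd_zero (z : E4) (i j : Fin 4) : extd (fun _ _ => 0) z i j = 0 := by
  simp [extd]

/-- The Ricci identity for a 1-form whose covariant derivative is `∑ c_A ⊗ t_A`. -/
theorem MetricOn.ricci_sum {G : CMetric} {V : Set E4} (hG : MetricOn G V) {ξ : E4 → Fin 4 → ℝ}
    (hξ : ∀ i, ContDiffOn ℝ ∞ (fun z => ξ z i) V) {c t : Fin 4 → E4 → Fin 4 → ℝ}
    (hc : ∀ A i, ContDiffOn ℝ ∞ (fun z => c A z i) V)
    (ht : ∀ A i, ContDiffOn ℝ ∞ (fun z => t A z i) V)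
    (hcov : ∀ z ∈ V, ∀ i j, cov1 G ξ z i j = ∑ A, c A z i * t A z j) {z : E4} (hz : z ∈ V)
    (i j k : Fin 4) :
    ∑ A, (extd (c A) z i j * t A z k + c A z j * cov1 G (t A) z i k - c A z i * cov1 G (t A) z j k)
      = - ∑ m, riem G z m k i j * ξ z m := by
  have dc : ∀ A i, DifferentiableAt ℝ (fun y => c A y i) z := fun A i =>
    differentiableAt_of_smooth hG.isOpen (hc A i) hz
  have dt : ∀ A i, DifferentiableAt ℝ (fun y => t A y i) z := fun A i =>
    differentiableAt_of_smooth hG.isOpen (ht A i) hz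
  have e : ∀ i j, pd i (fun y => cov1 G ξ y j k) z
      = ∑ A, (c A z j * pd i (fun y => t A y k) z + pd i (fun y => c A y j) z * t A z k) := by
    intro i j
    rw [pd_congr_on hG.isOpen (fun y hy => hcov y hy j k) hz,
      pd_sum _ fun A _ => (dc A j).fun_mul (dt A k)]
    exact Finset.sum_congr rfl fun A _ => pd_mul (dc A j) (dt A k) i
  rw [← hG.ricci_identity hξ hz i j k, e, e]
  simp only [hcov z hz]
  simp only [extd, cov1, Fin.sum_univ_four]
  ring

namespace NullFrame

variable {G : CMetric} {V : Set E4} (F : NullFrame G V)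

/-- The curvature operator of a type N metric applied to a 1-form. -/
theorem riem_contract (hG : MetricOn G V) (hR : F.TypeNCurvature) {z : E4} (hz : z ∈ V)
    (ξ : Fin 4 → ℝ) (k i j : Fin 4) : ∑ m, riem G z m k i j * ξ m
      = (ip1 G z (F.l z) ξ * F.e z k - ip1 G z (F.e z) ξ * F.l z k) * F.L z i j
      - (ip1 G z (F.l z) ξ * F.f z k - ip1 G z (F.f z) ξ * F.l z k) * F.M z i j := by
  have h1 : ∑ m, riem G z m k i j * ξ m = ∑ a, sharp G z ξ a * riemLow G z a k i j := by
    have : ∀ m, riem G z m k i j * ξ m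
        = ∑ a, (∑ b, G z a m * (ginv G z a b * ξ b)) * riem G z m k i j := by
      intro m
      have := hG.sum_mul_sharp hz ξ m
      simp only [sharp, Finset.mul_sum] at this
      rw [← Finset.sum_mul, mul_comm, ← this]
      congr 1
      exact Finset.sum_congr rfl fun a _ => Finset.sum_congr rfl fun b _ => by rw [hG.symm z hz m a]
    simp only [this, riemLow, sharp]
    rw [Finset.sum_comm]
    refine Finset.sum_congr rfl fun a _ => ?_
    rw [Finset.mul_sum]
    refine Finset.sum_congr rfl fun m _ => ?_
    rw [← Finset.mul_sum]; ring
  rw [h1]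
  simp only [hR z hz, ip1, pairing, L, M, wedge, Fin.sum_univ_four]
  ring

theorem forall_fin_four {P : Fin 4 → Prop} (h0 : P 0) (h1 : P 1) (h2 : P 2) (h3 : P 3) (A : Fin 4) :
    P A := by fin_cases A <;> assumption

/-- The structure equations for `dθ`, `da`, `db`: the components of the Ricci identity for `l`. The
curvature does not enter, because `l` annihilates it. -/
theorem ricci_l (hG : MetricOn G V) (hR : F.TypeNCurvature) {z : E4} (hz : z ∈ V) (i j : Fin 4) :
    extd F.th z i j = wedge (F.a z) (F.mu z) i j + wedge (F.b z) (F.nu z) i j ∧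
    extd F.a z i j = wedge (F.th z) (F.a z) i j + wedge (F.ps z) (F.b z) i j ∧
    extd F.b z i j = wedge (F.th z) (F.b z) i j - wedge (F.ps z) (F.a z) i j := by
  have h := fun k => hG.ricci_sum F.sl (c := ![F.th, fun _ _ => 0, F.a, F.b])
    (t := ![F.l, F.n, F.e, F.f])
    (forall_fin_four (F.s_th hG) (fun _ => contDiffOn_const) (F.s_a hG) (F.s_b hG))
    (forall_fin_four F.sl F.sn F.se F.sf)
    (fun y hy i j => by rw [F.cov_l hG hy]; simp [Fin.sum_univ_four]) hz i j k
  have hc := (F.prods hG hz).coeff_zero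
    (p := extd F.th z i j - wedge (F.a z) (F.mu z) i j - wedge (F.b z) (F.nu z) i j) (q := 0)
    (r := extd F.a z i j - wedge (F.th z) (F.a z) i j - wedge (F.ps z) (F.b z) i j)
    (s := extd F.b z i j - wedge (F.th z) (F.b z) i j + wedge (F.ps z) (F.a z) i j) (fun k => by
      have hk := h k
      rw [F.riem_contract hG hR hz, (F.prods hG hz).ll, (F.prods hG hz).el,
        (F.prods hG hz).fl] at hk
      simp [Fin.sum_univ_four, F.cov_l hG hz, F.cov_e hG hz, F.cov_f hG hz] at hk
      unfold wedge
      linear_combination hk)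
  exact ⟨by linarith [hc.1], by linarith [hc.2.2.1], by linarith [hc.2.2.2]⟩

/-- The structure equations for `dμ`, `dν`: the components of the Ricci identity for `n`. -/
theorem ricci_n (hG : MetricOn G V) (hR : F.TypeNCurvature) {z : E4} (hz : z ∈ V) (i j : Fin 4) :
    extd F.mu z i j = wedge (F.mu z) (F.th z) i j + wedge (F.ps z) (F.nu z) i j + F.L z i j ∧
    extd F.nu z i j = wedge (F.nu z) (F.th z) i j - wedge (F.ps z) (F.mu z) i j - F.M z i j := by
  have h := fun k => hG.ricci_sum F.sn (c := ![fun _ _ => 0, fun z i => - F.th z i, F.mu, F.nu])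
    (t := ![F.l, F.n, F.e, F.f])
    (forall_fin_four (fun _ => contDiffOn_const) (fun i => (F.s_th hG i).neg) (F.s_mu hG) (F.s_nu hG))
    (forall_fin_four F.sl F.sn F.se F.sf)
    (fun y hy i j => by rw [F.cov_n hG hy]; simp [Fin.sum_univ_four]) hz i j k
  have hc := (F.prods hG hz).coeff_zero
    (p := 0) (q := - extd F.th z i j + wedge (F.a z) (F.mu z) i j + wedge (F.b z) (F.nu z) i j)
    (r := extd F.mu z i j - wedge (F.mu z) (F.th z) i j - wedge (F.ps z) (F.nu z) i j - F.L z i j)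
    (s := extd F.nu z i j - wedge (F.nu z) (F.th z) i j + wedge (F.ps z) (F.mu z) i j
      + F.M z i j) (fun k => by
      have hk := h k
      rw [F.riem_contract hG hR hz, (F.prods hG hz).ln, (F.prods hG hz).en,
        (F.prods hG hz).fn] at hk
      simp [Fin.sum_univ_four, F.cov_n hG hz, F.cov_e hG hz, F.cov_f hG hz, extd_neg] at hk
      unfold wedge
      linear_combination hk)
  exact ⟨by linarith [hc.2.2.1], by linarith [hc.2.2.2]⟩

/-- The structure equation for `dψ`: the `f`-component of the Ricci identity for `e`. -/
theorem ricci_e (hG : MetricOn G V) (hR : F.TypeNCurvature) {z : E4} (hz : z ∈ V) (i j : Fin 4) :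
    extd F.ps z i j = wedge (F.a z) (F.nu z) i j + wedge (F.mu z) (F.b z) i j := by
  have h := fun k => hG.ricci_sum F.se (c := ![F.mu, F.a, fun _ _ => 0, F.ps])
    (t := ![F.l, F.n, F.e, F.f])
    (forall_fin_four (F.s_mu hG) (F.s_a hG) (fun _ => contDiffOn_const) (F.s_ps hG))
    (forall_fin_four F.sl F.sn F.se F.sf)
    (fun y hy i j => by rw [F.cov_e hG hy]; simp [Fin.sum_univ_four]; ring) hz i j k
  have hc := (F.prods hG hz).coeff_zero
    (p := extd F.mu z i j - wedge (F.mu z) (F.th z) i j - wedge (F.ps z) (F.nu z) i j - F.L z i j)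
    (q := extd F.a z i j - wedge (F.th z) (F.a z) i j - wedge (F.ps z) (F.b z) i j) (r := 0)
    (s := extd F.ps z i j - wedge (F.a z) (F.nu z) i j - wedge (F.mu z) (F.b z) i j) (fun k => by
      have hk := h k
      rw [F.riem_contract hG hR hz, (F.prods hG hz).le, (F.prods hG hz).ee,
        (F.prods hG hz).fe] at hk
      simp [Fin.sum_univ_four, F.cov_n hG hz, F.cov_l hG hz, F.cov_f hG hz] at hk
      unfold wedge
      linear_combination hk)
  linarith [hc.2.2.2]

/-- The exterior derivative is the antisymmetric part of the covariant derivative. -/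
theorem extd_eq_cov (hG : MetricOn G V) (ξ : E4 → Fin 4 → ℝ) {z : E4} (hz : z ∈ V) (i j : Fin 4) :
    extd ξ z i j = cov1 G ξ z i j - cov1 G ξ z j i := by
  unfold extd cov1
  simp only [hG.chr_symm hz _ i j]; ring

theorem extd_l (hG : MetricOn G V) {z : E4} (hz : z ∈ V) (i j : Fin 4) : extd F.l z i j
    = wedge (F.th z) (F.l z) i j + wedge (F.a z) (F.e z) i j + wedge (F.b z) (F.f z) i j := by
  rw [extd_eq_cov hG _ hz, F.cov_l hG hz, F.cov_l hG hz]; unfold wedge; ring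

theorem extd_e (hG : MetricOn G V) {z : E4} (hz : z ∈ V) (i j : Fin 4) : extd F.e z i j
    = wedge (F.a z) (F.n z) i j + wedge (F.mu z) (F.l z) i j + wedge (F.ps z) (F.f z) i j := by
  rw [extd_eq_cov hG _ hz, F.cov_e hG hz, F.cov_e hG hz]; unfold wedge; ring

theorem extd_f (hG : MetricOn G V) {z : E4} (hz : z ∈ V) (i j : Fin 4) : extd F.f z i j
    = wedge (F.b z) (F.n z) i j + wedge (F.nu z) (F.l z) i j - wedge (F.ps z) (F.e z) i j := by
  rw [extd_eq_cov hG _ hz, F.cov_f hG hz, F.cov_f hG hz]; unfold wedge; ring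

/-! Consequences of `d² = 0` when the null form `l` is recurrent. -/

/-- The null form `l` is recurrent on `V`. -/
def Recurrent : Prop := ∀ z ∈ V, ∀ i, F.a z i = 0 ∧ F.b z i = 0

variable {F}

theorem Recurrent.extd_th (hp : F.Recurrent) (hG : MetricOn G V) (hR : F.TypeNCurvature) {z : E4}
    (hz : z ∈ V) (i j : Fin 4) : extd F.th z i j = 0 := by
  rw [(F.ricci_l hG hR hz i j).1]; simp [wedge, hp z hz]

theorem Recurrent.extd_ps (hp : F.Recurrent) (hG : MetricOn G V) (hR : F.TypeNCurvature) {z : E4}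
    (hz : z ∈ V) (i j : Fin 4) : extd F.ps z i j = 0 := by
  rw [F.ricci_e hG hR hz i j]; simp [wedge, hp z hz]

/-- The Bianchi identity: `d² = 0` on the connection forms `mu` and `nu`. -/
theorem Recurrent.bianchi (hp : F.Recurrent) (hG : MetricOn G V) (hR : F.TypeNCurvature) {z : E4}
    (hz : z ∈ V) (i j k : Fin 4) :
    wedge3 (F.L z) (F.th z) i j k + wedge3 (F.M z) (F.ps z) i j k = 0 ∧
    wedge3 (F.M z) (F.th z) i j k - wedge3 (F.L z) (F.ps z) i j k = 0 := by
  have D : ∀ {ξ : E4 → Fin 4 → ℝ}, (∀ i, ContDiffOn ℝ ∞ (fun z => ξ z i) V) →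
      ∀ i, DifferentiableAt ℝ (fun y => ξ y i) z := fun h i =>
    differentiableAt_of_smooth hG.isOpen (h i) hz
  have dth := D (F.s_th hG)
  have dps := D (F.s_ps hG)
  have dmu := D (F.s_mu hG)
  have dnu := D (F.s_nu hG)
  have dl := D F.sl
  have de := D F.se
  have df := D F.sf
  have w := @wedge_differentiableAt
  have hl := F.extd_l hG hz
  have he := F.extd_e hG hz
  have hf := F.extd_f hG hz
  have h1 := extd2_extd hG.isOpen (F.s_mu hG) hz i j k
  have h2 := extd2_extd hG.isOpen (F.s_nu hG) hz i j k
  rw [extd2_congr_on hG.isOpen (fun y hy i j => (F.ricci_n hG hR hy i j).1) hz] at h1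
  rw [extd2_congr_on hG.isOpen (fun y hy i j => (F.ricci_n hG hR hy i j).2) hz] at h2
  simp only [L] at h1
  simp only [M] at h2
  rw [extd2_add (fun _ _ => (w dmu dth _ _).fun_add (w dps dnu _ _)) (w dl de),
    extd2_add (w dmu dth) (w dps dnu)] at h1
  rw [extd2_sub (fun _ _ => (w dnu dth _ _).fun_sub (w dps dmu _ _)) (w dl df),
    extd2_sub (w dnu dth) (w dps dmu)] at h2
  rw [extd2_wedge dmu dth, extd2_wedge dps dnu, extd2_wedge dl de] at h1
  rw [extd2_wedge dnu dth, extd2_wedge dps dmu, extd2_wedge dl df] at h2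
  simp only [wedge3, hp.extd_th hG hR hz, hp.extd_ps hG hR hz, fun i j => (F.ricci_n hG hR hz i j).1,
    fun i j => (F.ricci_n hG hR hz i j).2, hl, he, hf, wedge, hp z hz, L, M] at h1 h2 ⊢
  exact ⟨by linear_combination (1 / 2) * h1, by linear_combination (-1 / 2) * h2⟩

end NullFrame

/-! ### The Hodge dual in a null coframe -/

/-- The determinant of four vectors of the coordinate space. -/
def quad (t u v w : Fin 4 → ℝ) : ℝ :=
  t 0 * (u 1 * (v 2 * w 3 - v 3 * w 2) - u 2 * (v 1 * w 3 - v 3 * w 1)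
      + u 3 * (v 1 * w 2 - v 2 * w 1))
  - t 1 * (u 0 * (v 2 * w 3 - v 3 * w 2) - u 2 * (v 0 * w 3 - v 3 * w 0)
      + u 3 * (v 0 * w 2 - v 2 * w 0))
  + t 2 * (u 0 * (v 1 * w 3 - v 3 * w 1) - u 1 * (v 0 * w 3 - v 3 * w 0)
      + u 3 * (v 0 * w 1 - v 1 * w 0))
  - t 3 * (u 0 * (v 1 * w 2 - v 2 * w 1) - u 1 * (v 0 * w 2 - v 2 * w 0)
      + u 2 * (v 0 * w 1 - v 1 * w 0))

theorem det_eq_quad (A : Matrix (Fin 4) (Fin 4) ℝ) : A.det = quad (A 0) (A 1) (A 2) (A 3) := by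
  rw [Matrix.det_succ_row_zero, Fin.sum_univ_four]
  simp [Matrix.det_fin_three, Fin.succAbove, quad]
  ring

/-- The determinant as the sum over all index quadruples weighted by the alternating symbol. -/
theorem quad_sum (t u v w : Fin 4 → ℝ) : quad t u v w
    = ∑ a, ∑ b, ∑ c, ∑ d, eps a b c d * t a * u b * v c * w d := by
  have h0 : ∀ t u v w, quad t u v w = ∑ a, t a * quad (Pi.single a 1) u v w := by
    intro t u v w; simp [quad, Fin.sum_univ_four]; ring
  have h1 : ∀ t u v w, quad t u v w = ∑ a, u a * quad t (Pi.single a 1) v w := by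
    intro t u v w; simp [quad, Fin.sum_univ_four]; ring
  have h2 : ∀ t u v w, quad t u v w = ∑ a, v a * quad t u (Pi.single a 1) w := by
    intro t u v w; simp [quad, Fin.sum_univ_four]; ring
  have h3 : ∀ t u v w, quad t u v w = ∑ a, w a * quad t u v (Pi.single a 1) := by
    intro t u v w; simp [quad, Fin.sum_univ_four]; ring
  have he : ∀ a b c d, eps a b c d
      = quad (Pi.single a 1) (Pi.single b 1) (Pi.single c 1) (Pi.single d 1) := by
    intro a b c d
    unfold eps
    rw [det_eq_quad]
    congr 1 <;> funext k <;> simp [Pi.single_apply, eq_comm]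
  rw [h0]
  refine Finset.sum_congr rfl fun a _ => ?_
  rw [h1, Finset.mul_sum]
  refine Finset.sum_congr rfl fun b _ => ?_
  rw [h2, Finset.mul_sum, Finset.mul_sum]
  refine Finset.sum_congr rfl fun c _ => ?_
  rw [h3, Finset.mul_sum, Finset.mul_sum, Finset.mul_sum]
  refine Finset.sum_congr rfl fun d _ => ?_
  rw [he]; ring

theorem sum_single_mul (f : Fin 4 → ℝ) (a : Fin 4) :
    ∑ i, f i * (Pi.single a 1 : Fin 4 → ℝ) i = f a := by
  simp [Pi.single_apply]

theorem eps_contract_two (v w : Fin 4 → ℝ) (a b : Fin 4) :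
    ∑ c, ∑ d, eps a b c d * v c * w d = quad (Pi.single a 1) (Pi.single b 1) v w := by
  symm
  rw [quad_sum, Finset.sum_eq_single a (fun j _ hj => by simp [Pi.single_eq_of_ne hj]) (by simp),
    Finset.sum_eq_single b (fun j _ hj => by simp [Pi.single_eq_of_ne hj]) (by simp)]
  simp

theorem eps_contract_three (u v w : Fin 4 → ℝ) (d : Fin 4) :
    ∑ a, ∑ b, ∑ c, eps a b c d * u a * v b * w c = quad u v w (Pi.single d 1) := by
  rw [quad_sum]
  refine Finset.sum_congr rfl fun a _ => Finset.sum_congr rfl fun b _ =>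
    Finset.sum_congr rfl fun c _ => ?_
  rw [sum_single_mul (fun i => eps a b c i * u a * v b * w c)]

/-- The dual of a decomposable 2-form. -/
theorem hodge_wedge (G : CMetric) (F : E4 → Fin 4 → Fin 4 → ℝ) (z : E4) {v w : Fin 4 → ℝ}
    (hF : F z = wedge v w) (a b : Fin 4) : hodge G F z a b
      = √|(G z).det| * quad (Pi.single a 1) (Pi.single b 1) (sharp G z v) (sharp G z w) := by
  have key : ∀ v w : Fin 4 → ℝ, ∑ c, ∑ d, ∑ m, ∑ n,
      vol G z a b c d * ginv G z c m * ginv G z d n * (v m * w n)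
      = √|(G z).det| * quad (Pi.single a 1) (Pi.single b 1) (sharp G z v) (sharp G z w) := by
    intro v w
    rw [← eps_contract_two, Finset.mul_sum]
    refine Finset.sum_congr rfl fun c _ => ?_
    rw [Finset.mul_sum]
    refine Finset.sum_congr rfl fun d _ => ?_
    unfold sharp vol
    rw [mul_assoc (eps a b c d), Finset.sum_mul_sum, Finset.mul_sum, Finset.mul_sum]
    refine Finset.sum_congr rfl fun m _ => ?_
    rw [Finset.mul_sum, Finset.mul_sum]
    exact Finset.sum_congr rfl fun n _ => by ring
  have e : ∀ c d m n, vol G z a b c d * ginv G z c m * ginv G z d n * F z m n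
      = vol G z a b c d * ginv G z c m * ginv G z d n * (v m * w n)
        - vol G z a b c d * ginv G z c m * ginv G z d n * (w m * v n) := by
    intro c d m n; rw [hF]; unfold wedge; ring
  unfold hodge
  simp only [e, Finset.sum_sub_distrib, key]
  unfold quad; ring

theorem dual3_eq (G : CMetric) (u v w : E4 → Fin 4 → ℝ) (z : E4) (d : Fin 4) : dual3 G u v w z d
    = √|(G z).det| * quad (sharp G z (u z)) (sharp G z (v z)) (sharp G z (w z))
      (Pi.single d 1) := by
  rw [← eps_contract_three]
  unfold dual3 vol sharp
  simp only [Finset.mul_sum (a := √|(G z).det|)]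
  refine Finset.sum_congr rfl fun a _ => Finset.sum_congr rfl fun b _ =>
    Finset.sum_congr rfl fun c _ => ?_
  ring

section Frame

variable {G : CMetric} {V : Set E4} {z : E4} {l n e f : Fin 4 → ℝ}

theorem sharp_comb (p q r s : ℝ) (t u v w : Fin 4 → ℝ) (i : Fin 4) :
    sharp G z (fun k => p * t k + q * u k + r * v k + s * w k) i
      = p * sharp G z t i + q * sharp G z u i + r * sharp G z v i + s * sharp G z w i := by
  unfold sharp
  simp only [Finset.mul_sum, ← Finset.sum_add_distrib]
  exact Finset.sum_congr rfl fun _ _ => by ring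

theorem IsNullFrame.single_expand (h : IsNullFrame G z l n e f) (hG : MetricOn G V) (hz : z ∈ V)
    (a : Fin 4) : (Pi.single a 1 : Fin 4 → ℝ) = fun i => (-n a) * sharp G z l i
      + (-l a) * sharp G z n i + e a * sharp G z e i + f a * sharp G z f i := by
  funext i
  rw [← sharp_comb, ← hG.sharp_lower hz (Pi.single a 1) i]
  congr 1; funext k
  rw [sum_single_mul, h k a]; ring

/-- The value of the volume form on a null coframe. -/
def orient (G : CMetric) (z : E4) (l n e f : Fin 4 → ℝ) : ℝ :=
  √|(G z).det| * quad (sharp G z l) (sharp G z n) (sharp G z e) (sharp G z f)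

/-- The orientation factor of a null coframe is `±1`. -/
theorem NullProducts.orient_sq (h : NullProducts G z l n e f) (hG : MetricOn G V) (hz : z ∈ V) :
    orient G z l n e f * orient G z l n e f = 1 := by
  have hE := (h.isNullFrame hG hz).eq_mul
  have hd := hG.det_neg hz
  set C := coframe l n e f with hC
  have hN : nullGram.det = -1 := by
    rw [det_eq_quad]; simp [nullGram, quad]
  have hdet : (G z).det = - C.det ^ 2 := by
    rw [hE, Matrix.det_mul, Matrix.det_mul, Matrix.det_transpose, hN]; ring
  have hS : quad (sharp G z l) (sharp G z n) (sharp G z e) (sharp G z f)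
      = C.det * (G z)⁻¹.det := by
    rw [← Matrix.det_mul, det_eq_quad]
    have : ∀ a i, (C * (G z)⁻¹) a i = sharp G z (C a) i := by
      intro a i
      rw [Matrix.mul_apply]; unfold sharp
      exact Finset.sum_congr rfl fun j _ => by rw [hG.ginv_symm hz i j, mul_comm]; rfl
    congr 1 <;> funext i <;> rw [this] <;> rfl
  unfold orient
  rw [hS, Matrix.det_nonsing_inv, Ring.inverse_eq_inv']
  have h1 : √|(G z).det| * √|(G z).det| = - (G z).det := by
    rw [Real.mul_self_sqrt (abs_nonneg _), abs_of_neg hd]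
  have h2 : (G z).det ≠ 0 := hd.ne
  calc _ = (√|(G z).det| * √|(G z).det|) * C.det ^ 2 * ((G z).det⁻¹) ^ 2 := by ring
    _ = 1 := by
      rw [h1, show C.det ^ 2 = - (G z).det by rw [hdet]; ring]
      field_simp

theorem NullProducts.hodge_le (h : NullProducts G z l n e f) (hG : MetricOn G V) (hz : z ∈ V)
    {F : E4 → Fin 4 → Fin 4 → ℝ} (hF : F z = wedge l e) (a b : Fin 4) :
    hodge G F z a b = orient G z l n e f * wedge l f a b := by
  rw [hodge_wedge G F z hF, (h.isNullFrame hG hz).single_expand hG hz a,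
    (h.isNullFrame hG hz).single_expand hG hz b]
  unfold orient quad wedge; ring

theorem NullProducts.hodge_lf (h : NullProducts G z l n e f) (hG : MetricOn G V) (hz : z ∈ V)
    {F : E4 → Fin 4 → Fin 4 → ℝ} (hF : F z = wedge l f) (a b : Fin 4) :
    hodge G F z a b = - orient G z l n e f * wedge l e a b := by
  rw [hodge_wedge G F z hF, (h.isNullFrame hG hz).single_expand hG hz a,
    (h.isNullFrame hG hz).single_expand hG hz b]
  unfold orient quad wedge; ring

/-- The dual of the product of `l` with two 1-forms orthogonal to `l`. -/
theorem NullProducts.dual3_l (h : NullProducts G z l n e f) (hG : MetricOn G V) (hz : z ∈ V)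
    {u v w : E4 → Fin 4 → ℝ} (hu : u z = l) {p q r p' q' r' : ℝ}
    (hv : v z = fun k => p * l k + 0 * n k + q * e k + r * f k)
    (hw : w z = fun k => p' * l k + 0 * n k + q' * e k + r' * f k) (d : Fin 4) :
    dual3 G u v w z d = -(q * r' - r * q') * orient G z l n e f * l d := by
  have hs : ∀ p q r s : ℝ, sharp G z (fun k => p * l k + q * n k + r * e k + s * f k)
      = fun i => p * sharp G z l i + q * sharp G z n i + r * sharp G z e i + s * sharp G z f i :=
    fun p q r s => funext fun i => sharp_comb p q r s l n e f i
  rw [dual3_eq, hu, hv, hw, hs, hs, (h.isNullFrame hG hz).single_expand hG hz d]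
  unfold orient quad; ring

theorem ip1_smul_left (c : ℝ) (v w : Fin 4 → ℝ) :
    ip1 G z (fun k => c * v k) w = c * ip1 G z v w := by
  unfold ip1 pairing
  rw [Finset.mul_sum]
  exact Finset.sum_congr rfl fun _ _ => by ring

/-- Three 1-forms with the products of the first three forms of a null coframe complete to one. -/
theorem exists_completion (hG : MetricOn G V) (hz : z ∈ V) (hll : ip1 G z l l = 0)
    (hln : ip1 G z l n = -1) (hle : ip1 G z l e = 0) (hnn : ip1 G z n n = 0)
    (hne : ip1 G z n e = 0) (hee : ip1 G z e e = 1) : ∃ f, NullProducts G z l n e f := by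
  have hc := fun v w => hG.ip1_comm hz v w
  -- a nonzero form orthogonal to the three given ones
  obtain ⟨v, hv0, hv⟩ := (Matrix.exists_mulVec_eq_zero_iff
    (M := Matrix.of ![sharp G z l, sharp G z n, sharp G z e, 0])).2 (by
      rw [det_eq_quad]; simp [quad])
  have hvl : ip1 G z v l = 0 := by
    have := congrFun hv 0
    simpa [Matrix.mulVec, dotProduct, ip1, pairing, mul_comm] using this
  have hvn : ip1 G z v n = 0 := by
    have := congrFun hv 1
    simpa [Matrix.mulVec, dotProduct, ip1, pairing, mul_comm] using this
  have hve : ip1 G z v e = 0 := by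
    have := congrFun hv 2
    simpa [Matrix.mulVec, dotProduct, ip1, pairing, mul_comm] using this
  set q := ip1 G z v v with hq
  set C := coframe l n e v with hC
  have hK : C * (G z)⁻¹ * C.transpose
      = !![0, -1, 0, 0; -1, 0, 0, 0; 0, 0, 1, 0; 0, 0, 0, q] := by
    ext a b
    rw [gram_apply]
    fin_cases a <;> fin_cases b
    exacts [hll, hln, hle, (hc _ _).trans hvl, (hc _ _).trans hln, hnn, hne, (hc _ _).trans hvn,
      (hc _ _).trans hle, (hc _ _).trans hne, hee, (hc _ _).trans hve, hvl, hvn, hve, rfl]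
  have hdet : C.det ^ 2 * (G z).det⁻¹ = - q := by
    have := congrArg Matrix.det hK
    rw [Matrix.det_mul, Matrix.det_mul, Matrix.det_transpose, Matrix.det_nonsing_inv,
      Ring.inverse_eq_inv', det_eq_quad !![0, -1, 0, 0; -1, 0, 0, 0; 0, 0, 1, 0; 0, 0, 0, q]] at this
    simp [quad] at this
    linarith
  have hd := hG.det_neg hz
  have hq0 : 0 ≤ q := by
    have : C.det ^ 2 * (G z).det⁻¹ ≤ 0 :=
      mul_nonpos_of_nonneg_of_nonpos (sq_nonneg _) (inv_nonpos.2 hd.le)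
    linarith
  have hqne : q ≠ 0 := by
    intro h0
    have hC0 : C.det = 0 := by
      rw [h0, neg_zero, mul_eq_zero] at hdet
      rcases hdet with h | h
      · exact pow_eq_zero_iff (two_ne_zero) |>.1 h
      · exact absurd h (inv_ne_zero hd.ne)
    obtain ⟨y, hy0, hy⟩ := Matrix.exists_vecMul_eq_zero_iff.2 hC0
    have e0 : (fun k => y 0 * l k + y 1 * n k + y 2 * e k + y 3 * v k) = fun _ => (0 : ℝ) := by
      funext k
      have := congrFun hy k
      simpa [Matrix.vecMul, dotProduct, Fin.sum_univ_four, C, coframe] using this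
    have hv : ∀ w, y 0 * ip1 G z l w + y 1 * ip1 G z n w + y 2 * ip1 G z e w
        + y 3 * ip1 G z v w = 0 := by
      intro w
      rw [← ip1_comb, e0]; simp [ip1, pairing]
    have a1 := hv n
    have a2 := hv l
    have a3 := hv e
    rw [hln, hnn, hc e n, hne, hvn] at a1
    rw [hll, hc n l, hln, hc e l, hle, hvl] at a2
    rw [hle, hne, hee, hve] at a3
    have y0 : y 0 = 0 := by linarith
    have y1 : y 1 = 0 := by linarith
    have y2 : y 2 = 0 := by linarith
    have y3 : y 3 = 0 := by
      obtain ⟨k, hk⟩ := Function.ne_iff.1 hv0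
      have := congrFun e0 k
      simp only [y0, y1, y2, zero_mul, zero_add] at this
      exact (mul_eq_zero.1 this).resolve_right hk
    exact hy0 (by ext k; fin_cases k <;> assumption)
  have hqpos : 0 < q := lt_of_le_of_ne hq0 (Ne.symm hqne)
  have hs : √q ≠ 0 := (Real.sqrt_pos.2 hqpos).ne'
  have hz' : ∀ w, ip1 G z v w = 0 → ip1 G z (fun k => (√q)⁻¹ * v k) w = 0 := fun w hw => by
    rw [ip1_smul_left, hw, mul_zero]
  refine ⟨fun k => (√q)⁻¹ * v k, ?_⟩
  have hff : ip1 G z (fun k => (√q)⁻¹ * v k) (fun k => (√q)⁻¹ * v k) = 1 := by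
    rw [ip1_smul_left, hc, ip1_smul_left, ← hq]
    field_simp
    exact (Real.sq_sqrt hq0).symm
  constructor
  exacts [hll, hln, hle, (hc _ _).trans (hz' _ hvl), (hc _ _).trans hln, hnn, hne,
    (hc _ _).trans (hz' _ hvn), (hc _ _).trans hle, (hc _ _).trans hne, hee,
    (hc _ _).trans (hz' _ hve), hz' _ hvl, hz' _ hvn, hz' _ hve, hff]

/-- A null coframe can be chosen positively oriented. -/
theorem NullProducts.exists_oriented (h : NullProducts G z l n e f) (hG : MetricOn G V)
    (hz : z ∈ V) : ∃ f', NullProducts G z l n e f' ∧ orient G z l n e f' = 1 := by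
  have hs := h.orient_sq hG hz
  rcases mul_self_eq_one_iff.1 hs with h1 | h1
  · exact ⟨f, h, h1⟩
  have hc := fun v w => hG.ip1_comm hz v w
  have hz' : ∀ w, ip1 G z f w = 0 → ip1 G z (fun k => (-1) * f k) w = 0 := fun w hw => by
    rw [ip1_smul_left, hw, mul_zero]
  refine ⟨fun k => (-1) * f k, ?_, ?_⟩
  · constructor
    exacts [h.ll, h.ln, h.le, (hc _ _).trans (hz' _ h.fl), h.nl, h.nn, h.ne,
      (hc _ _).trans (hz' _ h.fn), h.el, h.en, h.ee, (hc _ _).trans (hz' _ h.fe), hz' _ h.fl,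
      hz' _ h.fn, hz' _ h.fe, by rw [ip1_smul_left, hc, ip1_smul_left, h.ff]; norm_num]
  · have : sharp G z (fun k => (-1) * f k) = fun i => - sharp G z f i := by
      funext i; unfold sharp; rw [← Finset.sum_neg_distrib]
      exact Finset.sum_congr rfl fun _ _ => by ring
    unfold orient at h1 ⊢
    rw [this]
    have hq : quad (sharp G z l) (sharp G z n) (sharp G z e) (fun i => - sharp G z f i)
        = - quad (sharp G z l) (sharp G z n) (sharp G z e) (sharp G z f) := by unfold quad; ring
    rw [hq]; linarith

end Frame

/-! ### The null coframe of a choice of fundamental elements -/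

section Algebra

variable {G : CMetric} {V : Set E4} {z : E4} {l n e f : Fin 4 → ℝ}

theorem NullProducts.l_ne (h : NullProducts G z l n e f) : ∃ k, l k ≠ 0 := by
  by_contra hc
  push Not at hc
  have : l = 0 := funext hc
  have h1 := h.ln
  rw [this] at h1; simp [ip1, pairing] at h1

/-- The 2-forms `l ∧ e` and `l ∧ f` are linearly independent. -/
theorem NullProducts.wedge_indep (h : NullProducts G z l n e f) {p q : ℝ}
    (h0 : ∀ i j, p * wedge l e i j + q * wedge l f i j = 0) : p = 0 ∧ q = 0 := by
  obtain ⟨i, hi⟩ := h.l_ne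
  have := h.coeff_zero (p := -(p * e i + q * f i)) (q := 0) (r := l i * p) (s := l i * q)
    (fun k => by have := h0 i k; unfold wedge at this; linear_combination this)
  exact ⟨(mul_eq_zero.1 this.2.2.1).resolve_left hi, (mul_eq_zero.1 this.2.2.2).resolve_left hi⟩

theorem ip1_lower (hG : MetricOn G V) (hz : z ∈ V) (v x : Fin 4 → ℝ) :
    ip1 G z v (fun i => ∑ j, G z i j * x j) = pairing v x := by
  unfold ip1
  congr 1; funext i; exact hG.sharp_lower hz x i

/-- The contraction of two 2-forms over one index. -/
theorem sum_wedge_wedge (a b c d : Fin 4 → ℝ) (j k : Fin 4) :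
    ∑ m, ∑ n, wedge a b j m * ginv G z m n * wedge c d k n
      = a j * c k * ip1 G z b d - a j * d k * ip1 G z b c
        - b j * c k * ip1 G z a d + b j * d k * ip1 G z a c := by
  unfold ip1 pairing sharp wedge
  simp only [Finset.mul_sum]
  simp only [← Finset.sum_add_distrib, ← Finset.sum_sub_distrib]
  refine Finset.sum_congr rfl fun m _ => Finset.sum_congr rfl fun n _ => ?_
  ring

theorem hodge_contDiffOn (hG : MetricOn G V) {F : E4 → Fin 4 → Fin 4 → ℝ}
    (hF : ∀ i j, ContDiffOn ℝ ∞ (fun y => F y i j) V) (a b : Fin 4) :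
    ContDiffOn ℝ ∞ (fun y => hodge G F y a b) V := by
  have hs : ContDiffOn ℝ ∞ (fun y => √|(G y).det|) V := by
    have h1 : ContDiffOn ℝ ∞ (fun y => √(-(G y).det)) V :=
      (det_contDiffOn hG.smooth).neg.sqrt fun y hy => (neg_pos.2 (hG.det_neg hy)).ne'
    exact h1.congr fun y hy => by rw [abs_of_neg (hG.det_neg hy)]
  unfold hodge vol
  exact contDiffOn_const.mul (ContDiffOn.sum fun c _ => ContDiffOn.sum fun d _ =>
    ContDiffOn.sum fun m _ => ContDiffOn.sum fun n _ =>
      (((hs.mul contDiffOn_const).mul (hG.ginv_smooth c m)).mul (hG.ginv_smooth d n)).mul (hF m n))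

/-- The covariant derivative of the product of two 1-forms. -/
theorem cov2_wedge {ξ θ : E4 → Fin 4 → ℝ} (hξ : ∀ i, DifferentiableAt ℝ (fun y => ξ y i) z)
    (hθ : ∀ i, DifferentiableAt ℝ (fun y => θ y i) z) (i j k : Fin 4) :
    cov2 G (fun y => wedge (ξ y) (θ y)) z i j k
      = wedge (cov1 G ξ z i) (θ z) j k + wedge (ξ z) (cov1 G θ z i) j k := by
  have h : pd i (fun y => wedge (ξ y) (θ y) j k) z
      = ξ z j * pd i (fun y => θ y k) z + pd i (fun y => ξ y j) z * θ z k
        - (θ z j * pd i (fun y => ξ y k) z + pd i (fun y => θ y j) z * ξ z k) := by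
    rw [← pd_mul (hξ j) (hθ k), ← pd_mul (hθ j) (hξ k),
      ← pd_sub ((hξ j).fun_mul (hθ k)) ((hθ j).fun_mul (hξ k))]
    rfl
  unfold cov2
  rw [h]
  simp only [wedge, cov1, smul_eq_mul, Fin.sum_univ_four]
  ring

theorem cov2_congr_on {F : Type*} [NormedAddCommGroup F] [NormedSpace ℝ F] (hV : IsOpen V)
    {S T : E4 → Fin 4 → Fin 4 → F} (h : ∀ y ∈ V, S y = T y) (hz : z ∈ V) (i j k : Fin 4) :
    cov2 G S z i j k = cov2 G T z i j k := by
  unfold cov2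
  rw [pd_congr_on hV (fun y hy => congrFun (congrFun (h y hy) j) k) hz, h z hz]

end Algebra

namespace NullFrame

variable {G : CMetric} {V : Set E4} (F : NullFrame G V)

theorem cov_L (hG : MetricOn G V) {z : E4} (hz : z ∈ V) (i j k : Fin 4) :
    cov2 G F.L z i j k = F.th z i * F.L z j k + F.ps z i * F.M z j k
      + F.a z i * wedge (F.l z) (F.n z) j k - F.b z i * wedge (F.e z) (F.f z) j k := by
  have D : ∀ {ξ : E4 → Fin 4 → ℝ}, (∀ i, ContDiffOn ℝ ∞ (fun z => ξ z i) V) →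
      ∀ i, DifferentiableAt ℝ (fun y => ξ y i) z := fun h i =>
    differentiableAt_of_smooth hG.isOpen (h i) hz
  refine (cov2_wedge (D F.sl) (D F.se) i j k).trans ?_
  simp only [wedge, F.cov_l hG hz, F.cov_e hG hz, L, M]
  ring

theorem cov_M (hG : MetricOn G V) {z : E4} (hz : z ∈ V) (i j k : Fin 4) :
    cov2 G F.M z i j k = F.th z i * F.M z j k - F.ps z i * F.L z j k
      + F.a z i * wedge (F.e z) (F.f z) j k + F.b z i * wedge (F.l z) (F.n z) j k := by
  have D : ∀ {ξ : E4 → Fin 4 → ℝ}, (∀ i, ContDiffOn ℝ ∞ (fun z => ξ z i) V) →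
      ∀ i, DifferentiableAt ℝ (fun y => ξ y i) z := fun h i =>
    differentiableAt_of_smooth hG.isOpen (h i) hz
  refine (cov2_wedge (D F.sl) (D F.sf) i j k).trans ?_
  simp only [wedge, F.cov_l hG hz, F.cov_f hG hz, L, M]
  ring

end NullFrame

namespace Fund

variable {G : CMetric} {V : Set E4} (D : Fund G V)

/-- The 1-form metrically equivalent to the time-like vector field `x`. -/
def xflat (z : E4) (i : Fin 4) : ℝ := ∑ j, G z i j * D.x z j

/-- The null form of the coframe that is transversal to `ℓ`, in the plane of `ℓ` and `x`. -/
def formN (z : E4) (i : Fin 4) : ℝ :=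
  -(1 / D.lx z) * D.xflat z i + pairing (D.xflat z) (D.x z) / (2 * D.lx z ^ 2) * D.ell z i

/-- The unit form `e` orthogonal to `x` with `L = ℓ ∧ e`. -/
def formE (z : E4) (i : Fin 4) : ℝ := -(1 / D.lx z) * ∑ j, D.L z i j * D.x z j

/-- The unit form `f` orthogonal to `x` with `*L = ℓ ∧ f`. -/
def formF (z : E4) (i : Fin 4) : ℝ := -(1 / D.lx z) * ∑ j, D.sL z i j * D.x z j

theorem lx_ne {z : E4} (hz : z ∈ V) : D.lx z ≠ 0 := (D.future z hz).ne

theorem wedge_contract (v w x : Fin 4 → ℝ) (i : Fin 4) :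
    ∑ j, wedge v w i j * x j = v i * pairing w x - w i * pairing v x := by
  unfold wedge pairing
  rw [Finset.mul_sum, Finset.mul_sum, ← Finset.sum_sub_distrib]
  exact Finset.sum_congr rfl fun _ _ => by ring

/-- At each point the four forms built from `ℓ`, `L`, `*L` and `x` are a null coframe, with
`L = ℓ ∧ e` and `*L = ℓ ∧ f`, and `e`, `f` annihilate `x`. -/
theorem pointwise_frame (hG : MetricOn G V) {z : E4} (hz : z ∈ V) :
    NullProducts G z (D.ell z) (D.formN z) (D.formE z) (D.formF z) ∧
    D.L z = wedge (D.ell z) (D.formE z) ∧ D.sL z = wedge (D.ell z) (D.formF z) ∧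
    pairing (D.formE z) (D.x z) = 0 ∧ pairing (D.formF z) (D.x z) = 0 := by
  have hlx := D.lx_ne hz
  have hc := fun v w => hG.ip1_comm hz v w
  obtain ⟨e2, he2, hle2, hL⟩ := D.L_eq z hz
  have hll := D.ell_null z hz
  have hX : ∀ v, ip1 G z v (D.xflat z) = pairing v (D.x z) := fun v => ip1_lower hG hz v (D.x z)
  have hlX : ip1 G z (D.ell z) (D.xflat z) = D.lx z := hX _
  -- the form `e` and its products
  have hE : D.formE z = fun k => 1 * e2 k + (-(pairing e2 (D.x z) / D.lx z)) * D.ell z k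
      + 0 * e2 k + 0 * e2 k := by
    funext k
    unfold formE
    rw [hL, wedge_contract]
    change -(1 / D.lx z) * (D.ell z k * pairing e2 (D.x z) - e2 k * D.lx z) = _
    field_simp; ring
  have hN : D.formN z = fun k => (-(1 / D.lx z)) * D.xflat z k
      + (pairing (D.xflat z) (D.x z) / (2 * D.lx z ^ 2)) * D.ell z k
      + 0 * e2 k + 0 * e2 k := by
    funext k; unfold formN; ring
  have hle : ip1 G z (D.ell z) (D.formE z) = 0 := by
    rw [hE, ip1_comb₂, hle2, hll]; ring
  have hee : ip1 G z (D.formE z) (D.formE z) = 1 := by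
    nth_rw 1 [hE]
    rw [ip1_comb, hle]
    rw [hE, ip1_comb₂, he2, hc e2, hle2]; ring
  have hLE : D.L z = wedge (D.ell z) (D.formE z) := by
    rw [hL, hE]; funext i j; unfold wedge; ring
  have hEx : pairing (D.formE z) (D.x z) = 0 := by
    rw [← hX, hE, ip1_comb, hX, hlX]; field_simp; ring
  have hln : ip1 G z (D.ell z) (D.formN z) = -1 := by
    rw [hN, ip1_comb₂, hlX, hll, hle2]; field_simp; ring
  have hnE : ip1 G z (D.formN z) (D.formE z) = 0 := by
    rw [hN, ip1_comb, hle, hc (D.xflat z), hX, hEx, hc e2]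
    ring
  have hnn : ip1 G z (D.formN z) (D.formN z) = 0 := by
    nth_rw 1 [hN]
    rw [ip1_comb, hln]
    rw [hN, ip1_comb₂, hX, hc (D.xflat z) (D.ell z), hlX]
    field_simp; ring
  obtain ⟨f₀, hf₀⟩ := exists_completion hG hz hll hln hle hnn hnE hee
  obtain ⟨f, hf, hor⟩ := hf₀.exists_oriented hG hz
  have hS : D.sL z = wedge (D.ell z) f := by
    funext i j
    exact (hf.hodge_le hG hz hLE i j).trans (by rw [hor, one_mul])
  have hfx : pairing f (D.x z) = 0 := by
    have h1 : ip1 G z f (D.formN z) = 0 := hf.fn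
    rw [hN, ip1_comb₂, hX, hf.fl] at h1
    have h2 : (-(1 / D.lx z)) * pairing f (D.x z) = 0 := by linarith
    exact (mul_eq_zero.1 h2).resolve_left (neg_ne_zero.2 (one_div_ne_zero hlx))
  have hF : D.formF z = f := by
    funext k
    unfold formF
    rw [hS, wedge_contract, hfx]
    change -(1 / D.lx z) * (D.ell z k * 0 - f k * D.lx z) = _
    field_simp; ring
  rw [hF]
  exact ⟨hf, hLE, hS, hEx, hfx⟩

theorem s_sL (hG : MetricOn G V) (i j : Fin 4) : ContDiffOn ℝ ∞ (fun z => D.sL z i j) V :=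
  hodge_contDiffOn hG D.smooth_L i j

theorem s_lx : ContDiffOn ℝ ∞ D.lx V := by
  change ContDiffOn ℝ ∞ (fun z => ∑ i, D.ell z i * D.x z i) V
  exact ContDiffOn.sum fun i _ => (D.smooth_ell i).mul (D.smooth_x i)

theorem s_inv_lx : ContDiffOn ℝ ∞ (fun z => -(1 / D.lx z)) V :=
  (contDiffOn_const.div D.s_lx fun _ hz => D.lx_ne hz).neg

theorem s_xflat (hG : MetricOn G V) (i : Fin 4) : ContDiffOn ℝ ∞ (fun z => D.xflat z i) V :=
  ContDiffOn.sum fun j _ => (hG.smooth i j).mul (D.smooth_x j)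

/-- The null coframe `(ℓ, n, e, f)` with `L = ℓ ∧ e` and `*L = ℓ ∧ f`, the forms `e` and `f` being
orthogonal to `x`. -/
def frame (hG : MetricOn G V) : NullFrame G V where
  l := D.ell
  n := D.formN
  e := D.formE
  f := D.formF
  sl := D.smooth_ell
  sn i := (D.s_inv_lx.mul (D.s_xflat hG i)).add
    (((ContDiffOn.sum fun j _ => (D.s_xflat hG j).mul (D.smooth_x j)).div
      (contDiffOn_const.mul (D.s_lx.pow 2)) fun _ hz =>
        mul_ne_zero two_ne_zero (pow_ne_zero 2 (D.lx_ne hz))).mul (D.smooth_ell i))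
  se i := D.s_inv_lx.mul (ContDiffOn.sum fun j _ => (D.smooth_L i j).mul (D.smooth_x j))
  sf i := D.s_inv_lx.mul (ContDiffOn.sum fun j _ => (D.s_sL hG i j).mul (D.smooth_x j))
  frame _ hz := (D.pointwise_frame hG hz).1.isNullFrame hG hz

variable (hG : MetricOn G V)

theorem L_eq_frame {z : E4} (hz : z ∈ V) : D.L z = (D.frame hG).L z :=
  (D.pointwise_frame hG hz).2.1

theorem sL_eq_frame {z : E4} (hz : z ∈ V) : D.sL z = (D.frame hG).M z :=
  (D.pointwise_frame hG hz).2.2.1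

theorem e_x {z : E4} (hz : z ∈ V) : pairing ((D.frame hG).e z) (D.x z) = 0 :=
  (D.pointwise_frame hG hz).2.2.2.1

theorem f_x {z : E4} (hz : z ∈ V) : pairing ((D.frame hG).f z) (D.x z) = 0 :=
  (D.pointwise_frame hG hz).2.2.2.2

/-- In vacuum the Riemann tensor is the Weyl tensor. -/
theorem riemLow_eq_weyl {z : E4} (h : ric G z = 0) : riemLow G z = weyl G z := by
  funext a b c d
  simp [weyl, scal, h]

theorem typeNCurvature (hric : ∀ z ∈ V, ric G z = 0) : (D.frame hG).TypeNCurvature := by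
  intro z hz a b c d
  rw [riemLow_eq_weyl (hric z hz), D.weyl_eq z hz, D.L_eq_frame hG hz]
  have := D.sL_eq_frame hG hz
  unfold sL at this
  rw [← this]

theorem cov2_L {z : E4} (hz : z ∈ V) (i j k : Fin 4) :
    cov2 G D.L z i j k = cov2 G (D.frame hG).L z i j k :=
  cov2_congr_on hG.isOpen (fun _ hy => D.L_eq_frame hG hy) hz i j k

theorem cov2_sL {z : E4} (hz : z ∈ V) (i j k : Fin 4) :
    cov2 G D.sL z i j k = cov2 G (D.frame hG).M z i j k :=
  cov2_congr_on hG.isOpen (fun _ hy => D.sL_eq_frame hG hy) hz i j k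

theorem wedge_sharp (v w u : Fin 4 → ℝ) (z : E4) (i : Fin 4) :
    ∑ j, wedge v w i j * sharp G z u j = v i * ip1 G z w u - w i * ip1 G z v u :=
  wedge_contract v w (sharp G z u) i

/-- The form `a` of the choice of fundamental elements is the connection form `a` of its coframe. -/
theorem a_eq {z : E4} (hz : z ∈ V) (i : Fin 4) : D.a z i = (D.frame hG).a z i := by
  have hp := (D.frame hG).prods hG hz
  have h1 : ∀ j, ∑ m, cov2 G D.L z i j m * sharp G z (D.ell z) m
      = - (D.frame hG).a z i * D.ell z j := by
    intro j
    simp only [D.cov2_L hG hz, (D.frame hG).cov_L hG hz, add_mul, sub_mul, mul_assoc,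
      Finset.sum_add_distrib, Finset.sum_sub_distrib, ← Finset.mul_sum, NullFrame.L, NullFrame.M]
    change (D.frame hG).th z i * ∑ m, _ * sharp G z ((D.frame hG).l z) m
      + (D.frame hG).ps z i * ∑ m, _ * sharp G z ((D.frame hG).l z) m
      + (D.frame hG).a z i * ∑ m, _ * sharp G z ((D.frame hG).l z) m
      - (D.frame hG).b z i * ∑ m, _ * sharp G z ((D.frame hG).l z) m
      = - (D.frame hG).a z i * (D.frame hG).l z j
    simp only [wedge_sharp, hp.ll, hp.nl, hp.el, hp.fl]
    ring
  unfold Fund.a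
  simp only [h1, mul_assoc, ← Finset.mul_sum]
  change -(1 / D.lx z) * (- (D.frame hG).a z i * D.lx z) = _
  have := D.lx_ne hz
  field_simp

/-- The form `a*` of the choice of fundamental elements is minus the connection form `b` of its
coframe. -/
theorem aS_eq {z : E4} (hz : z ∈ V) (i : Fin 4) : D.aS z i = - (D.frame hG).b z i := by
  have hp := (D.frame hG).prods hG hz
  have h1 : ∀ j, ∑ m, cov2 G D.sL z i j m * sharp G z (D.ell z) m
      = - (D.frame hG).b z i * D.ell z j := by
    intro j
    simp only [D.cov2_sL hG hz, (D.frame hG).cov_M hG hz, add_mul, sub_mul, mul_assoc,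
      Finset.sum_add_distrib, Finset.sum_sub_distrib, ← Finset.mul_sum, NullFrame.L, NullFrame.M]
    change (D.frame hG).th z i * ∑ m, _ * sharp G z ((D.frame hG).l z) m
      - (D.frame hG).ps z i * ∑ m, _ * sharp G z ((D.frame hG).l z) m
      + (D.frame hG).a z i * ∑ m, _ * sharp G z ((D.frame hG).l z) m
      + (D.frame hG).b z i * ∑ m, _ * sharp G z ((D.frame hG).l z) m
      = - (D.frame hG).b z i * (D.frame hG).l z j
    simp only [wedge_sharp, hp.ll, hp.nl, hp.el, hp.fl]
    ring
  unfold Fund.aS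
  simp only [h1, mul_assoc, ← Finset.mul_sum]
  change (1 / D.lx z) * (- (D.frame hG).b z i * D.lx z) = _
  have := D.lx_ne hz
  field_simp

/-- The form `b` is `θ + α e - α* f`, where `∇ℓ = θ ⊗ ℓ + a ⊗ e - a* ⊗ f`. -/
theorem b_eq {z : E4} (hz : z ∈ V) (i : Fin 4) : D.b z i = (D.frame hG).th z i
    + D.al z * (D.frame hG).e z i - D.alS z * (D.frame hG).f z i := by
  have hlx := D.lx_ne hz
  set F := D.frame hG with hF
  have hB : ∀ i, ∑ j, D.B z i j * D.x z j = F.th z i * D.lx z + F.l z i * pairing (F.th z) (D.x z)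
      + F.e z i * pairing (F.a z) (D.x z) + F.f z i * pairing (F.b z) (D.x z) := by
    intro i
    have he := D.e_x hG hz
    have hf := D.f_x hG hz
    have h1 : ∀ j, D.B z i j * D.x z j = F.th z i * (F.l z j * D.x z j)
        + F.a z i * (F.e z j * D.x z j) + F.b z i * (F.f z j * D.x z j)
        + F.l z i * (F.th z j * D.x z j) + F.e z i * (F.a z j * D.x z j)
        + F.f z i * (F.b z j * D.x z j) := by
      intro j
      have e1 : cov1 G D.ell z i j = _ := F.cov_l hG hz i j
      have e2 : cov1 G D.ell z j i = _ := F.cov_l hG hz j i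
      unfold Fund.B
      rw [e1, e2]; ring
    simp only [h1, Finset.sum_add_distrib, ← Finset.mul_sum]
    change F.th z i * D.lx z + F.a z i * pairing (F.e z) (D.x z)
      + F.b z i * pairing (F.f z) (D.x z) + F.l z i * pairing (F.th z) (D.x z)
      + F.e z i * pairing (F.a z) (D.x z) + F.f z i * pairing (F.b z) (D.x z) = _
    rw [he, hf]; ring
  have hBB : ∑ j, ∑ k, D.B z j k * D.x z j * D.x z k = 2 * pairing (F.th z) (D.x z) * D.lx z := by
    have h1 : ∀ j, ∑ k, D.B z j k * D.x z j * D.x z k = (F.th z j * D.x z j) * D.lx z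
        + (F.l z j * D.x z j) * pairing (F.th z) (D.x z)
        + (F.e z j * D.x z j) * pairing (F.a z) (D.x z)
        + (F.f z j * D.x z j) * pairing (F.b z) (D.x z) := by
      intro j
      have : ∀ k, D.B z j k * D.x z j * D.x z k = D.x z j * (D.B z j k * D.x z k) := fun k => by ring
      simp only [this, ← Finset.mul_sum, hB]; ring
    simp only [h1, Finset.sum_add_distrib, ← Finset.sum_mul]
    change pairing (F.th z) (D.x z) * D.lx z + D.lx z * pairing (F.th z) (D.x z)
      + pairing (F.e z) (D.x z) * pairing (F.a z) (D.x z)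
      + pairing (F.f z) (D.x z) * pairing (F.b z) (D.x z) = _
    rw [D.e_x hG hz, D.f_x hG hz]; ring
  have ha : D.a z = F.a z := funext fun i => D.a_eq hG hz i
  have hb : pairing (D.aS z) (D.x z) = - pairing (F.b z) (D.x z) := by
    unfold pairing; rw [← Finset.sum_neg_distrib]
    exact Finset.sum_congr rfl fun i _ => by rw [D.aS_eq hG hz, neg_mul]
  unfold Fund.b al alS
  rw [hB, hBB, ha, hb]
  change 1 / D.lx z * (F.th z i * D.lx z + D.ell z i * pairing (F.th z) (D.x z)
      + F.e z i * pairing (F.a z) (D.x z) + F.f z i * pairing (F.b z) (D.x z)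
      - _ / (2 * D.lx z) * D.ell z i) = _
  field_simp; ring

/-- `∇ℓ ∧̄ ℓ = 0` at a point means that `∇ℓ` is a multiple of `ℓ` there, in its second index. -/
theorem ppCond_iff {z : E4} (hz : z ∈ V) :
    D.PPCond z ↔ ∀ i, (D.frame hG).a z i = 0 ∧ (D.frame hG).b z i = 0 := by
  set F := D.frame hG
  have h1 : ∀ i j k, wedgeBarRight (cov1 G D.ell z) (D.ell z) i j k
      = - (F.a z i * wedge (F.l z) (F.e z) j k + F.b z i * wedge (F.l z) (F.f z) j k) := by
    intro i j k
    have e1 : ∀ j, cov1 G D.ell z i j = _ := F.cov_l hG hz i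
    unfold wedgeBarRight
    rw [e1, e1]
    change _ * F.l z k - _ * F.l z j = _
    unfold wedge; ring
  constructor
  · intro h i
    refine (F.prods hG hz).wedge_indep fun j k => ?_
    have : wedgeBarRight (cov1 G D.ell z) (D.ell z) i j k = 0 := by rw [h]; rfl
    rw [h1] at this; linarith
  · intro h
    funext i j k
    rw [h1, (h i).1, (h i).2]; simp

end Fund

/-! ### The invariants `φ₁, …, φ₇` -/

section ComplexForms

variable {G : CMetric} {z : E4}

theorem ip2_smul_add_left (c : ℂ) (S T H : Fin 4 → Fin 4 → ℂ) :
    ip2 G z (fun j k => c * S j k + T j k) H = c * ip2 G z S H + ip2 G z T H := by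
  unfold ip2
  rw [mul_smul_comm, ← smul_add]
  congr 1
  simp only [Finset.mul_sum, ← Finset.sum_add_distrib]
  refine Finset.sum_congr rfl fun a _ => Finset.sum_congr rfl fun b _ =>
    Finset.sum_congr rfl fun c _ => Finset.sum_congr rfl fun d _ => ?_
  simp only [Complex.real_smul]; ring

theorem ip2_comm_of (hs : ∀ i j, ginv G z i j = ginv G z j i) (S T : Fin 4 → Fin 4 → ℂ) :
    ip2 G z S T = ip2 G z T S := by
  unfold ip2
  congr 1
  have h1 : ∀ F : Fin 4 → Fin 4 → Fin 4 → Fin 4 → ℂ,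
      ∑ a, ∑ b, ∑ c, ∑ d, F a b c d = ∑ c, ∑ d, ∑ a, ∑ b, F a b c d := by
    intro F
    have : ∀ a, ∑ b, ∑ c, ∑ d, F a b c d = ∑ c, ∑ d, ∑ b, F a b c d := fun a => by
      rw [Finset.sum_comm]
      exact Finset.sum_congr rfl fun c _ => Finset.sum_comm
    simp only [this]
    rw [Finset.sum_comm]
    exact Finset.sum_congr rfl fun c _ => Finset.sum_comm
  rw [h1]
  refine Finset.sum_congr rfl fun a _ => Finset.sum_congr rfl fun b _ =>
    Finset.sum_congr rfl fun c _ => Finset.sum_congr rfl fun d _ => ?_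
  rw [hs c a, hs d b, mul_comm (S c d)]

theorem ip2_ofReal (S T : Fin 4 → Fin 4 → ℝ) :
    ip2 G z (fun j k => (S j k : ℂ)) (fun j k => (T j k : ℂ)) = ((ip2 G z S T : ℝ) : ℂ) := by
  unfold ip2
  simp only [Complex.real_smul, smul_eq_mul]
  push_cast
  rfl

/-- The square of a complex combination of the 2-forms `l ∧ e`, `l ∧ f`, `l ∧ n`, `e ∧ f`. -/
theorem NullProducts.ip2_complex {V : Set E4} {l n e f : Fin 4 → ℝ} (h : NullProducts G z l n e f)
    (hG : MetricOn G V) (hz : z ∈ V) (p q r s : ℂ) :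
    ip2 G z
      (fun j k => p * (wedge l e j k : ℂ) + (q * (wedge l f j k : ℂ)
        + (r * (wedge l n j k : ℂ) + (s * (wedge e f j k : ℂ) + 0 * (wedge e f j k : ℂ)))))
      (fun j k => p * (wedge l e j k : ℂ) + (q * (wedge l f j k : ℂ)
        + (r * (wedge l n j k : ℂ) + (s * (wedge e f j k : ℂ) + 0 * (wedge e f j k : ℂ)))))
      = - r ^ 2 + s ^ 2 := by
  have hc := fun S T => ip2_comm_of (z := z) (hG.ginv_symm hz) S T
  have h0 : ∀ T : Fin 4 → Fin 4 → ℂ, ip2 G z (fun j k => 0 * (wedge e f j k : ℂ)) T = 0 := by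
    intro T; simp [ip2]
  have hr : ∀ w v : Fin 4 → ℝ, ip2 G z (fun j k => (wedge w v j k : ℂ))
      (fun j k => p * (wedge l e j k : ℂ) + (q * (wedge l f j k : ℂ)
        + (r * (wedge l n j k : ℂ) + (s * (wedge e f j k : ℂ) + 0 * (wedge e f j k : ℂ)))))
      = p * ((ip2 G z (wedge l e) (wedge w v) : ℝ) : ℂ)
        + (q * ((ip2 G z (wedge l f) (wedge w v) : ℝ) : ℂ)
        + (r * ((ip2 G z (wedge l n) (wedge w v) : ℝ) : ℂ)
        + s * ((ip2 G z (wedge e f) (wedge w v) : ℝ) : ℂ))) := by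
    intro w v
    rw [hc]
    simp only [ip2_smul_add_left, h0, ip2_ofReal, add_zero]
  simp only [ip2_smul_add_left, h0, hr, ip2_wedge, h.ll, h.ln, h.le, h.lf, h.nl, h.nn, h.ne, h.nf,
    h.el, h.en, h.ee, h.ef, h.fl, h.fn, h.fe, h.ff]
  push_cast; ring

theorem pd_complex {f g : E4 → ℝ} (hf : DifferentiableAt ℝ f z) (hg : DifferentiableAt ℝ g z)
    (c : ℂ) (i : Fin 4) : pd i (fun y => c * ((f y : ℂ) - Complex.I * (g y : ℂ))) z
      = c * (((pd i f z : ℝ) : ℂ) - Complex.I * ((pd i g z : ℝ) : ℂ)) := by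
  have : (fun y => c * ((f y : ℂ) - Complex.I * (g y : ℂ)))
      = fun y => f y • c + g y • (-(c * Complex.I)) := by
    funext y; simp only [Complex.real_smul]; ring
  rw [this, pd_add (hf.fun_smul (differentiableAt_const _)) (hg.fun_smul (differentiableAt_const _)),
    pd_smul hf (differentiableAt_const _), pd_smul hg (differentiableAt_const _), pd_const, pd_const]
  simp only [smul_zero, zero_add, Complex.real_smul]; ring

end ComplexForms

namespace Fund

variable {G : CMetric} {V : Set E4} (D : Fund G V)

theorem cov2_cL (hG : MetricOn G V) {z : E4} (hz : z ∈ V) (i j k : Fin 4) :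
    cov2 G D.cL z i j k = ((1 / √2 : ℝ) : ℂ)
      * (((cov2 G D.L z i j k : ℝ) : ℂ) - Complex.I * ((cov2 G D.sL z i j k : ℝ) : ℂ)) := by
  have dL := differentiableAt_of_smooth hG.isOpen (D.smooth_L j k) hz
  have dS := differentiableAt_of_smooth hG.isOpen (D.s_sL hG j k) hz
  have h1 : pd i (fun y => D.cL y j k) z = ((1 / √2 : ℝ) : ℂ) * (((pd i (fun y => D.L y j k) z : ℝ) : ℂ)
      - Complex.I * ((pd i (fun y => D.sL y j k) z : ℝ) : ℂ)) := pd_complex dL dS _ i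
  unfold cov2
  rw [h1]
  simp only [cL, Complex.real_smul, smul_eq_mul, Fin.sum_univ_four]
  push_cast; ring

/-- The square of the derivative of the fundamental bivector in the direction `Y`. -/
theorem ip2_cov_cL (hG : MetricOn G V) {z : E4} (hz : z ∈ V) (Y : Fin 4 → ℝ) :
    ip2 G z (fun j k => ∑ i, Y i • cov2 G D.cL z i j k) (fun j k => ∑ i, Y i • cov2 G D.cL z i j k)
      = - ((pairing ((D.frame hG).a z) Y : ℂ)
        - Complex.I * (pairing ((D.frame hG).b z) Y : ℂ)) ^ 2 := by
  set F := D.frame hG with hF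
  set s : ℂ := ((1 / √2 : ℝ) : ℂ) with hs
  have hs2 : s ^ 2 = 1 / 2 := by
    rw [hs, ← Complex.ofReal_pow, one_div, inv_pow, Real.sq_sqrt (by norm_num)]; norm_num
  have e : (fun j k => ∑ i, Y i • cov2 G D.cL z i j k) = fun j k =>
      (s * ((pairing (F.th z) Y : ℂ) + Complex.I * (pairing (F.ps z) Y : ℂ)))
        * (wedge (F.l z) (F.e z) j k : ℂ)
      + ((-Complex.I * s * ((pairing (F.th z) Y : ℂ) + Complex.I * (pairing (F.ps z) Y : ℂ)))
        * (wedge (F.l z) (F.f z) j k : ℂ)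
      + ((s * ((pairing (F.a z) Y : ℂ) - Complex.I * (pairing (F.b z) Y : ℂ)))
        * (wedge (F.l z) (F.n z) j k : ℂ)
      + ((-Complex.I * s * ((pairing (F.a z) Y : ℂ) - Complex.I * (pairing (F.b z) Y : ℂ)))
        * (wedge (F.e z) (F.f z) j k : ℂ) + 0 * (wedge (F.e z) (F.f z) j k : ℂ)))) := by
    funext j k
    have hI : Complex.I * Complex.I = -1 := Complex.I_mul_I
    simp only [D.cov2_cL hG hz, D.cov2_L hG hz, D.cov2_sL hG hz, ← hF, F.cov_L hG hz,
      F.cov_M hG hz, Complex.real_smul, pairing, Fin.sum_univ_four, ← hs, NullFrame.L, NullFrame.M]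
    push_cast
    linear_combination (s * (wedge (F.l z) (F.f z) j k : ℂ)
      * ((F.ps z 0 : ℂ) * Y 0 + F.ps z 1 * Y 1 + F.ps z 2 * Y 2 + F.ps z 3 * Y 3)
      - s * (wedge (F.e z) (F.f z) j k : ℂ)
      * ((F.b z 0 : ℂ) * Y 0 + F.b z 1 * Y 1 + F.b z 2 * Y 2 + F.b z 3 * Y 3)) * hI
  rw [e, (F.prods hG hz).ip2_complex hG hz]
  have hI : Complex.I ^ 2 = -1 := Complex.I_sq
  linear_combination (-2 * ((pairing (F.a z) Y : ℂ) - Complex.I * (pairing (F.b z) Y : ℂ)) ^ 2) * hs2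
    + (s ^ 2 * ((pairing (F.a z) Y : ℂ) - Complex.I * (pairing (F.b z) Y : ℂ)) ^ 2) * hI

/-- `φ₁` is minus the square of the `ℓ`-component of `a - i b`, with the connection forms of the
coframe. -/
theorem phi1_eq (hG : MetricOn G V) {z : E4} (hz : z ∈ V) : D.phi1 z
    = - ((ip1 G z ((D.frame hG).a z) ((D.frame hG).l z) : ℂ)
        - Complex.I * (ip1 G z ((D.frame hG).b z) ((D.frame hG).l z) : ℂ)) ^ 2 :=
  D.ip2_cov_cL hG hz (sharp G z (D.ell z))

/-- `φ₂` is the sum of the square moduli of the components of `a - i b` along `a` and `a*`. -/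
theorem phi2_eq (hG : MetricOn G V) {z : E4} (hz : z ∈ V) : D.phi2 z
    = ‖((ip1 G z ((D.frame hG).a z) (D.a z) : ℂ)
        - Complex.I * (ip1 G z ((D.frame hG).b z) (D.a z) : ℂ)) ^ 2‖
      + ‖((ip1 G z ((D.frame hG).a z) (D.aS z) : ℂ)
        - Complex.I * (ip1 G z ((D.frame hG).b z) (D.aS z) : ℂ)) ^ 2‖ := by
  have h1 := D.ip2_cov_cL hG hz (sharp G z (D.a z))
  have h2 := D.ip2_cov_cL hG hz (sharp G z (D.aS z))
  unfold phi2 F2 F2S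
  rw [h1, h2, norm_neg, norm_neg]; rfl

theorem complex_eq_zero {p q : ℝ} (h : ((p : ℂ) - Complex.I * (q : ℂ)) ^ 2 = 0) :
    p = 0 ∧ q = 0 := by
  have h1 := pow_eq_zero_iff (two_ne_zero) |>.1 h
  have hr := congrArg Complex.re h1
  have hi := congrArg Complex.im h1
  simp at hr hi
  exact ⟨hr, hi⟩

/-- A 1-form that is null and orthogonal to `l` is a multiple of `l`. -/
theorem _root_.TypeN.IsNullFrame.eq_of_null {z : E4} {l n e f v : Fin 4 → ℝ}
    (h : IsNullFrame G z l n e f) (hG : MetricOn G V) (hz : z ∈ V) (hl : ip1 G z v l = 0)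
    (hv : ip1 G z v v = 0) (k : Fin 4) : v k = - ip1 G z v n * l k := by
  have hx := funext (h.expand hG hz v)
  have h2 : ip1 G z v v = ip1 G z v e ^ 2 + ip1 G z v f ^ 2 := by
    conv_lhs => arg 4; rw [hx]
    rw [ip1_comb₂, hl]; ring
  rw [hv] at h2
  have he : ip1 G z v e = 0 := by nlinarith [sq_nonneg (ip1 G z v e), sq_nonneg (ip1 G z v f)]
  have hf : ip1 G z v f = 0 := by nlinarith [sq_nonneg (ip1 G z v e), sq_nonneg (ip1 G z v f)]
  rw [h.expand hG hz v k, hl, he, hf]; ring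

theorem ip1_neg_right {z : E4} (v w : Fin 4 → ℝ) :
    ip1 G z v (fun k => - w k) = - ip1 G z v w := by
  have := ip1_comb₂ (G := G) (z := z) (-1) 0 0 0 w w w w v
  simpa using this

/-- If `φ₁ = φ₂ = 0`, then `a = α ℓ` and `a* = α* ℓ`. -/
theorem kundt (hG : MetricOn G V) {z : E4} (hz : z ∈ V) (h1 : D.phi1 z = 0) (h2 : D.phi2 z = 0)
    (i : Fin 4) : (D.frame hG).a z i = D.al z * (D.frame hG).l z i ∧
      (D.frame hG).b z i = -D.alS z * (D.frame hG).l z i := by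
  set F := D.frame hG with hF
  rw [D.phi1_eq hG hz, neg_eq_zero] at h1
  obtain ⟨hal, hbl⟩ := complex_eq_zero h1
  rw [D.phi2_eq hG hz] at h2
  have ha : D.a z = F.a z := funext fun i => D.a_eq hG hz i
  have hb : D.aS z = fun i => - F.b z i := funext fun i => D.aS_eq hG hz i
  obtain ⟨h3, h4⟩ := (add_eq_zero_iff_of_nonneg (norm_nonneg _) (norm_nonneg _)).1 h2
  obtain ⟨haa, -⟩ := complex_eq_zero (norm_eq_zero.1 h3)
  obtain ⟨-, hbb⟩ := complex_eq_zero (norm_eq_zero.1 h4)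
  rw [ha] at haa
  rw [hb, ip1_neg_right, neg_eq_zero] at hbb
  have e1 := (F.frame z hz).eq_of_null hG hz hal haa
  have e2 := (F.frame z hz).eq_of_null hG hz hbl hbb
  have hp : ∀ (v : Fin 4 → ℝ) (c : ℝ), (∀ k, v k = c * F.l z k) →
      pairing v (D.x z) / D.lx z = c := by
    intro v c hv
    have : pairing v (D.x z) = c * D.lx z := by
      unfold pairing lx pairing
      rw [Finset.mul_sum]
      exact Finset.sum_congr rfl fun k _ => by rw [hv k, mul_assoc]; rfl
    rw [this, mul_div_assoc, div_self (D.lx_ne hz), mul_one]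
  have e3 : D.al z = _ := hp (D.a z) _ fun k => by rw [ha]; exact e1 k
  have e4 : D.alS z = ip1 G z (F.b z) (F.n z) :=
    hp (D.aS z) _ fun k => by rw [hb]; change - F.b z k = _; rw [e2 k]; ring
  rw [e3, e4]
  exact ⟨e1 i, e2 i⟩

theorem s_al (hG : MetricOn G V) : ContDiffOn ℝ ∞ D.al V := by
  have : ContDiffOn ℝ ∞ (fun z => (∑ i, (D.frame hG).a z i * D.x z i) / D.lx z) V :=
    (ContDiffOn.sum fun i _ => ((D.frame hG).s_a hG i).mul (D.smooth_x i)).div D.s_lx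
      fun _ hz => D.lx_ne hz
  refine this.congr fun z hz => ?_
  unfold al pairing
  congr 1
  exact Finset.sum_congr rfl fun i _ => by rw [D.a_eq hG hz]

theorem s_alS (hG : MetricOn G V) : ContDiffOn ℝ ∞ D.alS V := by
  have : ContDiffOn ℝ ∞ (fun z => (∑ i, -(D.frame hG).b z i * D.x z i) / D.lx z) V :=
    (ContDiffOn.sum fun i _ => ((D.frame hG).s_b hG i).neg.mul (D.smooth_x i)).div D.s_lx
      fun _ hz => D.lx_ne hz
  refine this.congr fun z hz => ?_
  unfold alS pairing
  congr 1
  exact Finset.sum_congr rfl fun i _ => by rw [D.aS_eq hG hz]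

/-- A 1-form whose product with `l` vanishes is a multiple of `l`. -/
theorem _root_.TypeN.NullProducts.eq_of_wedge {z : E4} {l n e f v : Fin 4 → ℝ}
    (h : NullProducts G z l n e f) (h0 : ∀ i j, wedge v l i j = 0) : ∃ p, ∀ k, v k = p * l k := by
  obtain ⟨i, hi⟩ := h.l_ne
  refine ⟨v i / l i, fun k => ?_⟩
  have := h0 i k
  unfold wedge at this
  field_simp; linarith

/-- If `φ₁ = φ₂ = 0` on `V`, then `φ₅ = -(α² + α*²)²`. -/
theorem phi5_eq (hG : MetricOn G V) (hric : ∀ z ∈ V, ric G z = 0)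
    (hk : ∀ z ∈ V, D.phi1 z = 0 ∧ D.phi2 z = 0) {z : E4} (hz : z ∈ V) :
    D.phi5 z = -(D.al z ^ 2 + D.alS z ^ 2) ^ 2 := by
  set F := D.frame hG with hF
  have hR : F.TypeNCurvature := D.typeNCurvature hG hric
  have hp := F.prods hG hz
  have dd : ∀ {ξ : E4 → Fin 4 → ℝ}, (∀ i, ContDiffOn ℝ ∞ (fun z => ξ z i) V) →
      ∀ i, DifferentiableAt ℝ (fun y => ξ y i) z := fun h i =>
    differentiableAt_of_smooth hG.isOpen (h i) hz
  have dal := differentiableAt_of_smooth hG.isOpen (D.s_al hG) hz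
  have dalS := differentiableAt_of_smooth hG.isOpen (D.s_alS hG) hz
  have dbe : DifferentiableAt ℝ (fun y => - D.alS y) z := dalS.fun_neg
  have ha : ∀ y ∈ V, ∀ i, F.a y i = D.al y * F.l y i := fun y hy i =>
    (D.kundt hG hy (hk y hy).1 (hk y hy).2 i).1
  have hb : ∀ y ∈ V, ∀ i, F.b y i = -D.alS y * F.l y i := fun y hy i =>
    (D.kundt hG hy (hk y hy).1 (hk y hy).2 i).2
  -- the differentials of `α` and `α*`, up to multiples of `ℓ`
  obtain ⟨p, hp1⟩ := hp.eq_of_wedge (v := fun i => pd i D.al z + D.alS z * F.ps z i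
      - D.al z * (D.al z * F.e z i - D.alS z * F.f z i)) (fun i j => by
    have h1 := (F.ricci_l hG hR hz i j).2.1
    rw [extd_congr_on hG.isOpen ha hz, extd_mul dal (dd F.sl), F.extd_l hG hz] at h1
    simp only [wedge, ha z hz, hb z hz] at h1 ⊢
    linear_combination h1)
  obtain ⟨q, hq1⟩ := hp.eq_of_wedge (v := fun i => pd i (fun y => - D.alS y) z
      + D.al z * F.ps z i + D.alS z * (D.al z * F.e z i - D.alS z * F.f z i)) (fun i j => by
    have h1 := (F.ricci_l hG hR hz i j).2.2
    rw [extd_congr_on hG.isOpen hb hz, extd_mul dbe (dd F.sl), F.extd_l hG hz] at h1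
    simp only [wedge, ha z hz, hb z hz] at h1 ⊢
    linear_combination h1)
  -- `db`, with `b = θ + α e - α* f`
  have hdb : D.F5 z = wedge (F.l z) (fun k => (D.al z ^ 2 + D.alS z ^ 2) * F.n z k + p * F.e z k
      + q * F.f z k + 0 * F.f z k) := by
    funext i j
    have hd1 : ∀ i, DifferentiableAt ℝ (fun y => D.al y * F.e y i) z := fun i =>
      dal.fun_mul (dd F.se i)
    have hd2 : ∀ i, DifferentiableAt ℝ (fun y => -D.alS y * F.f y i) z := fun i =>
      dbe.fun_mul (dd F.sf i)
    have e1 : extd D.b z i j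
        = extd (fun y k => F.th y k + D.al y * F.e y k + -D.alS y * F.f y k) z i j :=
      extd_congr_on hG.isOpen (fun y hy k => by rw [D.b_eq hG hy]; ring) hz i j
    unfold F5
    rw [e1, extd_add (fun i => (dd (F.s_th hG) i).fun_add (hd1 i)) hd2,
      extd_add (dd (F.s_th hG)) hd1, extd_mul dal (dd F.se), extd_mul dbe (dd F.sf),
      (F.ricci_l hG hR hz i j).1, F.extd_e hG hz, F.extd_f hG hz]
    have hp2 : ∀ i, pd i D.al z = p * F.l z i - D.alS z * F.ps z i
      + D.al z * (D.al z * F.e z i - D.alS z * F.f z i) := fun i => by linarith [hp1 i]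
    have hq2 : ∀ i, pd i (fun y => - D.alS y) z = q * F.l z i - D.al z * F.ps z i
      - D.alS z * (D.al z * F.e z i - D.alS z * F.f z i) := fun i => by linarith [hq1 i]
    simp only [wedge, ha z hz, hb z hz, hp2, hq2]
    ring
  have hlv : ip1 G z (F.l z) (fun k => (D.al z ^ 2 + D.alS z ^ 2) * F.n z k + p * F.e z k
      + q * F.f z k + 0 * F.f z k) = -(D.al z ^ 2 + D.alS z ^ 2) := by
    rw [ip1_comb₂, hp.ln, hp.le, hp.lf]; ring
  unfold phi5
  rw [hdb, ip2_wedge, hp.ll, hG.ip1_comm hz _ (F.l z), hlv]; ring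

/-- `φ₁ = φ₂ = φ₅ = 0` makes `ℓ` recurrent: `α² + α*² = 0`, so that `a = a* = 0`. -/
theorem ppCond_of_phi (hG : MetricOn G V) (hric : ∀ z ∈ V, ric G z = 0)
    (h : ∀ z ∈ V, D.phi1 z = 0 ∧ D.phi2 z = 0 ∧ D.phi5 z = 0) {z : E4} (hz : z ∈ V) :
    D.PPCond z := by
  have hk : ∀ z ∈ V, D.phi1 z = 0 ∧ D.phi2 z = 0 := fun z hz => ⟨(h z hz).1, (h z hz).2.1⟩
  have h5 := (h z hz).2.2
  rw [D.phi5_eq hG hric hk hz, neg_eq_zero] at h5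
  have h6 := pow_eq_zero_iff two_ne_zero |>.1 h5
  have ha : D.al z = 0 := by nlinarith [sq_nonneg (D.al z), sq_nonneg (D.alS z)]
  have hb : D.alS z = 0 := by nlinarith [sq_nonneg (D.al z), sq_nonneg (D.alS z)]
  rw [D.ppCond_iff hG hz]
  intro i
  have := D.kundt hG hz (hk z hz).1 (hk z hz).2 i
  rw [ha, hb] at this
  exact ⟨by simpa using this.1, by simpa using this.2⟩

end Fund

/-! ### Recurrent fundamental vectors -/

/-- Contraction of the two Bianchi identities with a null coframe. -/
theorem NullProducts.bianchi_contract {G : CMetric} {z : E4} {l n e f t p : Fin 4 → ℝ}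
    (h : NullProducts G z l n e f)
    (h0 : ∀ i j k, wedge3 (wedge l e) t i j k + wedge3 (wedge l f) p i j k = 0) :
    ip1 G z t l = 0 ∧ ip1 G z p l = 0 ∧ ip1 G z p e = ip1 G z t f := by
  have zr : ∀ w, ip1 G z (fun _ => (0 : ℝ)) w = 0 := by intro w; simp [ip1, pairing]
  have h1 : ∀ i j, wedge l e i j * ip1 G z t n + e j * t i - e i * t j
      + wedge l f i j * ip1 G z p n + f j * p i - f i * p j = 0 := by
    intro i j
    have e1 : (fun k => wedge l e i j * t k + (l j * t i - l i * t j) * e k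
        + (e i * t j - e j * t i + f i * p j - f j * p i) * l k
        + 1 * (wedge l f i j * p k + (l j * p i - l i * p j) * f k + 0 * f k + 0 * f k))
        = fun _ => (0 : ℝ) := by
      funext k
      have := h0 i j k
      unfold wedge3 wedge at this
      unfold wedge
      linear_combination this
    have e2 := zr n
    rw [← e1, ip1_comb, ip1_comb, h.en, h.ln, h.fn] at e2
    linear_combination e2
  have h2 : ∀ i w, (ip1 G z e w * l i - ip1 G z l w * e i) * ip1 G z t n + ip1 G z e w * t i
      - ip1 G z t w * e i + (ip1 G z f w * l i - ip1 G z l w * f i) * ip1 G z p n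
      + ip1 G z f w * p i - ip1 G z p w * f i = 0 := by
    intro i w
    have e1 : (fun j => (l i * ip1 G z t n + t i) * e j
        + (- e i * ip1 G z t n - f i * ip1 G z p n) * l j + (- e i) * t j
        + 1 * ((l i * ip1 G z p n + p i) * f j + (- f i) * p j + 0 * f j + 0 * f j))
        = fun _ => (0 : ℝ) := by
      funext j
      have := h1 i j
      unfold wedge at this
      linear_combination this
    have e2 := zr w
    rw [← e1, ip1_comb, ip1_comb] at e2
    linear_combination e2
  have h3 := h.coeff_zero (p := 0) (q := 0) (r := - ip1 G z t l) (s := - ip1 G z p l) (fun i => by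
    have := h2 i l
    rw [h.el, h.ll, h.fl] at this
    linear_combination this)
  have h4 : (fun i => 1 * t i + ip1 G z t n * l i + (- ip1 G z t e) * e i + (- ip1 G z p e) * f i)
      = fun _ => (0 : ℝ) := by
    funext i
    have := h2 i e
    rw [h.ee, h.le, h.fe] at this
    linear_combination this
  have h5 := zr f
  rw [← h4, ip1_comb, h.lf, h.ef, h.ff] at h5
  exact ⟨by linarith [h3.2.2.1], by linarith [h3.2.2.2], by linarith⟩

namespace NullFrame.Recurrent

variable {G : CMetric} {V : Set E4} {F : NullFrame G V}

/-- The Bianchi identity in components: the forms `θ` and `ψ` are orthogonal to `l`, and modulo `l`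
the form `ψ` is `θ` rotated by a right angle. -/
theorem components (hp : F.Recurrent) (hG : MetricOn G V) (hR : F.TypeNCurvature) {z : E4}
    (hz : z ∈ V) : ip1 G z (F.th z) (F.l z) = 0 ∧ ip1 G z (F.ps z) (F.l z) = 0 ∧
      ip1 G z (F.ps z) (F.e z) = ip1 G z (F.th z) (F.f z) ∧
      ip1 G z (F.ps z) (F.f z) = - ip1 G z (F.th z) (F.e z) := by
  have hb := fun i j k => hp.bianchi hG hR hz i j k
  have h1 := (F.prods hG hz).bianchi_contract fun i j k => (hb i j k).1
  have h2 := (F.prods hG hz).bianchi_contract (t := fun k => - F.ps z k) (p := F.th z)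
    fun i j k => by
      have := (hb i j k).2
      unfold wedge3 L M at this
      unfold wedge3
      linear_combination this
  refine ⟨h1.1, h1.2.1, h1.2.2, ?_⟩
  have h3 := h2.2.2
  rw [hG.ip1_comm hz (fun k => -F.ps z k), Fund.ip1_neg_right, hG.ip1_comm hz (F.f z)] at h3
  linarith

/-- A recurrent `l` has `θ` orthogonal to `l`. -/
theorem th_expand (hp : F.Recurrent) (hG : MetricOn G V) (hR : F.TypeNCurvature) {z : E4}
    (hz : z ∈ V) (k : Fin 4) : F.th z k = (-ip1 G z (F.th z) (F.n z)) * F.l z k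
      + ip1 G z (F.th z) (F.e z) * F.e z k + ip1 G z (F.th z) (F.f z) * F.f z k := by
  have := (F.frame z hz).expand hG hz (F.th z) k
  rw [(hp.components hG hR hz).1] at this
  linarith

/-- Modulo `l`, the form `ψ` is `θ` rotated by a right angle. -/
theorem ps_expand (hp : F.Recurrent) (hG : MetricOn G V) (hR : F.TypeNCurvature) {z : E4}
    (hz : z ∈ V) (k : Fin 4) : F.ps z k = (-ip1 G z (F.ps z) (F.n z)) * F.l z k
      + ip1 G z (F.th z) (F.f z) * F.e z k - ip1 G z (F.th z) (F.e z) * F.f z k := by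
  have := (F.frame z hz).expand hG hz (F.ps z) k
  obtain ⟨-, h1, h2, h3⟩ := hp.components hG hR hz
  rw [h1, h2, h3] at this
  linarith

end NullFrame.Recurrent

namespace Fund

variable {G : CMetric} {V : Set E4} (D : Fund G V)

theorem recurrent_of_ppCond (hG : MetricOn G V) (h : ∀ z ∈ V, D.PPCond z) :
    (D.frame hG).Recurrent := fun z hz => (D.ppCond_iff hG hz).1 (h z hz)

variable {D} {hG : MetricOn G V}

theorem al_zero (hp : (D.frame hG).Recurrent) {z : E4} (hz : z ∈ V) : D.al z = 0 := by
  have : D.a z = 0 := funext fun i => (D.a_eq hG hz i).trans (hp z hz i).1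
  simp [al, this, pairing]

theorem alS_zero (hp : (D.frame hG).Recurrent) {z : E4} (hz : z ∈ V) : D.alS z = 0 := by
  have : D.aS z = 0 := funext fun i => by
    rw [D.aS_eq hG hz i, (hp z hz i).2]; simp
  simp [alS, this, pairing]

/-- For a recurrent fundamental vector, `b` is the connection form `θ`. -/
theorem b_eq_th (hp : (D.frame hG).Recurrent) {z : E4} (hz : z ∈ V) (i : Fin 4) :
    D.b z i = (D.frame hG).th z i := by
  rw [D.b_eq hG hz, al_zero hp hz, alS_zero hp hz]; ring

/-- For a recurrent fundamental vector, `c` is minus the connection form `ψ`. -/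
theorem c_eq (hp : (D.frame hG).Recurrent) {z : E4} (hz : z ∈ V) (i : Fin 4) :
    D.c z i = - (D.frame hG).ps z i := by
  have hlx := D.lx_ne hz
  have hq := (D.frame hG).prods hG hz
  set F := D.frame hG with hF
  have hpre : ∀ i j k, D.preC z i j k = - F.ps z i * D.ell z j * D.ell z k := by
    intro i j k
    have h1 : ∀ m n, cov2 G D.sL z i j m * ginv G z m n * D.L z k n
        = F.th z i * (wedge (F.l z) (F.f z) j m * ginv G z m n * wedge (F.l z) (F.e z) k n)
        - F.ps z i * (wedge (F.l z) (F.e z) j m * ginv G z m n * wedge (F.l z) (F.e z) k n) := by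
      intro m n
      rw [D.cov2_sL hG hz, ← hF, F.cov_M hG hz, (hp z hz i).1, (hp z hz i).2, D.L_eq_frame hG hz]
      unfold NullFrame.L NullFrame.M; ring
    unfold preC
    simp only [h1, Finset.sum_sub_distrib, ← Finset.mul_sum, sum_wedge_wedge, hq.fe, hq.fl, hq.le,
      hq.ll, hq.ee, hq.el]
    change _ = - F.ps z i * F.l z j * F.l z k
    ring
  have hC : ∀ i j k, D.C z i j k = -(1 / 3) * (F.ps z i * D.ell z j * D.ell z k
      + F.ps z j * D.ell z k * D.ell z i + F.ps z k * D.ell z i * D.ell z j) := by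
    intro i j k; unfold C; simp only [hpre]; ring
  have h2 : ∀ i, ∑ j, ∑ k, D.C z i j k * D.x z j * D.x z k = -(1 / 3) * (F.ps z i * D.lx z ^ 2
      + 2 * pairing (F.ps z) (D.x z) * D.lx z * D.ell z i) := by
    intro i; simp only [hC, lx, pairing, Fin.sum_univ_four]; ring
  have h3 : ∑ h, ∑ j, ∑ k, D.C z h j k * D.x z h * D.x z j * D.x z k
      = - pairing (F.ps z) (D.x z) * D.lx z ^ 2 := by
    have : ∀ h, ∑ j, ∑ k, D.C z h j k * D.x z h * D.x z j * D.x z k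
        = D.x z h * (-(1 / 3) * (F.ps z h * D.lx z ^ 2
          + 2 * pairing (F.ps z) (D.x z) * D.lx z * D.ell z h)) := by
      intro h
      rw [← h2, Finset.mul_sum]
      refine Finset.sum_congr rfl fun j _ => ?_
      rw [Finset.mul_sum]
      exact Finset.sum_congr rfl fun k _ => by ring
    rw [Finset.sum_congr rfl fun h _ => this h]
    simp only [lx, pairing, Fin.sum_univ_four]; ring
  unfold c
  rw [h2, h3]
  field_simp; ring

/-- For a recurrent fundamental vector, `φ₁, …, φ₆` vanish. -/
theorem phiZero_of_recurrent (hric : ∀ z ∈ V, ric G z = 0) (hp : (D.frame hG).Recurrent) {z : E4}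
    (hz : z ∈ V) (i : ℕ) (hi : 1 ≤ i) (hi' : i ≤ 6) : D.PhiZero i z := by
  have hR := D.typeNCurvature hG hric
  have hq := (D.frame hG).prods hG hz
  obtain ⟨ht, hs, -, -⟩ := hp.components hG hR hz
  have z0 : ∀ w, ip1 G z (fun _ => (0 : ℝ)) w = 0 := by intro w; simp [ip1, pairing]
  have ha : (D.frame hG).a z = fun _ => 0 := funext fun i => (hp z hz i).1
  have hb : (D.frame hG).b z = fun _ => 0 := funext fun i => (hp z hz i).2
  interval_cases i
  · change D.phi1 z = 0
    rw [D.phi1_eq hG hz, ha, hb, z0]; simp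
  · change D.phi2 z = 0
    rw [D.phi2_eq hG hz, ha, hb, z0, z0]; simp
  · change D.phi3 z = 0
    have h3 : D.F3 z = wedge ((D.frame hG).th z) ((D.frame hG).l z) := by
      funext i j
      refine ((D.frame hG).extd_l hG hz i j).trans ?_
      simp [wedge, hp z hz]
    unfold phi3
    rw [h3, ip2_wedge, ht, hq.ll]; ring
  · change D.phi4 z = 0
    have h4 : D.F4 z = wedge ((D.frame hG).l z) (fun k => - (D.frame hG).ps z k) := by
      unfold F4
      rw [show D.c z = fun k => - (D.frame hG).ps z k from funext fun k => c_eq hp hz k]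
      rfl
    unfold phi4
    have h5 : ip1 G z ((D.frame hG).l z) (fun k => - (D.frame hG).ps z k) = 0 := by
      rw [ip1_neg_right, hG.ip1_comm hz, hs, neg_zero]
    rw [h4, ip2_wedge, hq.ll, h5]; ring
  · change D.phi5 z = 0
    have h5 : D.F5 z = fun _ _ => 0 := by
      funext i j
      unfold F5
      rw [extd_congr_on hG.isOpen (fun y hy k => b_eq_th hp hy k) hz, hp.extd_th hG hR hz]
    unfold phi5
    rw [h5]; simp [ip2]
  · change D.phi6 z = 0
    have hf : D.f z = fun _ => 0 := by
      funext i
      unfold f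
      rw [pd_congr_on hG.isOpen (g := fun _ => 0) (fun y hy => al_zero hp hy) hz, pd_const,
        alS_zero hp hz]; ring
    funext d
    unfold phi6
    rw [dual3_eq, hf]
    have : sharp G z (fun _ => (0 : ℝ)) = fun _ => 0 := by funext i; simp [sharp]
    rw [this]; simp [quad]

/-- For a recurrent fundamental vector, `φ₇ = ∓(θ(e)² + θ(f)²) ℓ`: since `ψ` is `θ` rotated by a
right angle, `b` and `c` are independent modulo `ℓ` unless both are multiples of `ℓ`. -/
theorem phi7_eq (hric : ∀ z ∈ V, ric G z = 0) (hp : (D.frame hG).Recurrent) {z : E4}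
    (hz : z ∈ V) (d : Fin 4) : D.phi7 z d = -(ip1 G z ((D.frame hG).th z) ((D.frame hG).e z) ^ 2
      + ip1 G z ((D.frame hG).th z) ((D.frame hG).f z) ^ 2)
      * orient G z ((D.frame hG).l z) ((D.frame hG).n z) ((D.frame hG).e z) ((D.frame hG).f z)
      * (D.frame hG).l z d := by
  have hR := D.typeNCurvature hG hric
  have hq := (D.frame hG).prods hG hz
  unfold phi7
  rw [hq.dual3_l hG hz (u := D.ell) rfl
    (p := -ip1 G z ((D.frame hG).th z) ((D.frame hG).n z))
    (q := ip1 G z ((D.frame hG).th z) ((D.frame hG).e z))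
    (r := ip1 G z ((D.frame hG).th z) ((D.frame hG).f z))
    (p' := ip1 G z ((D.frame hG).ps z) ((D.frame hG).n z))
    (q' := -ip1 G z ((D.frame hG).th z) ((D.frame hG).f z))
    (r' := ip1 G z ((D.frame hG).th z) ((D.frame hG).e z))
    (funext fun k => by rw [b_eq_th hp hz, hp.th_expand hG hR hz k]; ring)
    (funext fun k => by rw [c_eq hp hz, hp.ps_expand hG hR hz k]; ring)]
  ring

/-- For a recurrent fundamental vector, `φ₇ = 0` at a point means that `θ` is a multiple of `ℓ`. -/
theorem phi7_zero_iff (hric : ∀ z ∈ V, ric G z = 0) (hp : (D.frame hG).Recurrent) {z : E4}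
    (hz : z ∈ V) : D.phi7 z = 0 ↔ ip1 G z ((D.frame hG).th z) ((D.frame hG).e z) = 0 ∧
      ip1 G z ((D.frame hG).th z) ((D.frame hG).f z) = 0 := by
  have hq := (D.frame hG).prods hG hz
  constructor
  · intro h
    obtain ⟨k, hk⟩ := hq.l_ne
    have h1 := congrFun h k
    rw [phi7_eq hric hp hz, Pi.zero_apply] at h1
    have ho : orient G z ((D.frame hG).l z) ((D.frame hG).n z) ((D.frame hG).e z)
        ((D.frame hG).f z) ≠ 0 := by
      intro h0
      have := hq.orient_sq hG hz
      rw [h0] at this; norm_num at this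
    have h2 := ((mul_eq_zero.1 h1).resolve_right hk |> mul_eq_zero.1).resolve_right ho
    constructor <;> nlinarith [sq_nonneg (ip1 G z ((D.frame hG).th z) ((D.frame hG).e z)),
      sq_nonneg (ip1 G z ((D.frame hG).th z) ((D.frame hG).f z))]
  · rintro ⟨h1, h2⟩
    funext d
    rw [phi7_eq hric hp hz, h1, h2]; simp

/-- For a recurrent fundamental vector, `ℓ ∧̄ ∇ℓ = 0` means that `θ` is a multiple of `ℓ`, and
so does `φ₇ = 0`. -/
theorem planeCond_iff (hric : ∀ z ∈ V, ric G z = 0) (hp : (D.frame hG).Recurrent) {z : E4}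
    (hz : z ∈ V) : D.PlaneCond z ↔ D.phi7 z = 0 := by
  have hR := D.typeNCurvature hG hric
  have hq := (D.frame hG).prods hG hz
  set F := D.frame hG with hF
  have h1 : ∀ i j k, wedgeBarLeft (D.ell z) (cov1 G D.ell z) i j k
      = F.l z k * (ip1 G z (F.th z) (F.e z) * wedge (F.l z) (F.e z) i j
        + ip1 G z (F.th z) (F.f z) * wedge (F.l z) (F.f z) i j) := by
    intro i j k
    have e1 : ∀ i, cov1 G D.ell z i k = F.th z i * F.l z k := fun i => by
      refine (F.cov_l hG hz i k).trans ?_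
      rw [(hp z hz i).1, (hp z hz i).2]; ring
    unfold wedgeBarLeft
    rw [e1, e1, hp.th_expand hG hR hz i, hp.th_expand hG hR hz j]
    change F.l z i * _ - F.l z j * _ = _
    unfold wedge; ring
  rw [phi7_zero_iff hric hp hz]
  constructor
  · intro h
    obtain ⟨k, hk⟩ := hq.l_ne
    refine hq.wedge_indep fun i j => ?_
    have : wedgeBarLeft (D.ell z) (cov1 G D.ell z) i j k = 0 := by rw [h]; rfl
    rw [h1] at this
    exact (mul_eq_zero.1 this).resolve_left hk
  · rintro ⟨h2, h3⟩
    funext i j k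
    rw [h1, show ip1 G z (F.th z) (F.e z) = 0 from h2, show ip1 G z (F.th z) (F.f z) = 0 from h3]
    simp

end Fund

/-! ### Closed forms, linear differential systems and functions of a function -/

/-- The Poincaré lemma for 1-forms on a ball. -/
theorem exists_primitive {y : E4} {r : ℝ} {θ : E4 → Fin 4 → ℝ}
    (hθ : ∀ i, ContDiffOn ℝ ∞ (fun z => θ z i) (Metric.ball y r))
    (hc : ∀ z ∈ Metric.ball y r, ∀ i j, extd θ z i j = 0) :
    ∃ f : E4 → ℝ, ContDiffOn ℝ ∞ f (Metric.ball y r) ∧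
      ∀ z ∈ Metric.ball y r, ∀ i, pd i f z = θ z i := by
  have hB : IsOpen (Metric.ball y r) := Metric.isOpen_ball
  let P : Fin 4 → (E4 →L[ℝ] ℝ) := fun i => ContinuousLinearMap.proj i
  let om : E4 → E4 →L[ℝ] ℝ := fun z => ∑ i, θ z i • P i
  have hom : ContDiffOn ℝ ∞ om (Metric.ball y r) :=
    ContDiffOn.sum (f := fun i z => θ z i • P i) fun i _ => (hθ i).smul contDiffOn_const
  have hd : ∀ z ∈ Metric.ball y r, ∀ i, DifferentiableAt ℝ (fun z => θ z i) z := fun z hz i =>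
    differentiableAt_of_smooth hB (hθ i) hz
  have hf : ∀ z ∈ Metric.ball y r, ∀ v w : E4,
      fderiv ℝ om z v w = ∑ i, ∑ j, v j * pd j (fun z => θ z i) z * w i := by
    intro z hz v w
    have h1 : fderiv ℝ om z = ∑ i, (fderiv ℝ (fun z => θ z i) z).smulRight (P i) := by
      have : HasFDerivAt om (∑ i, (fderiv ℝ (fun z => θ z i) z).smulRight (P i)) z := by
        refine HasFDerivAt.fun_sum fun i _ => ?_
        have := (hd z hz i).hasFDerivAt.smul_const (P i)
        exact this
      exact this.fderiv
    rw [h1]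
    simp only [sum_apply, ContinuousLinearMap.smulRight_apply,
      fderiv_eq_sum_pd v, smul_eq_mul, smul_apply, P,
      ContinuousLinearMap.proj_apply, Finset.sum_mul]
  obtain ⟨f, hf'⟩ := (convex_ball y r).exists_forall_hasFDerivAt_of_fderiv_symmetric hB
    (hom.differentiableOn (by simp)) fun z hz v w => by
      rw [hf z hz, hf z hz, Finset.sum_comm]
      refine Finset.sum_congr rfl fun i _ => Finset.sum_congr rfl fun j _ => ?_
      have := hc z hz i j
      unfold extd at this
      linear_combination (v i * w j) * this
  refine ⟨f, ?_, fun z hz i => ?_⟩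
  · rw [contDiffOn_infty_iff_fderiv_of_isOpen hB]
    refine ⟨fun z hz => (hf' z hz).differentiableAt.differentiableWithinAt, ?_⟩
    exact hom.congr fun z hz => (hf' z hz).fderiv
  · unfold pd
    rw [(hf' z hz).fderiv]
    simp [om, P, Pi.single_apply]

theorem const_of_hasDerivAt_zero {a b : ℝ} {f : ℝ → ℝ}
    (hf : ∀ s ∈ Set.Ioo a b, HasDerivAt f 0 s) {s t : ℝ} (hs : s ∈ Set.Ioo a b)
    (ht : t ∈ Set.Ioo a b) : f s = f t :=
  (convex_Ioo a b).is_const_of_fderivWithin_eq_zero (𝕜 := ℝ)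
    (fun t ht => (hf t ht).differentiableAt.differentiableWithinAt)
    (fun t ht => by
      rw [fderivWithin_eq_fderiv (isOpen_Ioo.uniqueDiffWithinAt ht) (hf t ht).differentiableAt]
      ext; simp [(hf t ht).deriv]) hs ht

/-- Local solutions of a smooth ordinary differential equation are smooth. -/
theorem exists_smooth_solution {E : Type*} [NormedAddCommGroup E] [NormedSpace ℝ E]
    [CompleteSpace E] {S : Set ℝ} (hS : IsOpen S) {f : ℝ × E → E}
    (hf : ContDiffOn ℝ ∞ f (S ×ˢ Set.univ)) {s₀ : ℝ} (hs : s₀ ∈ S) (Y₀ : E) :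
    ∃ ε > 0, Set.Ioo (s₀ - ε) (s₀ + ε) ⊆ S ∧ ∃ Y : ℝ → E, Y s₀ = Y₀ ∧
      ContDiffOn ℝ ∞ Y (Set.Ioo (s₀ - ε) (s₀ + ε)) ∧
      ∀ s ∈ Set.Ioo (s₀ - ε) (s₀ + ε), HasDerivAt Y (f (s, Y s)) s := by
  have hop : IsOpen (S ×ˢ (Set.univ : Set E)) := hS.prod isOpen_univ
  have hc : ContDiffAt ℝ 1 (fun q : ℝ × E => ((1 : ℝ), f q)) (s₀, Y₀) :=
    contDiffAt_const.prodMk ((hf.contDiffAt (hop.mem_nhds ⟨hs, trivial⟩)).of_le (by simp))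
  obtain ⟨γ, h0, ε, hε, hγ⟩ :=
    hc.exists_forall_mem_closedBall_exists_eq_forall_mem_Ioo_hasDerivAt₀ s₀
  obtain ⟨δ, hδ, hδS⟩ := Metric.isOpen_iff.1 hS s₀ hs
  rw [Real.ball_eq_Ioo] at hδS
  have hsub : Set.Ioo (s₀ - min ε δ) (s₀ + min ε δ) ⊆ Set.Ioo (s₀ - ε) (s₀ + ε) :=
    Set.Ioo_subset_Ioo (by linarith [min_le_left ε δ]) (by linarith [min_le_left ε δ])
  have hsub' : Set.Ioo (s₀ - min ε δ) (s₀ + min ε δ) ⊆ S := (Set.Ioo_subset_Ioo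
    (by linarith [min_le_right ε δ]) (by linarith [min_le_right ε δ])).trans hδS
  have hmem : s₀ ∈ Set.Ioo (s₀ - ε) (s₀ + ε) := ⟨by linarith, by linarith⟩
  -- the first component of an integral curve of `(1, f)` is the time
  have htime : ∀ s ∈ Set.Ioo (s₀ - ε) (s₀ + ε), (γ s).1 = s := by
    intro s hs'
    have h1 : ∀ t ∈ Set.Ioo (s₀ - ε) (s₀ + ε), HasDerivAt (fun t => (γ t).1 - t) 0 t := by
      intro t ht
      have h : HasDerivAt (fun t => (γ t).1 - t) (1 - 1) t :=
        ((ContinuousLinearMap.fst ℝ ℝ E).hasFDerivAt.comp_hasDerivAt t (hγ t ht)).sub (hasDerivAt_id t)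
      rwa [sub_self] at h
    have h2 := const_of_hasDerivAt_zero h1 hs' hmem
    simp only [h0] at h2
    linarith
  have hY : ∀ s ∈ Set.Ioo (s₀ - min ε δ) (s₀ + min ε δ),
      HasDerivAt (fun s => (γ s).2) (f (s, (γ s).2)) s := by
    intro s hs'
    have h1 := (hγ s (hsub hs')).snd
    have h2 : γ s = (s, (γ s).2) := Prod.ext (htime s (hsub hs')) rfl
    rw [h2] at h1
    exact h1
  refine ⟨min ε δ, lt_min hε hδ, hsub', fun s => (γ s).2, by simp [h0], ?_, hY⟩
  rw [contDiffOn_infty]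
  intro n
  induction n with
  | zero =>
    exact contDiffOn_zero.2 fun s hs' => (hY s hs').continuousAt.continuousWithinAt
  | succ n ih =>
    have : ((n + 1 : ℕ) : WithTop ℕ∞) = (n : WithTop ℕ∞) + 1 := by norm_cast
    rw [this, contDiffOn_succ_iff_deriv_of_isOpen isOpen_Ioo]
    refine ⟨fun s hs' => (hY s hs').differentiableAt.differentiableWithinAt, by simp, ?_⟩
    have h1 : ContDiffOn ℝ n (fun s => f (s, (γ s).2)) (Set.Ioo (s₀ - min ε δ) (s₀ + min ε δ)) :=
      (hf.of_le (by exact_mod_cast le_top)).comp (contDiffOn_id.prodMk ih)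
        fun s hs' => ⟨hsub' hs', trivial⟩
    exact h1.congr fun s hs' => (hY s hs').deriv

/-- A solution of a linear homogeneous total differential system which vanishes at a point vanishes
near that point. -/
theorem eventually_eq_zero_of_linear {F : Type*} [NormedAddCommGroup F] [NormedSpace ℝ F]
    {Y : E4 → F} {y : E4} {C : ℝ} (hd : ∀ᶠ z in 𝓝 y, DifferentiableAt ℝ Y z)
    (hC : ∀ᶠ z in 𝓝 y, ∀ i, ‖pd i Y z‖ ≤ C * ‖Y z‖) (h0 : Y y = 0) :
    ∀ᶠ z in 𝓝 y, Y z = 0 := by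
  obtain ⟨r, hr, hB⟩ := Metric.eventually_nhds_iff_ball.1 (hd.and hC)
  refine Metric.eventually_nhds_iff_ball.2 ⟨r, hr, fun z hz => ?_⟩
  -- Grönwall's inequality along the segment from `y` to `z`
  let c : ℝ → E4 := fun t => y + t • (z - y)
  have hc : ∀ t ∈ Set.Icc (0 : ℝ) 1, c t ∈ Metric.ball y r := by
    intro t ht
    rw [mem_ball_iff_norm] at hz ⊢
    simp only [c, add_sub_cancel_left, norm_smul, Real.norm_eq_abs, abs_of_nonneg ht.1]
    nlinarith [norm_nonneg (z - y), ht.2]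
  have hcd : ∀ t, HasDerivAt c (z - y) t := by
    intro t
    have := ((hasDerivAt_id t).smul_const (z - y)).const_add y
    rwa [one_smul] at this
  have hYd : ∀ t ∈ Set.Icc (0 : ℝ) 1,
      HasDerivAt (fun t => Y (c t)) (fderiv ℝ Y (c t) (z - y)) t := fun t ht =>
    (hB _ (hc t ht)).1.hasFDerivAt.comp_hasDerivAt t (hcd t)
  have h1 := eq_zero_of_abs_deriv_le_mul_abs_self_of_eq_zero_right (f := fun t => Y (c t))
    (f' := fun t => fderiv ℝ Y (c t) (z - y)) (K := (∑ i, |(z - y) i|) * C) (a := 0) (b := 1)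
    (fun t ht => (hYd t ht).continuousAt.continuousWithinAt)
    (fun t ht => (hYd t ⟨ht.1, ht.2.le⟩).hasDerivWithinAt)
    (by simp [c, h0])
    (fun t ht => by
      rw [fderiv_eq_sum_pd, Finset.sum_mul, Finset.sum_mul]
      refine (norm_sum_le _ _).trans (Finset.sum_le_sum fun i _ => ?_)
      rw [norm_smul, Real.norm_eq_abs, mul_assoc]
      exact mul_le_mul_of_nonneg_left ((hB _ (hc t ⟨ht.1, ht.2.le⟩)).2 i) (abs_nonneg _))
    1 ⟨zero_le_one, le_rfl⟩
  simpa [c] using h1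

/-- The map which replaces the `i`-th coordinate by the function `u`. -/
def replaceCoord (i : Fin 4) (u : E4 → ℝ) (z : E4) : E4 := z + (u z - z i) • (Pi.single i 1 : E4)

theorem replaceCoord_self (i : Fin 4) (u : E4 → ℝ) (z : E4) : replaceCoord i u z i = u z := by
  simp [replaceCoord]

/-- A function whose differential is a multiple of `du` is locally a smooth function of `u`. -/
theorem exists_eq_comp {V : Set E4} (hV : IsOpen V) {u : E4 → ℝ} (hu : ContDiffOn ℝ ∞ u V)
    {y : E4} (hy : y ∈ V) {i : Fin 4} (hi : pd i u y ≠ 0) :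
    ∃ r > 0, ∃ W : Set E4, IsOpen W ∧ y ∈ W ∧ W ⊆ V ∧
      u '' W ⊆ Set.Ioo (u y - r) (u y + r) ∧
      ∀ f : E4 → ℝ, ContDiffOn ℝ ∞ f V →
        (∀ z ∈ V, ∃ g, ∀ j, pd j f z = g * pd j u z) →
        ∃ P : ℝ → ℝ, ContDiffOn ℝ ∞ P (Set.Ioo (u y - r) (u y + r)) ∧
          ∀ z ∈ W, f z = P (u z) := by
  set Φ := replaceCoord i u with hΦ
  have hΦs : ContDiffOn ℝ ∞ Φ V := by
    refine contDiffOn_id.add ((hu.sub ?_).smul contDiffOn_const)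
    exact (contDiff_apply ℝ ℝ i).contDiffOn
  have hΦy : ContDiffAt ℝ ∞ Φ y := hΦs.contDiffAt (hV.mem_nhds hy)
  have hud : ∀ z ∈ V, DifferentiableAt ℝ u z := fun z hz => differentiableAt_of_smooth hV hu hz
  have hpdΦ : ∀ z ∈ V, ∀ v : E4, fderiv ℝ Φ z v
      = v + (fderiv ℝ u z v - v i) • (Pi.single i 1 : E4) := by
    intro z hz v
    have h1 : HasFDerivAt (fun z : E4 => z i) (ContinuousLinearMap.proj (R := ℝ) i) z :=
      (ContinuousLinearMap.proj (R := ℝ) (φ := fun _ : Fin 4 => ℝ) i).hasFDerivAt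
    have h2 := (hasFDerivAt_id z).add
      (((hud z hz).hasFDerivAt.sub h1).smul_const (Pi.single i 1 : E4))
    have h3 : fderiv ℝ Φ z = _ := h2.fderiv
    rw [h3]; simp
  have hA : ∀ z ∈ V, pd i u z ≠ 0 → ∃ A : E4 ≃L[ℝ] E4, HasFDerivAt Φ (A : E4 →L[ℝ] E4) z := by
    intro z hz hiz
    have hinj : Function.Injective (fderiv ℝ Φ z) := by
      rw [injective_iff_map_eq_zero]
      intro v hv
      rw [hpdΦ z hz] at hv
      have hvj : v = (v i) • (Pi.single i 1 : E4) := by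
        ext j
        by_cases hj : j = i
        · subst hj; simp
        · have := congrFun hv j
          simpa [Pi.single_apply, hj] using this
      have h1 := congrFun hv i
      simp only [Pi.add_apply, Pi.smul_apply, Pi.single_eq_same, smul_eq_mul, mul_one,
        Pi.zero_apply, add_sub_cancel] at h1
      rw [hvj, map_smul, smul_eq_mul] at h1
      rw [hvj, (mul_eq_zero.1 h1).resolve_right hiz, zero_smul]
    let A : E4 ≃L[ℝ] E4 := (LinearEquiv.ofInjectiveEndo
      ((fderiv ℝ Φ z : E4 →L[ℝ] E4) : E4 →ₗ[ℝ] E4) hinj).toContinuousLinearEquiv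
    refine ⟨A, ?_⟩
    have h1 : (A : E4 →L[ℝ] E4) = fderiv ℝ Φ z := by ext v; rfl
    rw [h1]
    exact (differentiableAt_of_smooth hV hΦs hz).hasFDerivAt
  obtain ⟨A, hAy⟩ := hA y hy hi
  set H := hΦy.toOpenPartialHomeomorph Φ hAy (by simp) with hH
  have hHc : ∀ z, H z = Φ z := fun z => rfl
  have hys : y ∈ H.source := hΦy.mem_toOpenPartialHomeomorph_source hAy (by simp)
  have hsymy : H.symm (Φ y) = y := H.left_inv hys
  have hV' : IsOpen (V ∩ pd i u ⁻¹' {0}ᶜ) :=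
    (pd_contDiffOn hV hu i).continuousOn.isOpen_inter_preimage hV isOpen_compl_singleton
  -- a ball on which the inverse is defined, smooth, and takes values in `V`
  have hev : ∀ᶠ w in 𝓝 (Φ y), w ∈ H.target ∧ H.symm w ∈ V ∩ pd i u ⁻¹' {0}ᶜ := by
    have h1 : ∀ᶠ w in 𝓝 (Φ y), w ∈ H.target := H.open_target.mem_nhds (H.map_source hys)
    have h2 : ∀ᶠ w in 𝓝 (Φ y), H.symm w ∈ V ∩ pd i u ⁻¹' {0}ᶜ :=
      (H.continuousAt_symm (H.map_source hys)).preimage_mem_nhds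
        (by rw [hHc, hsymy]; exact hV'.mem_nhds ⟨hy, hi⟩)
    exact h1.and h2
  obtain ⟨r, hr, hball⟩ := Metric.eventually_nhds_iff_ball.1 hev
  have hsm : ContDiffOn ℝ ∞ H.symm (Metric.ball (Φ y) r) := fun w hw => by
    obtain ⟨hwt, hwV, hwi⟩ := hball w hw
    obtain ⟨B, hB⟩ := hA _ hwV hwi
    exact (H.contDiffAt_symm hwt hB (hΦs.contDiffAt (hV.mem_nhds hwV))).contDiffWithinAt
  have hui : ∀ z, Φ z i = u z := replaceCoord_self i u
  refine ⟨r, hr, H.source ∩ H ⁻¹' Metric.ball (Φ y) r ∩ V, ?_, ?_, fun z hz => hz.2, ?_, ?_⟩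
  · exact (H.isOpen_inter_preimage Metric.isOpen_ball).inter hV
  · exact ⟨⟨hys, Metric.mem_ball_self hr⟩, hy⟩
  · rintro _ ⟨z, hz, rfl⟩
    have h1 : dist (Φ z) (Φ y) < r := hz.1.2
    have h2 := (dist_le_pi_dist (Φ z) (Φ y) i).trans_lt h1
    rw [hui, hui, Real.dist_eq, abs_lt] at h2
    exact ⟨by linarith [h2.1], by linarith [h2.2]⟩
  intro f hf hfu
  -- the curve in direction `i` through `Φ y`
  let c : ℝ → E4 := fun s => Φ y + (s - u y) • (Pi.single i 1 : E4)
  have hcs : ContDiff ℝ ∞ c :=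
    contDiff_const.add ((contDiff_id.sub contDiff_const).smul contDiff_const)
  have hcb : Set.MapsTo c (Set.Ioo (u y - r) (u y + r)) (Metric.ball (Φ y) r) := by
    intro s hs
    rw [mem_ball_iff_norm]
    simp only [c, add_sub_cancel_left, norm_smul, Pi.norm_single, Real.norm_eq_abs, abs_one, mul_one]
    rw [abs_lt]
    exact ⟨by linarith [hs.1], by linarith [hs.2]⟩
  have hfH : ContDiffOn ℝ ∞ (fun w => f (H.symm w)) (Metric.ball (Φ y) r) :=
    hf.comp hsm fun w hw => (hball w hw).2.1
  refine ⟨fun s => f (H.symm (c s)), hfH.comp hcs.contDiffOn hcb, fun z hz => ?_⟩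
  have hzb : Φ z ∈ Metric.ball (Φ y) r := hz.1.2
  have huz : u z ∈ Set.Ioo (u y - r) (u y + r) := by
    have h2 := (dist_le_pi_dist (Φ z) (Φ y) i).trans_lt hzb
    rw [hui, hui, Real.dist_eq, abs_lt] at h2
    exact ⟨by linarith [h2.1], by linarith [h2.2]⟩
  -- `f ∘ Φ⁻¹` is constant on the slices of the ball orthogonal to the `i`-th axis
  have hder : ∀ w ∈ Metric.ball (Φ y) r, ∀ v : E4, v i = 0 →
      fderiv ℝ (fun w => f (H.symm w)) w v = 0 := by
    intro w hw v hv
    obtain ⟨hwt, hwV, -⟩ := hball w hw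
    have hdH := differentiableAt_of_smooth Metric.isOpen_ball hsm hw
    obtain ⟨g, hg⟩ := hfu _ hwV
    have h1 : ∀ v', fderiv ℝ f (H.symm w) v' = g * fderiv ℝ u (H.symm w) v' := by
      intro v'
      rw [fderiv_eq_sum_pd, fderiv_eq_sum_pd, Finset.mul_sum]
      exact Finset.sum_congr rfl fun j _ => by rw [hg]; simp only [smul_eq_mul]; ring
    have h2 : fderiv ℝ (fun w => u (H.symm w)) w v = 0 := by
      have h3 : (fun w => u (H.symm w)) =ᶠ[𝓝 w] fun w => w i := by
        filter_upwards [H.open_target.mem_nhds hwt] with w' hw'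
        rw [← hui, ← hHc, H.right_inv hw']
      rw [h3.fderiv_eq]
      have h4 : HasFDerivAt (fun z : E4 => z i) (ContinuousLinearMap.proj (R := ℝ) i) w :=
        (ContinuousLinearMap.proj (R := ℝ) (φ := fun _ : Fin 4 => ℝ) i).hasFDerivAt
      rw [h4.fderiv]
      exact hv
    have h5 := (hud _ hwV).hasFDerivAt.comp w hdH.hasFDerivAt
    have h6 := (differentiableAt_of_smooth hV hf hwV).hasFDerivAt.comp w hdH.hasFDerivAt
    have h7 : fderiv ℝ (fun w => u (H.symm w)) w = _ := h5.fderiv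
    have h8 : fderiv ℝ (fun w => f (H.symm w)) w = _ := h6.fderiv
    rw [h7] at h2
    rw [h8]
    simp only [ContinuousLinearMap.comp_apply] at h2 ⊢
    rw [h1, h2, mul_zero]
  have hcz := hcb huz
  have hdir : (Φ z - c (u z)) i = 0 := by
    simp [c, hui]
  let q : ℝ → E4 := fun t => c (u z) + t • (Φ z - c (u z))
  have hq : ∀ t ∈ Set.Icc (0 : ℝ) 1, q t ∈ Metric.ball (Φ y) r := by
    intro t ht
    have := (convex_ball (Φ y) r).add_smul_sub_mem hcz hzb ht
    exact this
  have hqd : ∀ t ∈ Set.Icc (0 : ℝ) 1,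
      HasDerivAt (fun t => f (H.symm (q t))) 0 t := by
    intro t ht
    have h1 : HasDerivAt q (Φ z - c (u z)) t := by
      have := ((hasDerivAt_id t).smul_const (Φ z - c (u z))).const_add (c (u z))
      rwa [one_smul] at this
    have h2 := (differentiableAt_of_smooth Metric.isOpen_ball hfH
      (hq t ht)).hasFDerivAt.comp_hasDerivAt t h1
    rw [hder _ (hq t ht) _ hdir] at h2
    exact h2
  have h1 := constant_of_has_deriv_right_zero (f := fun t => f (H.symm (q t))) (a := 0) (b := 1)
    (fun t ht => (hqd t ht).continuousAt.continuousWithinAt)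
    (fun t ht => (hqd t ⟨ht.1, ht.2.le⟩).hasDerivWithinAt) 1 ⟨zero_le_one, le_rfl⟩
  have h2 : H.symm (Φ z) = z := H.left_inv hz.1.1
  simpa [q, h2] using h1

theorem pd_comp {u : E4 → ℝ} {g : ℝ → ℝ} {g' : ℝ} {z : E4} (hg : HasDerivAt g g' (u z))
    (hu : DifferentiableAt ℝ u z) (i : Fin 4) : pd i (fun z => g (u z)) z = g' * pd i u z := by
  have h : HasFDerivAt (fun z => g (u z)) (g' • fderiv ℝ u z) z :=
    hg.comp_hasFDerivAt z hu.hasFDerivAt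
  unfold pd
  rw [h.fderiv]; rfl

/-- A fundamental matrix of a linear differential equation, with its inverse. -/
theorem exists_fundamental_matrix {S : Set ℝ} (hS : IsOpen S) {A : ℝ → Fin 4 → Fin 4 → ℝ}
    (hA : ∀ a b, ContDiffOn ℝ ∞ (fun s => A s a b) S) {s₀ : ℝ} (hs : s₀ ∈ S) :
    ∃ ε > 0, Set.Ioo (s₀ - ε) (s₀ + ε) ⊆ S ∧ ∃ Φ Ψ : ℝ → Fin 4 → Fin 4 → ℝ,
      (∀ a b, ContDiffOn ℝ ∞ (fun s => Φ s a b) (Set.Ioo (s₀ - ε) (s₀ + ε))) ∧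
      (∀ a b, ContDiffOn ℝ ∞ (fun s => Ψ s a b) (Set.Ioo (s₀ - ε) (s₀ + ε))) ∧
      ∀ s ∈ Set.Ioo (s₀ - ε) (s₀ + ε), ∀ a b,
        HasDerivAt (fun s => Φ s a b) (∑ c, A s a c * Φ s c b) s ∧
        HasDerivAt (fun s => Ψ s a b) (- ∑ c, Ψ s a c * A s c b) s ∧
        ∑ c, Φ s a c * Ψ s c b = if a = b then 1 else 0 := by
  have hA' : ∀ a b, ContDiffOn ℝ ∞ (fun q : ℝ × (Fin 4 → Fin 4 → ℝ) => A q.1 a b)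
      (S ×ˢ Set.univ) := fun a b => (hA a b).comp contDiffOn_fst fun q hq => hq.1
  have hq : ∀ a b, ContDiffOn ℝ ∞ (fun q : ℝ × (Fin 4 → Fin 4 → ℝ) => q.2 a b)
      (S ×ˢ Set.univ) := fun a b =>
    ((contDiff_apply_apply ℝ ℝ a b).comp contDiff_snd).contDiffOn
  obtain ⟨ε₁, h₁, hs₁, Φ, hΦ0, hΦ, hΦ'⟩ := exists_smooth_solution hS
    (f := fun q : ℝ × (Fin 4 → Fin 4 → ℝ) => fun a b => ∑ c, A q.1 a c * q.2 c b)
    (contDiffOn_pi.2 fun a => contDiffOn_pi.2 fun b =>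
      ContDiffOn.sum fun c _ => (hA' a c).mul (hq c b)) hs (fun a b => if a = b then 1 else 0)
  obtain ⟨ε₂, h₂, hs₂, Ψ, hΨ0, hΨ, hΨ'⟩ := exists_smooth_solution hS
    (f := fun q : ℝ × (Fin 4 → Fin 4 → ℝ) => fun a b => - ∑ c, q.2 a c * A q.1 c b)
    (contDiffOn_pi.2 fun a => contDiffOn_pi.2 fun b =>
      (ContDiffOn.sum fun c _ => (hq a c).mul (hA' c b)).neg) hs (fun a b => if a = b then 1 else 0)
  have hm₁ : Set.Ioo (s₀ - min ε₁ ε₂) (s₀ + min ε₁ ε₂) ⊆ Set.Ioo (s₀ - ε₁) (s₀ + ε₁) :=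
    Set.Ioo_subset_Ioo (by linarith [min_le_left ε₁ ε₂]) (by linarith [min_le_left ε₁ ε₂])
  have hm₂ : Set.Ioo (s₀ - min ε₁ ε₂) (s₀ + min ε₁ ε₂) ⊆ Set.Ioo (s₀ - ε₂) (s₀ + ε₂) :=
    Set.Ioo_subset_Ioo (by linarith [min_le_right ε₁ ε₂]) (by linarith [min_le_right ε₁ ε₂])
  have hpos : 0 < min ε₁ ε₂ := lt_min h₁ h₂
  have d₁ : ∀ s ∈ Set.Ioo (s₀ - min ε₁ ε₂) (s₀ + min ε₁ ε₂), ∀ a b,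
      HasDerivAt (fun s => Φ s a b) (∑ c, A s a c * Φ s c b) s := fun s hs a b =>
    hasDerivAt_pi.1 (hasDerivAt_pi.1 (hΦ' s (hm₁ hs)) a) b
  have d₂ : ∀ s ∈ Set.Ioo (s₀ - min ε₁ ε₂) (s₀ + min ε₁ ε₂), ∀ a b,
      HasDerivAt (fun s => Ψ s a b) (- ∑ c, Ψ s a c * A s c b) s := fun s hs a b =>
    hasDerivAt_pi.1 (hasDerivAt_pi.1 (hΨ' s (hm₂ hs)) a) b
  refine ⟨min ε₁ ε₂, hpos, hm₁.trans hs₁, Φ, Ψ,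
    fun a b => (contDiffOn_pi.1 (contDiffOn_pi.1 (hΦ.mono hm₁) a) b),
    fun a b => (contDiffOn_pi.1 (contDiffOn_pi.1 (hΨ.mono hm₂) a) b), fun s hs a b =>
    ⟨d₁ s hs a b, d₂ s hs a b, ?_⟩⟩
  -- `Ψ Φ` is constant
  have hprod : ∀ a b, ∑ c, Ψ s a c * Φ s c b = if a = b then 1 else 0 := by
    intro a b
    have h0 : ∀ t ∈ Set.Ioo (s₀ - min ε₁ ε₂) (s₀ + min ε₁ ε₂),
        HasDerivAt (fun s => ∑ c, Ψ s a c * Φ s c b) 0 t := by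
      intro t ht
      have := HasDerivAt.fun_sum (u := Finset.univ) fun c _ =>
        (d₂ t ht a c).fun_mul (d₁ t ht c b)
      convert! this using 1
      simp only [Fin.sum_univ_four]; ring
    have h1 := const_of_hasDerivAt_zero h0 hs (t := s₀) ⟨by linarith, by linarith⟩
    rw [h1, hΨ0, hΦ0]
    simp
  have h1 : (Matrix.of (Ψ s)) * (Matrix.of (Φ s)) = 1 := by
    ext a b
    rw [Matrix.mul_apply, Matrix.one_apply]
    exact hprod a b
  have h2 : (Matrix.of (Φ s) * Matrix.of (Ψ s)) a b = (1 : Matrix (Fin 4) (Fin 4) ℝ) a b := by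
    rw [mul_eq_one_comm.1 h1]
  rw [Matrix.mul_apply, Matrix.one_apply] at h2
  exact h2

/-- The affine total differential system `dYᵃ = Bᵃ + Aᵃ_b(u) Yᵇ du` has local solutions when the
integrability condition `dBᵃ = du ∧ Aᵃ_b(u) Bᵇ` holds. A fundamental matrix of the equation in the
variable `u` reduces it to the Poincaré lemma. -/
theorem exists_affine_solution {y : E4} {r : ℝ} (hr : 0 < r) {u : E4 → ℝ}
    (hu : ContDiffOn ℝ ∞ u (Metric.ball y r)) {S : Set ℝ} (hS : IsOpen S) (hy : u y ∈ S)
    {A : ℝ → Fin 4 → Fin 4 → ℝ} (hA : ∀ a b, ContDiffOn ℝ ∞ (fun s => A s a b) S)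
    {B : Fin 4 → E4 → Fin 4 → ℝ}
    (hB : ∀ a i, ContDiffOn ℝ ∞ (fun z => B a z i) (Metric.ball y r))
    (hd : ∀ z ∈ Metric.ball y r, ∀ a i j, extd (B a) z i j
      = ∑ b, A (u z) a b * wedge (fun k => pd k u z) (B b z) i j) :
    ∃ r' > 0, r' ≤ r ∧ ∃ Y : Fin 4 → E4 → ℝ,
      (∀ a, ContDiffOn ℝ ∞ (Y a) (Metric.ball y r')) ∧
      ∀ z ∈ Metric.ball y r', ∀ a i,
        pd i (Y a) z = B a z i + (∑ b, A (u z) a b * Y b z) * pd i u z := by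
  obtain ⟨ε, hε, hεS, Φ, Ψ, sΦ, sΨ, hD⟩ := exists_fundamental_matrix hS hA hy
  have hev : ∀ᶠ z in 𝓝 y, u z ∈ Set.Ioo (u y - ε) (u y + ε) :=
    (hu.contDiffAt (Metric.ball_mem_nhds y hr)).continuousAt.preimage_mem_nhds
      (Ioo_mem_nhds (by linarith) (by linarith))
  obtain ⟨δ, hδ, hδu⟩ := Metric.eventually_nhds_iff_ball.1 hev
  have hsub : Metric.ball y (min r δ) ⊆ Metric.ball y r := Metric.ball_subset_ball (min_le_left _ _)
  have hmap : Set.MapsTo u (Metric.ball y (min r δ)) (Set.Ioo (u y - ε) (u y + ε)) := fun z hz =>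
    hδu z (Metric.ball_subset_ball (min_le_right _ _) hz)
  have hop : IsOpen (Metric.ball y (min r δ)) := Metric.isOpen_ball
  have hu' := hu.mono hsub
  have hB' := fun a i => (hB a i).mono hsub
  have cΦ : ∀ a b, ContDiffOn ℝ ∞ (fun z => Φ (u z) a b) (Metric.ball y (min r δ)) := fun a b =>
    (sΦ a b).comp hu' hmap
  have cΨ : ∀ a b, ContDiffOn ℝ ∞ (fun z => Ψ (u z) a b) (Metric.ball y (min r δ)) := fun a b =>
    (sΨ a b).comp hu' hmap
  have pΦ : ∀ z ∈ Metric.ball y (min r δ), ∀ a b i, pd i (fun z => Φ (u z) a b) z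
      = (∑ c, A (u z) a c * Φ (u z) c b) * pd i u z := fun z hz a b i =>
    pd_comp (hD _ (hmap hz) a b).1 (differentiableAt_of_smooth hop hu' hz) i
  have pΨ : ∀ z ∈ Metric.ball y (min r δ), ∀ a b i, pd i (fun z => Ψ (u z) a b) z
      = (- ∑ c, Ψ (u z) a c * A (u z) c b) * pd i u z := fun z hz a b i =>
    pd_comp (hD _ (hmap hz) a b).2.1 (differentiableAt_of_smooth hop hu' hz) i
  have hW : ∀ a, ∃ f : E4 → ℝ, ContDiffOn ℝ ∞ f (Metric.ball y (min r δ)) ∧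
      ∀ z ∈ Metric.ball y (min r δ), ∀ i, pd i f z = ∑ b, Ψ (u z) a b * B b z i := by
    intro a
    refine exists_primitive (fun i => ContDiffOn.sum fun b _ => (cΨ a b).mul (hB' b i))
      fun z hz i j => ?_
    have e1 : ∀ i j, pd i (fun z => ∑ b, Ψ (u z) a b * B b z j) z
        = ∑ b, (Ψ (u z) a b * pd i (fun z => B b z j) z
          + (- ∑ c, Ψ (u z) a c * A (u z) c b) * pd i u z * B b z j) := by
      intro i j
      have dΨ := fun b => differentiableAt_of_smooth hop (cΨ a b) hz
      have dB := fun b => differentiableAt_of_smooth hop (hB' b j) hz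
      rw [pd_sum _ fun b _ => (dΨ b).fun_mul (dB b)]
      exact Finset.sum_congr rfl fun b _ => by rw [pd_mul (dΨ b) (dB b), pΨ z hz]
    have e2 : ∀ b, pd i (fun z => B b z j) z - pd j (fun z => B b z i) z
        = ∑ c, A (u z) b c * wedge (fun k => pd k u z) (B c z) i j := fun b =>
      hd z (hsub hz) b i j
    have e3 : extd (fun z i => ∑ b, Ψ (u z) a b * B b z i) z i j
        = ∑ b, Ψ (u z) a b * (pd i (fun z => B b z j) z - pd j (fun z => B b z i) z)
        - ∑ b, (∑ c, Ψ (u z) a c * A (u z) c b) * wedge (fun k => pd k u z) (B b z) i j := by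
      unfold extd
      rw [e1, e1]
      simp only [Fin.sum_univ_four]
      unfold wedge; ring
    rw [e3]
    simp only [e2]
    simp only [Fin.sum_univ_four]
    ring
  choose W sW hWp using hW
  refine ⟨min r δ, lt_min hr hδ, min_le_left _ _, fun a z => ∑ b, Φ (u z) a b * W b z,
    fun a => ContDiffOn.sum fun b _ => (cΦ a b).mul (sW b), fun z hz a i => ?_⟩
  have dΦ := fun b => differentiableAt_of_smooth hop (cΦ a b) hz
  have dW := fun b => differentiableAt_of_smooth hop (sW b) hz
  rw [pd_sum _ fun b _ => (dΦ b).fun_mul (dW b)]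
  have e1 : ∀ b, pd i (fun z => Φ (u z) a b * W b z) z
      = ∑ c, Φ (u z) a b * Ψ (u z) b c * B c z i
        + (∑ c, A (u z) a c * Φ (u z) c b) * pd i u z * W b z := by
    intro b
    rw [pd_mul (dΦ b) (dW b), pΦ z hz, hWp b z hz, Finset.mul_sum]
    simp only [mul_assoc]
  simp only [e1, Finset.sum_add_distrib]
  congr 1
  · rw [Finset.sum_comm]
    have : ∀ c, ∑ b, Φ (u z) a b * Ψ (u z) b c * B c z i = (if a = c then 1 else 0) * B c z i := by
      intro c
      rw [← Finset.sum_mul, (hD _ (hmap hz) a c).2.2]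
    simp [this]
  · simp only [Fin.sum_univ_four]; ring

/-! ### pp-waves and plane waves -/

/-- A null coframe `dU, N, E₁, E₂` with `dU` parallel. The forms `M₁`, `M₂` are the remaining
connection forms, `∇N = M₁ ⊗ E₁ + M₂ ⊗ E₂` and `∇E_a = M_a ⊗ dU`, and `p`, `q` are the components of
the curvature. -/
structure ParallelFrame (G : CMetric) (V : Set E4) where
  U : E4 → ℝ
  p : E4 → ℝ
  q : E4 → ℝ
  N : E4 → Fin 4 → ℝ
  E₁ : E4 → Fin 4 → ℝ
  E₂ : E4 → Fin 4 → ℝ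
  M₁ : E4 → Fin 4 → ℝ
  M₂ : E4 → Fin 4 → ℝ
  sU : ContDiffOn ℝ ∞ U V
  sp : ContDiffOn ℝ ∞ p V
  sq : ContDiffOn ℝ ∞ q V
  sN : ∀ i, ContDiffOn ℝ ∞ (fun z => N z i) V
  sE₁ : ∀ i, ContDiffOn ℝ ∞ (fun z => E₁ z i) V
  sE₂ : ∀ i, ContDiffOn ℝ ∞ (fun z => E₂ z i) V
  sM₁ : ∀ i, ContDiffOn ℝ ∞ (fun z => M₁ z i) V
  sM₂ : ∀ i, ContDiffOn ℝ ∞ (fun z => M₂ z i) V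
  frame : ∀ z ∈ V, IsNullFrame G z (fun i => pd i U z) (N z) (E₁ z) (E₂ z)
  parallel : ∀ z ∈ V, cov1 G (fun z i => pd i U z) z = 0
  dN : ∀ z ∈ V, ∀ i j, extd N z i j = wedge (M₁ z) (E₁ z) i j + wedge (M₂ z) (E₂ z) i j
  dE₁ : ∀ z ∈ V, ∀ i j, extd E₁ z i j = wedge (M₁ z) (fun i => pd i U z) i j
  dE₂ : ∀ z ∈ V, ∀ i j, extd E₂ z i j = wedge (M₂ z) (fun i => pd i U z) i j
  dM₁ : ∀ z ∈ V, ∀ i j, extd M₁ z i j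
    = p z * wedge (fun i => pd i U z) (E₁ z) i j + q z * wedge (fun i => pd i U z) (E₂ z) i j
  dM₂ : ∀ z ∈ V, ∀ i j, extd M₂ z i j
    = q z * wedge (fun i => pd i U z) (E₁ z) i j - p z * wedge (fun i => pd i U z) (E₂ z) i j

/-- A recurrent null coframe of a type N vacuum metric can be rescaled and rotated so that the null
form becomes exact and parallel: the connection forms `θ` and `ψ` are closed, their primitives give
the scale and the angle. -/
theorem NullFrame.Recurrent.exists_parallelFrame {G : CMetric} {V : Set E4} {F : NullFrame G V}
    (hp : F.Recurrent) (hG : MetricOn G V) (hR : F.TypeNCurvature) {y : E4} {r : ℝ}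
    (hB : Metric.ball y r ⊆ V) : ∃ K : ParallelFrame G (Metric.ball y r),
      ∀ z ∈ Metric.ball y r, (∃ s ≠ 0, ∀ i, pd i K.U z = s * F.l z i) ∧
        ∀ i, pd i K.p z = 2 * (K.p z * F.th z i - K.q z * F.ps z i) ∧
          pd i K.q z = 2 * (K.q z * F.th z i + K.p z * F.ps z i) := by
  have hop : IsOpen (Metric.ball y r) := Metric.isOpen_ball
  have D : ∀ {ξ : E4 → Fin 4 → ℝ}, (∀ i, ContDiffOn ℝ ∞ (fun z => ξ z i) V) →
      ∀ z ∈ Metric.ball y r, ∀ i, DifferentiableAt ℝ (fun y => ξ y i) z := fun h z hz i =>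
    differentiableAt_of_smooth hG.isOpen (h i) (hB hz)
  -- `exp (-w)` is the factor that makes `l` parallel, and `φ` the angle that rotates `e, f`
  obtain ⟨w, sw, hw⟩ := exists_primitive (fun i => (F.s_th hG i).mono hB)
    fun z hz i j => hp.extd_th hG hR (hB hz) i j
  obtain ⟨φ, sφ, hφ⟩ := exists_primitive (fun i => (F.s_ps hG i).mono hB)
    fun z hz i j => hp.extd_ps hG hR (hB hz) i j
  have dw : ∀ z ∈ Metric.ball y r, DifferentiableAt ℝ w z := fun z hz =>
    differentiableAt_of_smooth hop sw hz
  have dφ : ∀ z ∈ Metric.ball y r, DifferentiableAt ℝ φ z := fun z hz =>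
    differentiableAt_of_smooth hop sφ hz
  have sF : ContDiffOn ℝ ∞ (fun z => Real.exp (-w z)) (Metric.ball y r) :=
    Real.contDiff_exp.comp_contDiffOn sw.neg
  have sI : ContDiffOn ℝ ∞ (fun z => Real.exp (w z)) (Metric.ball y r) :=
    Real.contDiff_exp.comp_contDiffOn sw
  have sc : ContDiffOn ℝ ∞ (fun z => Real.cos (φ z)) (Metric.ball y r) :=
    Real.contDiff_cos.comp_contDiffOn sφ
  have ss : ContDiffOn ℝ ∞ (fun z => Real.sin (φ z)) (Metric.ball y r) :=
    Real.contDiff_sin.comp_contDiffOn sφ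
  have pF : ∀ z ∈ Metric.ball y r, ∀ i, pd i (fun z => Real.exp (-w z)) z
      = - Real.exp (-w z) * F.th z i := by
    intro z hz i
    have h : HasDerivAt (fun t => Real.exp (-t)) (Real.exp (-w z) * -1) (w z) :=
      (Real.hasDerivAt_exp _).comp (w z) (hasDerivAt_neg _)
    rw [pd_comp h (dw z hz), hw z hz]; ring
  have pI : ∀ z ∈ Metric.ball y r, ∀ i, pd i (fun z => Real.exp (w z)) z
      = Real.exp (w z) * F.th z i := fun z hz i => by
    rw [pd_comp (Real.hasDerivAt_exp _) (dw z hz), hw z hz]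
  have pc : ∀ z ∈ Metric.ball y r, ∀ i, pd i (fun z => Real.cos (φ z)) z
      = - Real.sin (φ z) * F.ps z i := fun z hz i => by
    rw [pd_comp (Real.hasDerivAt_cos _) (dφ z hz), hφ z hz]
  have ps : ∀ z ∈ Metric.ball y r, ∀ i, pd i (fun z => Real.sin (φ z)) z
      = Real.cos (φ z) * F.ps z i := fun z hz i => by
    rw [pd_comp (Real.hasDerivAt_sin _) (dφ z hz), hφ z hz]
  have E : ∀ {s : E4 → ℝ}, ContDiffOn ℝ ∞ s (Metric.ball y r) → ∀ z ∈ Metric.ball y r,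
      DifferentiableAt ℝ s z := fun h z hz => differentiableAt_of_smooth hop h hz
  have hFI : ∀ z, Real.exp (-w z) * Real.exp (w z) = 1 := fun z => by
    rw [← Real.exp_add]; simp
  have hcs : ∀ z, Real.cos (φ z) ^ 2 + Real.sin (φ z) ^ 2 = 1 := fun z => by
    rw [add_comm]; exact Real.sin_sq_add_cos_sq _
  have hdl : ∀ z ∈ Metric.ball y r, ∀ i j, extd F.l z i j = wedge (F.th z) (F.l z) i j := by
    intro z hz i j
    rw [F.extd_l hG (hB hz)]; simp [wedge, hp z (hB hz)]
  have hde : ∀ z ∈ Metric.ball y r, ∀ i j, extd F.e z i j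
      = wedge (F.mu z) (F.l z) i j + wedge (F.ps z) (F.f z) i j := by
    intro z hz i j
    rw [F.extd_e hG (hB hz)]; simp [wedge, hp z (hB hz)]
  have hdf : ∀ z ∈ Metric.ball y r, ∀ i j, extd F.f z i j
      = wedge (F.nu z) (F.l z) i j - wedge (F.ps z) (F.e z) i j := by
    intro z hz i j
    rw [F.extd_f hG (hB hz)]; simp [wedge, hp z (hB hz)]
  have hdn : ∀ z ∈ Metric.ball y r, ∀ i j, extd F.n z i j = wedge (F.mu z) (F.e z) i j
      + wedge (F.nu z) (F.f z) i j - wedge (F.th z) (F.n z) i j := by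
    intro z hz i j
    rw [NullFrame.extd_eq_cov hG _ (hB hz), F.cov_n hG (hB hz), F.cov_n hG (hB hz)]; unfold wedge; ring
  -- the exterior derivative of a combination of two forms, multiplied by a function
  have comb : ∀ {g c d : E4 → ℝ} {ξ η : E4 → Fin 4 → ℝ}, ∀ z ∈ Metric.ball y r,
      DifferentiableAt ℝ g z → DifferentiableAt ℝ c z → DifferentiableAt ℝ d z →
      (∀ i, DifferentiableAt ℝ (fun y => ξ y i) z) → (∀ i, DifferentiableAt ℝ (fun y => η y i) z) →
      ∀ i j, extd (fun z i => g z * (c z * ξ z i + d z * η z i)) z i j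
        = g z * (c z * extd ξ z i j + wedge (fun k => pd k c z) (ξ z) i j
          + d z * extd η z i j + wedge (fun k => pd k d z) (η z) i j)
        + wedge (fun k => pd k g z) (fun i => c z * ξ z i + d z * η z i) i j := by
    intro g c d ξ η z hz hg hc hd hξ hη i j
    rw [extd_mul hg fun i => (hc.fun_mul (hξ i)).fun_add (hd.fun_mul (hη i)),
      extd_add (fun i => hc.fun_mul (hξ i)) (fun i => hd.fun_mul (hη i)), extd_mul hc hξ,
      extd_mul hd hη]
    ring
  obtain ⟨U, sU, hU⟩ := exists_primitive (y := y) (r := r)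
    (θ := fun z i => Real.exp (-w z) * F.l z i) (fun i => sF.mul ((F.sl i).mono hB))
    fun z hz i j => by
      rw [extd_mul (E sF z hz) (D F.sl z hz), hdl z hz]
      simp only [wedge, pF z hz]; ring
  have hU' : ∀ z ∈ Metric.ball y r, (fun i => pd i U z) = fun i => Real.exp (-w z) * F.l z i :=
    fun z hz => funext fun i => hU z hz i
  refine ⟨{
    U := U
    p := fun z => Real.exp (w z) * Real.exp (w z) *
      (Real.cos (φ z) * Real.cos (φ z) - Real.sin (φ z) * Real.sin (φ z))
    q := fun z => Real.exp (w z) * Real.exp (w z) * (2 * (Real.cos (φ z) * Real.sin (φ z)))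
    N := fun z i => Real.exp (w z) * F.n z i
    E₁ := fun z i => Real.cos (φ z) * F.e z i + -Real.sin (φ z) * F.f z i
    E₂ := fun z i => Real.sin (φ z) * F.e z i + Real.cos (φ z) * F.f z i
    M₁ := fun z i => Real.exp (w z) * (Real.cos (φ z) * F.mu z i + -Real.sin (φ z) * F.nu z i)
    M₂ := fun z i => Real.exp (w z) * (Real.sin (φ z) * F.mu z i + Real.cos (φ z) * F.nu z i)
    sU := sU
    sp := (sI.mul sI).mul ((sc.mul sc).sub (ss.mul ss))
    sq := (sI.mul sI).mul (contDiffOn_const.mul (sc.mul ss))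
    sN := fun i => sI.mul ((F.sn i).mono hB)
    sE₁ := fun i => (sc.mul ((F.se i).mono hB)).add (ss.neg.mul ((F.sf i).mono hB))
    sE₂ := fun i => (ss.mul ((F.se i).mono hB)).add (sc.mul ((F.sf i).mono hB))
    sM₁ := fun i => sI.mul ((sc.mul ((F.s_mu hG i).mono hB)).add
      (ss.neg.mul ((F.s_nu hG i).mono hB)))
    sM₂ := fun i => sI.mul ((ss.mul ((F.s_mu hG i).mono hB)).add
      (sc.mul ((F.s_nu hG i).mono hB)))
    frame := fun z hz i j => by
      rw [F.frame z (hB hz) i j]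
      simp only [hU z hz]
      linear_combination (F.l z i * F.n z j + F.n z i * F.l z j) * hFI z
        - (F.e z i * F.e z j + F.f z i * F.f z j) * hcs z
    parallel := fun z hz => by
      funext i j
      have h1 : cov1 G (fun z i => pd i U z) z i j
          = cov1 G (fun z i => Real.exp (-w z) * F.l z i) z i j := by
        unfold cov1
        rw [pd_congr_on hop (fun z hz => hU z hz j) hz]
        simp only [hU z hz]
      have h2 := F.cov_l hG (hB hz) i j
      rw [(hp z (hB hz) i).1, (hp z (hB hz) i).2] at h2
      rw [h1]
      unfold cov1 at h2 ⊢
      rw [pd_mul (E sF z hz) (D F.sl z hz j), pF z hz]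
      simp only [Fin.sum_univ_four] at h2 ⊢
      simp only [Pi.zero_apply]
      linear_combination Real.exp (-w z) * h2
    dN := fun z hz i j => by
      rw [extd_mul (E sI z hz) (D F.sn z hz), hdn z hz]
      simp only [wedge, pI z hz]
      linear_combination Real.exp (w z) * (-(F.mu z i * F.e z j - F.e z i * F.mu z j)
        - (F.nu z i * F.f z j - F.f z i * F.nu z j)) * hcs z
    dE₁ := fun z hz i j => by
      have h := comb (g := fun _ => 1) z hz (differentiableAt_const _) (E sc z hz) (E ss.neg z hz)
        (D F.se z hz) (D F.sf z hz) i j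
      simp only [one_mul] at h
      rw [h, hde z hz, hdf z hz, hU' z hz]
      simp only [wedge, pc z hz, pd_neg, ps z hz, pd_const]
      linear_combination (Real.cos (φ z) * (F.l z i * F.mu z j - F.mu z i * F.l z j)
        - Real.sin (φ z) * (F.l z i * F.nu z j - F.nu z i * F.l z j)) * hFI z
    dE₂ := fun z hz i j => by
      have h := comb (g := fun _ => 1) z hz (differentiableAt_const _) (E ss z hz) (E sc z hz)
        (D F.se z hz) (D F.sf z hz) i j
      simp only [one_mul] at h
      rw [h, hde z hz, hdf z hz, hU' z hz]
      simp only [wedge, pc z hz, ps z hz, pd_const]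
      linear_combination (Real.sin (φ z) * (F.l z i * F.mu z j - F.mu z i * F.l z j)
        + Real.cos (φ z) * (F.l z i * F.nu z j - F.nu z i * F.l z j)) * hFI z
    dM₁ := fun z hz i j => by
      have h := comb z hz (E sI z hz) (E sc z hz) (E ss.neg z hz)
        (D (F.s_mu hG) z hz) (D (F.s_nu hG) z hz) i j
      rw [h, (F.ricci_n hG hR (hB hz) i j).1, (F.ricci_n hG hR (hB hz) i j).2, hU' z hz]
      simp only [wedge, pc z hz, pd_neg, ps z hz, pI z hz, NullFrame.L, NullFrame.M]
      linear_combination (-Real.exp (w z) * (Real.cos (φ z) * (F.l z i * F.e z j - F.e z i * F.l z j)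
        + Real.sin (φ z) * (F.l z i * F.f z j - F.f z i * F.l z j))
          * (Real.cos (φ z) ^ 2 + Real.sin (φ z) ^ 2)) * hFI z
        - Real.exp (w z) * (Real.cos (φ z) * (F.l z i * F.e z j - F.e z i * F.l z j)
        + Real.sin (φ z) * (F.l z i * F.f z j - F.f z i * F.l z j)) * hcs z
    dM₂ := fun z hz i j => by
      have h := comb z hz (E sI z hz) (E ss z hz) (E sc z hz)
        (D (F.s_mu hG) z hz) (D (F.s_nu hG) z hz) i j
      rw [h, (F.ricci_n hG hR (hB hz) i j).1, (F.ricci_n hG hR (hB hz) i j).2, hU' z hz]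
      simp only [wedge, pc z hz, ps z hz, pI z hz, NullFrame.L, NullFrame.M]
      linear_combination (-Real.exp (w z) * (Real.sin (φ z) * (F.l z i * F.e z j - F.e z i * F.l z j)
        - Real.cos (φ z) * (F.l z i * F.f z j - F.f z i * F.l z j))
          * (Real.cos (φ z) ^ 2 + Real.sin (φ z) ^ 2)) * hFI z
        - Real.exp (w z) * (Real.sin (φ z) * (F.l z i * F.e z j - F.e z i * F.l z j)
        - Real.cos (φ z) * (F.l z i * F.f z j - F.f z i * F.l z j)) * hcs z },
    fun z hz => ⟨⟨_, Real.exp_ne_zero _, hU z hz⟩, fun i => ⟨?_, ?_⟩⟩⟩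
  · have e1 := (E sI z hz).fun_mul (E sI z hz)
    have e2 := (E sc z hz).fun_mul (E sc z hz)
    have e3 := (E ss z hz).fun_mul (E ss z hz)
    simp only
    rw [pd_mul e1 (e2.fun_sub e3), pd_sub e2 e3, pd_mul (E sI z hz) (E sI z hz),
      pd_mul (E sc z hz) (E sc z hz), pd_mul (E ss z hz) (E ss z hz), pI z hz, pc z hz, ps z hz]
    ring
  · have e1 := (E sI z hz).fun_mul (E sI z hz)
    have e2 := (E sc z hz).fun_mul (E ss z hz)
    simp only
    rw [pd_mul e1 (e2.const_mul 2), pd_const_mul _ e2, pd_mul (E sI z hz) (E sI z hz),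
      pd_mul (E sc z hz) (E ss z hz), pI z hz, pc z hz, ps z hz]
    ring

namespace ParallelFrame

variable {G : CMetric} {V : Set E4} (K : ParallelFrame G V)

theorem s_dU (hV : IsOpen V) (i : Fin 4) : ContDiffOn ℝ ∞ (fun z => pd i K.U z) V :=
  pd_contDiffOn hV K.sU i

theorem prods (hG : MetricOn G V) {z : E4} (hz : z ∈ V) :
    NullProducts G z (fun i => pd i K.U z) (K.N z) (K.E₁ z) (K.E₂ z) :=
  (K.frame z hz).products hG hz

theorem ppWaveNear (K : ParallelFrame G V) (hG : MetricOn G V) {U : Set E4} (hU : V ⊆ U) {y : E4}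
    (hy : y ∈ V) : PPWaveNear G U y := by
  refine ⟨V, hG.isOpen, hy, hU, _, K.s_dU hG.isOpen, fun z hz => ⟨?_, (K.prods hG hz).ll,
    K.parallel z hz⟩⟩
  obtain ⟨k, hk⟩ := (K.prods hG hz).l_ne
  exact fun h => hk (congrFun h k)

/-- The plane wave coordinates. The two functions `x_a` and the coefficients `S_a` with
`dx_a = E_a - S_a dU` satisfy an affine total differential system, integrable because `p` and `q`
are functions of `U`; the last coordinate is then a primitive of a closed form. -/
theorem planeWaveNear {y : E4} {r : ℝ} (hr : 0 < r) (K : ParallelFrame G (Metric.ball y r))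
    (hG : MetricOn G (Metric.ball y r)) {U : Set E4} (hU : Metric.ball y r ⊆ U)
    (hp : ∀ z ∈ Metric.ball y r, ∃ g, ∀ i, pd i K.p z = g * pd i K.U z)
    (hq : ∀ z ∈ Metric.ball y r, ∃ g, ∀ i, pd i K.q z = g * pd i K.U z) :
    PlaneWaveNear G U y := by
  obtain ⟨i₀, hi₀⟩ := (K.prods hG (Metric.mem_ball_self hr)).l_ne
  obtain ⟨ρ, hρ, W, hW, hyW, hWB, hWU, hfun⟩ := exists_eq_comp hG.isOpen K.sU
    (Metric.mem_ball_self hr) hi₀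
  obtain ⟨P, sP, hP⟩ := hfun K.p K.sp hp
  obtain ⟨Q, sQ, hQ⟩ := hfun K.q K.sq hq
  obtain ⟨r₁, hr₁, hr₁W⟩ := Metric.isOpen_iff.1 hW y hyW
  have hr₁B := hr₁W.trans hWB
  -- the unknowns are `x₁, x₂, S₁, S₂`, with `dx_a = E_a - S_a dU`,
  -- `dS₁ = M₁ + (p x₁ + q x₂) dU` and `dS₂ = M₂ + (q x₁ - p x₂) dU`
  let A : ℝ → Fin 4 → Fin 4 → ℝ := fun s =>
    ![![0, 0, -1, 0], ![0, 0, 0, -1], ![P s, Q s, 0, 0], ![Q s, - P s, 0, 0]]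
  obtain ⟨r₂, hr₂, hr₂₁, Y, sY, hY⟩ := exists_affine_solution hr₁ (K.sU.mono hr₁B)
    (S := Set.Ioo (K.U y - ρ) (K.U y + ρ)) isOpen_Ioo ⟨by linarith, by linarith⟩ (A := A)
    (fun a b => by fin_cases a <;> fin_cases b <;>
      first | exact contDiffOn_const | exact sP | exact sQ | exact sP.neg)
    (B := ![K.E₁, K.E₂, K.M₁, K.M₂])
    (NullFrame.forall_fin_four (fun i => (K.sE₁ i).mono hr₁B) (fun i => (K.sE₂ i).mono hr₁B)
      (fun i => (K.sM₁ i).mono hr₁B) (fun i => (K.sM₂ i).mono hr₁B))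
    (fun z hz => by
      refine NullFrame.forall_fin_four ?_ ?_ ?_ ?_ <;> intro i j
      · refine (K.dE₁ z (hr₁B hz) i j).trans ?_
        simp [A, Fin.sum_univ_four, wedge]
      · refine (K.dE₂ z (hr₁B hz) i j).trans ?_
        simp [A, Fin.sum_univ_four, wedge]
      · refine (K.dM₁ z (hr₁B hz) i j).trans ?_
        simp [A, Fin.sum_univ_four, hP z (hr₁W hz), hQ z (hr₁W hz)]
      · refine (K.dM₂ z (hr₁B hz) i j).trans ?_
        simp [A, Fin.sum_univ_four, hP z (hr₁W hz), hQ z (hr₁W hz)]; ring)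
  have hr₂B : Metric.ball y r₂ ⊆ Metric.ball y r₁ := Metric.ball_subset_ball hr₂₁
  have hsub : Metric.ball y r₂ ⊆ Metric.ball y r := hr₂B.trans hr₁B
  have hop : IsOpen (Metric.ball y r₂) := Metric.isOpen_ball
  have h0 : ∀ z ∈ Metric.ball y r₂, ∀ i, pd i (Y 0) z = K.E₁ z i - Y 2 z * pd i K.U z := by
    intro z hz i
    rw [hY z hz]; simp [A, Fin.sum_univ_four]; ring
  have h1 : ∀ z ∈ Metric.ball y r₂, ∀ i, pd i (Y 1) z = K.E₂ z i - Y 3 z * pd i K.U z := by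
    intro z hz i
    rw [hY z hz]; simp [A, Fin.sum_univ_four]; ring
  have h2 : ∀ z ∈ Metric.ball y r₂, ∀ i, pd i (Y 2) z
      = K.M₁ z i + (K.p z * Y 0 z + K.q z * Y 1 z) * pd i K.U z := by
    intro z hz i
    rw [hY z hz, hP z (hr₁W (hr₂B hz)), hQ z (hr₁W (hr₂B hz))]; simp [A, Fin.sum_univ_four]
  have h3 : ∀ z ∈ Metric.ball y r₂, ∀ i, pd i (Y 3) z
      = K.M₂ z i + (K.q z * Y 0 z - K.p z * Y 1 z) * pd i K.U z := by
    intro z hz i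
    rw [hY z hz, hP z (hr₁W (hr₂B hz)), hQ z (hr₁W (hr₂B hz))]
    simp [A, Fin.sum_univ_four]
    exact Or.inl (by ring)
  -- the coefficient of `dU` in the differential of the last coordinate
  let T : E4 → ℝ := fun z => (1 / 2) * (Y 2 z * Y 2 z + Y 3 z * Y 3 z
    - K.p z * (Y 0 z * Y 0 z - Y 1 z * Y 1 z)) - K.q z * (Y 0 z * Y 1 z)
  have sp := K.sp.mono hsub
  have sq := K.sq.mono hsub
  have sT : ContDiffOn ℝ ∞ T (Metric.ball y r₂) :=
    (contDiffOn_const.mul ((((sY 2).mul (sY 2)).add ((sY 3).mul (sY 3))).sub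
      (sp.mul (((sY 0).mul (sY 0)).sub ((sY 1).mul (sY 1)))))).sub (sq.mul ((sY 0).mul (sY 1)))
  have pT : ∀ z ∈ Metric.ball y r₂, ∃ g, ∀ i, pd i T z = g * pd i K.U z
      + Y 2 z * K.M₁ z i + Y 3 z * K.M₂ z i - (K.p z * Y 0 z + K.q z * Y 1 z) * K.E₁ z i
      - (K.q z * Y 0 z - K.p z * Y 1 z) * K.E₂ z i := by
    intro z hz
    obtain ⟨gp, hgp⟩ := hp z (hsub hz)
    obtain ⟨gq, hgq⟩ := hq z (hsub hz)
    have d := fun a => differentiableAt_of_smooth hop (sY a) hz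
    have dp := differentiableAt_of_smooth hop sp hz
    have dq := differentiableAt_of_smooth hop sq hz
    refine ⟨2 * (Y 2 z * (K.p z * Y 0 z + K.q z * Y 1 z) + Y 3 z * (K.q z * Y 0 z - K.p z * Y 1 z))
      - 1 / 2 * gp * (Y 0 z * Y 0 z - Y 1 z * Y 1 z) - gq * (Y 0 z * Y 1 z), fun i => ?_⟩
    have m := fun a b => (d a).fun_mul (d b)
    simp only [T]
    rw [pd_sub (((((m 2 2).fun_add (m 3 3)).fun_sub (dp.fun_mul ((m 0 0).fun_sub (m 1 1))))).const_mul _)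
      (dq.fun_mul (m 0 1)), pd_const_mul _ (((m 2 2).fun_add (m 3 3)).fun_sub
        (dp.fun_mul ((m 0 0).fun_sub (m 1 1)))), pd_sub ((m 2 2).fun_add (m 3 3))
        (dp.fun_mul ((m 0 0).fun_sub (m 1 1))), pd_add (m 2 2) (m 3 3),
        pd_mul dp ((m 0 0).fun_sub (m 1 1)), pd_sub (m 0 0) (m 1 1), pd_mul dq (m 0 1),
        pd_mul (d 2) (d 2), pd_mul (d 3) (d 3), pd_mul (d 0) (d 0), pd_mul (d 1) (d 1),
        pd_mul (d 0) (d 1), h0 z hz, h1 z hz, h2 z hz, h3 z hz, hgp, hgq]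
    ring
  -- with this coefficient the differential of the last coordinate is closed
  obtain ⟨v, sv, hv⟩ := exists_primitive (y := y) (r := r₂)
    (θ := fun z i => K.N z i - Y 2 z * K.E₁ z i - Y 3 z * K.E₂ z i + T z * pd i K.U z)
    (fun i => ((((K.sN i).mono hsub).sub ((sY 2).mul ((K.sE₁ i).mono hsub))).sub
      ((sY 3).mul ((K.sE₂ i).mono hsub))).add (sT.mul ((K.s_dU hG.isOpen i).mono hsub)))
    (fun z hz i j => by
      obtain ⟨g, hg⟩ := pT z hz
      have D : ∀ {ξ : E4 → Fin 4 → ℝ}, (∀ i, ContDiffOn ℝ ∞ (fun z => ξ z i) (Metric.ball y r)) →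
          ∀ i, DifferentiableAt ℝ (fun y => ξ y i) z := fun h i =>
        differentiableAt_of_smooth hG.isOpen (h i) (hsub hz)
      have d := fun a => differentiableAt_of_smooth hop (sY a) hz
      have dT := differentiableAt_of_smooth hop sT hz
      have e1 := fun i => (d 2).fun_mul (D K.sE₁ i)
      have e2 := fun i => (d 3).fun_mul (D K.sE₂ i)
      have e3 := fun i => dT.fun_mul (D (K.s_dU hG.isOpen) i)
      rw [extd_add (fun i => ((D K.sN i).fun_sub (e1 i)).fun_sub (e2 i)) e3,
        extd_sub (fun i => (D K.sN i).fun_sub (e1 i)) e2, extd_sub (D K.sN) e1,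
        extd_mul (d 2) (D K.sE₁), extd_mul (d 3) (D K.sE₂), extd_mul dT (D (K.s_dU hG.isOpen)),
        K.dN z (hsub hz), K.dE₁ z (hsub hz), K.dE₂ z (hsub hz), extd_pd hG.isOpen K.sU (hsub hz)]
      simp only [wedge, h2 z hz, h3 z hz, hg]
      ring)
  refine ⟨Metric.ball y r₂, hop, Metric.mem_ball_self hr₂, hsub.trans hU, K.U, v, Y 0, Y 1,
    fun s => P s / 2, fun s => Q s / 2, fun s => - P s / 2, K.sU.mono hsub, sv, sY 0, sY 1, ?_, ?_, ?_,
    fun z hz i j => ?_⟩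
  · exact (sP.mono ((Set.image_mono (hr₂B.trans hr₁W)).trans hWU)).div_const 2
  · exact (sQ.mono ((Set.image_mono (hr₂B.trans hr₁W)).trans hWU)).div_const 2
  · exact (sP.mono ((Set.image_mono (hr₂B.trans hr₁W)).trans hWU)).neg.div_const 2
  · rw [K.frame z (hsub hz) i j, h0 z hz, h0 z hz, h1 z hz, h1 z hz, hv z hz, hv z hz]
    simp only [T, hP z (hr₁W (hr₂B hz)), hQ z (hr₁W (hr₂B hz))]
    ring

end ParallelFrame

/-! ### Killing vector fields of plane waves -/

theorem image_mem_nhds_of_pd_ne {V : Set E4} (hV : IsOpen V) {u : E4 → ℝ}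
    (hu : ContDiffOn ℝ ∞ u V) {y : E4} (hy : y ∈ V) {i : Fin 4} (hi : pd i u y ≠ 0) :
    u '' V ∈ 𝓝 (u y) := by
  have hs : HasStrictFDerivAt u (fderiv ℝ u y) y :=
    (hu.contDiffAt (hV.mem_nhds hy)).hasStrictFDerivAt (by simp)
  have hsurj : (fderiv ℝ u y).range = ⊤ := by
    rw [LinearMap.range_eq_top]
    intro t
    refine ⟨(t / pd i u y) • (Pi.single i 1 : E4), ?_⟩
    change fderiv ℝ u y _ = t
    rw [map_smul, smul_eq_mul]
    exact div_mul_cancel₀ t hi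
  rw [← hs.map_nhds_eq_of_surj hsurj]
  exact Filter.image_mem_map (hV.mem_nhds hy)

/-- The Lie derivative of `h du ⊗ du + ∑ df ⊗ dg` along `X`, in terms of the derivatives of the
functions in the direction `X`, for a metric in the plane wave form and a field `X` tangent to the
level sets of `u`. -/
theorem lieMetric_planeForm {G : CMetric} {V : Set E4} (hV : IsOpen V) {u v x₁ x₂ h : E4 → ℝ}
    (hu : ContDiffOn ℝ ∞ u V) (hv : ContDiffOn ℝ ∞ v V) (h₁ : ContDiffOn ℝ ∞ x₁ V)
    (h₂ : ContDiffOn ℝ ∞ x₂ V) (hh : ContDiffOn ℝ ∞ h V)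
    (hG : ∀ z ∈ V, ∀ i j, G z i j = pd i x₁ z * pd j x₁ z + pd i x₂ z * pd j x₂ z
      - (pd i u z * pd j v z + pd i v z * pd j u z) - 2 * h z * (pd i u z * pd j u z))
    {X : E4 → Fin 4 → ℝ} (hX : ∀ i, ContDiffOn ℝ ∞ (fun z => X z i) V)
    {a b c : E4 → ℝ} (hXu : ∀ z ∈ V, ∑ k, X z k * pd k u z = 0)
    (hXv : ∀ z ∈ V, ∑ k, X z k * pd k v z = c z)
    (hX₁ : ∀ z ∈ V, ∑ k, X z k * pd k x₁ z = a z) (hX₂ : ∀ z ∈ V, ∑ k, X z k * pd k x₂ z = b z)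
    {z : E4} (hz : z ∈ V) (i j : Fin 4) :
    lieMetric G X z i j = pd i a z * pd j x₁ z + pd i x₁ z * pd j a z
      + pd i b z * pd j x₂ z + pd i x₂ z * pd j b z - (pd i u z * pd j c z + pd i c z * pd j u z)
      - 2 * (∑ k, X z k * pd k h z) * (pd i u z * pd j u z) := by
  have key : ∀ {f g : E4 → ℝ}, ContDiffOn ℝ ∞ f V → (∀ z ∈ V, ∑ k, X z k * pd k f z = g z) →
      ∀ i, pd i g z = ∑ k, (X z k * pd k (pd i f) z + pd i (fun z => X z k) z * pd k f z) := by
    intro f g hf hg i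
    have d1 := fun k => differentiableAt_of_smooth hV (hX k) hz
    have d2 := fun k => differentiableAt_of_smooth hV (pd_contDiffOn hV hf k) hz
    rw [← pd_congr_on hV hg hz, pd_sum _ fun k _ => (d1 k).fun_mul (d2 k)]
    refine Finset.sum_congr rfl fun k _ => ?_
    rw [pd_mul (d1 k) (d2 k), pd_comm hV hf hz]
  have dG : ∀ k i j, pd k (fun z => G z i j) z
      = pd i x₁ z * pd k (pd j x₁) z + pd k (pd i x₁) z * pd j x₁ z
      + (pd i x₂ z * pd k (pd j x₂) z + pd k (pd i x₂) z * pd j x₂ z)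
      - (pd i u z * pd k (pd j v) z + pd k (pd i u) z * pd j v z
        + (pd i v z * pd k (pd j u) z + pd k (pd i v) z * pd j u z))
      - (2 * h z * (pd i u z * pd k (pd j u) z + pd k (pd i u) z * pd j u z)
        + 2 * pd k h z * (pd i u z * pd j u z)) := by
    intro k i j
    have d := fun {f : E4 → ℝ} (hf : ContDiffOn ℝ ∞ f V) i =>
      differentiableAt_of_smooth hV (pd_contDiffOn hV hf i) hz
    have dh := (differentiableAt_of_smooth hV hh hz)
    have e1 := (d h₁ i).fun_mul (d h₁ j)
    have e2 := (d h₂ i).fun_mul (d h₂ j)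
    have e3 := (d hu i).fun_mul (d hv j)
    have e4 := (d hv i).fun_mul (d hu j)
    have e5 := (d hu i).fun_mul (d hu j)
    rw [pd_congr_on hV (fun z hz => hG z hz i j) hz,
      pd_sub ((e1.fun_add e2).fun_sub (e3.fun_add e4)) ((dh.const_mul 2).fun_mul e5),
      pd_sub (e1.fun_add e2) (e3.fun_add e4), pd_add e1 e2, pd_add e3 e4,
      pd_mul (dh.const_mul 2) e5, pd_const_mul _ dh, pd_mul (d h₁ i) (d h₁ j),
      pd_mul (d h₂ i) (d h₂ j), pd_mul (d hu i) (d hv j), pd_mul (d hv i) (d hu j),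
      pd_mul (d hu i) (d hu j)]
  have ka := key h₁ hX₁
  have kb := key h₂ hX₂
  have kc := key hv hXv
  have k0 := key hu (g := fun _ => 0) hXu
  simp only [pd_const] at k0
  unfold lieMetric
  simp only [dG, hG z hz]
  rw [ka i, ka j, kb i, kb j, kc i, kc j]
  have k0i := k0 i
  have k0j := k0 j
  simp only [Fin.sum_univ_four] at k0i k0j ⊢
  linear_combination (pd j v z + 2 * h z * pd j u z) * k0i + (pd i v z + 2 * h z * pd i u z) * k0j

/-- At every point, a plane wave has Killing vector fields which vanish at the point but not near
it: with `p'' = -2 (P, Q; Q, R) p` along `u`, the field with `X u = 0`, `X x_a = p_a`,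
`X v = p_a' x_a` is Killing. -/
theorem not_trivialIsotropyNear_of_planeWaveNear {G : CMetric} {U : Set E4} (hG : MetricOn G U)
    {y : E4} (h : PlaneWaveNear G U y) : ¬ TrivialIsotropyNear G U y := by
  obtain ⟨V, hV, hyV, hVU, u, v, x₁, x₂, P, Q, R, su, sv, s₁, s₂, sP, sQ, sR, hform⟩ := h
  have hGV := hG.mono hV hVU
  have hframe : ∀ z ∈ V, IsNullFrame G z (fun i => pd i u z) (fun i => pd i v z
      + (P (u z) * x₁ z ^ 2 + 2 * Q (u z) * (x₁ z * x₂ z) + R (u z) * x₂ z ^ 2) * pd i u z)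
      (fun i => pd i x₁ z) (fun i => pd i x₂ z) := fun z hz i j => by
    rw [hform z hz]; ring
  have hprod := fun z hz => (hframe z hz).products hGV hz
  obtain ⟨i₀, hi₀⟩ := (hprod y hyV).l_ne
  have hS : u y ∈ interior (u '' V) :=
    mem_interior_iff_mem_nhds.2 (image_mem_nhds_of_pd_ne hV su hyV hi₀)
  -- initial values: a nonzero covector annihilating the point `(x₁, x₂)`
  obtain ⟨c₁, c₂, hc, hc0⟩ : ∃ c₁ c₂ : ℝ, c₁ * x₁ y + c₂ * x₂ y = 0 ∧ (c₁ ≠ 0 ∨ c₂ ≠ 0) := by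
    by_cases hx : x₁ y = 0
    · exact ⟨1, 0, by simp [hx], Or.inl one_ne_zero⟩
    · exact ⟨-x₂ y, x₁ y, by ring, Or.inr hx⟩
  have hin : interior (u '' V) ⊆ u '' V := interior_subset
  have hcomp : ∀ {f : ℝ → ℝ}, ContDiffOn ℝ ∞ f (u '' V) →
      ContDiffOn ℝ ∞ (fun q : ℝ × (Fin 4 → ℝ) => f q.1) (interior (u '' V) ×ˢ Set.univ) := fun hf =>
    (hf.mono hin).comp contDiffOn_fst fun q hq => hq.1
  have hcoord : ∀ a, ContDiffOn ℝ ∞ (fun q : ℝ × (Fin 4 → ℝ) => q.2 a)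
      (interior (u '' V) ×ˢ Set.univ) := fun a =>
    ((contDiff_apply ℝ ℝ a).comp contDiff_snd).contDiffOn
  -- a solution `η` of `d²η/du² = -2 [P, Q; Q, R] η`, with its derivative `ζ` as the last two
  -- components, with the initial values `η = 0` and `ζ = (c₁, c₂)` at the given point
  obtain ⟨ε, hε, hεS, Y, hY0, sY, hY⟩ := exists_smooth_solution (isOpen_interior (s := u '' V))
    (f := fun q : ℝ × (Fin 4 → ℝ) => ![q.2 2, q.2 3, -2 * (P q.1 * q.2 0 + Q q.1 * q.2 1),
      -2 * (Q q.1 * q.2 0 + R q.1 * q.2 1)])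
    (contDiffOn_pi.2 (NullFrame.forall_fin_four (hcoord 2) (hcoord 3)
      (contDiffOn_const.mul (((hcomp sP).mul (hcoord 0)).add ((hcomp sQ).mul (hcoord 1))))
      (contDiffOn_const.mul (((hcomp sQ).mul (hcoord 0)).add ((hcomp sR).mul (hcoord 1))))))
    hS ![0, 0, c₁, c₂]
  have hYa := fun s hs a => hasDerivAt_pi.1 (hY s hs) a
  -- the domain of the vector field
  set W := V ∩ u ⁻¹' Set.Ioo (u y - ε) (u y + ε) with hWdef
  have hW : IsOpen W := su.continuousOn.isOpen_inter_preimage hV isOpen_Ioo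
  have hyW : y ∈ W := ⟨hyV, by constructor <;> simp [hε]⟩
  have hWV : W ⊆ V := Set.inter_subset_left
  have hGW := hGV.mono hW hWV
  have tu := su.mono hWV
  have tv := sv.mono hWV
  have t₁ := s₁.mono hWV
  have t₂ := s₂.mono hWV
  have sp : ∀ a, ContDiffOn ℝ ∞ (fun z => Y (u z) a) W := fun a =>
    (contDiffOn_pi.1 sY a).comp tu fun z hz => hz.2
  have hpd : ∀ z ∈ W, ∀ a i, pd i (fun z => Y (u z) a) z
      = ![Y (u z) 2, Y (u z) 3, -2 * (P (u z) * Y (u z) 0 + Q (u z) * Y (u z) 1),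
      -2 * (Q (u z) * Y (u z) 0 + R (u z) * Y (u z) 1)] a * pd i u z := fun z hz a i =>
    pd_comp (hYa _ hz.2 a) (differentiableAt_of_smooth hW tu hz) i
  -- the vector field `η₁ ∂₁ + η₂ ∂₂ + (ζ₁ x₁ + ζ₂ x₂) ∂ᵥ`, as a 1-form; by the choice of
  -- `c₁, c₂` it vanishes at the given point
  let om : E4 → Fin 4 → ℝ := fun z i => Y (u z) 0 * pd i x₁ z + Y (u z) 1 * pd i x₂ z
    + (-(Y (u z) 2 * x₁ z + Y (u z) 3 * x₂ z)) * pd i u z + 0 * pd i u z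
  have som : ∀ i, ContDiffOn ℝ ∞ (fun z => om z i) W := fun i =>
    ((((sp 0).mul (pd_contDiffOn hW t₁ i)).add ((sp 1).mul (pd_contDiffOn hW t₂ i))).add
      ((((sp 2).mul t₁).add ((sp 3).mul t₂)).neg.mul (pd_contDiffOn hW tu i))).add
      (contDiffOn_const.mul (pd_contDiffOn hW tu i))
  have sX := hGW.sharp_smooth som
  have hXf : ∀ z ∈ W, ∀ w : Fin 4 → ℝ, ∑ k, sharp G z (om z) k * w k
      = Y (u z) 0 * ip1 G z (fun i => pd i x₁ z) w + Y (u z) 1 * ip1 G z (fun i => pd i x₂ z) w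
        + (-(Y (u z) 2 * x₁ z + Y (u z) 3 * x₂ z)) * ip1 G z (fun i => pd i u z) w := by
    intro z hz w
    have h1 : ∑ k, sharp G z (om z) k * w k = ip1 G z (om z) w := by
      rw [hGW.ip1_comm hz]
      exact Finset.sum_congr rfl fun k _ => mul_comm _ _
    rw [h1, ip1_comb]; ring
  -- the derivatives of the coordinates, and of the profile `h`, along the vector field
  have hXu : ∀ z ∈ W, ∑ k, sharp G z (om z) k * pd k u z = 0 := fun z hz => by
    have q := hprod z (hWV hz)
    rw [hXf z hz, q.el, q.fl, q.ll]; ring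
  have hX₁ : ∀ z ∈ W, ∑ k, sharp G z (om z) k * pd k x₁ z = Y (u z) 0 := fun z hz => by
    have q := hprod z (hWV hz)
    rw [hXf z hz, q.ee, q.fe, q.le]; ring
  have hX₂ : ∀ z ∈ W, ∑ k, sharp G z (om z) k * pd k x₂ z = Y (u z) 1 := fun z hz => by
    have q := hprod z (hWV hz)
    rw [hXf z hz, q.ef, q.ff, q.lf]; ring
  have hXv : ∀ z ∈ W, ∑ k, sharp G z (om z) k * pd k v z
      = Y (u z) 2 * x₁ z + Y (u z) 3 * x₂ z := fun z hz => by
    have q := hprod z (hWV hz)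
    have h1 := hXf z hz (fun i => pd i v z
      + (P (u z) * x₁ z ^ 2 + 2 * Q (u z) * (x₁ z * x₂ z) + R (u z) * x₂ z ^ 2) * pd i u z)
    rw [q.en, q.fn, q.ln] at h1
    simp only [mul_add, Finset.sum_add_distrib] at h1
    have h2 := hXu z hz
    simp only [Fin.sum_univ_four] at h1 h2 ⊢
    linear_combination h1 - (P (u z) * x₁ z ^ 2 + 2 * Q (u z) * (x₁ z * x₂ z)
      + R (u z) * x₂ z ^ 2) * h2
  have sc : ∀ {f : ℝ → ℝ}, ContDiffOn ℝ ∞ f (u '' V) → ContDiffOn ℝ ∞ (fun z => f (u z)) W :=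
    fun hf => hf.comp tu fun z hz => ⟨z, hWV hz, rfl⟩
  have hS' : u '' V ∈ 𝓝 (u y) := mem_interior_iff_mem_nhds.1 hS
  have sh : ContDiffOn ℝ ∞ (fun z => P (u z) * x₁ z ^ 2 + 2 * Q (u z) * (x₁ z * x₂ z)
      + R (u z) * x₂ z ^ 2) W :=
    (((sc sP).mul (t₁.pow 2)).add ((contDiffOn_const.mul (sc sQ)).mul (t₁.mul t₂))).add
      ((sc sR).mul (t₂.pow 2))
  have hXh : ∀ z ∈ W, ∑ k, sharp G z (om z) k * pd k (fun z => P (u z) * x₁ z ^ 2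
      + 2 * Q (u z) * (x₁ z * x₂ z) + R (u z) * x₂ z ^ 2) z
      = 2 * (P (u z) * Y (u z) 0 + Q (u z) * Y (u z) 1) * x₁ z
        + 2 * (Q (u z) * Y (u z) 0 + R (u z) * Y (u z) 1) * x₂ z := by
    intro z hz
    have hn : u '' V ∈ 𝓝 (u z) := Filter.mem_of_superset
      (isOpen_interior.mem_nhds (hεS hz.2)) hin
    have dd : ∀ {f : ℝ → ℝ}, ContDiffOn ℝ ∞ f (u '' V) → DifferentiableAt ℝ f (u z) := fun hf =>
      (hf.contDiffAt hn).differentiableAt (by simp)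
    have du := differentiableAt_of_smooth hW tu hz
    have e : ∀ {f : E4 → ℝ}, ContDiffOn ℝ ∞ f W → DifferentiableAt ℝ f z := fun hf =>
      differentiableAt_of_smooth hW hf hz
    have e₁ := e t₁
    have e₂ := e t₂
    have hk : ∀ k, pd k (fun z => P (u z) * x₁ z ^ 2
        + 2 * Q (u z) * (x₁ z * x₂ z) + R (u z) * x₂ z ^ 2) z
        = (deriv P (u z) * x₁ z ^ 2 + 2 * deriv Q (u z) * (x₁ z * x₂ z)
          + deriv R (u z) * x₂ z ^ 2) * pd k u z
        + (2 * P (u z) * x₁ z + 2 * Q (u z) * x₂ z) * pd k x₁ z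
        + (2 * Q (u z) * x₁ z + 2 * R (u z) * x₂ z) * pd k x₂ z := by
      intro k
      simp only [pow_two]
      rw [pd_add (((e (sc sP)).fun_mul (e₁.fun_mul e₁)).fun_add
        (((e (sc sQ)).const_mul 2).fun_mul (e₁.fun_mul e₂))) ((e (sc sR)).fun_mul (e₂.fun_mul e₂)),
        pd_add ((e (sc sP)).fun_mul (e₁.fun_mul e₁))
        (((e (sc sQ)).const_mul 2).fun_mul (e₁.fun_mul e₂)),
        pd_mul (e (sc sP)) (e₁.fun_mul e₁), pd_mul ((e (sc sQ)).const_mul 2) (e₁.fun_mul e₂),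
        pd_mul (e (sc sR)) (e₂.fun_mul e₂), pd_const_mul _ (e (sc sQ)), pd_mul e₁ e₁,
        pd_mul e₁ e₂, pd_mul e₂ e₂, pd_comp (dd sP).hasDerivAt du, pd_comp (dd sQ).hasDerivAt du,
        pd_comp (dd sR).hasDerivAt du]
      ring
    simp only [hk]
    have a0 := hXu z hz
    have a1 := hX₁ z hz
    have a2 := hX₂ z hz
    simp only [Fin.sum_univ_four] at a0 a1 a2 ⊢
    linear_combination (deriv P (u z) * x₁ z ^ 2 + 2 * deriv Q (u z) * (x₁ z * x₂ z)
          + deriv R (u z) * x₂ z ^ 2) * a0 + (2 * P (u z) * x₁ z + 2 * Q (u z) * x₂ z) * a1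
          + (2 * Q (u z) * x₁ z + 2 * R (u z) * x₂ z) * a2
  have hLie : ∀ z ∈ W, lieMetric G (fun z => sharp G z (om z)) z = 0 := by
    intro z hz
    funext i j
    have e : ∀ {f : E4 → ℝ}, ContDiffOn ℝ ∞ f W → DifferentiableAt ℝ f z := fun hf =>
      differentiableAt_of_smooth hW hf hz
    have hpc : ∀ i, pd i (fun z => Y (u z) 2 * x₁ z + Y (u z) 3 * x₂ z) z
        = Y (u z) 2 * pd i x₁ z + Y (u z) 3 * pd i x₂ z
          - 2 * ((P (u z) * Y (u z) 0 + Q (u z) * Y (u z) 1) * x₁ z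
            + (Q (u z) * Y (u z) 0 + R (u z) * Y (u z) 1) * x₂ z) * pd i u z := by
      intro i
      rw [pd_add ((e (sp 2)).fun_mul (e t₁)) ((e (sp 3)).fun_mul (e t₂)),
        pd_mul (e (sp 2)) (e t₁), pd_mul (e (sp 3)) (e t₂), hpd z hz, hpd z hz]
      simp; ring
    rw [lieMetric_planeForm hW tu tv t₁ t₂ sh (fun z hz i j => hform z (hWV hz) i j) sX hXu hXv
      hX₁ hX₂ hz, hXh z hz, hpc, hpc, hpd z hz, hpd z hz, hpd z hz, hpd z hz]
    simp; ring
  intro htriv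
  have hom : om y = 0 := by
    funext i
    have h2 : Y (u y) 2 = c₁ := by rw [hY0]; rfl
    have h3 : Y (u y) 3 = c₂ := by rw [hY0]; rfl
    have h0 : Y (u y) 0 = 0 := by rw [hY0]; rfl
    have h1 : Y (u y) 1 = 0 := by rw [hY0]; rfl
    simp only [om, h0, h1, h2, h3, hc]; simp
  have hz := htriv W hW hyW (hWV.trans hVU) (fun z => sharp G z (om z)) sX hLie (by
    simp only [hom]; funext i; simp [sharp])
  -- if the field vanished near the point, so would `η`, against `(c₁, c₂) ≠ 0`
  have hz' : ∀ᶠ z in 𝓝 y, Y (u z) 0 = 0 ∧ Y (u z) 1 = 0 := by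
    filter_upwards [hz, hW.mem_nhds hyW] with z h0 hzW
    have h1 := hX₁ z hzW
    have h2 := hX₂ z hzW
    simp only [h0, Pi.zero_apply, zero_mul, Finset.sum_const_zero] at h1 h2
    exact ⟨h1.symm, h2.symm⟩
  have e0 : pd i₀ (fun z => Y (u z) 0) y = 0 := by
    rw [pd_congr (g := fun _ => 0) (hz'.mono fun z h => h.1), pd_const]
  have e1 : pd i₀ (fun z => Y (u z) 1) y = 0 := by
    rw [pd_congr (g := fun _ => 0) (hz'.mono fun z h => h.2), pd_const]
  rw [hpd y hyW, hY0] at e0 e1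
  have f0 : c₁ = 0 := (mul_eq_zero.1 e0).resolve_right hi₀
  have f1 : c₂ = 0 := (mul_eq_zero.1 e1).resolve_right hi₀
  exact hc0.elim (fun h => h f0) fun h => h f1

/-! ### Killing vector fields of pp-waves -/

theorem lieMetric_eq_cov {G : CMetric} {V : Set E4} (hG : MetricOn G V) {X : E4 → Fin 4 → ℝ}
    (hX : ∀ i, ContDiffOn ℝ ∞ (fun z => X z i) V) {z : E4} (hz : z ∈ V) (i j : Fin 4) :
    lieMetric G X z i j = cov1 G (fun z i => ∑ k, G z i k * X z k) z i j
      + cov1 G (fun z i => ∑ k, G z i k * X z k) z j i := by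
  have dX := fun k => differentiableAt_of_smooth hG.isOpen (hX k) hz
  have dG := fun a b => differentiableAt_of_smooth hG.isOpen (hG.smooth a b) hz
  have e : ∀ i j, pd i (fun z => ∑ k, G z j k * X z k) z
      = ∑ k, (G z j k * pd i (fun z => X z k) z + pd i (fun z => G z j k) z * X z k) := by
    intro i j
    rw [pd_sum _ fun k _ => (dG j k).fun_mul (dX k)]
    exact Finset.sum_congr rfl fun k _ => pd_mul (dG j k) (dX k) i
  have hs := hG.symm z hz
  have h1 : ∀ m, ∑ k, chr G z k i j * G z k m = (1 / 2) * (pd i (fun z => G z j m) z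
      + pd j (fun z => G z i m) z - pd m (fun z => G z i j) z) := by
    intro m
    rw [← hG.sum_mul_chr hz m i j]
    exact Finset.sum_congr rfl fun k _ => by rw [hs k m, mul_comm]
  have h2 : ∀ i j, ∑ k, chr G z k i j * ∑ m, G z k m * X z m
      = ∑ m, (∑ k, chr G z k i j * G z k m) * X z m := by
    intro i j
    simp only [Finset.mul_sum, Finset.sum_mul]
    rw [Finset.sum_comm]
    exact Finset.sum_congr rfl fun _ _ => Finset.sum_congr rfl fun _ _ => by ring
  have h3 : ∀ m, ∑ k, chr G z k j i * G z k m = (1 / 2) * (pd i (fun z => G z j m) z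
      + pd j (fun z => G z i m) z - pd m (fun z => G z i j) z) := by
    intro m
    rw [← h1]
    exact Finset.sum_congr rfl fun k _ => by rw [hG.chr_symm hz]
  unfold cov1 lieMetric
  rw [e, e, h2, h2]
  simp only [h1, h3]
  have h4 : ∀ k, G z k j = G z j k := fun k => hs k j
  simp only [h4, Fin.sum_univ_four]
  ring

/-- The contraction `T(v, w)` of a 2-tensor with two 1-forms. -/
def dbl (G : CMetric) (z : E4) (T : Fin 4 → Fin 4 → ℝ) (v w : Fin 4 → ℝ) : ℝ :=
  ip1 G z (fun i => ip1 G z (T i) w) v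

section Dbl

variable {G : CMetric} {z : E4}

theorem dbl_comb_left (T : Fin 4 → Fin 4 → ℝ) (p q r s : ℝ) (t u v w x : Fin 4 → ℝ) :
    dbl G z T (fun k => p * t k + q * u k + r * v k + s * w k) x
      = p * dbl G z T t x + q * dbl G z T u x + r * dbl G z T v x + s * dbl G z T w x :=
  ip1_comb₂ p q r s t u v w _

theorem dbl_comb_right (T : Fin 4 → Fin 4 → ℝ) (p q r s : ℝ) (t u v w x : Fin 4 → ℝ) :
    dbl G z T x (fun k => p * t k + q * u k + r * v k + s * w k)
      = p * dbl G z T x t + q * dbl G z T x u + r * dbl G z T x v + s * dbl G z T x w := by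
  unfold dbl
  rw [← ip1_comb]
  congr 1; funext i; exact ip1_comb₂ p q r s t u v w _

theorem dbl_eq (T : Fin 4 → Fin 4 → ℝ) (v w : Fin 4 → ℝ) :
    dbl G z T v w = ∑ i, ∑ j, T i j * sharp G z v i * sharp G z w j := by
  unfold dbl ip1 pairing
  refine Finset.sum_congr rfl fun i _ => ?_
  rw [Finset.sum_mul]
  exact Finset.sum_congr rfl fun j _ => by ring

theorem dbl_skew {T : Fin 4 → Fin 4 → ℝ} (hT : ∀ i j, T i j = - T j i) (v w : Fin 4 → ℝ) :
    dbl G z T v w = - dbl G z T w v := by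
  rw [dbl_eq, dbl_eq, Finset.sum_comm, ← Finset.sum_neg_distrib]
  refine Finset.sum_congr rfl fun i _ => ?_
  rw [← Finset.sum_neg_distrib]
  exact Finset.sum_congr rfl fun j _ => by rw [hT j i]; ring

theorem dbl_self {T : Fin 4 → Fin 4 → ℝ} (hT : ∀ i j, T i j = - T j i) (v : Fin 4 → ℝ) :
    dbl G z T v v = 0 := by
  have := dbl_skew (G := G) (z := z) hT v v
  linarith

theorem dbl_wedge (a b v w : Fin 4 → ℝ) :
    dbl G z (wedge a b) v w = ip1 G z a v * ip1 G z b w - ip1 G z b v * ip1 G z a w := by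
  rw [dbl_eq]
  simp only [ip1, pairing, wedge, Fin.sum_univ_four]
  ring

theorem pd_dbl {V : Set E4} (hG : MetricOn G V) {T : E4 → Fin 4 → Fin 4 → ℝ}
    {v w : E4 → Fin 4 → ℝ} (hT : ∀ i j, ContDiffOn ℝ ∞ (fun z => T z i j) V)
    (hv : ∀ i, ContDiffOn ℝ ∞ (fun z => v z i) V) (hw : ∀ i, ContDiffOn ℝ ∞ (fun z => w z i) V)
    (hz : z ∈ V) (k : Fin 4) :
    pd k (fun y => dbl G y (T y) (v y) (w y)) z = dbl G z (cov2 G T z k) (v z) (w z)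
      + dbl G z (T z) (cov1 G v z k) (w z) + dbl G z (T z) (v z) (cov1 G w z k) := by
  have D : ∀ {ξ : E4 → Fin 4 → ℝ}, (∀ i, ContDiffOn ℝ ∞ (fun z => ξ z i) V) →
      ∀ i, DifferentiableAt ℝ (fun y => ξ y i) z := fun h i =>
    differentiableAt_of_smooth hG.isOpen (h i) hz
  have hs : ∀ i, ContDiffOn ℝ ∞ (fun z => ip1 G z (T z i) (w z)) V := fun i =>
    hG.ip1_smooth (hT i) hw
  unfold dbl
  rw [hG.pd_ip1 hz (D hs) (D hv) k]
  have h1 : (cov1 G (fun y i => ip1 G y (T y i) (w y)) z k) = fun i =>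
      1 * ip1 G z (cov2 G T z k i) (w z) + 1 * ip1 G z (T z i) (cov1 G w z k)
      + 0 * ip1 G z (T z i) (w z) + 0 * ip1 G z (T z i) (w z) := by
    funext i
    have h2 : ip1 G z (cov2 G T z k i) (w z) = ip1 G z (cov1 G (fun y => T y i) z k) (w z)
        - ∑ m, chr G z m k i * ip1 G z (T z m) (w z) := by
      unfold ip1 pairing
      simp only [Finset.mul_sum]
      rw [Finset.sum_comm, ← Finset.sum_sub_distrib]
      refine Finset.sum_congr rfl fun j _ => ?_
      simp only [cov2, cov1, smul_eq_mul, sub_mul, Finset.sum_mul, mul_assoc]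
      ring
    rw [h2]
    unfold cov1
    rw [hG.pd_ip1 hz (D (hT i)) (D hw) k]
    unfold cov1
    ring
  rw [h1, ip1_comb]
  ring

end Dbl

namespace NullFrame

variable {G : CMetric} {V : Set E4} (F : NullFrame G V)

/-- The restriction of a null coframe to a smaller set. -/
def restrict {W : Set E4} (hW : W ⊆ V) : NullFrame G W where
  l := F.l
  n := F.n
  e := F.e
  f := F.f
  sl i := (F.sl i).mono hW
  sn i := (F.sn i).mono hW
  se i := (F.se i).mono hW
  sf i := (F.sf i).mono hW
  frame z hz := F.frame z (hW hz)

/-- The 1-form `λ = (l, ξ) e - (e, ξ) l`, the contraction of `l ∧ e` with `ξ`. -/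
def lam (ξ : E4 → Fin 4 → ℝ) (z : E4) (i : Fin 4) : ℝ :=
  ip1 G z (F.l z) (ξ z) * F.e z i - ip1 G z (F.e z) (ξ z) * F.l z i

/-- The 1-form `κ = (l, ξ) f - (f, ξ) l`, the contraction of `l ∧ f` with `ξ`. -/
def kap (ξ : E4 → Fin 4 → ℝ) (z : E4) (i : Fin 4) : ℝ :=
  ip1 G z (F.l z) (ξ z) * F.f z i - ip1 G z (F.f z) (ξ z) * F.l z i

variable {F} {ξ : E4 → Fin 4 → ℝ}

/-- The second covariant derivative of a Killing form is given by the curvature. -/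
theorem cov2_killing (hG : MetricOn G V) (hR : F.TypeNCurvature)
    (hξ : ∀ i, ContDiffOn ℝ ∞ (fun z => ξ z i) V)
    (hK : ∀ z ∈ V, ∀ i j, cov1 G ξ z i j = - cov1 G ξ z j i) {z : E4} (hz : z ∈ V) (k i j : Fin 4) :
    cov2 G (cov1 G ξ) z k i j = F.L z i j * F.lam ξ z k - F.M z i j * F.kap ξ z k := by
  -- the difference of the two sides is symmetric in `k, i` and skew in `i, j`
  have h1 : ∀ k i j, cov2 G (cov1 G ξ) z k i j - cov2 G (cov1 G ξ) z i k j
      = - (F.lam ξ z j * F.L z k i - F.kap ξ z j * F.M z k i) := by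
    intro k i j
    have h := hG.ricci_identity hξ hz k i j
    rw [F.riem_contract hG hR hz] at h
    unfold lam kap
    rw [← h]
    unfold cov2
    simp only [hG.chr_symm hz _ i k, smul_eq_mul, Finset.sum_sub_distrib]
    ring
  have h2 : ∀ k i j, cov2 G (cov1 G ξ) z k i j = - cov2 G (cov1 G ξ) z k j i := by
    intro k i j
    have e : pd k (fun y => cov1 G ξ y i j) z = - pd k (fun y => cov1 G ξ y j i) z := by
      rw [pd_congr_on hG.isOpen (fun y hy => hK y hy i j) hz, pd_neg]
    unfold cov2
    rw [e]
    have e1 : ∀ m, cov1 G ξ z m j = - cov1 G ξ z j m := fun m => hK z hz m j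
    have e2 : ∀ m, cov1 G ξ z i m = - cov1 G ξ z m i := fun m => hK z hz i m
    simp only [e1, e2, smul_neg, Finset.sum_neg_distrib]
    ring
  have h3 : ∀ k i j, F.L z i j * F.lam ξ z k + F.L z j k * F.lam ξ z i
      + F.L z k i * F.lam ξ z j = 0 := by
    intro k i j; unfold L lam wedge; ring
  have h4 : ∀ k i j, F.M z i j * F.kap ξ z k + F.M z j k * F.kap ξ z i
      + F.M z k i * F.kap ξ z j = 0 := by
    intro k i j; unfold M kap wedge; ring
  have s1 : ∀ i j, F.L z i j = - F.L z j i := fun i j => by unfold L wedge; ring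
  have s2 : ∀ i j, F.M z i j = - F.M z j i := fun i j => by unfold M wedge; ring
  set T : Fin 4 → Fin 4 → Fin 4 → ℝ := fun k i j => cov2 G (cov1 G ξ) z k i j
    - (F.L z i j * F.lam ξ z k - F.M z i j * F.kap ξ z k) with hT
  have t1 : ∀ k i j, T k i j = T i k j := by
    intro k i j
    simp only [hT]
    have := h1 k i j
    have a := h3 k i j
    have b := h4 k i j
    rw [s1 j k] at a
    rw [s2 j k] at b
    linear_combination this - a + b
  have t2 : ∀ k i j, T k i j = - T k j i := by
    intro k i j
    simp only [hT]
    rw [h2 k i j, s1 i j, s2 i j]; ring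
  have : T k i j = 0 := by
    have e1 := t1 k i j
    have e2 := t2 i k j
    have e3 := t1 i j k
    have e4 := t2 j i k
    have e5 := t1 j k i
    have e6 := t2 k j i
    linarith
  simp only [hT] at this
  linarith

end NullFrame

/-- The exterior derivative of a combination of 1-forms with variable coefficients. -/
theorem extd_sum_mul {n : ℕ} {c : Fin n → E4 → ℝ} {t : Fin n → E4 → Fin 4 → ℝ} {z : E4}
    (hc : ∀ A, DifferentiableAt ℝ (c A) z) (ht : ∀ A i, DifferentiableAt ℝ (fun y => t A y i) z)
    (i j : Fin 4) : extd (fun y k => ∑ A, c A y * t A y k) z i j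
      = ∑ A, (c A z * extd (t A) z i j + wedge (fun k => pd k (c A) z) (t A z) i j) := by
  unfold extd
  rw [pd_sum _ fun A _ => (hc A).fun_mul (ht A j), pd_sum _ fun A _ => (hc A).fun_mul (ht A i),
    ← Finset.sum_sub_distrib]
  refine Finset.sum_congr rfl fun A _ => ?_
  rw [pd_mul (hc A) (ht A j), pd_mul (hc A) (ht A i)]
  unfold wedge; ring

namespace NullFrame

variable {G : CMetric} {V : Set E4}

section Killing

variable {F : NullFrame G V} {ξ : E4 → Fin 4 → ℝ}

/-- The components `∇ξ(l, n), ∇ξ(l, e), ∇ξ(l, f), ∇ξ(n, e), ∇ξ(n, f), ∇ξ(e, f)` of the covariant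
derivative of a Killing form. -/
def kil (F : NullFrame G V) (ξ : E4 → Fin 4 → ℝ) (a : Fin 6) (z : E4) : ℝ :=
  dbl G z (cov1 G ξ z) (![F.l z, F.l z, F.l z, F.n z, F.n z, F.e z] a)
    (![F.n z, F.e z, F.f z, F.e z, F.f z, F.f z] a)

/-- The components `ξ(l), ξ(n), ξ(e), ξ(f)` of a 1-form. -/
def comp (F : NullFrame G V) (ξ : E4 → Fin 4 → ℝ) (a : Fin 4) (z : E4) : ℝ :=
  ip1 G z (![F.l z, F.n z, F.e z, F.f z] a) (ξ z)

theorem s_kil (hG : MetricOn G V) (hξ : ∀ i, ContDiffOn ℝ ∞ (fun z => ξ z i) V) (a : Fin 6) :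
    ContDiffOn ℝ ∞ (F.kil ξ a) V := by
  have h : ∀ {v w : E4 → Fin 4 → ℝ}, (∀ i, ContDiffOn ℝ ∞ (fun z => v z i) V) →
      (∀ i, ContDiffOn ℝ ∞ (fun z => w z i) V) →
      ContDiffOn ℝ ∞ (fun z => dbl G z (cov1 G ξ z) (v z) (w z)) V := fun hv hw =>
    hG.ip1_smooth (fun i => hG.ip1_smooth (hG.cov1_smooth hξ i) hw) hv
  fin_cases a
  exacts [h F.sl F.sn, h F.sl F.se, h F.sl F.sf, h F.sn F.se, h F.sn F.sf, h F.se F.sf]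

theorem s_comp (hG : MetricOn G V) (hξ : ∀ i, ContDiffOn ℝ ∞ (fun z => ξ z i) V) (a : Fin 4) :
    ContDiffOn ℝ ∞ (F.comp ξ a) V := by
  fin_cases a
  exacts [hG.ip1_smooth F.sl hξ, hG.ip1_smooth F.sn hξ, hG.ip1_smooth F.se hξ,
    hG.ip1_smooth F.sf hξ]

/-- The derivatives of a null coframe with recurrent null form. -/
theorem Recurrent.cov_eq (hp : F.Recurrent) (hG : MetricOn G V) {z : E4} (hz : z ∈ V) (i : Fin 4) :
    (cov1 G F.l z i = fun j => F.th z i * F.l z j + 0 * F.n z j + 0 * F.e z j + 0 * F.f z j) ∧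
    (cov1 G F.n z i = fun j => 0 * F.l z j + (- F.th z i) * F.n z j + F.mu z i * F.e z j
      + F.nu z i * F.f z j) ∧
    (cov1 G F.e z i = fun j => F.mu z i * F.l z j + 0 * F.n z j + 0 * F.e z j
      + F.ps z i * F.f z j) ∧
    (cov1 G F.f z i = fun j => F.nu z i * F.l z j + 0 * F.n z j + (- F.ps z i) * F.e z j
      + 0 * F.f z j) := by
  obtain ⟨h1, h2⟩ := hp z hz i
  refine ⟨?_, ?_, ?_, ?_⟩ <;> funext j
  · rw [F.cov_l hG hz, h1, h2]; ring
  · rw [F.cov_n hG hz]; ring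
  · rw [F.cov_e hG hz, h1]; ring
  · rw [F.cov_f hG hz, h2]; ring

/-- The derivatives of the components of the covariant derivative of a Killing form. -/
theorem pd_kil (hG : MetricOn G V) (hR : F.TypeNCurvature) (hp : F.Recurrent)
    (hξ : ∀ i, ContDiffOn ℝ ∞ (fun z => ξ z i) V)
    (hK : ∀ z ∈ V, ∀ i j, cov1 G ξ z i j = - cov1 G ξ z j i) {z : E4} (hz : z ∈ V) (k : Fin 4) :
    pd k (F.kil ξ 0) z = F.mu z k * F.kil ξ 1 z + F.nu z k * F.kil ξ 2 z ∧
    pd k (F.kil ξ 1) z = F.th z k * F.kil ξ 1 z + F.ps z k * F.kil ξ 2 z ∧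
    pd k (F.kil ξ 2) z = F.th z k * F.kil ξ 2 z - F.ps z k * F.kil ξ 1 z ∧
    pd k (F.kil ξ 3) z = - F.lam ξ z k - F.th z k * F.kil ξ 3 z + F.ps z k * F.kil ξ 4 z
      - F.nu z k * F.kil ξ 5 z - F.mu z k * F.kil ξ 0 z ∧
    pd k (F.kil ξ 4) z = F.kap ξ z k - F.th z k * F.kil ξ 4 z - F.ps z k * F.kil ξ 3 z
      + F.mu z k * F.kil ξ 5 z - F.nu z k * F.kil ξ 0 z ∧
    pd k (F.kil ξ 5) z = F.mu z k * F.kil ξ 2 z - F.nu z k * F.kil ξ 1 z := by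
  have q := F.prods hG hz
  have hsk := hK z hz
  have h0 : ∀ v w, dbl G z (cov2 G (cov1 G ξ) z k) v w
      = F.lam ξ z k * dbl G z (F.L z) v w - F.kap ξ z k * dbl G z (F.M z) v w := by
    intro v w
    rw [show cov2 G (cov1 G ξ) z k = fun i j => F.L z i j * F.lam ξ z k - F.M z i j * F.kap ξ z k
      from funext fun i => funext fun j => cov2_killing hG hR hξ hK hz k i j]
    simp only [dbl_eq, Finset.mul_sum, ← Finset.sum_sub_distrib]
    exact Finset.sum_congr rfl fun _ _ => Finset.sum_congr rfl fun _ _ => by ring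
  have h1 : ∀ {v w : E4 → Fin 4 → ℝ}, (∀ i, ContDiffOn ℝ ∞ (fun z => v z i) V) →
      (∀ i, ContDiffOn ℝ ∞ (fun z => w z i) V) →
      pd k (fun z => dbl G z (cov1 G ξ z) (v z) (w z)) z
        = F.lam ξ z k * dbl G z (F.L z) (v z) (w z) - F.kap ξ z k * dbl G z (F.M z) (v z) (w z)
        + dbl G z (cov1 G ξ z) (cov1 G v z k) (w z)
        + dbl G z (cov1 G ξ z) (v z) (cov1 G w z k) := fun hv hw => by
    rw [pd_dbl hG (fun i j => hG.cov1_smooth hξ i j) hv hw hz, h0]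
  obtain ⟨cl, cn, ce, cf⟩ := hp.cov_eq hG hz k
  have s := fun v => dbl_self (G := G) (z := z) hsk v
  have k0 : dbl G z (cov1 G ξ z) (F.l z) (F.n z) = F.kil ξ 0 z := rfl
  have k1 : dbl G z (cov1 G ξ z) (F.l z) (F.e z) = F.kil ξ 1 z := rfl
  have k2 : dbl G z (cov1 G ξ z) (F.l z) (F.f z) = F.kil ξ 2 z := rfl
  have k3 : dbl G z (cov1 G ξ z) (F.n z) (F.e z) = F.kil ξ 3 z := rfl
  have k4 : dbl G z (cov1 G ξ z) (F.n z) (F.f z) = F.kil ξ 4 z := rfl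
  have k5 : dbl G z (cov1 G ξ z) (F.e z) (F.f z) = F.kil ξ 5 z := rfl
  have m0 : dbl G z (cov1 G ξ z) (F.n z) (F.l z) = - F.kil ξ 0 z := dbl_skew hsk _ _
  have m1 : dbl G z (cov1 G ξ z) (F.e z) (F.l z) = - F.kil ξ 1 z := dbl_skew hsk _ _
  have m5 : dbl G z (cov1 G ξ z) (F.f z) (F.e z) = - F.kil ξ 5 z := dbl_skew hsk _ _
  refine ⟨(h1 F.sl F.sn).trans ?_, (h1 F.sl F.se).trans ?_, (h1 F.sl F.sf).trans ?_,
    (h1 F.sn F.se).trans ?_, (h1 F.sn F.sf).trans ?_, (h1 F.se F.sf).trans ?_⟩ <;>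
  · simp only [cl, cn, ce, cf, dbl_comb_left, dbl_comb_right, NullFrame.L, NullFrame.M, dbl_wedge,
      q.ll, q.ln, q.le, q.lf, q.el, q.en, q.ee, q.ef, q.fl, q.fn, q.fe, q.ff,
      s, k0, k1, k2, k3, k4, k5, m0, m1, m5]
    ring

/-- The contractions of the covariant derivative of a Killing form with the null coframe. -/
theorem killing_contract (hG : MetricOn G V) (hK : ∀ z ∈ V, ∀ i j, cov1 G ξ z i j = - cov1 G ξ z j i)
    {z : E4} (hz : z ∈ V) (k : Fin 4) :
    ip1 G z (cov1 G ξ z k) (F.l z)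
      = F.kil ξ 0 z * F.l z k - F.kil ξ 1 z * F.e z k - F.kil ξ 2 z * F.f z k ∧
    ip1 G z (cov1 G ξ z k) (F.n z)
      = - F.kil ξ 0 z * F.n z k - F.kil ξ 3 z * F.e z k - F.kil ξ 4 z * F.f z k ∧
    ip1 G z (cov1 G ξ z k) (F.e z)
      = - F.kil ξ 3 z * F.l z k - F.kil ξ 1 z * F.n z k - F.kil ξ 5 z * F.f z k ∧
    ip1 G z (cov1 G ξ z k) (F.f z)
      = - F.kil ξ 4 z * F.l z k - F.kil ξ 2 z * F.n z k + F.kil ξ 5 z * F.e z k := by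
  have hsk := hK z hz
  have h : ∀ v, ip1 G z (cov1 G ξ z k) v = (- dbl G z (cov1 G ξ z) (F.n z) v) * F.l z k
      + (- dbl G z (cov1 G ξ z) (F.l z) v) * F.n z k + dbl G z (cov1 G ξ z) (F.e z) v * F.e z k
      + dbl G z (cov1 G ξ z) (F.f z) v * F.f z k := fun v =>
    (F.frame z hz).expand hG hz (fun i => ip1 G z (cov1 G ξ z i) v) k
  have s := fun v => dbl_self (G := G) (z := z) hsk v
  have k0 : dbl G z (cov1 G ξ z) (F.l z) (F.n z) = F.kil ξ 0 z := rfl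
  have k1 : dbl G z (cov1 G ξ z) (F.l z) (F.e z) = F.kil ξ 1 z := rfl
  have k2 : dbl G z (cov1 G ξ z) (F.l z) (F.f z) = F.kil ξ 2 z := rfl
  have k3 : dbl G z (cov1 G ξ z) (F.n z) (F.e z) = F.kil ξ 3 z := rfl
  have k4 : dbl G z (cov1 G ξ z) (F.n z) (F.f z) = F.kil ξ 4 z := rfl
  have k5 : dbl G z (cov1 G ξ z) (F.e z) (F.f z) = F.kil ξ 5 z := rfl
  have m0 : dbl G z (cov1 G ξ z) (F.n z) (F.l z) = - F.kil ξ 0 z := dbl_skew hsk _ _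
  have m1 : dbl G z (cov1 G ξ z) (F.e z) (F.l z) = - F.kil ξ 1 z := dbl_skew hsk _ _
  have m2 : dbl G z (cov1 G ξ z) (F.f z) (F.l z) = - F.kil ξ 2 z := dbl_skew hsk _ _
  have m3 : dbl G z (cov1 G ξ z) (F.e z) (F.n z) = - F.kil ξ 3 z := dbl_skew hsk _ _
  have m4 : dbl G z (cov1 G ξ z) (F.f z) (F.n z) = - F.kil ξ 4 z := dbl_skew hsk _ _
  have m5 : dbl G z (cov1 G ξ z) (F.f z) (F.e z) = - F.kil ξ 5 z := dbl_skew hsk _ _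
  refine ⟨(h _).trans ?_, (h _).trans ?_, (h _).trans ?_, (h _).trans ?_⟩ <;>
  · simp only [s, k0, k1, k2, k3, k4, k5, m0, m1, m2, m3, m4, m5]
    ring

/-- The derivatives of the components of a Killing form. -/
theorem pd_comp_killing (hG : MetricOn G V) (hp : F.Recurrent)
    (hξ : ∀ i, ContDiffOn ℝ ∞ (fun z => ξ z i) V)
    (hK : ∀ z ∈ V, ∀ i j, cov1 G ξ z i j = - cov1 G ξ z j i) {z : E4} (hz : z ∈ V) (k : Fin 4) :
    pd k (F.comp ξ 0) z = F.kil ξ 0 z * F.l z k - F.kil ξ 1 z * F.e z k - F.kil ξ 2 z * F.f z k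
      + F.th z k * F.comp ξ 0 z ∧
    pd k (F.comp ξ 1) z = - F.kil ξ 0 z * F.n z k - F.kil ξ 3 z * F.e z k - F.kil ξ 4 z * F.f z k
      - F.th z k * F.comp ξ 1 z + F.mu z k * F.comp ξ 2 z + F.nu z k * F.comp ξ 3 z ∧
    pd k (F.comp ξ 2) z = - F.kil ξ 3 z * F.l z k - F.kil ξ 1 z * F.n z k - F.kil ξ 5 z * F.f z k
      + F.mu z k * F.comp ξ 0 z + F.ps z k * F.comp ξ 3 z ∧
    pd k (F.comp ξ 3) z = - F.kil ξ 4 z * F.l z k - F.kil ξ 2 z * F.n z k + F.kil ξ 5 z * F.e z k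
      + F.nu z k * F.comp ξ 0 z - F.ps z k * F.comp ξ 2 z := by
  have D : ∀ {ξ : E4 → Fin 4 → ℝ}, (∀ i, ContDiffOn ℝ ∞ (fun z => ξ z i) V) →
      ∀ i, DifferentiableAt ℝ (fun y => ξ y i) z := fun h i =>
    differentiableAt_of_smooth hG.isOpen (h i) hz
  obtain ⟨c0, c1, c2, c3⟩ := killing_contract (F := F) hG hK hz k
  obtain ⟨cl, cn, ce, cf⟩ := hp.cov_eq hG hz k
  have k0 : ip1 G z (F.l z) (ξ z) = F.comp ξ 0 z := rfl
  have k1 : ip1 G z (F.n z) (ξ z) = F.comp ξ 1 z := rfl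
  have k2 : ip1 G z (F.e z) (ξ z) = F.comp ξ 2 z := rfl
  have k3 : ip1 G z (F.f z) (ξ z) = F.comp ξ 3 z := rfl
  have h : ∀ {v : E4 → Fin 4 → ℝ}, (∀ i, ContDiffOn ℝ ∞ (fun z => v z i) V) →
      pd k (fun z => ip1 G z (v z) (ξ z)) z = ip1 G z (cov1 G v z k) (ξ z)
        + ip1 G z (cov1 G ξ z k) (v z) := fun hv => by
    rw [hG.pd_ip1 hz (D hv) (D hξ), hG.ip1_comm hz _ (cov1 G ξ z k)]
  refine ⟨(h F.sl).trans ?_, (h F.sn).trans ?_, (h F.se).trans ?_, (h F.sf).trans ?_⟩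
  · rw [cl, ip1_comb, c0, k0]; ring
  · rw [cn, ip1_comb, c1, k1, k2, k3]; ring
  · rw [ce, ip1_comb, c2, k0, k3]; ring
  · rw [cf, ip1_comb, c3, k0, k2]; ring

/-- The integrability conditions of the equations of a Killing form: `d² = 0` for the component
`∇ξ(l, n)` gives the vanishing of the components with `l`; for the component `∇ξ(n, e)` it
determines `∇ξ(l, n)` and `∇ξ(e, f)`. -/
theorem killing_integrability (hG : MetricOn G V) (hR : F.TypeNCurvature) (hp : F.Recurrent)
    (hξ : ∀ i, ContDiffOn ℝ ∞ (fun z => ξ z i) V)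
    (hK : ∀ z ∈ V, ∀ i j, cov1 G ξ z i j = - cov1 G ξ z j i) {z : E4} (hz : z ∈ V) :
    F.kil ξ 1 z = 0 ∧ F.kil ξ 2 z = 0 ∧ F.kil ξ 0 z = - ip1 G z (F.th z) (ξ z) ∧
      F.kil ξ 5 z = ip1 G z (F.ps z) (ξ z) := by
  have hop := hG.isOpen
  have D : ∀ {ξ : E4 → Fin 4 → ℝ}, (∀ i, ContDiffOn ℝ ∞ (fun z => ξ z i) V) → ∀ z ∈ V,
      ∀ i, DifferentiableAt ℝ (fun y => ξ y i) z := fun h z hz i =>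
    differentiableAt_of_smooth hop (h i) hz
  have dk := fun a z hz => differentiableAt_of_smooth hop (s_kil (F := F) hG hξ a) (z := z) hz
  have dc := fun a => differentiableAt_of_smooth hop (s_comp (F := F) hG hξ a) hz
  -- `d²` of `∇ξ(l, n)`, whose differential is a combination of `μ` and `ν`
  have hk : ∀ z ∈ V, F.kil ξ 1 z = 0 ∧ F.kil ξ 2 z = 0 := by
    intro z hz
    have h0 := extd_pd hop (s_kil (F := F) hG hξ 0) hz
    have hw := (F.prods hG hz).wedge_indep (p := F.kil ξ 1 z) (q := - F.kil ξ 2 z) fun i j => by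
      have h1 := h0 i j
      rw [extd_congr_on (θ := fun z k => ∑ A, ![F.kil ξ 1, F.kil ξ 2] A z * ![F.mu, F.nu] A z k)
        hop (fun y hy k => by
          rw [(pd_kil hG hR hp hξ hK hy k).1]; simp [Fin.sum_univ_two]; ring) hz,
        extd_sum_mul (fun A => by fin_cases A; exacts [dk 1 z hz, dk 2 z hz])
          (fun A => by fin_cases A; exacts [D (F.s_mu hG) z hz, D (F.s_nu hG) z hz])] at h1
      have e1 := fun k => (pd_kil hG hR hp hξ hK hz k).2.1
      have e2 := fun k => (pd_kil hG hR hp hξ hK hz k).2.2.1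
      have e3 := F.ricci_n hG hR hz i j
      simp only [Fin.sum_univ_two, Matrix.cons_val_zero, Matrix.cons_val_one, e1, e2, e3.1, e3.2] at h1
      simp only [wedge, L, M] at h1 ⊢
      linear_combination h1
    exact ⟨hw.1, neg_eq_zero.1 hw.2⟩
  obtain ⟨hk1, hk2⟩ := hk z hz
  refine ⟨hk1, hk2, ?_⟩
  -- `d²` of `∇ξ(n, e)`
  have h0 := extd_pd hop (s_kil (F := F) hG hξ 3) hz
  have ht := fun k => hp.th_expand hG hR hz k
  have hs := fun k => hp.ps_expand hG hR hz k
  set t0 := -ip1 G z (F.th z) (F.n z)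
  set t2 := ip1 G z (F.th z) (F.e z)
  set t3 := ip1 G z (F.th z) (F.f z)
  set s0 := -ip1 G z (F.ps z) (F.n z)
  have hw := (F.prods hG hz).wedge_indep
    (p := -F.kil ξ 0 z - (t0 * F.comp ξ 0 z + t2 * F.comp ξ 2 z + t3 * F.comp ξ 3 z))
    (q := F.kil ξ 5 z - (s0 * F.comp ξ 0 z + t3 * F.comp ξ 2 z - t2 * F.comp ξ 3 z)) fun i j => by
    have h1 := h0 i j
    rw [extd_congr_on (θ := fun z k => ∑ A, ![fun z => - F.comp ξ 0 z, F.comp ξ 2,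
        fun z => - F.kil ξ 3 z, F.kil ξ 4, fun z => - F.kil ξ 5 z, fun z => - F.kil ξ 0 z] A z
        * ![F.e, F.l, F.th, F.ps, F.nu, F.mu] A z k)
      hop (fun y hy k => by
        rw [(pd_kil hG hR hp hξ hK hy k).2.2.2.1]
        simp [Fin.sum_univ_six, lam, comp]; ring) hz,
      extd_sum_mul (fun A => by
          fin_cases A
          exacts [(dc 0).neg, dc 2, (dk 3 z hz).neg, dk 4 z hz, (dk 5 z hz).neg, (dk 0 z hz).neg])
        (fun A => by
          fin_cases A
          exacts [D F.se z hz, D F.sl z hz, D (F.s_th hG) z hz, D (F.s_ps hG) z hz,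
            D (F.s_nu hG) z hz, D (F.s_mu hG) z hz])] at h1
    have e0 := fun k => (pd_kil hG hR hp hξ hK hz k).1
    have e3 := fun k => (pd_kil hG hR hp hξ hK hz k).2.2.2.1
    have e4 := fun k => (pd_kil hG hR hp hξ hK hz k).2.2.2.2.1
    have e5 := fun k => (pd_kil hG hR hp hξ hK hz k).2.2.2.2.2
    have c0 := fun k => (pd_comp_killing hG hp hξ hK hz k).1
    have c2 := fun k => (pd_comp_killing hG hp hξ hK hz k).2.2.1
    have r := F.ricci_n hG hR hz i j
    have dl : extd F.l z i j = wedge (F.th z) (F.l z) i j := by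
      rw [F.extd_l hG hz]; simp [wedge, hp z hz]
    have de : extd F.e z i j = wedge (F.mu z) (F.l z) i j + wedge (F.ps z) (F.f z) i j := by
      rw [F.extd_e hG hz]; simp [wedge, hp z hz]
    have hl : F.lam ξ z = fun k => F.comp ξ 0 z * F.e z k - F.comp ξ 2 z * F.l z k := rfl
    have hκ : F.kap ξ z = fun k => F.comp ξ 0 z * F.f z k - F.comp ξ 3 z * F.l z k := rfl
    simp [Fin.sum_univ_six, pd_neg, e0, e3, e4, e5, c0, c2, r.1, r.2, dl, de, hk1, hk2,
      hp.extd_th hG hR hz, hp.extd_ps hG hR hz, hl, hκ] at h1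
    simp only [wedge, L, M] at h1 ⊢
    rw [ht i, ht j, hs i, hs j] at h1
    linear_combination (1 / 2) * h1
  have e1 : ip1 G z (F.th z) (ξ z) = t0 * F.comp ξ 0 z + t2 * F.comp ξ 2 z + t3 * F.comp ξ 3 z := by
    have h : F.th z = fun k => t0 * F.l z k + t2 * F.e z k + t3 * F.f z k + 0 * F.l z k :=
      funext fun k => by rw [ht k]; ring
    rw [h, ip1_comb, zero_mul, add_zero]; rfl
  have e2 : ip1 G z (F.ps z) (ξ z) = s0 * F.comp ξ 0 z + t3 * F.comp ξ 2 z - t2 * F.comp ξ 3 z := by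
    have h : F.ps z = fun k => s0 * F.l z k + t3 * F.e z k + (-t2) * F.f z k + 0 * F.l z k :=
      funext fun k => by rw [hs k]; ring
    rw [h, ip1_comb]
    change s0 * F.comp ξ 0 z + t3 * F.comp ξ 2 z + -t2 * F.comp ξ 3 z + 0 * F.comp ξ 0 z = _
    ring
  exact ⟨by rw [e1]; linarith [hw.1], by rw [e2]; linarith [hw.2]⟩

/-- Where `θ` is not a multiple of `l`, a Killing form which vanishes has vanishing covariant
derivative: the constants `∇ξ(l, n)` and `∇ξ(e, f)` vanish, and the derivatives of the identities
for them give a regular linear system for the remaining components. -/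
theorem kil_eq_zero (hG : MetricOn G V) (hR : F.TypeNCurvature) (hp : F.Recurrent)
    (hξ : ∀ i, ContDiffOn ℝ ∞ (fun z => ξ z i) V)
    (hK : ∀ z ∈ V, ∀ i j, cov1 G ξ z i j = - cov1 G ξ z j i) {z : E4} (hz : z ∈ V) (h0 : ξ z = 0)
    (hθ : ip1 G z (F.th z) (F.e z) ≠ 0 ∨ ip1 G z (F.th z) (F.f z) ≠ 0) (a : Fin 6) :
    F.kil ξ a z = 0 := by
  have hop := hG.isOpen
  have D : ∀ {ξ : E4 → Fin 4 → ℝ}, (∀ i, ContDiffOn ℝ ∞ (fun z => ξ z i) V) →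
      ∀ i, DifferentiableAt ℝ (fun y => ξ y i) z := fun h i =>
    differentiableAt_of_smooth hop (h i) hz
  have zr : ∀ v, ip1 G z v (ξ z) = 0 := by
    intro v; rw [h0]; simp [ip1, pairing, sharp]
  obtain ⟨k1, k2, k0, k5⟩ := killing_integrability hG hR hp hξ hK hz
  rw [zr, neg_zero] at k0
  rw [zr] at k5
  have hd := fun k => killing_contract (F := F) hG hK hz k
  obtain ⟨k, hk⟩ := (F.prods hG hz).l_ne
  obtain ⟨dl, -, de, df⟩ := killing_contract (F := F) hG hK hz k
  rw [k0, k1, k2] at dl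
  rw [k1, k5] at de
  rw [k2, k5] at df
  -- the identities `∇ξ(l, n) = -θ(ξ)` and `∇ξ(e, f) = ψ(ξ)` are differentiated in a direction in
  -- which `l` does not vanish
  have h1 : ip1 G z (F.th z) (F.e z) * F.kil ξ 3 z + ip1 G z (F.th z) (F.f z) * F.kil ξ 4 z = 0 := by
    have e : pd k (F.kil ξ 0) z = 0 := by
      rw [(pd_kil hG hR hp hξ hK hz k).1, k1, k2]; ring
    have e' : ip1 G z (cov1 G ξ z k) (F.th z) = 0 := by
      rw [pd_congr_on hop (fun y hy => (killing_integrability hG hR hp hξ hK hy).2.2.1) hz, pd_neg,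
        hG.pd_ip1 hz (D (F.s_th hG)) (D hξ), zr, zero_add, hG.ip1_comm hz, neg_eq_zero] at e
      exact e
    have h : F.th z = fun k => (-ip1 G z (F.th z) (F.n z)) * F.l z k
        + ip1 G z (F.th z) (F.e z) * F.e z k + ip1 G z (F.th z) (F.f z) * F.f z k + 0 * F.l z k :=
      funext fun k => (hp.th_expand hG hR hz k).trans (by ring)
    rw [h, ip1_comb₂, dl, de, df] at e'
    refine (mul_eq_zero.1 ?_).resolve_right hk
    linear_combination -e'
  have h2 : ip1 G z (F.th z) (F.f z) * F.kil ξ 3 z - ip1 G z (F.th z) (F.e z) * F.kil ξ 4 z = 0 := by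
    have e : pd k (F.kil ξ 5) z = 0 := by
      rw [(pd_kil hG hR hp hξ hK hz k).2.2.2.2.2, k1, k2]; ring
    have e' : ip1 G z (cov1 G ξ z k) (F.ps z) = 0 := by
      rw [pd_congr_on hop (fun y hy => (killing_integrability hG hR hp hξ hK hy).2.2.2) hz,
        hG.pd_ip1 hz (D (F.s_ps hG)) (D hξ), zr, zero_add, hG.ip1_comm hz] at e
      exact e
    have h : F.ps z = fun k => (-ip1 G z (F.ps z) (F.n z)) * F.l z k
        + ip1 G z (F.th z) (F.f z) * F.e z k + (-ip1 G z (F.th z) (F.e z)) * F.f z k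
        + 0 * F.l z k :=
      funext fun k => (hp.ps_expand hG hR hz k).trans (by ring)
    rw [h, ip1_comb₂, dl, de, df] at e'
    refine (mul_eq_zero.1 ?_).resolve_right hk
    linear_combination -e'
  set p := ip1 G z (F.th z) (F.e z)
  set q := ip1 G z (F.th z) (F.f z)
  have hpq : p ^ 2 + q ^ 2 ≠ 0 := by
    intro h
    rcases hθ with h' | h'
    · exact h' (by nlinarith [sq_nonneg p, sq_nonneg q])
    · exact h' (by nlinarith [sq_nonneg p, sq_nonneg q])
  have k3 : F.kil ξ 3 z = 0 := (mul_eq_zero.1 (show (p ^ 2 + q ^ 2) * F.kil ξ 3 z = 0 by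
    linear_combination p * h1 + q * h2)).resolve_left hpq
  have k4 : F.kil ξ 4 z = 0 := (mul_eq_zero.1 (show (p ^ 2 + q ^ 2) * F.kil ξ 4 z = 0 by
    linear_combination q * h1 - p * h2)).resolve_left hpq
  fin_cases a <;> assumption

/-- A Killing form which vanishes at a point together with its covariant derivative vanishes near
that point. -/
theorem killing_eventually_zero (hG : MetricOn G V) (hR : F.TypeNCurvature) (hp : F.Recurrent)
    (hξ : ∀ i, ContDiffOn ℝ ∞ (fun z => ξ z i) V)
    (hK : ∀ z ∈ V, ∀ i j, cov1 G ξ z i j = - cov1 G ξ z j i) {y : E4} (hy : y ∈ V) (h0 : ξ y = 0)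
    (hA : ∀ a, F.kil ξ a y = 0) : ∀ᶠ z in 𝓝 y, ξ z = 0 := by
  have hop := hG.isOpen
  -- the components of `ξ` and `∇ξ` satisfy a linear system with the entries of `c` as coefficients;
  -- each derivative is a sum of at most six products
  let Y : E4 → (Fin 4 → ℝ) × (Fin 6 → ℝ) := fun z => (fun a => F.comp ξ a z, fun a => F.kil ξ a z)
  let c : E4 → Fin 8 → Fin 4 → ℝ := fun z =>
    ![F.l z, F.n z, F.e z, F.f z, F.th z, F.mu z, F.nu z, F.ps z]
  have hd : ∀ z ∈ V, DifferentiableAt ℝ Y z := fun z hz =>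
    (differentiableAt_pi.2 fun a => differentiableAt_of_smooth hop (s_comp hG hξ a) hz).prodMk
      (differentiableAt_pi.2 fun a => differentiableAt_of_smooth hop (s_kil hG hξ a) hz)
  have hc : ContinuousAt c y := by
    have e : ∀ {v : E4 → Fin 4 → ℝ}, (∀ i, ContDiffOn ℝ ∞ (fun z => v z i) V) →
        ContinuousAt v y := fun h => continuousAt_pi.2 fun i =>
      ((h i).contDiffAt (hop.mem_nhds hy)).continuousAt
    refine continuousAt_pi.2 fun A => ?_
    fin_cases A
    exacts [e F.sl, e F.sn, e F.se, e F.sf, e (F.s_th hG), e (F.s_mu hG), e (F.s_nu hG),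
      e (F.s_ps hG)]
  have hK' : ∀ᶠ z in 𝓝 y, ‖c z‖ ≤ ‖c y‖ + 1 :=
    (hc.norm.eventually (gt_mem_nhds (lt_add_one _))).mono fun z h => le_of_lt h
  have hY0 : Y y = 0 := by
    refine Prod.ext (funext fun a => ?_) (funext hA)
    change ip1 G y _ (ξ y) = 0
    rw [h0]; simp [ip1, pairing, sharp]
  have hev := eventually_eq_zero_of_linear (Y := Y) (y := y) (C := 6 * (‖c y‖ + 1))
    ((show ∀ᶠ z in 𝓝 y, z ∈ V from hop.mem_nhds hy).mono hd) (by
      filter_upwards [hK', hop.mem_nhds hy] with z hcz hz i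
      have hb : ∀ A a, |c z A i * F.kil ξ a z| ≤ (‖c y‖ + 1) * ‖Y z‖ := fun A a => by
        rw [abs_mul]
        refine mul_le_mul ?_ ?_ (abs_nonneg _) (by positivity)
        · exact ((norm_le_pi_norm (c z A) i).trans (norm_le_pi_norm (c z) A)).trans hcz
        · exact (norm_le_pi_norm (Y z).2 a).trans (norm_snd_le (Y z))
      have hb' : ∀ A a, |c z A i * F.comp ξ a z| ≤ (‖c y‖ + 1) * ‖Y z‖ := fun A a => by
        rw [abs_mul]
        refine mul_le_mul ?_ ?_ (abs_nonneg _) (by positivity)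
        · exact ((norm_le_pi_norm (c z A) i).trans (norm_le_pi_norm (c z) A)).trans hcz
        · exact (norm_le_pi_norm (Y z).1 a).trans (norm_fst_le (Y z))
      set N := (‖c y‖ + 1) * ‖Y z‖ with hN
      have hN0 : 0 ≤ N := by positivity
      have hpd : pd i Y z = (fun a => pd i (F.comp ξ a) z, fun a => pd i (F.kil ξ a) z) := by
        have h1 : ∀ a, DifferentiableAt ℝ (F.comp ξ a) z := fun a =>
          differentiableAt_of_smooth hop (s_comp hG hξ a) hz
        have h2 : ∀ a, DifferentiableAt ℝ (F.kil ξ a) z := fun a =>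
          differentiableAt_of_smooth hop (s_kil hG hξ a) hz
        have := ((hasFDerivAt_pi.2 fun a => (h1 a).hasFDerivAt).prodMk
          (hasFDerivAt_pi.2 fun a => (h2 a).hasFDerivAt)).fderiv
        unfold pd
        rw [this]; rfl
      rw [hpd, mul_assoc, ← hN]
      have hl : F.lam ξ z i = F.comp ξ 0 z * F.e z i - F.comp ξ 2 z * F.l z i := rfl
      have hκ : F.kap ξ z i = F.comp ξ 0 z * F.f z i - F.comp ξ 3 z * F.l z i := rfl
      obtain ⟨a0, a1, a2, a3⟩ := pd_comp_killing hG hp hξ hK hz i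
      obtain ⟨b0, b1, b2, b3, b4, b5⟩ := pd_kil hG hR hp hξ hK hz i
      rw [hl] at b3
      rw [hκ] at b4
      have kl : ∀ a, -N ≤ F.l z i * F.kil ξ a z ∧ F.l z i * F.kil ξ a z ≤ N := fun a =>
        abs_le.1 (hb 0 a)
      have kn : ∀ a, -N ≤ F.n z i * F.kil ξ a z ∧ F.n z i * F.kil ξ a z ≤ N := fun a =>
        abs_le.1 (hb 1 a)
      have ke : ∀ a, -N ≤ F.e z i * F.kil ξ a z ∧ F.e z i * F.kil ξ a z ≤ N := fun a =>
        abs_le.1 (hb 2 a)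
      have kf : ∀ a, -N ≤ F.f z i * F.kil ξ a z ∧ F.f z i * F.kil ξ a z ≤ N := fun a =>
        abs_le.1 (hb 3 a)
      have kth : ∀ a, -N ≤ F.th z i * F.kil ξ a z ∧ F.th z i * F.kil ξ a z ≤ N := fun a =>
        abs_le.1 (hb 4 a)
      have kmu : ∀ a, -N ≤ F.mu z i * F.kil ξ a z ∧ F.mu z i * F.kil ξ a z ≤ N := fun a =>
        abs_le.1 (hb 5 a)
      have knu : ∀ a, -N ≤ F.nu z i * F.kil ξ a z ∧ F.nu z i * F.kil ξ a z ≤ N := fun a =>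
        abs_le.1 (hb 6 a)
      have kps : ∀ a, -N ≤ F.ps z i * F.kil ξ a z ∧ F.ps z i * F.kil ξ a z ≤ N := fun a =>
        abs_le.1 (hb 7 a)
      have cl : ∀ a, -N ≤ F.l z i * F.comp ξ a z ∧ F.l z i * F.comp ξ a z ≤ N := fun a =>
        abs_le.1 (hb' 0 a)
      have ce : ∀ a, -N ≤ F.e z i * F.comp ξ a z ∧ F.e z i * F.comp ξ a z ≤ N := fun a =>
        abs_le.1 (hb' 2 a)
      have cf : ∀ a, -N ≤ F.f z i * F.comp ξ a z ∧ F.f z i * F.comp ξ a z ≤ N := fun a =>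
        abs_le.1 (hb' 3 a)
      have cth : ∀ a, -N ≤ F.th z i * F.comp ξ a z ∧ F.th z i * F.comp ξ a z ≤ N := fun a =>
        abs_le.1 (hb' 4 a)
      have cmu : ∀ a, -N ≤ F.mu z i * F.comp ξ a z ∧ F.mu z i * F.comp ξ a z ≤ N := fun a =>
        abs_le.1 (hb' 5 a)
      have cnu : ∀ a, -N ≤ F.nu z i * F.comp ξ a z ∧ F.nu z i * F.comp ξ a z ≤ N := fun a =>
        abs_le.1 (hb' 6 a)
      have cps : ∀ a, -N ≤ F.ps z i * F.comp ξ a z ∧ F.ps z i * F.comp ξ a z ≤ N := fun a =>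
        abs_le.1 (hb' 7 a)
      have ha0 : |pd i (F.comp ξ 0) z| ≤ 6 * N := by
        rw [a0, abs_le]
        constructor <;> linarith [(kl 0).1, (kl 0).2, (ke 1).1, (ke 1).2, (kf 2).1, (kf 2).2,
          (cth 0).1, (cth 0).2]
      have ha1 : |pd i (F.comp ξ 1) z| ≤ 6 * N := by
        rw [a1, abs_le]
        constructor <;> linarith [(kn 0).1, (kn 0).2, (ke 3).1, (ke 3).2, (kf 4).1, (kf 4).2,
          (cth 1).1, (cth 1).2, (cmu 2).1, (cmu 2).2, (cnu 3).1, (cnu 3).2]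
      have ha2 : |pd i (F.comp ξ 2) z| ≤ 6 * N := by
        rw [a2, abs_le]
        constructor <;> linarith [(kl 3).1, (kl 3).2, (kn 1).1, (kn 1).2, (kf 5).1, (kf 5).2,
          (cmu 0).1, (cmu 0).2, (cps 3).1, (cps 3).2]
      have ha3 : |pd i (F.comp ξ 3) z| ≤ 6 * N := by
        rw [a3, abs_le]
        constructor <;> linarith [(kl 4).1, (kl 4).2, (kn 2).1, (kn 2).2, (ke 5).1, (ke 5).2,
          (cnu 0).1, (cnu 0).2, (cps 2).1, (cps 2).2]
      have hb0 : |pd i (F.kil ξ 0) z| ≤ 6 * N := by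
        rw [b0, abs_le]
        constructor <;> linarith [(kmu 1).1, (kmu 1).2, (knu 2).1, (knu 2).2]
      have hb1 : |pd i (F.kil ξ 1) z| ≤ 6 * N := by
        rw [b1, abs_le]
        constructor <;> linarith [(kth 1).1, (kth 1).2, (kps 2).1, (kps 2).2]
      have hb2 : |pd i (F.kil ξ 2) z| ≤ 6 * N := by
        rw [b2, abs_le]
        constructor <;> linarith [(kth 2).1, (kth 2).2, (kps 1).1, (kps 1).2]
      have hb3 : |pd i (F.kil ξ 3) z| ≤ 6 * N := by
        rw [b3, abs_le]
        constructor <;> linarith [(ce 0).1, (ce 0).2, (cl 2).1, (cl 2).2, (kth 3).1, (kth 3).2,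
          (kps 4).1, (kps 4).2, (knu 5).1, (knu 5).2, (kmu 0).1, (kmu 0).2]
      have hb4 : |pd i (F.kil ξ 4) z| ≤ 6 * N := by
        rw [b4, abs_le]
        constructor <;> linarith [(cf 0).1, (cf 0).2, (cl 3).1, (cl 3).2, (kth 4).1, (kth 4).2,
          (kps 3).1, (kps 3).2, (kmu 5).1, (kmu 5).2, (knu 0).1, (knu 0).2]
      have hb5 : |pd i (F.kil ξ 5) z| ≤ 6 * N := by
        rw [b5, abs_le]
        constructor <;> linarith [(kmu 2).1, (kmu 2).2, (knu 1).1, (knu 1).2]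
      refine max_le ((pi_norm_le_iff_of_nonneg (by positivity)).2
        (NullFrame.forall_fin_four ha0 ha1 ha2 ha3)) ((pi_norm_le_iff_of_nonneg (by positivity)).2
        fun a => ?_)
      fin_cases a
      exacts [hb0, hb1, hb2, hb3, hb4, hb5]) hY0
  filter_upwards [hev, hop.mem_nhds hy] with z hz hzV
  have hc0 : ∀ a, F.comp ξ a z = 0 := fun a => congrFun (congrArg Prod.fst hz) a
  have e : ∀ a, ip1 G z (ξ z) (![F.l z, F.n z, F.e z, F.f z] a) = 0 := fun a => by
    rw [hG.ip1_comm hzV]; exact hc0 a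
  funext k
  have e0 : ip1 G z (ξ z) (F.l z) = 0 := e 0
  have e1 : ip1 G z (ξ z) (F.n z) = 0 := e 1
  have e2 : ip1 G z (ξ z) (F.e z) = 0 := e 2
  have e3 : ip1 G z (ξ z) (F.f z) = 0 := e 3
  rw [(F.frame z hzV).expand hG hzV (ξ z) k, e0, e1, e2, e3]; simp

end Killing

/-- Trivial isotropy of a type N vacuum metric with recurrent null form, at the points where the
form `θ` is not a multiple of `l`. -/
theorem trivialIsotropyNear (F : NullFrame G V) (hG : MetricOn G V) (hR : F.TypeNCurvature)
    (hp : F.Recurrent) {y : E4}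
    (hθ : ip1 G y (F.th y) (F.e y) ≠ 0 ∨ ip1 G y (F.th y) (F.f y) ≠ 0) :
    TrivialIsotropyNear G V y := by
  intro W hW hyW hWV X sX hL hX0
  have hGW := hG.mono hW hWV
  have hRW : (F.restrict hWV).TypeNCurvature := fun z hz => hR z (hWV hz)
  have hpW : (F.restrict hWV).Recurrent := fun z hz => hp z (hWV hz)
  have sξ : ∀ i, ContDiffOn ℝ ∞ (fun z => ∑ k, G z i k * X z k) W := fun i =>
    ContDiffOn.sum fun k _ => (hGW.smooth i k).mul (sX k)
  have hK : ∀ z ∈ W, ∀ i j, cov1 G (fun z i => ∑ k, G z i k * X z k) z i j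
      = - cov1 G (fun z i => ∑ k, G z i k * X z k) z j i := fun z hz i j => by
    have h := lieMetric_eq_cov hGW sX hz i j
    rw [hL z hz] at h
    have h' : (0 : ℝ) = _ := h
    linarith
  have h0 : (fun i => ∑ k, G y i k * X y k) = 0 := by
    rw [hX0]; funext i; simp
  have hk := kil_eq_zero (F := F.restrict hWV) hGW hRW hpW sξ hK hyW h0 hθ
  filter_upwards [killing_eventually_zero hGW hRW hpW sξ hK hyW h0 hk, hW.mem_nhds hyW]
    with z hz hzW
  funext i
  rw [← hGW.sharp_lower hzW (X z) i]
  have : (fun k => ∑ j, G z k j * X z j) = 0 := hz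
  rw [this]; simp [sharp]

end NullFrame

/-! ### Waves and isotropy in terms of the fundamental elements -/

theorem TrivialIsotropyNear.of_subset {G : CMetric} {V U : Set E4} {y : E4} (hV : IsOpen V)
    (hy : y ∈ V) (h : TrivialIsotropyNear G V y) : TrivialIsotropyNear G U y := by
  intro W hW hyW _ X hX hK h0
  exact h (W ∩ V) (hW.inter hV) ⟨hyW, hy⟩ Set.inter_subset_right X
    (fun i => (hX i).mono Set.inter_subset_left) (fun z hz => hK z hz.1) h0

theorem MetricOn.exists_ball {G : CMetric} {V W : Set E4} (hG : MetricOn G V) {y : E4}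
    (hy : y ∈ V) (hW : W ∈ 𝓝 y) : ∃ r > 0, Metric.ball y r ⊆ V ∧ Metric.ball y r ⊆ W := by
  obtain ⟨r, hr, h⟩ := Metric.mem_nhds_iff.1 (Filter.inter_mem (hG.isOpen.mem_nhds hy) hW)
  exact ⟨r, hr, h.trans Set.inter_subset_left, h.trans Set.inter_subset_right⟩

namespace NullFrame

variable {G : CMetric} {V : Set E4} {F : NullFrame G V}

theorem Recurrent.ppWaveNear (hp : F.Recurrent) (hG : MetricOn G V) (hR : F.TypeNCurvature)
    {U : Set E4} (hU : V ⊆ U) {y : E4} (hy : y ∈ V) : PPWaveNear G U y := by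
  obtain ⟨r, hr, hB, -⟩ := hG.exists_ball hy Filter.univ_mem
  obtain ⟨K, -⟩ := hp.exists_parallelFrame hG hR hB
  exact K.ppWaveNear (hG.mono Metric.isOpen_ball hB) (hB.trans hU) (Metric.mem_ball_self hr)

/-- If the connection form `th` of a recurrent null frame is proportional to `l`, then so is
`ps`, and the metric is a plane wave. -/
theorem Recurrent.planeWaveNear (hp : F.Recurrent) (hG : MetricOn G V) (hR : F.TypeNCurvature)
    {U : Set E4} (hU : V ⊆ U) {y : E4} (hy : y ∈ V)
    (h : ∀ᶠ z in 𝓝 y, ip1 G z (F.th z) (F.e z) = 0 ∧ ip1 G z (F.th z) (F.f z) = 0) :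
    PlaneWaveNear G U y := by
  obtain ⟨r, hr, hB, hW⟩ := hG.exists_ball hy h
  obtain ⟨K, hK⟩ := hp.exists_parallelFrame hG hR hB
  have key : ∀ z ∈ Metric.ball y r, ∃ t p s : ℝ, s ≠ 0 ∧ (∀ i, F.th z i = t * F.l z i) ∧
      (∀ i, F.ps z i = p * F.l z i) ∧ ∀ i, pd i K.U z = s * F.l z i := by
    intro z hz
    obtain ⟨h2, h3⟩ := hW hz
    obtain ⟨⟨s, hs, hs'⟩, -⟩ := hK z hz
    refine ⟨-ip1 G z (F.th z) (F.n z), -ip1 G z (F.ps z) (F.n z), s, hs, fun i => ?_, fun i => ?_, hs'⟩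
    · rw [hp.th_expand hG hR (hB hz) i, h2, h3, zero_mul, zero_mul, add_zero, add_zero]
    · rw [hp.ps_expand hG hR (hB hz) i, h2, h3, zero_mul, zero_mul, add_zero, sub_zero]
  refine K.planeWaveNear hr (hG.mono Metric.isOpen_ball hB) (hB.trans hU) (fun z hz => ?_)
    fun z hz => ?_
  · obtain ⟨t, p, s, hs, h1, h2, h3⟩ := key z hz
    refine ⟨2 * (K.p z * t - K.q z * p) / s, fun i => ?_⟩
    rw [((hK z hz).2 i).1, h1, h2, h3]; field_simp
  · obtain ⟨t, p, s, hs, h1, h2, h3⟩ := key z hz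
    refine ⟨2 * (K.q z * t + K.p z * p) / s, fun i => ?_⟩
    rw [((hK z hz).2 i).2, h1, h2, h3]; field_simp

/-- The curvature annihilates a parallel 1-form. -/
theorem _root_.TypeN.MetricOn.riem_parallel (hG : MetricOn G V) {k : E4 → Fin 4 → ℝ}
    (hk : ∀ i, ContDiffOn ℝ ∞ (fun z => k z i) V) (h0 : ∀ z ∈ V, cov1 G k z = 0) {z : E4}
    (hz : z ∈ V) (c i j : Fin 4) : ∑ m, riem G z m c i j * k z m = 0 := by
  have h := hG.ricci_identity hk hz i j c
  have e : ∀ a b, pd a (fun y => cov1 G k y b c) z = 0 := fun a b => by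
    rw [pd_congr_on hG.isOpen (g := fun _ => (0 : ℝ))
      (fun y hy => congrFun (congrFun (h0 y hy) b) c) hz, pd_const]
  rw [e, e, h0 z hz] at h
  simpa using h

/-- In a vacuum type N metric, a parallel 1-form is a multiple of `l`. -/
theorem eq_of_parallel (hG : MetricOn G V) (hR : F.TypeNCurvature) {k : E4 → Fin 4 → ℝ}
    (hk : ∀ i, ContDiffOn ℝ ∞ (fun z => k z i) V) (h0 : ∀ z ∈ V, cov1 G k z = 0) {z : E4}
    (hz : z ∈ V) (i : Fin 4) : k z i = (- ip1 G z (k z) (F.n z)) * F.l z i := by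
  have hP := F.prods hG hz
  have h1 : ∀ c, ip1 G z (F.l z) (k z) * F.e z c - ip1 G z (F.e z) (k z) * F.l z c = 0 ∧
      ip1 G z (F.l z) (k z) * F.f z c - ip1 G z (F.f z) (k z) * F.l z c = 0 := by
    intro c
    have := hP.wedge_indep (p := ip1 G z (F.l z) (k z) * F.e z c - ip1 G z (F.e z) (k z) * F.l z c)
      (q := -(ip1 G z (F.l z) (k z) * F.f z c - ip1 G z (F.f z) (k z) * F.l z c)) fun i j => by
        have h := F.riem_contract hG hR hz (k z) c i j
        rw [hG.riem_parallel hk h0 hz] at h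
        unfold L M at h
        linarith
    exact ⟨this.1, neg_eq_zero.1 this.2⟩
  have h2 := hP.coeff_zero (p := - ip1 G z (F.e z) (k z)) (q := 0) (r := ip1 G z (F.l z) (k z))
    (s := 0) fun c => by linarith [(h1 c).1]
  have h3 := hP.coeff_zero (p := - ip1 G z (F.f z) (k z)) (q := 0) (r := 0)
    (s := ip1 G z (F.l z) (k z)) fun c => by linarith [(h1 c).2]
  rw [(F.frame z hz).expand hG hz (k z) i, hG.ip1_comm hz (k z) (F.l z), h2.2.2.1,
    hG.ip1_comm hz (k z) (F.e z), hG.ip1_comm hz (k z) (F.f z), neg_eq_zero.1 h2.1,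
    neg_eq_zero.1 h3.1]
  ring

/-- A null frame of a vacuum type N metric with a parallel 1-form is recurrent. -/
theorem recurrent_of_parallel (hG : MetricOn G V) (hR : F.TypeNCurvature) {k : E4 → Fin 4 → ℝ}
    (hk : ∀ i, ContDiffOn ℝ ∞ (fun z => k z i) V)
    (h0 : ∀ z ∈ V, k z ≠ 0 ∧ cov1 G k z = 0) : F.Recurrent := by
  intro z hz i
  have hx : ∀ z ∈ V, k z = fun c => (- ip1 G z (k z) (F.n z)) * F.l z c := fun z hz =>
    funext fun c => eq_of_parallel hG hR hk (fun z hz => (h0 z hz).2) hz c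
  set φ := - ip1 G z (k z) (F.n z) with hφ
  have hφ0 : φ ≠ 0 := fun h => (h0 z hz).1 (by
    rw [hx z hz, ← hφ, h]; funext c; simp)
  have hkl : ∀ z ∈ V, ∀ w, ip1 G z (k z) w = (- ip1 G z (k z) (F.n z)) * ip1 G z (F.l z) w :=
    fun z hz w => by
      conv_lhs => rw [hx z hz]
      rw [ip1_smul_left]
  have step : ∀ w : E4 → Fin 4 → ℝ, (∀ i, ContDiffOn ℝ ∞ (fun z => w z i) V) →
      (∀ z ∈ V, ip1 G z (F.l z) (w z) = 0) → ip1 G z (cov1 G F.l z i) (w z) = 0 := by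
    intro w hw hlw
    have h1 := cov_skew hG hk hw (c := 0)
      (fun z hz => by rw [hkl z hz, hlw z hz, mul_zero]) hz i
    have h2 := cov_skew hG F.sl hw hlw hz i
    rw [(h0 z hz).2] at h1
    have h3 : ip1 G z ((0 : Fin 4 → Fin 4 → ℝ) i) (w z) = 0 := by simp [ip1, pairing]
    rw [h3, hG.ip1_comm hz, hkl z hz, hG.ip1_comm hz (F.l z), ← hφ] at h1
    rcases mul_eq_zero.1 (neg_eq_zero.1 h1.symm) with h | h
    · exact absurd h hφ0
    · rw [h2, h, neg_zero]
  exact ⟨step F.e F.se fun z hz => (F.prods hG hz).le, step F.f F.sf fun z hz => (F.prods hG hz).lf⟩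

end NullFrame

namespace Fund

variable {G : CMetric} {V : Set E4}

/-- The restriction of fundamental elements to a smaller set. -/
def restrict (D : Fund G V) {W : Set E4} (hW : W ⊆ V) : Fund G W where
  L := D.L
  ell := D.ell
  x := D.x
  smooth_L i j := (D.smooth_L i j).mono hW
  smooth_ell i := (D.smooth_ell i).mono hW
  smooth_x i := (D.smooth_x i).mono hW
  weyl_eq y hy := D.weyl_eq y (hW hy)
  ell_ne y hy := D.ell_ne y (hW hy)
  ell_null y hy := D.ell_null y (hW hy)
  L_eq y hy := D.L_eq y (hW hy)
  x_timelike y hy := D.x_timelike y (hW hy)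
  future y hy := D.future y (hW hy)

variable {D : Fund G V}

theorem ppCond_of_ppWaveNear (hG : MetricOn G V) (hric : ∀ z ∈ V, ric G z = 0) {U : Set E4}
    {y : E4} (hy : y ∈ V) (h : PPWaveNear G U y) : D.PPCond y := by
  obtain ⟨W, hW, hyW, -, k, hk, hk0⟩ := h
  have hGW := hG.mono (hG.isOpen.inter hW) Set.inter_subset_left
  set D' := D.restrict (W := V ∩ W) Set.inter_subset_left
  have hR := D'.typeNCurvature hGW fun z hz => hric z hz.1
  exact (D'.ppCond_iff hGW ⟨hy, hyW⟩).2 (NullFrame.recurrent_of_parallel hGW hR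
    (fun i => (hk i).mono Set.inter_subset_right) (fun z hz => ⟨(hk0 z hz.2).1, (hk0 z hz.2).2.2⟩)
    y ⟨hy, hyW⟩)

theorem planeWaveNear (hG : MetricOn G V) (hric : ∀ z ∈ V, ric G z = 0)
    (hp : (D.frame hG).Recurrent) {U : Set E4} (hU : V ⊆ U) {y : E4} (hy : y ∈ V)
    (h : ∀ᶠ z in 𝓝 y, D.phi7 z = 0) : PlaneWaveNear G U y := by
  refine hp.planeWaveNear hG (D.typeNCurvature hG hric) hU hy ?_
  filter_upwards [h, hG.isOpen.mem_nhds hy] with z hz hzV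
  exact (phi7_zero_iff hric hp hzV).1 hz

theorem trivialIsotropyNear (hG : MetricOn G V) (hric : ∀ z ∈ V, ric G z = 0)
    (hp : (D.frame hG).Recurrent) {y : E4} (hy : y ∈ V) (h : D.phi7 y ≠ 0) :
    TrivialIsotropyNear G V y := by
  refine (D.frame hG).trivialIsotropyNear hG (D.typeNCurvature hG hric) hp ?_
  by_contra! h'
  exact h ((phi7_zero_iff hric hp hy).2 h')

end Fund

/-! ### Algebraic symmetries of the curvature tensor -/

/-- The algebraic symmetries of a Riemann tensor with lowered indices. -/
structure CurvatureSymm (W : Fin 4 → Fin 4 → Fin 4 → Fin 4 → ℝ) : Prop where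
  skew_left : ∀ a b c d, W a b c d = - W b a c d
  skew_right : ∀ a b c d, W a b c d = - W a b d c
  cyclic : ∀ a b c d, W a b c d + W a c d b + W a d b c = 0

theorem CurvatureSymm.pair {W : Fin 4 → Fin 4 → Fin 4 → Fin 4 → ℝ} (h : CurvatureSymm W)
    (a b c d : Fin 4) : W a b c d = W c d a b := by
  have h1 := h.cyclic a b c d
  have h2 := h.cyclic b c d a
  have h3 := h.cyclic c d a b
  have h4 := h.cyclic d a b c
  linarith [h.skew_left b a c d, h.skew_right b c d a, h.skew_left c b d a, h.skew_right c b d a,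
    h.skew_left b d a c, h.skew_right b d a c, h.skew_left d b a c, h.skew_left c a b d,
    h.skew_right c a b d, h.skew_left a c b d, h.skew_right a c b d, h.skew_right b a c d,
    h.skew_left d c a b, h.skew_left d a b c, h.skew_right d a b c, h.skew_left a d b c,
    h.skew_right a d b c, h.skew_right d c a b, h.skew_right d b c a, h.skew_left d b c a,
    h.skew_right c d a b]

namespace MetricOn

variable {G : CMetric} {V : Set E4}

theorem riem_skew_right (z : E4) (l k i j : Fin 4) : riem G z l k i j = - riem G z l k j i := by
  unfold riem
  simp only [Finset.sum_sub_distrib]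
  ring

/-- The first Bianchi identity. -/
theorem riem_cyclic (hG : MetricOn G V) {z : E4} (hz : z ∈ V) (l k i j : Fin 4) :
    riem G z l k i j + riem G z l i j k + riem G z l j k i = 0 := by
  have hc : ∀ a b c d, pd d (fun y => chr G y a b c) z = pd d (fun y => chr G y a c b) z :=
    fun a b c d => pd_congr_on hG.isOpen (fun y hy => hG.chr_symm hy a b c) hz d
  unfold riem
  rw [hc l j k i, hc l i k j, hc l j i k]
  simp only [Finset.sum_sub_distrib, hG.chr_symm hz _ j k, hG.chr_symm hz _ i k,
    hG.chr_symm hz _ j i]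
  ring

theorem riem_eq (hG : MetricOn G V) {z : E4} (hz : z ∈ V) (l k i j : Fin 4) :
    riem G z l k i j = ∑ a, ginv G z l a * riemLow G z a k i j := by
  have h := hG.sharp_lower hz (fun m => riem G z m k i j) l
  exact h.symm

/-- The curvature tensor is skew in its first pair of indices, because the connection is metric. -/
theorem riemLow_skew_left (hG : MetricOn G V) {z : E4} (hz : z ∈ V) (a b i j : Fin 4) :
    riemLow G z a b i j = - riemLow G z b a i j := by
  -- the commutator of second derivatives of the product of two constant 1-forms vanishes
  set ξ : E4 → Fin 4 → ℝ := fun _ => G z a with hξ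
  set θ : E4 → Fin 4 → ℝ := fun _ => G z b with hθ
  have sξ : ∀ k, ContDiffOn ℝ ∞ (fun y => ξ y k) V := fun k => contDiffOn_const
  have sθ : ∀ k, ContDiffOn ℝ ∞ (fun y => θ y k) V := fun k => contDiffOn_const
  have dξ := fun y (hy : y ∈ V) k => differentiableAt_of_smooth hG.isOpen (sξ k) hy
  have dθ := fun y (hy : y ∈ V) k => differentiableAt_of_smooth hG.isOpen (sθ k) hy
  have second : ∀ p q, pd p (fun y => pd q (fun w => ip1 G w (ξ w) (θ w)) y) z
      = ip1 G z (cov1 G (fun y => cov1 G ξ y q) z p) (θ z)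
        + ip1 G z (cov1 G ξ z q) (cov1 G θ z p) + (ip1 G z (cov1 G ξ z p) (cov1 G θ z q)
        + ip1 G z (ξ z) (cov1 G (fun y => cov1 G θ y q) z p)) := by
    intro p q
    have s1 : ∀ k, DifferentiableAt ℝ (fun y => cov1 G ξ y q k) z := fun k =>
      differentiableAt_of_smooth hG.isOpen (hG.cov1_smooth sξ q k) hz
    have s2 : ∀ k, DifferentiableAt ℝ (fun y => cov1 G θ y q k) z := fun k =>
      differentiableAt_of_smooth hG.isOpen (hG.cov1_smooth sθ q k) hz
    rw [pd_congr_on hG.isOpen (fun y hy => hG.pd_ip1 hy (dξ y hy) (dθ y hy) q) hz, pd_add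
      (differentiableAt_of_smooth hG.isOpen (hG.ip1_smooth (hG.cov1_smooth sξ q) sθ) hz)
      (differentiableAt_of_smooth hG.isOpen (hG.ip1_smooth sξ (hG.cov1_smooth sθ q)) hz),
      hG.pd_ip1 hz s1 (dθ z hz), hG.pd_ip1 hz (dξ z hz) s2]
  have hcomm := pd_comm hG.isOpen (hG.ip1_smooth sξ sθ) hz i j
  rw [second, second] at hcomm
  have ricci : ∀ η : E4 → Fin 4 → ℝ, (∀ k, ContDiffOn ℝ ∞ (fun y => η y k) V) → ∀ k,
      cov1 G (fun y => cov1 G η y j) z i k - cov1 G (fun y => cov1 G η y i) z j k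
        = - ∑ m, riem G z m k i j * η z m := fun η hη k => by
    rw [← hG.ricci_identity hη hz i j k]
    unfold cov1
    simp only [Finset.sum_sub_distrib]
    ring
  have contract : ∀ (η : Fin 4 → ℝ) (c : Fin 4), ip1 G z η (G z c) = η c := fun η c => by
    have h : G z c = fun k => ∑ j, G z k j * (Pi.single c 1 : Fin 4 → ℝ) j := funext fun k => by
      rw [sum_single_mul, hG.symm z hz k c]
    rw [h, ip1_lower hG hz]
    exact sum_single_mul η c
  rw [hG.ip1_comm hz (ξ z), hG.ip1_comm hz (ξ z)] at hcomm
  simp only [hξ, hθ, contract] at hcomm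
  have h1 := ricci ξ sξ b
  have h2 := ricci θ sθ a
  have h3 : riemLow G z a b i j = ∑ m, riem G z m b i j * ξ z m :=
    Finset.sum_congr rfl fun m _ => mul_comm _ _
  have h4 : riemLow G z b a i j = ∑ m, riem G z m a i j * θ z m :=
    Finset.sum_congr rfl fun m _ => mul_comm _ _
  have h5 := hG.ip1_comm hz (cov1 G ξ z i) (cov1 G θ z j)
  have h6 := hG.ip1_comm hz (cov1 G ξ z j) (cov1 G θ z i)
  simp only [hξ, hθ] at h1 h2 h3 h4 hcomm
  linarith

theorem curvatureSymm (hG : MetricOn G V) {z : E4} (hz : z ∈ V) :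
    CurvatureSymm (riemLow G z) where
  skew_left a b c d := hG.riemLow_skew_left hz a b c d
  skew_right a b c d := by
    unfold riemLow
    rw [← Finset.sum_neg_distrib]
    exact Finset.sum_congr rfl fun l _ => by rw [riem_skew_right]; ring
  cyclic a b c d := by
    unfold riemLow
    rw [← Finset.sum_add_distrib, ← Finset.sum_add_distrib]
    refine Finset.sum_eq_zero fun l _ => ?_
    linear_combination G z a l * hG.riem_cyclic hz l b c d

end MetricOn

/-! ### Components in an orthonormal basis -/

/-- The matrix, indexed by pairs of indices, of a 4-tensor. -/
def pairMat {R : Type*} (W : Fin 4 → Fin 4 → Fin 4 → Fin 4 → R) :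
    Matrix (Fin 4 × Fin 4) (Fin 4 × Fin 4) R := Matrix.of fun p q => W p.1 p.2 q.1 q.2

/-- The components of a covariant 4-tensor in the basis of vectors given by the rows of `B`. -/
def frameComp {R : Type*} [CommRing R] (B : Matrix (Fin 4) (Fin 4) R)
    (W : Fin 4 → Fin 4 → Fin 4 → Fin 4 → R) (a b c d : Fin 4) : R :=
  ∑ i, ∑ j, ∑ k, ∑ l, B a i * B b j * B c k * B d l * W i j k l

section

variable {R : Type*} [CommRing R]

theorem sum_comm_pairs (F : Fin 4 → Fin 4 → Fin 4 → Fin 4 → R) :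
    ∑ k, ∑ l, ∑ i, ∑ j, F i j k l = ∑ i, ∑ j, ∑ k, ∑ l, F i j k l := by
  have e1 : ∀ k, ∑ l, ∑ i, ∑ j, F i j k l = ∑ i, ∑ j, ∑ l, F i j k l := fun k => by
    rw [Finset.sum_comm]
    exact Finset.sum_congr rfl fun i _ => Finset.sum_comm
  simp only [e1]
  rw [Finset.sum_comm]
  exact Finset.sum_congr rfl fun i _ => Finset.sum_comm

theorem kronecker_conj_apply (B : Matrix (Fin 4) (Fin 4) R)
    (X : Matrix (Fin 4 × Fin 4) (Fin 4 × Fin 4) R) (p q : Fin 4 × Fin 4) :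
    (Matrix.kronecker B B * X * (Matrix.kronecker B B).transpose) p q
      = frameComp B (fun i j k l => X (i, j) (k, l)) p.1 p.2 q.1 q.2 := by
  simp only [Matrix.mul_apply, Matrix.transpose_apply, Matrix.kronecker, Matrix.kroneckerMap_apply,
    Fintype.sum_prod_type, Finset.sum_mul, frameComp]
  rw [sum_comm_pairs]
  refine Finset.sum_congr rfl fun i _ => Finset.sum_congr rfl fun j _ =>
    Finset.sum_congr rfl fun k _ => Finset.sum_congr rfl fun l _ => by ring

/-- A product of matrices indexed by pairs, contracted with `K`, in the basis in which `K`
is `η`. -/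
theorem kronecker_conj_mul {B K η : Matrix (Fin 4) (Fin 4) R} (hK : K = B.transpose * η * B)
    (X Y : Matrix (Fin 4 × Fin 4) (Fin 4 × Fin 4) R) :
    Matrix.kronecker B B * (X * Matrix.kronecker K K * Y) * (Matrix.kronecker B B).transpose
      = (Matrix.kronecker B B * X * (Matrix.kronecker B B).transpose) * Matrix.kronecker η η
        * (Matrix.kronecker B B * Y * (Matrix.kronecker B B).transpose) := by
  have h : Matrix.kronecker K K
      = (Matrix.kronecker B B).transpose * Matrix.kronecker η η * Matrix.kronecker B B := by
    rw [hK]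
    simp only [Matrix.kronecker, Matrix.mul_kronecker_mul, Matrix.kroneckerMap_transpose]
  rw [h]
  simp only [Matrix.mul_assoc]

/-- The components of a product of two tensors, contracted with the metric in two indices. -/
theorem frameComp_contract {B K : Matrix (Fin 4) (Fin 4) R} {η : Fin 4 → R}
    (hK : K = B.transpose * Matrix.diagonal η * B) (X Y : Fin 4 → Fin 4 → Fin 4 → Fin 4 → R)
    (a b m n : Fin 4) :
    frameComp B (fun a b m n => ∑ c, ∑ d, ∑ p, ∑ q, K c p * K d q * (X a b c d * Y p q m n)) a b m n
      = ∑ c, ∑ d, η c * η d * (frameComp B X a b c d * frameComp B Y c d m n) := by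
  have h := congrFun (congrFun (kronecker_conj_mul hK (pairMat X) (pairMat Y)) (a, b)) (m, n)
  rw [kronecker_conj_apply, Matrix.mul_apply] at h
  have h1 : (fun i j k l => (pairMat X * Matrix.kronecker K K * pairMat Y) (i, j) (k, l))
      = fun a b m n => ∑ c, ∑ d, ∑ p, ∑ q, K c p * K d q * (X a b c d * Y p q m n) := by
    funext i j k l
    simp only [Matrix.mul_apply, Matrix.kronecker, Matrix.kroneckerMap_apply, pairMat, Matrix.of_apply,
      Fintype.sum_prod_type, Finset.sum_mul]
    rw [sum_comm_pairs]
    refine Finset.sum_congr rfl fun i _ => Finset.sum_congr rfl fun j _ =>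
      Finset.sum_congr rfl fun k _ => Finset.sum_congr rfl fun l _ => by ring
  rw [h1] at h
  rw [h]
  simp only [Matrix.kronecker, Matrix.diagonal_kronecker_diagonal, Matrix.mul_diagonal,
    Fintype.sum_prod_type]
  refine Finset.sum_congr rfl fun c _ => Finset.sum_congr rfl fun d _ => ?_
  have e1 := kronecker_conj_apply B (pairMat X) (a, b) (c, d)
  have e2 := kronecker_conj_apply B (pairMat Y) (c, d) (m, n)
  simp only [Matrix.kronecker] at e1 e2
  rw [e1, e2]
  simp only [pairMat, Matrix.of_apply]
  ring

/-- A tensor is determined by its components in a basis. -/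
theorem frameComp_injective {B : Matrix (Fin 4) (Fin 4) R} (hB : IsUnit B.det)
    {X Y : Fin 4 → Fin 4 → Fin 4 → Fin 4 → R}
    (h : ∀ a b c d, frameComp B X a b c d = frameComp B Y a b c d) : X = Y := by
  have hinv : B⁻¹ * B = 1 := Matrix.nonsing_inv_mul B hB
  have hk : Matrix.kronecker B⁻¹ B⁻¹ * Matrix.kronecker B B = 1 := by
    simp only [Matrix.kronecker, ← Matrix.mul_kronecker_mul, hinv, Matrix.one_kronecker_one]
  have hk' : (Matrix.kronecker B B).transpose * (Matrix.kronecker B⁻¹ B⁻¹).transpose = 1 := by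
    rw [← Matrix.transpose_mul, hk, Matrix.transpose_one]
  have key : Matrix.kronecker B B * pairMat X * (Matrix.kronecker B B).transpose
      = Matrix.kronecker B B * pairMat Y * (Matrix.kronecker B B).transpose := by
    ext p q
    rw [kronecker_conj_apply, kronecker_conj_apply]
    exact h _ _ _ _
  have h2 := congrArg (fun Z => Matrix.kronecker B⁻¹ B⁻¹ * Z
    * (Matrix.kronecker B⁻¹ B⁻¹).transpose) key
  simp only [← Matrix.mul_assoc, hk, Matrix.one_mul] at h2
  simp only [Matrix.mul_assoc, hk', Matrix.mul_one] at h2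
  funext a b c d
  exact congrFun (congrFun h2 (a, b)) (c, d)

theorem frameComp_add (B : Matrix (Fin 4) (Fin 4) R) (X Y : Fin 4 → Fin 4 → Fin 4 → Fin 4 → R)
    (a b c d : Fin 4) : frameComp B (fun i j k l => X i j k l + Y i j k l) a b c d
      = frameComp B X a b c d + frameComp B Y a b c d := by
  simp only [frameComp, mul_add, Finset.sum_add_distrib]

theorem frameComp_smul (B : Matrix (Fin 4) (Fin 4) R) (s : R)
    (X : Fin 4 → Fin 4 → Fin 4 → Fin 4 → R) (a b c d : Fin 4) :
    frameComp B (fun i j k l => s * X i j k l) a b c d = s * frameComp B X a b c d := by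
  simp only [frameComp, Finset.mul_sum]
  refine Finset.sum_congr rfl fun i _ => Finset.sum_congr rfl fun j _ =>
    Finset.sum_congr rfl fun k _ => Finset.sum_congr rfl fun l _ => by ring

/-- The components of a product of two 2-forms. -/
theorem frameComp_mul (B : Matrix (Fin 4) (Fin 4) R) (S T : Fin 4 → Fin 4 → R)
    (a b c d : Fin 4) : frameComp B (fun i j k l => S i j * T k l) a b c d
      = (∑ i, ∑ j, B a i * B b j * S i j) * ∑ k, ∑ l, B c k * B d l * T k l := by
  simp only [frameComp, Finset.sum_mul, Finset.mul_sum]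
  rw [sum_comm_pairs]
  refine Finset.sum_congr rfl fun i _ => Finset.sum_congr rfl fun j _ =>
    Finset.sum_congr rfl fun k _ => Finset.sum_congr rfl fun l _ => by ring

end

theorem frameComp_map {S : Type*} [CommRing S] {R : Type*} [CommRing R] (φ : R →+* S)
    (B : Matrix (Fin 4) (Fin 4) R) (X : Fin 4 → Fin 4 → Fin 4 → Fin 4 → R) (a b c d : Fin 4) :
    frameComp (B.map φ) (fun i j k l => φ (X i j k l)) a b c d = φ (frameComp B X a b c d) := by
  simp only [frameComp, map_sum, map_mul, Matrix.map_apply]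

theorem CurvatureSymm.frameComp {W : Fin 4 → Fin 4 → Fin 4 → Fin 4 → ℝ} (h : CurvatureSymm W)
    (B : Matrix (Fin 4) (Fin 4) ℝ) : CurvatureSymm (TypeN.frameComp B W) where
  skew_left a b c d := by
    unfold TypeN.frameComp
    rw [Finset.sum_comm, ← Finset.sum_neg_distrib]
    refine Finset.sum_congr rfl fun i _ => ?_
    rw [← Finset.sum_neg_distrib]
    refine Finset.sum_congr rfl fun j _ => ?_
    simp only [← Finset.sum_neg_distrib]
    refine Finset.sum_congr rfl fun k _ => Finset.sum_congr rfl fun l _ => ?_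
    rw [h.skew_left]; ring
  skew_right a b c d := by
    unfold TypeN.frameComp
    simp only [← Finset.sum_neg_distrib]
    refine Finset.sum_congr rfl fun i _ => Finset.sum_congr rfl fun j _ => ?_
    rw [Finset.sum_comm]
    refine Finset.sum_congr rfl fun k _ => Finset.sum_congr rfl fun l _ => ?_
    rw [h.skew_right]; ring
  cyclic a b c d := by
    have e1 : TypeN.frameComp B W a c d b
        = ∑ i, ∑ j, ∑ k, ∑ l, B a i * B b j * B c k * B d l * W i k l j := by
      unfold TypeN.frameComp
      refine Finset.sum_congr rfl fun i _ => ?_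
      have : ∀ x, ∑ y, ∑ z, B a i * B c x * B d y * B b z * W i x y z
          = ∑ z, ∑ y, B a i * B c x * B d y * B b z * W i x y z := fun x => Finset.sum_comm
      simp only [this]
      rw [Finset.sum_comm]
      refine Finset.sum_congr rfl fun j _ => Finset.sum_congr rfl fun k _ =>
        Finset.sum_congr rfl fun l _ => by ring
    have e2 : TypeN.frameComp B W a d b c
        = ∑ i, ∑ j, ∑ k, ∑ l, B a i * B b j * B c k * B d l * W i l j k := by
      unfold TypeN.frameComp
      refine Finset.sum_congr rfl fun i _ => ?_
      rw [Finset.sum_comm]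
      refine Finset.sum_congr rfl fun j _ => ?_
      rw [Finset.sum_comm]
      refine Finset.sum_congr rfl fun k _ => Finset.sum_congr rfl fun l _ => by ring
    rw [e1, e2]
    unfold TypeN.frameComp
    simp only [← Finset.sum_add_distrib]
    refine Finset.sum_eq_zero fun i _ => Finset.sum_eq_zero fun j _ => Finset.sum_eq_zero fun k _ =>
      Finset.sum_eq_zero fun l _ => ?_
    linear_combination B a i * B b j * B c k * B d l * h.cyclic i j k l

/-- The components of the permutation symbol in the basis given by the rows of `B`. -/
theorem frameComp_eps (B : Matrix (Fin 4) (Fin 4) ℝ) (a b c d : Fin 4) :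
    frameComp B eps a b c d = B.det * eps a b c d := by
  have h1 : frameComp B eps a b c d = quad (B a) (B b) (B c) (B d) := by
    rw [quad_sum]
    unfold frameComp
    refine Finset.sum_congr rfl fun i _ => Finset.sum_congr rfl fun j _ =>
      Finset.sum_congr rfl fun k _ => Finset.sum_congr rfl fun l _ => by ring
  have h2 : (Matrix.of fun i j : Fin 4 => if ![a, b, c, d] i = j then (1 : ℝ) else 0) * B
      = Matrix.of ![B a, B b, B c, B d] := by
    ext i j
    rw [Matrix.mul_apply]
    simp only [Matrix.of_apply, ite_mul, one_mul, zero_mul, Finset.sum_ite_eq, Finset.mem_univ,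
      if_true]
    fin_cases i <;> rfl
  have h3 := congrArg Matrix.det h2
  rw [Matrix.det_mul] at h3
  rw [h1, mul_comm]
  exact (det_eq_quad (Matrix.of ![B a, B b, B c, B d])).symm.trans h3.symm

/-! ### The algebraic classification of type N curvature tensors -/

/-- The diagonal entries of the Minkowski metric. -/
def mink : Fin 4 → ℝ := ![-1, 1, 1, 1]

/-- The rows of `B` are an orthonormal basis of the metric `g`. -/
def IsOrthonormal (g B : Matrix (Fin 4) (Fin 4) ℝ) : Prop :=
  B * g * B.transpose = Matrix.diagonal mink

theorem IsOrthonormal.isUnit {g B : Matrix (Fin 4) (Fin 4) ℝ} (h : IsOrthonormal g B) :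
    IsUnit B.det := by
  have h1 := congrArg Matrix.det h
  rw [Matrix.det_mul, Matrix.det_mul, Matrix.det_diagonal, Fin.prod_univ_four] at h1
  refine isUnit_iff_ne_zero.2 fun h0 => ?_
  rw [h0] at h1
  simp [mink] at h1

theorem IsOrthonormal.inv_eq {g B : Matrix (Fin 4) (Fin 4) ℝ} (h : IsOrthonormal g B) :
    g⁻¹ = B.transpose * Matrix.diagonal mink * B := by
  refine Matrix.inv_eq_right_inv ?_
  have hB : B⁻¹ * B = 1 := Matrix.nonsing_inv_mul B h.isUnit
  have hη : Matrix.diagonal mink * Matrix.diagonal mink = 1 := by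
    rw [Matrix.diagonal_mul_diagonal, ← Matrix.diagonal_one]
    congr 1; funext i; fin_cases i <;> simp [mink]
  calc g * (B.transpose * Matrix.diagonal mink * B)
      = B⁻¹ * B * (g * (B.transpose * Matrix.diagonal mink * B)) := by rw [hB, one_mul]
    _ = B⁻¹ * (B * g * B.transpose * Matrix.diagonal mink * B) := by
        simp only [Matrix.mul_assoc]
    _ = 1 := by rw [show B * g * B.transpose = _ from h, hη, one_mul, hB]

theorem IsOrthonormal.abs_det {g B : Matrix (Fin 4) (Fin 4) ℝ} (h : IsOrthonormal g B) :
    (√|g.det| * B.det) * (√|g.det| * B.det) = 1 := by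
  have h1 := congrArg Matrix.det h
  rw [Matrix.det_mul, Matrix.det_mul, Matrix.det_transpose, Matrix.det_diagonal,
    Fin.prod_univ_four] at h1
  simp [mink] at h1
  have h2 := Real.mul_self_sqrt (abs_nonneg g.det)
  have h3 : g.det < 0 := by nlinarith [sq_nonneg B.det, sq_nonneg g.det]
  rw [abs_of_neg h3] at h2 ⊢
  linear_combination B.det ^ 2 * h2 - h1

section

variable {G : CMetric} {V : Set E4} {z : E4} {B : Matrix (Fin 4) (Fin 4) ℝ}

theorem IsOrthonormal.ginv_eq (h : IsOrthonormal (G z) B) (i j : Fin 4) :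
    ginv G z i j = ∑ A, mink A * B A i * B A j := by
  unfold ginv
  rw [h.inv_eq]
  rw [Matrix.mul_apply]
  simp only [Matrix.mul_diagonal, Matrix.transpose_apply]
  exact Finset.sum_congr rfl fun A _ => by ring

theorem IsOrthonormal.ip1_eq (h : IsOrthonormal (G z) B) (v w : Fin 4 → ℝ) :
    ip1 G z v w = ∑ A, mink A * (B.mulVec v A * B.mulVec w A) := by
  simp only [ip1, pairing, sharp, h.ginv_eq, Matrix.mulVec, dotProduct, Fin.sum_univ_four]
  ring

theorem sum_comm_five (F : Fin 4 → Fin 4 → Fin 4 → Fin 4 → Fin 4 → ℝ) :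
    ∑ A, ∑ i, ∑ j, ∑ k, ∑ l, F A i j k l = ∑ j, ∑ l, ∑ A, ∑ i, ∑ k, F A i j k l := by
  have e1 : ∀ A, ∑ i, ∑ j, ∑ k, ∑ l, F A i j k l = ∑ j, ∑ l, ∑ i, ∑ k, F A i j k l := fun A => by
    rw [Finset.sum_comm]
    refine Finset.sum_congr rfl fun j _ => ?_
    have e2 : ∀ i, ∑ k, ∑ l, F A i j k l = ∑ l, ∑ k, F A i j k l := fun i => Finset.sum_comm
    simp only [e2]
    exact Finset.sum_comm
  simp only [e1]
  rw [Finset.sum_comm]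
  exact Finset.sum_congr rfl fun j _ => Finset.sum_comm

theorem IsOrthonormal.frame_ricci (hG : MetricOn G V) (hz : z ∈ V) (h : IsOrthonormal (G z) B)
    (hric : ric G z = 0) (b d : Fin 4) :
    ∑ A, mink A * frameComp B (riemLow G z) A b A d = 0 := by
  have h1 : ∀ j l, ∑ i, ∑ k, ginv G z i k * riemLow G z i j k l = 0 := fun j l => by
    have h2 : ric G z j l = 0 := by rw [hric]; rfl
    unfold ric at h2
    simp only [hG.riem_eq hz] at h2
    rw [Finset.sum_comm, ← h2]
    exact Finset.sum_congr rfl fun k _ => Finset.sum_congr rfl fun i _ => by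
      rw [hG.ginv_symm hz]
  have h3 : ∑ A, mink A * frameComp B (riemLow G z) A b A d
      = ∑ j, ∑ l, B b j * B d l * ∑ i, ∑ k, ginv G z i k * riemLow G z i j k l := by
    have e1 : ∀ j l, B b j * B d l * ∑ i, ∑ k, ginv G z i k * riemLow G z i j k l
        = ∑ A, ∑ i, ∑ k, mink A * (B A i * B b j * B A k * B d l * riemLow G z i j k l) := by
      intro j l
      simp only [h.ginv_eq, Finset.sum_mul, Finset.mul_sum]
      have e2 : ∀ i, ∑ k, ∑ A, B b j * B d l * (mink A * B A i * B A k * riemLow G z i j k l)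
          = ∑ A, ∑ k, B b j * B d l * (mink A * B A i * B A k * riemLow G z i j k l) :=
        fun i => Finset.sum_comm
      simp only [e2]
      rw [Finset.sum_comm]
      refine Finset.sum_congr rfl fun A _ => Finset.sum_congr rfl fun i _ =>
        Finset.sum_congr rfl fun k _ => by ring
    simp only [e1, frameComp, Finset.mul_sum]
    exact sum_comm_five fun A i j k l =>
      mink A * (B A i * B b j * B A k * B d l * riemLow G z i j k l)
  rw [h3]
  exact Finset.sum_eq_zero fun j _ => Finset.sum_eq_zero fun l _ => by rw [h1, mul_zero]

theorem hodge_pointwise (G : CMetric) (F : E4 → Fin 4 → Fin 4 → ℝ) (z : E4) (a b : Fin 4) :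
    hodge G F z a b = hodge G (fun _ => F z) z a b := rfl

theorem hodge_contract (G : CMetric) (z : E4) (W : Fin 4 → Fin 4 → Fin 4 → Fin 4 → ℝ) :
    (fun a b m n => hodge G (fun _ p q => W p q m n) z a b)
      = fun a b m n => (1 / 2) * ∑ c, ∑ d, ∑ p, ∑ q, (G z)⁻¹ c p * (G z)⁻¹ d q *
        (√|(G z).det| * eps a b c d * W p q m n) := by
  funext a b m n
  unfold hodge vol ginv
  congr 1
  refine Finset.sum_congr rfl fun c _ => Finset.sum_congr rfl fun d _ =>
    Finset.sum_congr rfl fun p _ => Finset.sum_congr rfl fun q _ => by ring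

theorem IsOrthonormal.frame_hodge (h : IsOrthonormal (G z) B)
    (W : Fin 4 → Fin 4 → Fin 4 → Fin 4 → ℝ) (a b m n : Fin 4) :
    frameComp B (fun a b m n => hodge G (fun _ p q => W p q m n) z a b) a b m n
      = (1 / 2) * (√|(G z).det| * B.det) * ∑ c, ∑ d, mink c * mink d *
        (eps a b c d * frameComp B W c d m n) := by
  rw [hodge_contract G z W, frameComp_smul, frameComp_contract h.inv_eq, mul_assoc]
  congr 1
  rw [Finset.mul_sum]
  refine Finset.sum_congr rfl fun c _ => ?_
  rw [Finset.mul_sum]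
  refine Finset.sum_congr rfl fun d _ => ?_
  rw [frameComp_smul, frameComp_eps]
  ring

/-- The components of the self-dual Weyl tensor. -/
theorem IsOrthonormal.frame_sdWeyl (h : IsOrthonormal (G z) B) (a b c d : Fin 4) :
    frameComp (B.map Complex.ofRealHom) (sdWeyl G z) a b c d
      = (1 / 2 : ℂ) * (((frameComp B (weyl G z) a b c d : ℝ) : ℂ) - Complex.I *
        (((1 / 2) * (√|(G z).det| * B.det) * ∑ m, ∑ n, mink m * mink n *
          (eps a b m n * frameComp B (weyl G z) m n c d) : ℝ) : ℂ)) := by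
  have h1 : sdWeyl G z = fun a b c d => (1 / 2 : ℂ) * (Complex.ofRealHom (weyl G z a b c d)
      + (-Complex.I) * Complex.ofRealHom
        ((fun a b c d => hodge G (fun _ p q => weyl G z p q c d) z a b) a b c d)) := by
    funext a b c d
    unfold sdWeyl
    simp only [Complex.ofRealHom_eq_coe]
    rw [hodge_pointwise]; ring
  rw [h1, frameComp_smul, frameComp_add, frameComp_smul, frameComp_map, frameComp_map,
    h.frame_hodge]
  simp only [Complex.ofRealHom_eq_coe]
  ring

/-- The condition `𝒲² = 0` in components with respect to an orthonormal basis. -/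
theorem IsOrthonormal.frame_sdWeylSq (h : IsOrthonormal (G z) B) (h0 : sdWeylSq G z = 0)
    (a b m n : Fin 4) :
    ∑ c, ∑ d, (mink c : ℂ) * (mink d : ℂ) *
      (frameComp (B.map Complex.ofRealHom) (sdWeyl G z) a b c d
        * frameComp (B.map Complex.ofRealHom) (sdWeyl G z) c d m n) = 0 := by
  have hK : (G z)⁻¹.map Complex.ofRealHom = (B.map Complex.ofRealHom).transpose
      * Matrix.diagonal (fun i => (mink i : ℂ)) * B.map Complex.ofRealHom := by
    rw [h.inv_eq, Matrix.map_mul, Matrix.map_mul, Matrix.transpose_map, Matrix.diagonal_map (by simp)]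
    rfl
  rw [← frameComp_contract hK]
  have h1 : (fun a b m n => ∑ c, ∑ d, ∑ p, ∑ q, (G z)⁻¹.map Complex.ofRealHom c p
      * (G z)⁻¹.map Complex.ofRealHom d q * (sdWeyl G z a b c d * sdWeyl G z p q m n))
      = fun a b m n => (2 : ℂ) * sdWeylSq G z a b m n := by
    funext a b m n
    unfold sdWeylSq ginv
    rw [← mul_assoc]
    norm_num
  rw [h1, frameComp_smul, h0]
  simp [frameComp]

end

/-- The spatial pairs of indices dual to the pairs `(0, 1)`, `(0, 2)`, `(0, 3)`. -/
def dp₁ : Fin 3 → Fin 4 := ![2, 3, 1]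
/-- See `dp₁`. -/
def dp₂ : Fin 3 → Fin 4 := ![3, 1, 2]

/-- A skew tensor is determined by its six components over the pairs `(0, i)` and their duals. -/
theorem skew_eq_zero {f : Fin 4 → Fin 4 → ℝ} (hf : ∀ i j, f i j = - f j i)
    (h0 : ∀ i : Fin 3, f 0 i.succ = 0) (h1 : ∀ i, f (dp₁ i) (dp₂ i) = 0) (i j : Fin 4) :
    f i j = 0 := by
  have hd : ∀ i, f i i = 0 := fun i => by linarith [hf i i]
  have a1 : f 0 1 = 0 := h0 0
  have a2 : f 0 2 = 0 := h0 1
  have a3 : f 0 3 = 0 := h0 2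
  have b1 : f 2 3 = 0 := h1 0
  have b2 : f 3 1 = 0 := h1 1
  have b3 : f 1 2 = 0 := h1 2
  have c1 := hf 1 0
  have c2 := hf 2 0
  have c3 := hf 3 0
  have d1 := hf 3 2
  have d2 := hf 1 3
  have d3 := hf 2 1
  rw [a1] at c1; rw [a2] at c2; rw [a3] at c3; rw [b1] at d1; rw [b2] at d2; rw [b3] at d3
  fin_cases i <;> fin_cases j <;> first
    | exact hd _ | exact a1 | exact a2 | exact a3 | exact b1 | exact b2 | exact b3
    | simpa using c1 | simpa using c2 | simpa using c3
    | simpa using d1 | simpa using d2 | simpa using d3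

/-- A double contraction of 2-forms in an orthonormal basis. -/
theorem sum_skew_mul {S T : Fin 4 → Fin 4 → ℂ} (hS : ∀ i j, S i j = - S j i)
    (hT : ∀ i j, T i j = - T j i) :
    ∑ c, ∑ d, (mink c : ℂ) * (mink d : ℂ) * (S c d * T c d)
      = 2 * ∑ k : Fin 3, (S (dp₁ k) (dp₂ k) * T (dp₁ k) (dp₂ k) - S 0 k.succ * T 0 k.succ) := by
  have hd : ∀ i, S i i = 0 := fun i => by
    have := hS i i
    linear_combination (1 / 2) * this
  simp only [Fin.sum_univ_four, Fin.sum_univ_three, hd, mink, dp₁, dp₂]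
  rw [hS 1 0, hS 2 0, hS 3 0, hT 1 0, hT 2 0, hT 3 0, hS 3 2, hT 3 2, hS 1 3, hT 1 3, hS 2 1,
    hT 2 1]
  simp
  ring

/-- The dual of a 2-form in an orthonormal basis. -/
theorem sum_eps_mul {f : Fin 4 → Fin 4 → ℝ} (hf : ∀ i j, f i j = - f j i) (k : Fin 3) :
    (1 / 2) * ∑ c, ∑ d, mink c * mink d * (eps 0 k.succ c d * f c d) = f (dp₁ k) (dp₂ k) ∧
    (1 / 2) * ∑ c, ∑ d, mink c * mink d * (eps (dp₁ k) (dp₂ k) c d * f c d) = - f 0 k.succ := by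
  have e : ∀ a b c d, eps a b c d = quad (fun j => if a = j then 1 else 0)
      (fun j => if b = j then 1 else 0) (fun j => if c = j then 1 else 0)
      (fun j => if d = j then 1 else 0) := fun a b c d => by
    unfold eps; rw [det_eq_quad]; rfl
  fin_cases k
  · have h1 := hf 3 2
    have h2 := hf 1 0
    constructor <;> simp [Fin.sum_univ_four, e, quad, mink, dp₁, dp₂] <;> linarith
  · have h1 := hf 1 3
    have h2 := hf 2 0
    constructor <;> simp [Fin.sum_univ_four, e, quad, mink, dp₁, dp₂] <;> linarith
  · have h1 := hf 2 1
    have h2 := hf 3 0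
    constructor <;> simp [Fin.sum_univ_four, e, quad, mink, dp₁, dp₂] <;> linarith

/-- In an orthonormal basis, a trace-free curvature tensor is given by two symmetric matrices. -/
theorem CurvatureSymm.vacuum {w : Fin 4 → Fin 4 → Fin 4 → Fin 4 → ℝ} (h : CurvatureSymm w)
    (ht : ∀ b d, ∑ A, mink A * w A b A d = 0) (i j : Fin 3) :
    w (dp₁ i) (dp₂ i) (dp₁ j) (dp₂ j) = - w 0 i.succ 0 j.succ ∧
    w 0 i.succ (dp₁ j) (dp₂ j) = w 0 j.succ (dp₁ i) (dp₂ i) := by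
  have hd₁ : ∀ a c d, w a a c d = 0 := fun a c d => by linarith [h.skew_left a a c d]
  have hd₂ : ∀ a b c, w a b c c = 0 := fun a b c => by linarith [h.skew_right a b c c]
  have ht' : ∀ b d, - w 0 b 0 d + w 1 b 1 d + w 2 b 2 d + w 3 b 3 d = 0 := fun b d => by
    have := ht b d
    simp only [Fin.sum_univ_four, mink] at this
    simp at this
    linarith
  -- ordering the indices within each pair, and then the pairs
  have o1 : ∀ c d, w 1 0 c d = - w 0 1 c d ∧ w 2 0 c d = - w 0 2 c d ∧ w 3 0 c d = - w 0 3 c d ∧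
      w 3 2 c d = - w 2 3 c d ∧ w 1 3 c d = - w 3 1 c d ∧ w 2 1 c d = - w 1 2 c d := fun c d =>
    ⟨h.skew_left _ _ _ _, h.skew_left _ _ _ _, h.skew_left _ _ _ _, h.skew_left _ _ _ _,
      h.skew_left _ _ _ _, h.skew_left _ _ _ _⟩
  have o2 : ∀ a b, w a b 1 0 = - w a b 0 1 ∧ w a b 2 0 = - w a b 0 2 ∧ w a b 3 0 = - w a b 0 3 ∧
      w a b 3 2 = - w a b 2 3 ∧ w a b 1 3 = - w a b 3 1 ∧ w a b 2 1 = - w a b 1 2 := fun a b =>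
    ⟨h.skew_right _ _ _ _, h.skew_right _ _ _ _, h.skew_right _ _ _ _, h.skew_right _ _ _ _,
      h.skew_right _ _ _ _, h.skew_right _ _ _ _⟩
  have p1 := h.pair 2 3 3 1
  have p2 := h.pair 2 3 1 2
  have p3 := h.pair 3 1 1 2
  have p4 := h.pair 0 1 0 2
  have p5 := h.pair 0 1 0 3
  have p6 := h.pair 0 2 0 3
  have t00 := ht' 0 0
  have t01 := ht' 0 1
  have t02 := ht' 0 2
  have t03 := ht' 0 3
  have t11 := ht' 1 1
  have t12 := ht' 1 2
  have t13 := ht' 1 3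
  have t22 := ht' 2 2
  have t23 := ht' 2 3
  have t33 := ht' 3 3
  simp only [hd₁, hd₂, o1, o2] at t00 t01 t02 t03 t11 t12 t13 t22 t23 t33
  fin_cases i <;> fin_cases j <;> refine ⟨?_, ?_⟩ <;> simp [dp₁, dp₂] <;> linarith

/-- The two symmetric matrices of a trace-free curvature tensor are trace-free: for the second one
this is the first Bianchi identity. -/
theorem CurvatureSymm.vacuum_trace {w : Fin 4 → Fin 4 → Fin 4 → Fin 4 → ℝ} (h : CurvatureSymm w)
    (ht : ∀ b d, ∑ A, mink A * w A b A d = 0) :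
    ∑ i : Fin 3, w 0 i.succ 0 i.succ = 0 ∧ ∑ i : Fin 3, w 0 i.succ (dp₁ i) (dp₂ i) = 0 := by
  have h00 := ht 0 0
  simp only [Fin.sum_univ_four, mink] at h00
  simp at h00
  have hd : w 0 0 0 0 = 0 := by linarith [h.skew_left 0 0 0 0]
  constructor
  · simp only [Fin.sum_univ_three]
    change w 0 1 0 1 + w 0 2 0 2 + w 0 3 0 3 = 0
    linarith [h.skew_left 1 0 1 0, h.skew_right 0 1 1 0, h.skew_left 2 0 2 0, h.skew_right 0 2 2 0,
      h.skew_left 3 0 3 0, h.skew_right 0 3 3 0]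
  · simp only [Fin.sum_univ_three]
    exact h.cyclic 0 1 2 3

/-- A symmetric trace-free matrix of order three with square zero has rank at most one. -/
theorem exists_eq_mul_of_sq_zero {Q : Fin 3 → Fin 3 → ℂ} (hs : ∀ i j, Q i j = Q j i)
    (ht : ∑ i, Q i i = 0) (h2 : ∀ i j, ∑ k, Q i k * Q k j = 0) :
    ∃ q : Fin 3 → ℂ, ∀ i j, Q i j = q i * q j := by
  simp only [Fin.sum_univ_three] at ht h2
  have s1 := hs 1 0
  have s2 := hs 2 0
  have s3 := hs 2 1
  -- by the Cayley-Hamilton theorem the adjugate matrix vanishes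
  have minor : ∀ k i j, Q k k * Q i j = Q i k * Q j k := by
    have h00 := h2 0 0
    have h01 := h2 0 1
    have h02 := h2 0 2
    have h11 := h2 1 1
    have h12 := h2 1 2
    have h22 := h2 2 2
    rw [s1, s2] at h00
    rw [s3] at h01
    rw [s1] at h11
    rw [s3] at h11
    rw [s1] at h12
    rw [s2, s3] at h22
    have m1 : Q 0 0 * Q 1 1 = Q 0 1 * Q 0 1 := by
      linear_combination (1 / 2) * (Q 0 0 + Q 1 1 - Q 2 2) * ht
        - (1 / 2) * (h00 + h11 - h22)
    have m2 : Q 0 0 * Q 2 2 = Q 0 2 * Q 0 2 := by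
      linear_combination (1 / 2) * (Q 0 0 + Q 2 2 - Q 1 1) * ht
        - (1 / 2) * (h00 + h22 - h11)
    have m3 : Q 1 1 * Q 2 2 = Q 1 2 * Q 1 2 := by
      linear_combination (1 / 2) * (Q 1 1 + Q 2 2 - Q 0 0) * ht
        - (1 / 2) * (h11 + h22 - h00)
    have m4 : Q 0 0 * Q 1 2 = Q 0 1 * Q 0 2 := by linear_combination Q 1 2 * ht - h12
    have m5 : Q 1 1 * Q 0 2 = Q 0 1 * Q 1 2 := by linear_combination Q 0 2 * ht - h02
    have m6 : Q 2 2 * Q 0 1 = Q 0 2 * Q 1 2 := by linear_combination Q 0 1 * ht - h01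
    intro k i j
    fin_cases k <;> fin_cases i <;> fin_cases j <;> simp [s1, s2, s3] <;>
      first
      | ring1 | linear_combination m1 | linear_combination m2 | linear_combination m3
      | linear_combination m4 | linear_combination m5 | linear_combination m6
  by_cases hk : ∃ k, Q k k ≠ 0
  · obtain ⟨k, hk⟩ := hk
    obtain ⟨s, hs'⟩ := IsAlgClosed.exists_pow_nat_eq (Q k k) (n := 2) (by norm_num)
    have hs0 : s ≠ 0 := fun h => hk (by rw [← hs', h]; ring)
    refine ⟨fun i => Q i k / s, fun i j => ?_⟩
    rw [div_mul_div_comm, ← minor k i j, ← sq, hs', mul_div_cancel_left₀ _ hk]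
  · push Not at hk
    refine ⟨0, fun i j => ?_⟩
    have h1 := minor i j j
    rw [hk i, zero_mul] at h1
    have h3 := mul_self_eq_zero.1 h1.symm
    rw [hs i j, h3]; simp

/-- The null tetrad of an orthonormal basis that is adapted to two orthogonal spatial vectors of
equal length. -/
theorem exists_tetrad {u v : Fin 3 → ℝ} {r σ : ℝ} (hr : r ≠ 0) (hσ : σ * σ = 1)
    (huu : ∑ i, u i * u i = r ^ 2) (hvv : ∑ i, v i * v i = r ^ 2) (huv : ∑ i, u i * v i = 0) :
    ∃ l n e f : Fin 4 → ℝ,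
      (∑ A, mink A * (l A * l A) = 0 ∧ ∑ A, mink A * (l A * n A) = -1 ∧
        ∑ A, mink A * (l A * e A) = 0 ∧ ∑ A, mink A * (l A * f A) = 0 ∧
        ∑ A, mink A * (n A * n A) = 0 ∧ ∑ A, mink A * (n A * e A) = 0 ∧
        ∑ A, mink A * (n A * f A) = 0 ∧ ∑ A, mink A * (e A * e A) = 1 ∧
        ∑ A, mink A * (e A * f A) = 0 ∧ ∑ A, mink A * (f A * f A) = 1) ∧
      (∀ i, wedge l e 0 i.succ = u i) ∧ (∀ i, wedge l f 0 i.succ = v i) ∧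
      (∀ i, wedge l e (dp₁ i) (dp₂ i) = - σ * v i) ∧
      ∀ i, wedge l f (dp₁ i) (dp₂ i) = σ * u i := by
  simp only [Fin.sum_univ_three] at huu hvv huv
  -- the vector product of `u` and `v`
  obtain ⟨c0, h0⟩ : ∃ c, c = u 1 * v 2 - u 2 * v 1 := ⟨_, rfl⟩
  obtain ⟨c1, h1⟩ : ∃ c, c = u 2 * v 0 - u 0 * v 2 := ⟨_, rfl⟩
  obtain ⟨c2, h2⟩ : ∃ c, c = u 0 * v 1 - u 1 * v 0 := ⟨_, rfl⟩
  have hcc : c0 * c0 + c1 * c1 + c2 * c2 = r ^ 4 := by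
    rw [h0, h1, h2]
    linear_combination (v 0 * v 0 + v 1 * v 1 + v 2 * v 2) * huu + r ^ 2 * hvv
      - (u 0 * v 0 + u 1 * v 1 + u 2 * v 2) * huv
  have hcu : c0 * u 0 + c1 * u 1 + c2 * u 2 = 0 := by rw [h0, h1, h2]; ring
  have hcv : c0 * v 0 + c1 * v 1 + c2 * v 2 = 0 := by rw [h0, h1, h2]; ring
  have u0 : c1 * u 2 - u 1 * c2 = r ^ 2 * v 0 := by
    rw [h1, h2]; linear_combination v 0 * huu - u 0 * huv
  have u1 : c2 * u 0 - u 2 * c0 = r ^ 2 * v 1 := by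
    rw [h2, h0]; linear_combination v 1 * huu - u 1 * huv
  have u2 : c0 * u 1 - u 0 * c1 = r ^ 2 * v 2 := by
    rw [h0, h1]; linear_combination v 2 * huu - u 2 * huv
  have v0 : c1 * v 2 - v 1 * c2 = - r ^ 2 * u 0 := by
    rw [h1, h2]; linear_combination v 0 * huv - u 0 * hvv
  have v1 : c2 * v 0 - v 2 * c0 = - r ^ 2 * u 1 := by
    rw [h2, h0]; linear_combination v 1 * huv - u 1 * hvv
  have v2 : c0 * v 1 - v 0 * c1 = - r ^ 2 * u 2 := by
    rw [h0, h1]; linear_combination v 2 * huv - u 2 * hvv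
  clear h0 h1 h2
  refine ⟨![r, -σ * c0 / r, -σ * c1 / r, -σ * c2 / r],
    ![1 / (2 * r), σ * c0 / (2 * r ^ 3), σ * c1 / (2 * r ^ 3), σ * c2 / (2 * r ^ 3)],
    ![0, u 0 / r, u 1 / r, u 2 / r], ![0, v 0 / r, v 1 / r, v 2 / r],
    ⟨?_, ?_, ?_, ?_, ?_, ?_, ?_, ?_, ?_, ?_⟩, ?_, ?_, ?_, ?_⟩
  · simp [Fin.sum_univ_four, mink]
    field_simp
    linear_combination σ * σ * hcc + r ^ 4 * hσ
  · simp [Fin.sum_univ_four, mink]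
    field_simp
    linear_combination - (σ * σ) * hcc - r ^ 4 * hσ
  · simp [Fin.sum_univ_four, mink]
    field_simp
    linear_combination - σ * hcu
  · simp [Fin.sum_univ_four, mink]
    field_simp
    linear_combination - σ * hcv
  · simp [Fin.sum_univ_four, mink]
    field_simp
    linear_combination σ * σ * hcc + r ^ 4 * hσ
  · simp [Fin.sum_univ_four, mink]
    field_simp
    linear_combination σ * hcu
  · simp [Fin.sum_univ_four, mink]
    field_simp
    linear_combination σ * hcv
  · simp [Fin.sum_univ_four, mink]
    field_simp
    linear_combination huu
  · simp [Fin.sum_univ_four, mink]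
    field_simp
    linear_combination huv
  · simp [Fin.sum_univ_four, mink]
    field_simp
    linear_combination hvv
  · intro i
    fin_cases i <;> simp [wedge] <;> field_simp
  · intro i
    fin_cases i <;> simp [wedge] <;> field_simp
  · intro i
    fin_cases i <;> simp [wedge, dp₁, dp₂] <;> field_simp
    · linear_combination - σ * u0
    · linear_combination - σ * u1
    · linear_combination - σ * u2
  · intro i
    fin_cases i <;> simp [wedge, dp₁, dp₂] <;> field_simp
    · linear_combination - σ * v0
    · linear_combination - σ * v1
    · linear_combination - σ * v2

theorem eps_skew (a b c d : Fin 4) : eps a b c d = - eps b a c d := by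
  have e : ∀ a b c d, eps a b c d = quad (fun j => if a = j then 1 else 0)
      (fun j => if b = j then 1 else 0) (fun j => if c = j then 1 else 0)
      (fun j => if d = j then 1 else 0) := fun a b c d => by
    unfold eps; rw [det_eq_quad]; rfl
  rw [e, e]
  unfold quad
  ring

/-- In a vacuum, `𝒲² = 0` says that a symmetric trace-free complex matrix of order three has
square zero. -/
theorem sq_zero_of_frame {w : Fin 4 → Fin 4 → Fin 4 → Fin 4 → ℝ} (hw : CurvatureSymm w)
    (ht : ∀ b d, ∑ A, mink A * w A b A d = 0) {σ : ℝ} (hσ : σ * σ = 1)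
    {Z : Fin 4 → Fin 4 → Fin 4 → Fin 4 → ℂ}
    (hZ : ∀ a b c d, Z a b c d = (1 / 2 : ℂ) * ((w a b c d : ℂ) - Complex.I *
        (((1 / 2) * σ * ∑ m, ∑ n, mink m * mink n * (eps a b m n * w m n c d) : ℝ) : ℂ)))
    (h0 : ∀ a b m n, ∑ c, ∑ d, (mink c : ℂ) * (mink d : ℂ) * (Z a b c d * Z c d m n) = 0)
    (i j : Fin 3) :
    ∑ k : Fin 3, ((w 0 i.succ 0 k.succ : ℂ) - Complex.I * (σ * w 0 i.succ (dp₁ k) (dp₂ k) : ℝ))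
      * ((w 0 k.succ 0 j.succ : ℂ) - Complex.I * (σ * w 0 k.succ (dp₁ j) (dp₂ j) : ℝ)) = 0 := by
  have hI := Complex.I_mul_I
  have hσ' : (σ : ℂ) * σ = 1 := by rw [← Complex.ofReal_mul, hσ, Complex.ofReal_one]
  have skR : ∀ a b c d, Z a b c d = - Z a b d c := fun a b c d => by
    rw [hZ, hZ, hw.skew_right a b c d]
    have : ∀ m n, w m n c d = - w m n d c := fun m n => hw.skew_right m n c d
    simp only [this, mul_neg, Finset.sum_neg_distrib, Complex.ofReal_neg]
    ring
  have skL : ∀ a b c d, Z a b c d = - Z b a c d := fun a b c d => by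
    rw [hZ, hZ, hw.skew_left a b c d]
    have : ∀ m n, eps a b m n = - eps b a m n := fun m n => eps_skew a b m n
    simp only [this, neg_mul, mul_neg, Finset.sum_neg_distrib, Complex.ofReal_neg]
    ring
  -- the components of `Z` over the pairs `(0, k)` and over the dual pairs differ by a factor `±i`
  have Z1 : ∀ (k : Fin 3) c d, Z 0 k.succ c d
      = (1 / 2 : ℂ) * ((w 0 k.succ c d : ℂ) - Complex.I * (σ * w (dp₁ k) (dp₂ k) c d : ℝ)) := by
    intro k c d
    rw [hZ, ← (sum_eps_mul (f := fun m n => w m n c d) (fun m n => hw.skew_left m n c d) k).1]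
    push_cast; ring
  have Z2 : ∀ (k : Fin 3) c d, Z (dp₁ k) (dp₂ k) c d
      = (1 / 2 : ℂ) * ((w (dp₁ k) (dp₂ k) c d : ℂ) + Complex.I * (σ * w 0 k.succ c d : ℝ)) := by
    intro k c d
    have h := (sum_eps_mul (f := fun m n => w m n c d) (fun m n => hw.skew_left m n c d) k).2
    rw [hZ, show w 0 k.succ c d = -(-w 0 k.succ c d) by ring, ← h]
    push_cast; ring
  have hv := fun i j => hw.vacuum ht i j
  have q1 : ∀ i k : Fin 3, Z 0 i.succ 0 k.succ = (1 / 2 : ℂ) * ((w 0 i.succ 0 k.succ : ℂ)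
      - Complex.I * (σ * w 0 i.succ (dp₁ k) (dp₂ k) : ℝ)) := fun i k => by
    rw [Z1, hw.pair (dp₁ i), (hv k i).2]
  have q2 : ∀ i k : Fin 3, Z 0 i.succ (dp₁ k) (dp₂ k) = (1 / 2 : ℂ) * (Complex.I * σ)
      * ((w 0 i.succ 0 k.succ : ℂ) - Complex.I * (σ * w 0 i.succ (dp₁ k) (dp₂ k) : ℝ)) :=
    fun i k => by
      rw [Z1, (hv i k).1]
      push_cast
      linear_combination (1 / 2) * (w 0 i.succ (dp₁ k) (dp₂ k) : ℂ) * (σ * σ) * hI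
        - (1 / 2) * (w 0 i.succ (dp₁ k) (dp₂ k) : ℂ) * hσ'
  have q3 : ∀ k j : Fin 3, Z (dp₁ k) (dp₂ k) 0 j.succ = (1 / 2 : ℂ) * (Complex.I * σ)
      * ((w 0 k.succ 0 j.succ : ℂ) - Complex.I * (σ * w 0 k.succ (dp₁ j) (dp₂ j) : ℝ)) :=
    fun k j => by
      rw [Z2, hw.pair (dp₁ k), (hv j k).2]
      push_cast
      linear_combination (1 / 2) * (w 0 k.succ (dp₁ j) (dp₂ j) : ℂ) * (σ * σ) * hI
        - (1 / 2) * (w 0 k.succ (dp₁ j) (dp₂ j) : ℂ) * hσ'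
  have h1 := h0 0 i.succ 0 j.succ
  rw [sum_skew_mul (fun c d => skR _ _ c d) (fun c d => skL c d _ _)] at h1
  simp only [q1, q2, q3] at h1
  have h2 := (mul_eq_zero.1 h1).resolve_left two_ne_zero
  rw [← mul_right_inj' (show (-(1 / 2) : ℂ) ≠ 0 by norm_num), mul_zero, ← h2, Finset.mul_sum]
  refine Finset.sum_congr rfl fun k _ => ?_
  generalize ((w 0 i.succ 0 k.succ : ℂ) - Complex.I * (σ * w 0 i.succ (dp₁ k) (dp₂ k) : ℝ)) = X
  generalize ((w 0 k.succ 0 j.succ : ℂ) - Complex.I * (σ * w 0 k.succ (dp₁ j) (dp₂ j) : ℝ)) = Y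
  linear_combination - (1 / 4) * X * Y * (σ * σ) * hI + (1 / 4) * X * Y * hσ'

/-- A tensor that is skew in two pairs of indices is determined by six components in each pair. -/
theorem tensor_eq_of_pairs {X Y : Fin 4 → Fin 4 → Fin 4 → Fin 4 → ℝ}
    (hX : ∀ a b c d, X a b c d = - X b a c d ∧ X a b c d = - X a b d c)
    (hY : ∀ a b c d, Y a b c d = - Y b a c d ∧ Y a b c d = - Y a b d c)
    (h1 : ∀ i j : Fin 3, X 0 i.succ 0 j.succ = Y 0 i.succ 0 j.succ)
    (h2 : ∀ i j : Fin 3, X 0 i.succ (dp₁ j) (dp₂ j) = Y 0 i.succ (dp₁ j) (dp₂ j))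
    (h3 : ∀ i j : Fin 3, X (dp₁ i) (dp₂ i) 0 j.succ = Y (dp₁ i) (dp₂ i) 0 j.succ)
    (h4 : ∀ i j : Fin 3, X (dp₁ i) (dp₂ i) (dp₁ j) (dp₂ j) = Y (dp₁ i) (dp₂ i) (dp₁ j) (dp₂ j))
    (a b c d : Fin 4) : X a b c d = Y a b c d := by
  have k1 : ∀ (i : Fin 3) c d, X 0 i.succ c d - Y 0 i.succ c d = 0 := fun i =>
    skew_eq_zero (f := fun c d => X 0 i.succ c d - Y 0 i.succ c d)
      (fun c d => by linarith [(hX 0 i.succ c d).2, (hY 0 i.succ c d).2])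
      (fun j => sub_eq_zero.2 (h1 i j)) (fun j => sub_eq_zero.2 (h2 i j))
  have k2 : ∀ (i : Fin 3) c d, X (dp₁ i) (dp₂ i) c d - Y (dp₁ i) (dp₂ i) c d = 0 := fun i =>
    skew_eq_zero (f := fun c d => X (dp₁ i) (dp₂ i) c d - Y (dp₁ i) (dp₂ i) c d)
      (fun c d => by linarith [(hX (dp₁ i) (dp₂ i) c d).2, (hY (dp₁ i) (dp₂ i) c d).2])
      (fun j => sub_eq_zero.2 (h3 i j)) (fun j => sub_eq_zero.2 (h4 i j))
  exact sub_eq_zero.1 (skew_eq_zero (f := fun a b => X a b c d - Y a b c d)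
    (fun a b => by linarith [(hX a b c d).1, (hY a b c d).1])
    (fun i => k1 i c d) (fun i => k2 i c d) a b)

/-- The canonical form of a vacuum type N curvature tensor at a point. -/
theorem exists_nullProducts_of_typeN {G : CMetric} {V : Set E4} (hG : MetricOn G V) {z : E4}
    (hz : z ∈ V) (hric : ric G z = 0) (hN : TypeNAt G z) :
    ∃ l n e f, NullProducts G z l n e f ∧ ∀ a b c d,
      weyl G z a b c d = wedge l e a b * wedge l e c d - wedge l f a b * wedge l f c d := by
  obtain ⟨B, hB⟩ := hG.lor z hz
  have h : IsOrthonormal (G z) B := hB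
  have hRW : riemLow G z = weyl G z := Fund.riemLow_eq_weyl hric
  set w := frameComp B (weyl G z) with hw'
  have hw : CurvatureSymm w := by
    have := (hG.curvatureSymm hz).frameComp B
    rwa [hRW] at this
  have ht : ∀ b d, ∑ A, mink A * w A b A d = 0 := fun b d => by
    have := h.frame_ricci hG hz hric b d
    rwa [hRW] at this
  obtain ⟨σ, hσ'⟩ : ∃ σ, σ = √|(G z).det| * B.det := ⟨_, rfl⟩
  have hσ : σ * σ = 1 := by rw [hσ']; exact h.abs_det
  have hsq := sq_zero_of_frame hw ht hσ
    (Z := frameComp (B.map Complex.ofRealHom) (sdWeyl G z))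
    (fun a b c d => by rw [hσ']; exact h.frame_sdWeyl a b c d) (h.frame_sdWeylSq hN.2)
  obtain ⟨htr, htr'⟩ := hw.vacuum_trace ht
  have hv := fun i j => hw.vacuum ht i j
  -- the electric and the magnetic part of the curvature, as one complex matrix
  set Q : Fin 3 → Fin 3 → ℂ := fun i k => (w 0 i.succ 0 k.succ : ℂ)
    - Complex.I * (σ * w 0 i.succ (dp₁ k) (dp₂ k) : ℝ) with hQ
  have hQre : ∀ i k, (Q i k).re = w 0 i.succ 0 k.succ := fun i k => by simp [hQ]
  have hQim : ∀ i k, (Q i k).im = - (σ * w 0 i.succ (dp₁ k) (dp₂ k)) := fun i k => by simp [hQ]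
  obtain ⟨q, hq⟩ := exists_eq_mul_of_sq_zero (Q := Q)
    (fun i j => by simp only [hQ]; rw [hw.pair 0 i.succ 0 j.succ, (hv j i).2])
    (by
      simp only [hQ, Finset.sum_sub_distrib, ← Finset.mul_sum]
      rw [← Complex.ofReal_sum, ← Complex.ofReal_sum, ← Finset.mul_sum, htr, htr']
      simp) hsq
  -- `Q = q ⊗ q` with `q = u + i v` isotropic: `u` and `v` are orthogonal and of equal length
  set u : Fin 3 → ℝ := fun i => (q i).re with hu
  set v : Fin 3 → ℝ := fun i => (q i).im with hv'
  have hE : ∀ i j, w 0 i.succ 0 j.succ = u i * u j - v i * v j := fun i j => by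
    rw [← hQre, hq, Complex.mul_re]
  have hK : ∀ i j, w 0 i.succ (dp₁ j) (dp₂ j) = - σ * (u i * v j + v i * u j) := fun i j => by
    have h1 : (Q i j).im = u i * v j + v i * u j := by rw [hq, Complex.mul_im]
    rw [hQim] at h1
    linear_combination - (w 0 i.succ (dp₁ j) (dp₂ j)) * hσ - σ * h1
  simp only [hE, Finset.sum_sub_distrib] at htr
  have huv : ∑ i, u i * v i = 0 := by
    simp only [hK] at htr'
    rw [← Finset.mul_sum, Finset.sum_add_distrib] at htr'
    have hσ0 : -σ ≠ 0 := fun h0 => by rw [neg_eq_zero.1 h0] at hσ; norm_num at hσ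
    have h1 := (mul_eq_zero.1 htr').resolve_left hσ0
    have h2 : ∑ i, v i * u i = ∑ i, u i * v i := Finset.sum_congr rfl fun i _ => mul_comm _ _
    linarith
  have huu0 : 0 ≤ ∑ i, u i * u i := Finset.sum_nonneg fun i _ => mul_self_nonneg _
  have skw : ∀ a b c d, w a b c d = - w b a c d ∧ w a b c d = - w a b d c := fun a b c d =>
    ⟨hw.skew_left a b c d, hw.skew_right a b c d⟩
  have hr : ∑ i, u i * u i ≠ 0 := by
    intro h0
    have u0 : ∀ i, u i = 0 := fun i => mul_self_eq_zero.1
      ((Finset.sum_eq_zero_iff_of_nonneg fun i _ => mul_self_nonneg _).1 h0 i (Finset.mem_univ i))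
    have v0 : ∀ i, v i = 0 := fun i => mul_self_eq_zero.1
      ((Finset.sum_eq_zero_iff_of_nonneg fun i _ => mul_self_nonneg _).1 (by linarith) i
        (Finset.mem_univ i))
    refine hN.1 (frameComp_injective (Y := 0) h.isUnit fun a b c d => ?_)
    have h1 := tensor_eq_of_pairs (X := w) (Y := fun _ _ _ _ => 0) skw (by simp)
      (fun i j => by rw [hE, u0, v0]; simp) (fun i j => by rw [hK]; simp [u0, v0])
      (fun i j => by rw [hw.pair, hK]; simp [u0, v0])
      (fun i j => by rw [(hv i j).1, hE, u0, v0]; simp) a b c d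
    rw [← hw', h1]
    simp [frameComp]
  have hrs : √(∑ i, u i * u i) ^ 2 = ∑ i, u i * u i := Real.sq_sqrt huu0
  obtain ⟨l, n, e, f, ⟨ll, ln, le, lf, nn, ne, nf, ee, ef, ff⟩, w1, w2, w3, w4⟩ :=
    exists_tetrad (r := √(∑ i, u i * u i)) (σ := σ) (by
      intro h0; rw [h0] at hrs; exact hr (by rw [← hrs]; norm_num)) hσ hrs.symm
      (by rw [hrs]; linarith) huv
  have hBi : ∀ x, B.mulVec (B⁻¹.mulVec x) = x := fun x => by
    rw [Matrix.mulVec_mulVec, Matrix.mul_nonsing_inv B h.isUnit, Matrix.one_mulVec]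
  have ip : ∀ x y, ip1 G z (B⁻¹.mulVec x) (B⁻¹.mulVec y) = ∑ A, mink A * (x A * y A) :=
    fun x y => by rw [h.ip1_eq, hBi, hBi]
  have sy : ∀ x y : Fin 4 → ℝ, ∑ A, mink A * (x A * y A) = ∑ A, mink A * (y A * x A) :=
    fun x y => Finset.sum_congr rfl fun A _ => by rw [mul_comm (x A)]
  refine ⟨B⁻¹.mulVec l, B⁻¹.mulVec n, B⁻¹.mulVec e, B⁻¹.mulVec f, ?_, ?_⟩
  · constructor <;> rw [ip]
    exacts [ll, ln, le, lf, by rw [sy, ln], nn, ne, nf, by rw [sy, le], by rw [sy, ne], ee, ef,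
      by rw [sy, lf], by rw [sy, nf], by rw [sy, ef], ff]
  · have fw : ∀ x y : Fin 4 → ℝ, ∀ a b,
        ∑ i, ∑ j, B a i * B b j * wedge (B⁻¹.mulVec x) (B⁻¹.mulVec y) i j = wedge x y a b := by
      intro x y a b
      have h1 : wedge x y a b = wedge (B.mulVec (B⁻¹.mulVec x)) (B.mulVec (B⁻¹.mulVec y)) a b := by
        rw [hBi, hBi]
      rw [h1]
      generalize B⁻¹.mulVec x = x'
      generalize B⁻¹.mulVec y = y'
      simp only [wedge, Matrix.mulVec, dotProduct, Fin.sum_univ_four]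
      ring
    have key : weyl G z = fun a b c d =>
        wedge (B⁻¹.mulVec l) (B⁻¹.mulVec e) a b * wedge (B⁻¹.mulVec l) (B⁻¹.mulVec e) c d
        + (-1) * (wedge (B⁻¹.mulVec l) (B⁻¹.mulVec f) a b
          * wedge (B⁻¹.mulVec l) (B⁻¹.mulVec f) c d) := by
      refine frameComp_injective h.isUnit fun a b c d => ?_
      rw [frameComp_add, frameComp_smul, frameComp_mul, frameComp_mul, fw, fw, fw, fw, ← hw']
      refine tensor_eq_of_pairs (X := w) (Y := fun a b c d => wedge l e a b * wedge l e c d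
        + -1 * (wedge l f a b * wedge l f c d)) skw
        (fun a b c d => ⟨by simp only [wedge]; ring, by simp only [wedge]; ring⟩)
        (fun i j => ?_) (fun i j => ?_) (fun i j => ?_) (fun i j => ?_) a b c d
      · rw [hE, w1, w1, w2, w2]; ring
      · rw [hK, w1, w2, w3, w4]; ring
      · rw [hw.pair, hK, w1, w2, w3, w4]; ring
      · rw [(hv i j).1, hE, w3, w3, w4, w4]
        linear_combination (u i * u j - v i * v j) * hσ
    intro a b c d
    rw [key]; ring

/-! ### The curvature of vacuum pp-waves -/

theorem hodge_comb (G : CMetric) (z : E4) (p q : ℝ) (F H : Fin 4 → Fin 4 → ℝ) (a b : Fin 4) :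
    hodge G (fun _ m n => p * F m n + q * H m n) z a b
      = p * hodge G (fun _ => F) z a b + q * hodge G (fun _ => H) z a b := by
  unfold hodge
  rw [mul_left_comm p, mul_left_comm q, ← mul_add]
  congr 1
  simp only [Finset.mul_sum, ← Finset.sum_add_distrib]
  refine Finset.sum_congr rfl fun c _ => Finset.sum_congr rfl fun d _ =>
    Finset.sum_congr rfl fun m _ => Finset.sum_congr rfl fun n _ => by ring

section Pointwise

variable {G : CMetric} {V : Set E4} {z : E4} {l n e f : Fin 4 → ℝ}

/-- A nonzero null 1-form belongs to a null coframe. -/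
theorem exists_nullProducts (hG : MetricOn G V) (hz : z ∈ V) (hl : l ≠ 0)
    (hll : ip1 G z l l = 0) : ∃ n e f, NullProducts G z l n e f := by
  obtain ⟨B, hB⟩ := hG.lor z hz
  have h : IsOrthonormal (G z) B := hB
  have hBi : ∀ x, B.mulVec (B⁻¹.mulVec x) = x := fun x => by
    rw [Matrix.mulVec_mulVec, Matrix.mul_nonsing_inv B h.isUnit, Matrix.one_mulVec]
  have hBi' : B⁻¹.mulVec (B.mulVec l) = l := by
    rw [Matrix.mulVec_mulVec, Matrix.nonsing_inv_mul B h.isUnit, Matrix.one_mulVec]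
  obtain ⟨k, hk⟩ : ∃ k, k = B.mulVec l := ⟨_, rfl⟩
  have hkk : - (k 0 * k 0) + k 1 * k 1 + k 2 * k 2 + k 3 * k 3 = 0 := by
    rw [h.ip1_eq, ← hk] at hll
    simpa [Fin.sum_univ_four, mink] using hll
  have hk0 : k 0 ≠ 0 := by
    intro h0
    refine hl ?_
    rw [← hBi', ← hk]
    have : k = 0 := by
      rw [h0] at hkk
      have h1 : k 1 = 0 := by
        nlinarith [mul_self_nonneg (k 1), mul_self_nonneg (k 2), mul_self_nonneg (k 3)]
      have h2 : k 2 = 0 := by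
        nlinarith [mul_self_nonneg (k 1), mul_self_nonneg (k 2), mul_self_nonneg (k 3)]
      have h3 : k 3 = 0 := by
        nlinarith [mul_self_nonneg (k 1), mul_self_nonneg (k 2), mul_self_nonneg (k 3)]
      funext i; fin_cases i
      exacts [h0, h1, h2, h3]
    rw [this, Matrix.mulVec_zero]
  -- a spatial unit vector orthogonal to the spatial part of `k`
  obtain ⟨p, q, s, hpq, hunit⟩ : ∃ p q s : ℝ, p * k 1 + q * k 2 + s * k 3 = 0 ∧
      p * p + q * q + s * s = 1 := by
    by_cases h0 : k 1 * k 1 + k 2 * k 2 = 0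
    · have h1 : k 1 = 0 := by
        nlinarith [mul_self_nonneg (k 1), mul_self_nonneg (k 2)]
      exact ⟨1, 0, 0, by rw [h1]; ring, by ring⟩
    · have hpos : 0 ≤ k 1 * k 1 + k 2 * k 2 := by
        nlinarith [mul_self_nonneg (k 1), mul_self_nonneg (k 2)]
      obtain ⟨r, hr⟩ : ∃ r, r * r = k 1 * k 1 + k 2 * k 2 := ⟨_, Real.mul_self_sqrt hpos⟩
      have hr0 : r ≠ 0 := fun h' => h0 (by rw [← hr, h']; ring)
      refine ⟨-k 2 / r, k 1 / r, 0, by ring, ?_⟩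
      field_simp
      linear_combination - hr
  have hl' : l = B⁻¹.mulVec k := by rw [hk, hBi']
  have ip : ∀ x y, ip1 G z (B⁻¹.mulVec x) (B⁻¹.mulVec y)
      = - (x 0 * y 0) + x 1 * y 1 + x 2 * y 2 + x 3 * y 3 := fun x y => by
    rw [h.ip1_eq, hBi, hBi]
    simp [Fin.sum_univ_four, mink]
  have hn : ip1 G z l (B⁻¹.mulVec ![1 / (2 * k 0), -k 1 / (2 * k 0 ^ 2), -k 2 / (2 * k 0 ^ 2),
      -k 3 / (2 * k 0 ^ 2)]) = -1 := by
    rw [hl', ip]; simp; field_simp; linear_combination - hkk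
  have he : ip1 G z l (B⁻¹.mulVec ![0, p, q, s]) = 0 := by
    rw [hl', ip]; simp; linear_combination hpq
  obtain ⟨f, hf⟩ := exists_completion hG hz hll hn he
    (by rw [ip]; simp; field_simp; linear_combination hkk)
    (by rw [ip]; simp; field_simp; linear_combination - hpq)
    (by rw [ip]; simp; linear_combination hunit)
  exact ⟨_, _, f, hf⟩

/-- The expansion of a 2-form annihilated by the vector `l`. -/
theorem IsNullFrame.expand_two (h : IsNullFrame G z l n e f) (hG : MetricOn G V) (hz : z ∈ V)
    {T : Fin 4 → Fin 4 → ℝ} (hT : ∀ i j, T i j = - T j i) (h0 : ∀ w, dbl G z T l w = 0)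
    (i j : Fin 4) : T i j = - dbl G z T n e * wedge l e i j - dbl G z T n f * wedge l f i j
      + dbl G z T e f * wedge e f i j := by
  have h1 := h.expand hG hz (T i) j
  have h2 : ∀ w, ip1 G z (T i) w = - dbl G z T n w * l i + - dbl G z T l w * n i
      + dbl G z T e w * e i + dbl G z T f w * f i := fun w =>
    h.expand hG hz (fun i => ip1 G z (T i) w) i
  simp only [h2, h0, dbl_self hT] at h1
  have h3 : ∀ w, dbl G z T w l = 0 := fun w => by rw [dbl_skew hT, h0, neg_zero]
  rw [h1, h3, h3, h3, dbl_skew hT e n, dbl_skew hT f n, dbl_skew hT f e]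
  unfold wedge
  ring

/-- The self-dual part of a curvature tensor built from `l ∧ e` and `l ∧ f` has square zero. -/
theorem sdWeylSq_eq_zero (h : NullProducts G z l n e f) (hG : MetricOn G V) (hz : z ∈ V) {A B : ℝ}
    (hW : ∀ a b c d, weyl G z a b c d = wedge l e a b * (A * wedge l e c d + B * wedge l f c d)
      + wedge l f a b * (B * wedge l e c d - A * wedge l f c d)) : sdWeylSq G z = 0 := by
  have hε := h.orient_sq hG hz
  set ε := orient G z l n e f with hε'
  set N : Fin 4 → Fin 4 → ℂ := fun a b => (wedge l e a b : ℂ) + -Complex.I * ε * wedge l f a b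
    with hN
  have hh : ∀ a b c d, hodge G (fun z m n => weyl G z m n c d) z a b
      = ε * wedge l f a b * (A * wedge l e c d + B * wedge l f c d)
        - ε * wedge l e a b * (B * wedge l e c d - A * wedge l f c d) := by
    intro a b c d
    have e1 := h.hodge_le hG hz (F := fun _ => wedge l e) rfl a b
    have e2 := h.hodge_lf hG hz (F := fun _ => wedge l f) rfl a b
    rw [hodge_pointwise]
    simp only [hW]
    generalize A * wedge l e c d + B * wedge l f c d = S
    generalize B * wedge l e c d - A * wedge l f c d = T
    have e3 := hodge_comb G z S T (wedge l e) (wedge l f) a b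
    simp only [mul_comm S, mul_comm T] at e3
    rw [e3, e1, e2]; ring
  have hεC : (ε : ℂ) * ε = 1 := by rw [← Complex.ofReal_mul, hε, Complex.ofReal_one]
  have hsd : ∀ a b c d, sdWeyl G z a b c d = (1 / 2) * (A + Complex.I * ε * B) * (N a b * N c d) := by
    intro a b c d
    unfold sdWeyl
    rw [hh, hW]
    simp only [hN]
    push_cast
    linear_combination (1 / 2) * ((B : ℂ) * (wedge l e a b * wedge l f c d
      + wedge l f a b * wedge l e c d) - (A + Complex.I * ε * B) * wedge l f a b * wedge l f c d)
      * (ε * ε * Complex.I_mul_I - hεC)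
  have hNN : ip2 G z N N = 0 := by
    have := h.ip2_complex hG hz 1 (-Complex.I * ε) 0 0
    simpa [hN] using this
  funext a b m n
  have h1 : sdWeylSq G z a b m n = (1 / 2) * ((1 / 2) * (A + Complex.I * ε * B)) ^ 2
      * (N a b * N m n) * (2 * ip2 G z N N) := by
    unfold sdWeylSq ip2
    simp only [hsd, Complex.real_smul, Finset.mul_sum]
    refine Finset.sum_congr rfl fun c _ => Finset.sum_congr rfl fun d _ =>
      Finset.sum_congr rfl fun p _ => Finset.sum_congr rfl fun q _ => ?_
    push_cast; ring
  rw [h1, hNN]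
  simp

/-- A vacuum curvature tensor annihilated by a null vector. -/
theorem exists_coeff_of_null (h : NullProducts G z l n e f) (hG : MetricOn G V) (hz : z ∈ V)
    (hric : ric G z = 0) (h0 : ∀ b c d, ip1 G z (fun a => riemLow G z a b c d) l = 0) :
    ∃ A B : ℝ, ∀ a b c d, riemLow G z a b c d
      = wedge l e a b * (A * wedge l e c d + B * wedge l f c d)
        + wedge l f a b * (B * wedge l e c d - A * wedge l f c d) := by
  have hF := h.isNullFrame hG hz
  have hS := hG.curvatureSymm hz
  set W := riemLow G z with hW
  have sk : ∀ c d a b, W a b c d = - W b a c d := fun c d a b => hS.skew_left a b c d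
  have sk' : ∀ a b c d, W a b c d = - W a b d c := hS.skew_right
  have nul : ∀ c d w, dbl G z (fun a b => W a b c d) l w = 0 := fun c d w => by
    rw [dbl_skew (sk c d)]
    have h1 : ∀ i, ip1 G z (fun b => W i b c d) l = 0 := fun i => by
      have h2 := h0 i c d
      simp only [ip1, pairing] at h2 ⊢
      rw [← neg_eq_zero, ← Finset.sum_neg_distrib, ← h2]
      exact Finset.sum_congr rfl fun b _ => by rw [sk c d b i]; ring
    unfold dbl
    simp only [h1]
    simp [ip1, pairing]
  have nul' : ∀ a b w, dbl G z (W a b) l w = 0 := fun a b w => by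
    have : W a b = fun c d => W c d a b := by funext c d; exact hS.pair a b c d
    rw [this]
    exact nul a b w
  -- the contraction of the first pair with two vectors is a 2-form annihilated by `l`
  have sym : ∀ v w v' w', dbl G z (fun c d => dbl G z (fun a b => W a b c d) v w) v' w'
      = dbl G z (fun c d => dbl G z (W c d) v w) v' w' := fun v w v' w' => by
    congr 1; funext c d; congr 1; funext a b; exact hS.pair a b c d
  have swap : ∀ v w v' w', dbl G z (fun c d => dbl G z (W c d) v' w') v w
      = dbl G z (fun c d => dbl G z (W c d) v w) v' w' := fun v w v' w' => by
    rw [← sym v w]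
    simp only [dbl_eq, Finset.sum_mul]
    rw [sum_comm_pairs]
    refine Finset.sum_congr rfl fun c _ => Finset.sum_congr rfl fun d _ =>
      Finset.sum_congr rfl fun a _ => Finset.sum_congr rfl fun b _ => by ring
  have ex : ∀ v w c d, dbl G z (fun a b => W a b c d) v w
      = - dbl G z (fun c d => dbl G z (W c d) v w) n e * wedge l e c d
        - dbl G z (fun c d => dbl G z (W c d) v w) n f * wedge l f c d
        + dbl G z (fun c d => dbl G z (W c d) v w) e f * wedge e f c d := by
    intro v w c d
    rw [hF.expand_two hG hz (T := fun c d => dbl G z (fun a b => W a b c d) v w)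
      (fun c d => by
        have : (fun a b => W a b c d) = fun a b => - W a b d c := by funext a b; exact sk' a b c d
        rw [this]
        simp only [dbl_eq, neg_mul, Finset.sum_neg_distrib])
      (fun u => by
        rw [sym, ← swap]
        have : (fun c d => dbl G z (W c d) l u) = fun _ _ => 0 := by funext c d; exact nul' c d u
        rw [this]
        simp [dbl_eq]) c d]
    simp only [sym]
  have main : ∀ a b c d, W a b c d = - dbl G z (fun a b => W a b c d) n e * wedge l e a b
      - dbl G z (fun a b => W a b c d) n f * wedge l f a b
      + dbl G z (fun a b => W a b c d) e f * wedge e f a b := fun a b c d =>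
    hF.expand_two hG hz (T := fun a b => W a b c d) (sk c d) (nul c d) a b
  simp only [ex] at main
  rw [swap n e n f, swap n e e f, swap n f e f] at main
  obtain ⟨A, hA⟩ : ∃ A, A = dbl G z (fun c d => dbl G z (W c d) n e) n e := ⟨_, rfl⟩
  obtain ⟨B, hB⟩ : ∃ B, B = dbl G z (fun c d => dbl G z (W c d) n e) n f := ⟨_, rfl⟩
  obtain ⟨P, hP⟩ : ∃ P, P = dbl G z (fun c d => dbl G z (W c d) n e) e f := ⟨_, rfl⟩
  obtain ⟨C, hC⟩ : ∃ C, C = dbl G z (fun c d => dbl G z (W c d) n f) n f := ⟨_, rfl⟩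
  obtain ⟨Q, hQ⟩ : ∃ Q, Q = dbl G z (fun c d => dbl G z (W c d) n f) e f := ⟨_, rfl⟩
  obtain ⟨D, hD⟩ : ∃ D, D = dbl G z (fun c d => dbl G z (W c d) e f) e f := ⟨_, rfl⟩
  rw [← hA, ← hB, ← hP, ← hC, ← hQ, ← hD] at main
  -- the Ricci tensor of this expression
  have hR : ∀ b d, (A + C) * (l b * l d) + D * (e b * e d + f b * f d)
      + P * (l b * f d + f b * l d) - Q * (l b * e d + e b * l d) = 0 := by
    intro b d
    have h1 : ∑ a, ∑ c, ginv G z a c * W a b c d = 0 := by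
      have h2 : ric G z b d = 0 := by rw [hric]; rfl
      unfold ric at h2
      simp only [hG.riem_eq hz, ← hW] at h2
      rw [Finset.sum_comm, ← h2]
      exact Finset.sum_congr rfl fun k _ => Finset.sum_congr rfl fun i _ => by
        rw [hG.ginv_symm hz]
    have h3 : ∀ p q r s : Fin 4 → ℝ, ∑ a, ∑ c, ginv G z a c * (wedge p q a b * wedge r s c d)
        = p b * r d * ip1 G z q s - p b * s d * ip1 G z q r
          - q b * r d * ip1 G z p s + q b * s d * ip1 G z p r := by
      intro p q r s
      rw [← sum_wedge_wedge]
      refine Finset.sum_congr rfl fun a _ => Finset.sum_congr rfl fun c _ => ?_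
      unfold wedge; ring
    have h4 : ∑ a, ∑ c, ginv G z a c * W a b c d
        = A * (∑ a, ∑ c, ginv G z a c * (wedge l e a b * wedge l e c d))
        + B * (∑ a, ∑ c, ginv G z a c * (wedge l e a b * wedge l f c d))
        - P * (∑ a, ∑ c, ginv G z a c * (wedge l e a b * wedge e f c d))
        + B * (∑ a, ∑ c, ginv G z a c * (wedge l f a b * wedge l e c d))
        + C * (∑ a, ∑ c, ginv G z a c * (wedge l f a b * wedge l f c d))
        - Q * (∑ a, ∑ c, ginv G z a c * (wedge l f a b * wedge e f c d))
        - P * (∑ a, ∑ c, ginv G z a c * (wedge e f a b * wedge l e c d))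
        - Q * (∑ a, ∑ c, ginv G z a c * (wedge e f a b * wedge l f c d))
        + D * (∑ a, ∑ c, ginv G z a c * (wedge e f a b * wedge e f c d)) := by
      simp only [Finset.mul_sum, ← Finset.sum_add_distrib, ← Finset.sum_sub_distrib]
      refine Finset.sum_congr rfl fun a _ => Finset.sum_congr rfl fun c _ => ?_
      rw [main a b c d]; ring
    rw [h4] at h1
    simp only [h3, h.ll, h.le, h.lf, h.el, h.ee, h.ef, h.fl, h.fe, h.ff] at h1
    linear_combination h1
  have h5 : ∀ b, (A + C) * l b + P * f b - Q * e b = 0 ∧ D * e b - Q * l b = 0 ∧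
      D * f b + P * l b = 0 := by
    intro b
    have := h.coeff_zero (p := (A + C) * l b + P * f b - Q * e b) (q := 0)
      (r := D * e b - Q * l b) (s := D * f b + P * l b) fun d => by linear_combination hR b d
    exact ⟨this.1, this.2.2.1, this.2.2.2⟩
  have h6 := h.coeff_zero (p := A + C) (q := 0) (r := -Q) (s := P) fun b => by
    linear_combination (h5 b).1
  have h7 := h.coeff_zero (p := -Q) (q := 0) (r := D) (s := 0) fun b => by
    linear_combination (h5 b).2.1
  have hP0 : P = 0 := h6.2.2.2
  have hQ0 : Q = 0 := neg_eq_zero.1 h6.2.2.1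
  have hD0 : D = 0 := h7.2.2.1
  have hC0 : C = - A := by linarith [h6.1]
  refine ⟨A, B, fun a b c d => ?_⟩
  rw [main, hP0, hQ0, hD0, hC0]
  ring

/-- A vacuum metric with a parallel null 1-form is of type N where the Weyl tensor does not
vanish. -/
theorem typeNAt_of_parallel (hG : MetricOn G V) {k : E4 → Fin 4 → ℝ}
    (hk : ∀ i, ContDiffOn ℝ ∞ (fun z => k z i) V) (h0 : ∀ z ∈ V, cov1 G k z = 0) (hz : z ∈ V)
    (hne : k z ≠ 0) (hnull : ip1 G z (k z) (k z) = 0) (hric : ric G z = 0) (hW : weyl G z ≠ 0) :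
    TypeNAt G z := by
  obtain ⟨n, e, f, h⟩ := exists_nullProducts hG hz hne hnull
  refine ⟨hW, ?_⟩
  obtain ⟨A, B, hAB⟩ := exists_coeff_of_null h hG hz hric fun b c d => by
    rw [← hG.riem_parallel hk h0 hz b c d]
    simp only [hG.riem_eq hz, ip1, pairing, sharp, Finset.sum_mul, Finset.mul_sum]
    rw [Finset.sum_comm]
    refine Finset.sum_congr rfl fun m _ => Finset.sum_congr rfl fun a _ => ?_
    rw [hG.ginv_symm hz a m]; ring
  rw [Fund.riemLow_eq_weyl hric] at hAB
  exact sdWeylSq_eq_zero h hG hz hAB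

end Pointwise

/-! ### Local existence of smooth fundamental elements -/

section

variable {G : CMetric} {V : Set E4}

theorem MetricOn.riem_smooth (hG : MetricOn G V) (l k i j : Fin 4) :
    ContDiffOn ℝ ∞ (fun z => riem G z l k i j) V := by
  unfold riem
  exact ((pd_contDiffOn hG.isOpen (hG.chr_smooth l j k) i).sub
    (pd_contDiffOn hG.isOpen (hG.chr_smooth l i k) j)).add
    (ContDiffOn.sum fun m _ => ((hG.chr_smooth l i m).mul (hG.chr_smooth m j k)).sub
      ((hG.chr_smooth l j m).mul (hG.chr_smooth m i k)))

theorem MetricOn.riemLow_smooth (hG : MetricOn G V) (a b c d : Fin 4) :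
    ContDiffOn ℝ ∞ (fun z => riemLow G z a b c d) V :=
  ContDiffOn.sum fun l _ => (hG.smooth a l).mul (hG.riem_smooth l b c d)

theorem MetricOn.weyl_smooth (hG : MetricOn G V) (hric : ∀ z ∈ V, ric G z = 0) (a b c d : Fin 4) :
    ContDiffOn ℝ ∞ (fun z => weyl G z a b c d) V :=
  (hG.riemLow_smooth a b c d).congr fun z hz => by rw [Fund.riemLow_eq_weyl (hric z hz)]

/-- A null 1-form does not annihilate a time-like vector. -/
theorem NullProducts.pairing_ne {z : E4} {l n e f x : Fin 4 → ℝ} (h : NullProducts G z l n e f)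
    (hG : MetricOn G V) (hz : z ∈ V) (hx : ∑ i, ∑ j, G z i j * x i * x j < 0) :
    pairing l x ≠ 0 := by
  intro h0
  have h1 : ∑ i, ∑ j, G z i j * x i * x j
      = -2 * (pairing l x * pairing n x) + pairing e x ^ 2 + pairing f x ^ 2 := by
    simp only [h.isNullFrame hG hz _ _, pairing, Fin.sum_univ_four]
    ring
  rw [h1, h0] at hx
  nlinarith [sq_nonneg (pairing e x), sq_nonneg (pairing f x)]

/-- The fundamental 2-form is the square root of the curvature: contracting the curvature with a
constant bivector gives a multiple of it and of its dual, and the two coefficients are recovered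
from a further contraction. -/
theorem exists_smooth_L (hG : MetricOn G V) (hric : ∀ z ∈ V, ric G z = 0)
    (hN : ∀ z ∈ V, TypeNAt G z) {y : E4} (hy : y ∈ V) :
    ∃ U : Set E4, IsOpen U ∧ y ∈ U ∧ U ⊆ V ∧ ∃ L : E4 → Fin 4 → Fin 4 → ℝ,
      (∀ i j, ContDiffOn ℝ ∞ (fun z => L z i j) U) ∧ ∀ z ∈ U,
        (∀ a b c d, weyl G z a b c d = L z a b * L z c d - hodge G L z a b * hodge G L z c d) ∧
        ∃ l n e f, NullProducts G z l n e f ∧ L z = wedge l e := by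
  have point : ∀ z ∈ V, ∃ l n e f, NullProducts G z l n e f ∧ ∀ a b c d,
      weyl G z a b c d = wedge l e a b * wedge l e c d - wedge l f a b * wedge l f c d :=
    fun z hz => exists_nullProducts_of_typeN hG hz (hric z hz) (hN z hz)
  obtain ⟨l, n, e, f, h, hW⟩ := point y hy
  obtain ⟨F, hF⟩ : ∃ F : Fin 4 → Fin 4 → ℝ, F = fun c d => sharp G y n c * sharp G y e d :=
    ⟨_, rfl⟩
  have hFw : ∀ p q, ∑ c, ∑ d, wedge p q c d * F c d
      = ip1 G y p n * ip1 G y q e - ip1 G y q n * ip1 G y p e := fun p q => by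
    rw [← dbl_wedge, dbl_eq]
    exact Finset.sum_congr rfl fun c _ => Finset.sum_congr rfl fun d _ => by rw [hF]; ring
  obtain ⟨T, hT⟩ : ∃ T : E4 → Fin 4 → Fin 4 → ℝ, T = fun z a b =>
    ∑ c, ∑ d, weyl G z a b c d * F c d := ⟨_, rfl⟩
  obtain ⟨H, hH⟩ : ∃ H : E4 → Fin 4 → Fin 4 → ℝ, H = fun z a b => hodge G T z a b := ⟨_, rfl⟩
  obtain ⟨P, hP⟩ : ∃ P : E4 → ℝ, P = fun z => ∑ a, ∑ b, T z a b * F a b := ⟨_, rfl⟩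
  obtain ⟨R, hR⟩ : ∃ R : E4 → ℝ, R = fun z => ∑ a, ∑ b, H z a b * F a b := ⟨_, rfl⟩
  have sT : ∀ a b, ContDiffOn ℝ ∞ (fun z => T z a b) V := by
    rw [hT]
    exact fun a b => ContDiffOn.sum fun c _ => ContDiffOn.sum fun d _ =>
      (hG.weyl_smooth hric a b c d).mul contDiffOn_const
  have sH : ∀ a b, ContDiffOn ℝ ∞ (fun z => H z a b) V := by
    rw [hH]; exact hodge_contDiffOn hG sT
  have sP : ContDiffOn ℝ ∞ P V := by
    rw [hP]
    exact ContDiffOn.sum fun a _ => ContDiffOn.sum fun b _ => (sT a b).mul contDiffOn_const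
  have sR : ContDiffOn ℝ ∞ R V := by
    rw [hR]
    exact ContDiffOn.sum fun a _ => ContDiffOn.sum fun b _ => (sH a b).mul contDiffOn_const
  -- the values of these functions in a null coframe
  have val : ∀ z ∈ V, ∃ l n e f, NullProducts G z l n e f ∧ (∀ a b c d, weyl G z a b c d
      = wedge l e a b * wedge l e c d - wedge l f a b * wedge l f c d) ∧
      ∃ ε p q : ℝ, ε * ε = 1 ∧ ε = orient G z l n e f ∧
      p = ∑ c, ∑ d, wedge l e c d * F c d ∧ ε * q = ∑ c, ∑ d, wedge l f c d * F c d ∧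
      (∀ a b, T z a b = p * wedge l e a b - ε * q * wedge l f a b) ∧
      (∀ a b, H z a b = ε * p * wedge l f a b + q * wedge l e a b) ∧
      P z = p ^ 2 - q ^ 2 ∧ R z = 2 * p * q := by
    intro z hz
    obtain ⟨l, n, e, f, h, hW⟩ := point z hz
    obtain ⟨ε, hε'⟩ : ∃ ε, ε = orient G z l n e f := ⟨_, rfl⟩
    have hε : ε * ε = 1 := by rw [hε']; exact h.orient_sq hG hz
    obtain ⟨p, hp⟩ : ∃ p, p = ∑ c, ∑ d, wedge l e c d * F c d := ⟨_, rfl⟩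
    obtain ⟨q, hq⟩ : ∃ q, q = ε * ∑ c, ∑ d, wedge l f c d * F c d := ⟨_, rfl⟩
    have hq' : ε * q = ∑ c, ∑ d, wedge l f c d * F c d := by
      rw [hq, ← mul_assoc, hε, one_mul]
    have hTz : ∀ a b, T z a b = p * wedge l e a b - ε * q * wedge l f a b := fun a b => by
      rw [hq', hp, Finset.sum_mul, Finset.sum_mul]
      simp only [hT, Finset.sum_mul, ← Finset.sum_sub_distrib]
      refine Finset.sum_congr rfl fun c _ => Finset.sum_congr rfl fun d _ => ?_
      rw [hW]; ring
    have hHz : ∀ a b, H z a b = ε * p * wedge l f a b + q * wedge l e a b := fun a b => by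
      have e1 := h.hodge_le hG hz (F := fun _ => wedge l e) rfl a b
      have e2 := h.hodge_lf hG hz (F := fun _ => wedge l f) rfl a b
      rw [← hε'] at e1 e2
      have e3 : T z = fun a b => p * wedge l e a b + -(ε * q) * wedge l f a b := by
        funext a b; rw [hTz]; ring
      simp only [hH]
      rw [hodge_pointwise, e3, hodge_comb, e1, e2]
      linear_combination q * wedge l e a b * hε
    refine ⟨l, n, e, f, h, hW, ε, p, q, hε, hε', hp, hq', hTz, hHz, ?_, ?_⟩
    · have e1 : P z = p * (∑ a, ∑ b, wedge l e a b * F a b)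
          - ε * q * ∑ a, ∑ b, wedge l f a b * F a b := by
        simp only [hP, hTz, Finset.mul_sum, ← Finset.sum_sub_distrib]
        exact Finset.sum_congr rfl fun a _ => Finset.sum_congr rfl fun b _ => by ring
      rw [e1, ← hp, ← hq']
      linear_combination - q ^ 2 * hε
    · have e1 : R z = ε * p * (∑ a, ∑ b, wedge l f a b * F a b)
          + q * ∑ a, ∑ b, wedge l e a b * F a b := by
        simp only [hR, hHz, Finset.mul_sum, ← Finset.sum_add_distrib]
        exact Finset.sum_congr rfl fun a _ => Finset.sum_congr rfl fun b _ => by ring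
      rw [e1, ← hp, ← hq']
      linear_combination p * q * hε
  have hPy : 0 < P y := by
    have e1 : P y = (∑ a, ∑ b, wedge l e a b * F a b) * (∑ c, ∑ d, wedge l e c d * F c d)
        - (∑ a, ∑ b, wedge l f a b * F a b) * ∑ c, ∑ d, wedge l f c d * F c d := by
      simp only [hP, hT, hW, Finset.sum_mul, Finset.mul_sum, ← Finset.sum_sub_distrib]
      exact Finset.sum_congr rfl fun a _ => Finset.sum_congr rfl fun b _ =>
        Finset.sum_congr rfl fun c _ => Finset.sum_congr rfl fun d _ => by ring
    rw [e1, hFw, hFw, h.ln, h.ee, h.en, h.le, h.fe, h.fn]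
    norm_num
  obtain ⟨U, hU⟩ : ∃ U : Set E4, U = V ∩ P ⁻¹' Set.Ioi 0 := ⟨_, rfl⟩
  have hUo : IsOpen U := by
    rw [hU]; exact sP.continuousOn.isOpen_inter_preimage hG.isOpen isOpen_Ioi
  have hUV : U ⊆ V := by rw [hU]; exact Set.inter_subset_left
  have hPU : ∀ z ∈ U, 0 < P z := fun z hz => by
    rw [hU] at hz; exact hz.2
  -- the square roots `√(P² + R²) = p² + q²` and `√((√(P² + R²) + P) / 2) = |p|`
  have pos₁ : ∀ z ∈ U, P z ^ 2 + R z ^ 2 ≠ 0 := fun z hz => by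
    have := hPU z hz; positivity
  have sS : ContDiffOn ℝ ∞ (fun z => √(P z ^ 2 + R z ^ 2)) U :=
    (((sP.mono hUV).pow 2).add ((sR.mono hUV).pow 2)).sqrt pos₁
  have pos₂ : ∀ z ∈ U, (√(P z ^ 2 + R z ^ 2) + P z) / 2 ≠ 0 := fun z hz => by
    have := hPU z hz; positivity
  have sp : ContDiffOn ℝ ∞ (fun z => √((√(P z ^ 2 + R z ^ 2) + P z) / 2)) U :=
    ((sS.add (sP.mono hUV)).div_const 2).sqrt pos₂
  have pos₃ : ∀ z ∈ U, 2 * √((√(P z ^ 2 + R z ^ 2) + P z) / 2) ≠ 0 := fun z hz => by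
    have := hPU z hz; positivity
  have sq : ContDiffOn ℝ ∞ (fun z => R z / (2 * √((√(P z ^ 2 + R z ^ 2) + P z) / 2))) U :=
    (sR.mono hUV).div (contDiffOn_const.mul sp) pos₃
  refine ⟨U, hUo, by rw [hU]; exact ⟨hy, hPy⟩, hUV, fun z a b =>
    (√((√(P z ^ 2 + R z ^ 2) + P z) / 2) * T z a b
      + R z / (2 * √((√(P z ^ 2 + R z ^ 2) + P z) / 2)) * H z a b) / √(P z ^ 2 + R z ^ 2),
    fun a b => ((sp.mul ((sT a b).mono hUV)).add (sq.mul ((sH a b).mono hUV))).div sS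
      fun z hz => ?_, fun z hz => ?_⟩
  · have := hPU z hz; positivity
  obtain ⟨l, n, e, f, h, hW, ε, p, q, hε, hε', hp, hq, hTz, hHz, hPz, hRz⟩ := val z (hUV hz)
  have hPp := hPU z hz
  have hp0 : p ≠ 0 := fun h0 => by rw [hPz, h0] at hPp; nlinarith [sq_nonneg q]
  have hS : √(P z ^ 2 + R z ^ 2) = p ^ 2 + q ^ 2 := by
    rw [hPz, hRz, show (p ^ 2 - q ^ 2) ^ 2 + (2 * p * q) ^ 2 = (p ^ 2 + q ^ 2) ^ 2 by ring]
    exact Real.sqrt_sq (by positivity)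
  have hp' : √((√(P z ^ 2 + R z ^ 2) + P z) / 2) = |p| := by
    rw [hS, hPz, show (p ^ 2 + q ^ 2 + (p ^ 2 - q ^ 2)) / 2 = p ^ 2 by ring, Real.sqrt_sq_eq_abs]
  have hpos : p ^ 2 + q ^ 2 ≠ 0 := by positivity
  obtain ⟨s, hs, hsp⟩ : ∃ s : ℝ, s * s = 1 ∧ |p| = s * p := by
    rcases abs_choice p with h1 | h1
    · exact ⟨1, by norm_num, by rw [h1]; ring⟩
    · exact ⟨-1, by norm_num, by rw [h1]; ring⟩
  have hs0 : s ≠ 0 := fun h0 => by rw [h0] at hs; norm_num at hs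
  have hL : ∀ a b, (√((√(P z ^ 2 + R z ^ 2) + P z) / 2) * T z a b
      + R z / (2 * √((√(P z ^ 2 + R z ^ 2) + P z) / 2)) * H z a b) / √(P z ^ 2 + R z ^ 2)
      = s * wedge l e a b := by
    intro a b
    rw [hp', hsp, hS, hTz, hHz, hRz]
    have hq' : 2 * p * q / (2 * (s * p)) = s * q := by
      field_simp
      linear_combination - q * hs
    rw [hq', div_eq_iff hpos]
    ring
  have hse : ∀ a b, s * wedge l e a b = wedge l (fun i => s * e i) a b := fun a b => by
    unfold wedge; ring
  refine ⟨fun a b c d => ?_, l, n, fun i => s * e i, f, ?_, ?_⟩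
  · have hh : ∀ a b, hodge G (fun z a b => (√((√(P z ^ 2 + R z ^ 2) + P z) / 2) * T z a b
        + R z / (2 * √((√(P z ^ 2 + R z ^ 2) + P z) / 2)) * H z a b) / √(P z ^ 2 + R z ^ 2)) z a b
        = s * (ε * wedge l f a b) := fun a b => by
      have e1 := hodge_comb G z s 0 (wedge l e) (wedge l e) a b
      rw [hodge_pointwise]
      simp only [hL]
      simp only [zero_mul, add_zero] at e1
      rw [e1, h.hodge_le hG (hUV hz) (F := fun _ => wedge l e) rfl a b, ← hε']
    rw [hh, hh]
    simp only [hL]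
    rw [hW]
    linear_combination (-(wedge l e a b * wedge l e c d) + ε * ε * wedge l f a b * wedge l f c d)
      * hs + wedge l f a b * wedge l f c d * hε
  · have sr : ∀ v : Fin 4 → ℝ, ip1 G z v (fun i => s * e i) = s * ip1 G z v e := fun v => by
      rw [hG.ip1_comm (hUV hz), ip1_smul_left, hG.ip1_comm (hUV hz)]
    constructor <;> simp only [sr, ip1_smul_left, h.ll, h.ln, h.le, h.lf, h.nl, h.nn, h.ne, h.nf,
      h.el, h.en, h.ee, h.ef, h.fl, h.fn, h.fe, h.ff, mul_zero]
    rw [mul_one, hs]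
  · funext a b
    simp only [hL]
    exact hse a b

/-- Near each point, a vacuum type N metric has smooth fundamental elements. -/
theorem exists_fund (hG : MetricOn G V) (hric : ∀ z ∈ V, ric G z = 0)
    (hN : ∀ z ∈ V, TypeNAt G z) {y : E4} (hy : y ∈ V) :
    ∃ U : Set E4, IsOpen U ∧ y ∈ U ∧ U ⊆ V ∧ Nonempty (Fund G U) := by
  obtain ⟨U₁, hU₁, hyU₁, hU₁V, L, sL, hL⟩ := exists_smooth_L hG hric hN hy
  obtain ⟨B, hB⟩ := hG.lor y hy
  set x : Fin 4 → ℝ := B 0 with hx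
  set g : E4 → ℝ := fun z => ∑ i, ∑ j, G z i j * x i * x j with hg
  have hgy : g y < 0 := by
    have h1 := congrFun (congrFun hB 0) 0
    simp only [Matrix.mul_apply, Matrix.transpose_apply, Matrix.diagonal_apply_eq] at h1
    have h2 : g y = ∑ j, (∑ i, B 0 i * G y i j) * B 0 j := by
      simp only [hg, hx, Finset.sum_mul]
      rw [Finset.sum_comm]
      exact Finset.sum_congr rfl fun j _ => Finset.sum_congr rfl fun i _ => by ring
    rw [h2, h1]
    simp
  have sg : ContDiffOn ℝ ∞ g V := ContDiffOn.sum fun i _ => ContDiffOn.sum fun j _ =>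
    ((hG.smooth i j).mul contDiffOn_const).mul contDiffOn_const
  set U : Set E4 := U₁ ∩ g ⁻¹' Set.Iio 0 with hU
  have hUo : IsOpen U := (sg.mono hU₁V).continuousOn.isOpen_inter_preimage hU₁ isOpen_Iio
  have hUU : U ⊆ U₁ := Set.inter_subset_left
  have hGU := hG.mono hUo (hUU.trans hU₁V)
  -- `L ⋅ L = ℓ ⊗ ℓ`
  set X : E4 → Fin 4 → ℝ := fun z i => ∑ j, (∑ m, ∑ n, L z i m * ginv G z m n * L z j n) * x j
    with hX
  set N : E4 → ℝ := fun z => ∑ i, X z i * x i with hNd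
  have sX : ∀ i, ContDiffOn ℝ ∞ (fun z => X z i) U := fun i => ContDiffOn.sum fun j _ =>
    (ContDiffOn.sum fun m _ => ContDiffOn.sum fun n _ => (((sL i m).mono hUU).mul
      (hGU.ginv_smooth m n)).mul ((sL j n).mono hUU)).mul contDiffOn_const
  have sN : ContDiffOn ℝ ∞ N U := ContDiffOn.sum fun i _ => (sX i).mul contDiffOn_const
  have val : ∀ z ∈ U, ∃ l n e f, NullProducts G z l n e f ∧ L z = wedge l e ∧ pairing l x ≠ 0 ∧
      (∀ i, X z i = l i * pairing l x) ∧ N z = pairing l x ^ 2 := by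
    intro z hz
    obtain ⟨-, l, n, e, f, h, hLz⟩ := hL z (hUU hz)
    have hXz : ∀ i, X z i = l i * pairing l x := fun i => by
      simp only [hX, hLz, sum_wedge_wedge, h.ee, h.el, h.ll, h.le, pairing, Finset.mul_sum]
      exact Finset.sum_congr rfl fun j _ => by ring
    refine ⟨l, n, e, f, h, hLz, h.pairing_ne hGU hz hz.2, hXz, ?_⟩
    simp only [hNd, hXz]
    unfold pairing
    rw [sq, Finset.sum_mul]
    exact Finset.sum_congr rfl fun i _ => by ring
  have Npos : ∀ z ∈ U, 0 < N z := fun z hz => by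
    obtain ⟨l, n, e, f, -, -, h0, -, h1⟩ := val z hz
    rw [h1]; positivity
  have sq0 : ∀ z ∈ U, √(N z) ≠ 0 := fun z hz => (Real.sqrt_pos.2 (Npos z hz)).ne'
  -- the sign relating `ℓ` to the form of the null coframe
  have sgn : ∀ z ∈ U, ∃ l n e f, ∃ t : ℝ, NullProducts G z l n e f ∧ L z = wedge l e ∧ t * t = 1 ∧
      (∀ i, -(X z i) / √(N z) = t * l i) := by
    intro z hz
    obtain ⟨l, n, e, f, h, hLz, h0, hXz, hNz⟩ := val z hz
    have hr : √(N z) = |pairing l x| := by rw [hNz, Real.sqrt_sq_eq_abs]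
    rcases abs_choice (pairing l x) with h1 | h1
    · exact ⟨l, n, e, f, -1, h, hLz, by norm_num, fun i => by rw [hr, h1, hXz]; field_simp⟩
    · exact ⟨l, n, e, f, 1, h, hLz, by norm_num, fun i => by rw [hr, h1, hXz]; field_simp⟩
  refine ⟨U, hUo, ⟨hyU₁, hgy⟩, hUU.trans hU₁V, ⟨{
    L := L
    ell := fun z i => -(X z i) / √(N z)
    x := fun _ => x
    smooth_L := fun i j => (sL i j).mono hUU
    smooth_ell := fun i => (sX i).neg.div (sN.sqrt fun z hz => (Npos z hz).ne') sq0
    smooth_x := fun i => contDiffOn_const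
    weyl_eq := fun z hz => (hL z (hUU hz)).1
    ell_ne := ?_
    ell_null := ?_
    L_eq := ?_
    x_timelike := fun z hz => hz.2
    future := ?_ }⟩⟩
  · intro z hz h0
    obtain ⟨l, n, e, f, t, h, hLz, ht, hl⟩ := sgn z hz
    obtain ⟨k, hk⟩ := h.l_ne
    have h1 := congrFun h0 k
    simp only [hl, Pi.zero_apply] at h1
    rcases mul_eq_zero.1 h1 with h2 | h2
    · rw [h2] at ht; norm_num at ht
    · exact hk h2
  · intro z hz
    obtain ⟨l, n, e, f, t, h, hLz, ht, hl⟩ := sgn z hz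
    simp only [hl]
    rw [ip1_smul_left, hGU.ip1_comm hz, ip1_smul_left, h.ll]; ring
  · intro z hz
    obtain ⟨l, n, e, f, t, h, hLz, ht, hl⟩ := sgn z hz
    refine ⟨fun i => t * e i, ?_, ?_, ?_⟩
    · rw [ip1_smul_left, hGU.ip1_comm hz, ip1_smul_left, h.ee, mul_one, ht]
    · simp only [hl]
      rw [ip1_smul_left, hGU.ip1_comm hz, ip1_smul_left, h.el]; ring
    · funext i j
      simp only [hl, hLz, wedge]
      linear_combination - (l i * e j - e i * l j) * ht
  · intro z hz
    have h1 : pairing (fun i => -(X z i) / √(N z)) x = - √(N z) := by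
      have h2 : pairing (fun i => -(X z i) / √(N z)) x = -(N z) / √(N z) := by
        simp only [pairing, hNd, div_mul_eq_mul_div, neg_mul, neg_div, Finset.sum_neg_distrib,
          Finset.sum_div]
      rw [h2, neg_div, Real.div_sqrt]
    have h2 := Real.sqrt_pos.2 (Npos z hz)
    rw [h1]; linarith

end

/-! ### From charts to the manifold -/

namespace LorentzianMetric

variable {M : Type*} [TopologicalSpace M] [ChartedSpace E4 M] {g : LorentzianMetric M}

/-- In a chart of the smooth structure, the components of a Lorentzian metric form a smooth field of
symmetric matrices of Lorentzian signature. -/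
theorem metricOn [IsManifold 𝓘(ℝ, E4) ∞ M] (g : LorentzianMetric M)
    {e : OpenPartialHomeomorph M E4} (he : e ∈ IsManifold.maximalAtlas 𝓘(ℝ, E4) ∞ M) :
    MetricOn (g.inChart e) e.target where
  isOpen := e.open_target
  smooth := g.smooth e he
  symm _ _ _ _ := g.symm _ _ _
  lor z hz := by
    have : IsManifold 𝓘(ℝ, E4) 1 M := IsManifold.of_le (n := ∞) (by simp)
    have he1 : e ∈ IsManifold.maximalAtlas 𝓘(ℝ, E4) 1 M :=
      IsManifold.maximalAtlas_subset_of_le (by simp) he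
    have hd : e.MDifferentiable 𝓘(ℝ, E4) 𝓘(ℝ, E4) :=
      ⟨fun p hp => (mdifferentiableAt_of_mem_maximalAtlas he1 hp).mdifferentiableWithinAt,
        fun p hp => (mdifferentiableAt_symm_of_mem_maximalAtlas he1 hp).mdifferentiableWithinAt⟩
    have hs : Function.Surjective (mfderiv 𝓘(ℝ, E4) 𝓘(ℝ, E4) e.symm z) :=
      hd.symm.mfderiv_surjective hz
    obtain ⟨b, hb⟩ := g.signature (e.symm z)
    choose w hw using fun i => hs (b i)
    refine ⟨Matrix.of fun i j => (show E4 from w i) j, ?_⟩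
    have hexp : ∀ i, b i = ∑ k, (show E4 from w i) k •
        mfderiv 𝓘(ℝ, E4) 𝓘(ℝ, E4) e.symm z (Pi.single k 1 : E4) := fun i => by
      rw [← hw i]
      conv_lhs => rw [show w i = ∑ k, (show E4 from w i) k • (Pi.single k 1 : E4) from
        pi_eq_sum_univ' (show E4 from w i)]
      exact (map_sum _ _ _).trans (Finset.sum_congr rfl fun k _ => map_smul _ _ _)
    ext i j
    have h1 := hb i j
    rw [hexp i, hexp j] at h1
    simp only [map_sum, map_smul, LinearMap.sum_apply, LinearMap.smul_apply, smul_eq_mul] at h1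
    rw [Matrix.diagonal_apply, Matrix.mul_apply]
    simp only [Matrix.mul_apply, Matrix.transpose_apply, Matrix.of_apply, Finset.sum_mul]
    rw [show (if i = j then (![-1, 1, 1, 1] : Fin 4 → ℝ) i else 0)
      = if i = j then (if i = 0 then -1 else 1) else 0 by fin_cases i <;> simp, ← h1]
    refine Finset.sum_congr rfl fun k _ => ?_
    rw [Finset.mul_sum]
    refine Finset.sum_congr rfl fun m _ => ?_
    simp only [inChart, Matrix.of_apply]
    ring

theorem IsVacuum.ric_eq (hvac : g.IsVacuum) {e : OpenPartialHomeomorph M E4}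
    (he : e ∈ IsManifold.maximalAtlas 𝓘(ℝ, E4) ∞ M) {V : Set E4} (hV : V ⊆ e.target) :
    ∀ z ∈ V, ric (g.inChart e) z = 0 := fun z hz => hvac e he z (hV hz)

variable [IsManifold 𝓘(ℝ, E4) ∞ M]

theorem IsTypeN.exists_fund (hN : g.IsTypeN) (hvac : g.IsVacuum) {e : OpenPartialHomeomorph M E4}
    (he : e ∈ IsManifold.maximalAtlas 𝓘(ℝ, E4) ∞ M) {y : E4} (hy : y ∈ e.target) :
    ∃ U : Set E4, IsOpen U ∧ y ∈ U ∧ U ⊆ e.target ∧ Nonempty (Fund (g.inChart e) U) :=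
  TypeN.exists_fund (g.metricOn he) (hvac.ric_eq he subset_rfl) (hN e he) hy

/-- A pp-wave with non-vanishing curvature is of type N: its curvature annihilates the covariantly
constant null vector. -/
theorem IsPPWave.isTypeN (hpp : g.IsPPWave) (hvac : g.IsVacuum) (hW : g.WeylNonvanishing) :
    g.IsTypeN := fun e he y hy => by
  obtain ⟨V, hV, hyV, hVe, k, hk, hk'⟩ := hpp e he y hy
  exact typeNAt_of_parallel ((g.metricOn he).mono hV hVe) hk (fun z hz => (hk' z hz).2.2) hyV
    (hk' y hyV).1 (hk' y hyV).2.1 (hvac e he y hy) (hW e he y hy)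

theorem IsPPWave.ppCond (hpp : g.IsPPWave) (hvac : g.IsVacuum) :
    g.ForFund fun _ _ D y => D.PPCond y := fun e he _ hV hVe _ y hy =>
  Fund.ppCond_of_ppWaveNear ((g.metricOn he).mono hV hVe) (hvac.ric_eq he hVe) hy
    (hpp e he y (hVe hy))

/-- The condition `∇ℓ ∧̄ ℓ = 0` makes the metric a pp-wave: `ℓ` is recurrent, hence proportional to
a covariantly constant vector. -/
theorem IsTypeN.isPPWave (hN : g.IsTypeN) (hvac : g.IsVacuum)
    (h : g.ForFund fun _ _ D y => D.PPCond y) : g.IsPPWave := fun e he y hy => by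
  obtain ⟨U, hU, hyU, hUe, ⟨D⟩⟩ := hN.exists_fund hvac he hy
  have hG := (g.metricOn he).mono hU hUe
  exact (D.recurrent_of_ppCond hG (h e he U hU hUe D)).ppWaveNear hG
    (D.typeNCurvature hG (hvac.ric_eq he hUe)) hUe hyU

theorem ForFund.phiZero (h : g.ForFund fun _ _ D y => D.PPCond y) (hvac : g.IsVacuum) :
    g.ForFund fun _ _ D y => ∀ i, 1 ≤ i → i ≤ 6 → D.PhiZero i y :=
  fun e he V hV hVe D _ hy i h1 h6 => Fund.phiZero_of_recurrent (hvac.ric_eq he hVe)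
    (D.recurrent_of_ppCond ((g.metricOn he).mono hV hVe) (h e he V hV hVe D)) hy i h1 h6

theorem InFamily.ppCond {n : ℕ} (hn : 5 ≤ n) (h : g.InFamily n) (hvac : g.IsVacuum) :
    g.ForFund fun _ _ D y => D.PPCond y := fun e he V hV hVe D _ hy =>
  D.ppCond_of_phi ((g.metricOn he).mono hV hVe) (hvac.ric_eq he hVe)
    (fun z hz => ⟨h.2 e he V hV hVe D z hz 1 (by norm_num) (by omega),
      h.2 e he V hV hVe D z hz 2 (by norm_num) (by omega),
      h.2 e he V hV hVe D z hz 5 (by norm_num) hn⟩) hy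

theorem IsPPWave.planeCond_iff (hpp : g.IsPPWave) (hvac : g.IsVacuum) :
    g.ForFund fun _ _ D y => (D.PlaneCond y ↔ D.phi7 y = 0) := fun e he V hV hVe D _ hy =>
  Fund.planeCond_iff (hvac.ric_eq he hVe) (D.recurrent_of_ppCond ((g.metricOn he).mono hV hVe)
    (hpp.ppCond hvac e he V hV hVe D)) hy

/-- Where `ℓ ∧ b ∧ c ≠ 0` the isotropy of a pp-wave is trivial, and where `ℓ ∧ b ∧ c` vanishes
identically the metric is a plane wave. -/
theorem IsPPWave.dichotomy (hpp : g.IsPPWave) (hvac : g.IsVacuum) :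
    g.ForFund fun G V D y => (D.phi7 y ≠ 0 → TrivialIsotropyNear G V y) ∧
      ∀ U : Set E4, V ⊆ U → (∀ᶠ z in 𝓝 y, D.phi7 z = 0) → PlaneWaveNear G U y :=
  fun e he V hV hVe D y hy => by
    have hG := (g.metricOn he).mono hV hVe
    have hp := D.recurrent_of_ppCond hG (hpp.ppCond hvac e he V hV hVe D)
    exact ⟨D.trivialIsotropyNear hG (hvac.ric_eq he hVe) hp hy,
      fun U hU => D.planeWaveNear hG (hvac.ric_eq he hVe) hp hU hy⟩

theorem IsPlaneWave.nontrivialIsotropy (h : g.IsPlaneWave) : g.NontrivialIsotropy :=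
  fun e he y hy => not_trivialIsotropyNear_of_planeWaveNear (g.metricOn he) (h e he y hy)

theorem NontrivialIsotropy.phi7_eq_zero (h : g.NontrivialIsotropy) (hpp : g.IsPPWave)
    (hvac : g.IsVacuum) : g.ForFund fun _ _ D y => D.phi7 y = 0 := fun e he V hV hVe D y hy => by
  by_contra h7
  exact h e he y (hVe hy)
    (((hpp.dichotomy hvac e he V hV hVe D y hy).1 h7).of_subset hV hy)

theorem IsPPWave.isPlaneWave (hpp : g.IsPPWave) (hvac : g.IsVacuum) (hW : g.WeylNonvanishing)
    (h : g.ForFund fun _ _ D y => D.phi7 y = 0) : g.IsPlaneWave := fun e he y hy => by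
  obtain ⟨U, hU, hyU, hUe, ⟨D⟩⟩ := (hpp.isTypeN hvac hW).exists_fund hvac he hy
  exact (hpp.dichotomy hvac e he U hU hUe D y hyU).2 _ hUe
    (Filter.eventually_of_mem (hU.mem_nhds hyU) (h e he U hU hUe D))

end LorentzianMetric

end TypeN
end

theorem mainTheorem6 {M : Type*} [TopologicalSpace M] [ChartedSpace TypeN.E4 M]
    [IsManifold 𝓘(ℝ, TypeN.E4) ∞ M] (g : TypeN.LorentzianMetric M) (hvac : g.IsVacuum) :
    -- the vacuum pp-waves are the vacuum type N solutions in the family Ĉ5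
    ((g.IsPPWave ∧ g.WeylNonvanishing) ↔ g.InFamily 5) ∧
    -- these are the vacuum type N solutions with `∇ℓ ∧̄ ℓ = 0`
    (g.InFamily 5 ↔ (g.IsTypeN ∧ g.ForFund fun _ _ D y => D.PPCond y)) ∧
    -- the vacuum pp-waves
    (g.IsPPWave → g.WeylNonvanishing →
      -- when `φ₇` is nowhere zero or identically zero, those with trivial isotropy are of class C7
      ((g.InClass 7 ∨ g.InFamily 7) → (g.TrivialIsotropy ↔ g.InClass 7)) ∧
      -- class C7 means `ℓ ∧ b ∧ c ≠ 0`
      (g.InClass 7 ↔ g.ForFund fun _ _ D y => D.phi7 y ≠ 0) ∧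
      -- without that proviso: the isotropy is trivial where `ℓ ∧ b ∧ c ≠ 0`, and where it is
      -- trivial, `ℓ ∧ b ∧ c` does not vanish identically on any neighbourhood
      (g.ForFund fun G V D y =>
        (D.phi7 y ≠ 0 → TypeN.TrivialIsotropyNear G V y) ∧
        (TypeN.TrivialIsotropyNear G V y → ∃ᶠ z in 𝓝 y, D.phi7 z ≠ 0)) ∧
      -- those with non-trivial isotropy are the plane waves
      (g.NontrivialIsotropy ↔ g.IsPlaneWave) ∧
      -- plane waves are characterised by `ℓ ∧̄ ∇ℓ = 0`
      (g.IsPlaneWave ↔ g.ForFund fun _ _ D y => D.PlaneCond y) ∧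
      -- which is, at each point, the condition complementary to `ℓ ∧ b ∧ c ≠ 0`
      (g.ForFund fun _ _ D y => (D.PlaneCond y ↔ ¬ (D.phi7 y ≠ 0)))) := by
  have h52 : g.InFamily 5 ↔ (g.IsTypeN ∧ g.ForFund fun _ _ D y => D.PPCond y) :=
    ⟨fun h => ⟨h.1, h.ppCond le_rfl hvac⟩, fun ⟨hN, h⟩ => ⟨hN, fun e he V hV hVe D y hy i h1 h5 =>
      h.phiZero hvac e he V hV hVe D y hy i h1 (by omega)⟩⟩
  refine ⟨⟨fun ⟨hpp, hW⟩ => h52.2 ⟨hpp.isTypeN hvac hW, hpp.ppCond hvac⟩, fun h =>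
    ⟨h.1.isPPWave hvac (h52.1 h).2, fun e he y hy => (h.1 e he y hy).1⟩⟩, h52, fun hpp hW => ?_⟩
  have hN : g.IsTypeN := hpp.isTypeN hvac hW
  have hC7 : g.InClass 7 ↔ g.ForFund fun _ _ D y => D.phi7 y ≠ 0 :=
    ⟨fun h e he V hV hVe D y hy => (h.2 e he V hV hVe D y hy).2, fun h =>
      ⟨hN, fun e he V hV hVe D y hy => ⟨fun i h1 h7 => (hpp.ppCond hvac).phiZero hvac e he V hV hVe
        D y hy i h1 (by omega), h e he V hV hVe D y hy⟩⟩⟩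
  have htriv : g.InClass 7 → g.TrivialIsotropy := fun h e he y hy => by
    obtain ⟨U, hU, hyU, hUe, ⟨D⟩⟩ := hN.exists_fund hvac he hy
    exact ((hpp.dichotomy hvac e he U hU hUe D y hyU).1 (hC7.1 h e he U hU hUe D y hyU)).of_subset
      hU hyU
  refine ⟨fun h7 => ⟨fun ht => h7.elim id fun hF => ?_, htriv⟩, hC7,
    fun e he V hV hVe D y hy => ?_, ?_, ?_, fun e he V hV hVe D y hy => ?_⟩
  · -- a pp-wave with trivial isotropy and `φ₇ = 0` can only live on an empty manifold
    have hpl := hpp.isPlaneWave hvac hW fun e he V hV hVe D y hy =>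
      hF.2 e he V hV hVe D y hy 7 (by norm_num) le_rfl
    exact hC7.2 fun e he V _ hVe _ y hy =>
      absurd (ht e he y (hVe hy)) (hpl.nontrivialIsotropy e he y (hVe hy))
  · have hd := hpp.dichotomy hvac e he V hV hVe D y hy
    refine ⟨hd.1, fun ht hev => ?_⟩
    simp only [not_not] at hev
    exact TypeN.not_trivialIsotropyNear_of_planeWaveNear ((g.metricOn he).mono hV hVe)
      (hd.2 V subset_rfl hev) ht
  · exact ⟨fun h => hpp.isPlaneWave hvac hW (h.phi7_eq_zero hpp hvac),
      TypeN.LorentzianMetric.IsPlaneWave.nontrivialIsotropy⟩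
  · exact ⟨fun h e he V hV hVe D y hy => (hpp.planeCond_iff hvac e he V hV hVe D y hy).2
      (h.nontrivialIsotropy.phi7_eq_zero hpp hvac e he V hV hVe D y hy),
      fun h => hpp.isPlaneWave hvac hW fun e he V hV hVe D y hy =>
        (hpp.planeCond_iff hvac e he V hV hVe D y hy).1 (h e he V hV hVe D y hy)⟩
  · simp only [not_not]
    exact hpp.planeCond_iff hvac e he V hV hVe D y hy
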